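/- Let $n\in\{1,2,3\}$. Write $x=(x^1,\dots,x^n)$, let $k\ge 0$, $y=(y^1,\dots,y^k)$, and let $u$ be a scalar dependent variable; $u_i=u_{x^i}$, $u_\mu=u_{y^\mu}$, $u_{ij}=u_{x^ix^j}$, $u_{i\mu}=u_{x^iy^\mu}$, $u_{\mu\nu}=u_{y^\mu y^\nu}$ ($1\le i,j\le n$, $1\le\mu,\nu\le k$). "Smooth" means $C^\infty$. A free action of a real Lie algebra $\mathfrak g$ on an open set $Z\subset\mathbb R^N$ is a linear map $\rho$ from $\mathfrak g$ to smooth vector fields on $Z$ with $[\rho(X),\rho(Y)]=\rho([X,Y])$ such that $X\mapsto\rho(X)_z$ is injective for every $z\in Z$. **Table.** Each row gives the non-zero commutation relations of a basis $e_1,\dots,e_n$, the generators $X_i$, and functions $J_1,\dots,J_n$ (linear in $u_1,\dots,u_n$) and $K_1,\dots,K_{n(n+1)/2}$. The domain $D$ of $x$ is $\mathbb R^n$, except for $\mathfrak g^3_7$, where $D=\{|x^2|<\pi/2\}$. Let $J_{i\mu}$ denote $J_i$ with $u_1,\dots,u_n$ replaced by $u_{1\mu},\dots,u_{n\mu}$.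 The list of invariants of each row is $$y,\quad u,\quad J_i,\quad u_\mu,\quad K_s,\quad J_{i\mu},\quad u_{\mu\nu}.$$ *Dimension 1.* - $\mathfrak g^1$: $X_1=\partial_{x^1}$; $J$: $u_1$; $K$: $u_{11}$. *Dimension 2.* - $2\mathfrak g^1$ (abelian): $X_1=\partial_{x^1}$, $X_2=\partial_{x^2}$; $J$: $u_1,u_2$; $K$: $u_{11},u_{12},u_{22}$. - $\mathfrak g^2$, $[e_1,e_2]=e_1$: $X_1=\partial_{x^1}$, $X_2=x^1\partial_{x^1}+\partial_{x^2}$; $J$: $e^{x^2}u_1$, $u_2$; $K$: $e^{2x^2}u_{11}$, $e^{x^2}(u_{12}+\frac{u_1}2)$, $u_{22}$. *Dimension 3.* - $3\mathfrak g^1$ (abelian): $X_i=\partial_{x^i}$; $J$: $u_1,u_2,u_3$; $K$: $u_{11},u_{12},u_{13},u_{22},u_{23},u_{33}$. - $\mathfrak g^1+\mathfrak g^2$, $[e_1,e_2]=e_1$: $X_1=\partial_{x^1}$, $X_2=x^1\partial_{x^1}+\partial_{x^2}$, $X_3=\partial_{x^3}$; $J$: $e^{x^2}u_1,u_2,u_3$;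 $K$: $e^{2x^2}u_{11}$, $e^{x^2}(u_{12}+\frac{u_1}2)$, $e^{x^2}u_{13}$, $u_{22}$, $u_{23}$, $u_{33}$. - $\mathfrak g^3_1$, $[e_2,e_3]=e_1$: $X_1=\partial_{x^1}$, $X_2=\partial_{x^2}$, $X_3=x^2\partial_{x^1}+\partial_{x^3}$; $J$: $u_1$, $x^3u_1+u_2$, $u_3$; $K$: $u_{11}$, $x^3u_{11}+u_{12}$, $u_{13}$, $(x^3)^2u_{11}+2x^3u_{12}+u_{22}$, $x^3u_{13}+u_{23}+\frac{u_1}2$, $u_{33}$. - $\mathfrak g^3_2$, $[e_1,e_3]=e_1$, $[e_2,e_3]=e_1+e_2$: $X_1=\partial_{x^1}$, $X_2=\partial_{x^2}$, $X_3=(x^1+x^2)\partial_{x^1}+x^2\partial_{x^2}+\partial_{x^3}$; $J$: $e^{x^3}u_1$, $e^{x^3}(x^3u_1+u_2)$, $u_3$; $K$: $e^{2x^3}u_{11}$, $e^{2x^3}(x^3u_{11}+u_{12})$, $e^{x^3}(u_{13}+\frac{u_1}2)$, $u_{33}$, $e^{2x^3}((x^3)^2u_{11}+2x^3u_{12}+u_{22})$,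 $e^{x^3}x^3(u_{13}+\frac{u_1}2)+e^{x^3}(u_{23}+\frac{u_1+u_2}2)$. - $\mathfrak g^3_3$, $[e_1,e_3]=e_1$, $[e_2,e_3]=e_2$: $X_1=\partial_{x^1}$, $X_2=\partial_{x^2}$, $X_3=x^1\partial_{x^1}+x^2\partial_{x^2}+\partial_{x^3}$; $J$: $e^{x^3}u_1$, $e^{x^3}u_2$, $u_3$; $K$: $e^{2x^3}u_{11}$, $e^{2x^3}u_{12}$, $e^{x^3}(u_{13}+\frac{u_1}2)$, $e^{2x^3}u_{22}$, $e^{x^3}(u_{23}+\frac{u_2}2)$, $u_{33}$. - $\mathfrak g^3_4$ with a real parameter $h$, $|h|\le1$, $h\ne0,1$, $[e_1,e_3]=e_1$, $[e_2,e_3]=he_2$: $X_1=\partial_{x^1}$, $X_2=\partial_{x^2}$, $X_3=x^1\partial_{x^1}+hx^2\partial_{x^2}+\partial_{x^3}$; $J$: $e^{x^3}u_1$, $e^{hx^3}u_2$, $u_3$; $K$: $e^{2x^3}u_{11}$, $e^{(1+h)x^3}u_{12}$, $e^{x^3}(u_{13}+\frac{u_1}2)$, $e^{2hx^3}u_{22}$,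 $e^{hx^3}(u_{23}+\frac{hu_2}2)$, $u_{33}$. - $\mathfrak g^3_5$ with a real parameter $p\ge0$, $[e_1,e_3]=pe_1-e_2$, $[e_2,e_3]=pe_2+e_1$: $X_1=\partial_{x^1}$, $X_2=\partial_{x^2}$, $X_3=(px^1+x^2)\partial_{x^1}+(px^2-x^1)\partial_{x^2}+\partial_{x^3}$; $J$: $e^{px^3}(u_1\cos x^3-u_2\sin x^3)$, $e^{px^3}(u_1\sin x^3+u_2\cos x^3)$, $u_3$; $K$: $e^{2px^3}(u_{11}+u_{22})$, $e^{2px^3}[(u_{11}-u_{22})\cos2x^3-2u_{12}\sin2x^3]$, $e^{2px^3}[(u_{11}-u_{22})\sin2x^3+2u_{12}\cos2x^3]$, $e^{px^3}[A\cos x^3-B\sin x^3]$, $e^{px^3}[A\sin x^3+B\cos x^3]$, $u_{33}$, where $A=u_{13}+\frac{pu_1-u_2}2$, $B=u_{23}+\frac{pu_2+u_1}2$. - $\mathfrak g^3_6$, $[e_1,e_2]=e_1$, $[e_1,e_3]=2e_2$, $[e_2,e_3]=e_3$: $X_1=\partial_{x^1}$, $X_2=x^1\partial_{x^1}+\partial_{x^2}$,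 $X_3=(x^1)^2\partial_{x^1}+2x^1\partial_{x^2}+e^{x^2}\partial_{x^3}$; $J$: $e^{x^2}u_1+2x^3u_2+(x^3)^2u_3$, $u_2+x^3u_3$, $u_3$; $K$: $\frac14e^{2x^2}u_{11}+e^{x^2}x^3\bigl(u_{12}+\frac{x^3u_{13}+u_1}2\bigr)+(x^3)^2\bigl(x^3u_{23}+u_{22}+\frac{u_2+x^3u_3}2+\frac{(x^3)^2u_{33}}4\bigr)$, $e^{x^2}(u_{12}+x^3u_{13}+\frac{u_1}2)+(x^3)^3u_{33}+3(x^3)^2(u_{23}+\frac{u_3}2)+x^3(2u_{22}+u_2)$, $e^{x^2}u_{13}+(x^3)^2u_{33}+x^3(2u_{23}+u_3)+u_2$, $(x^3)^2u_{33}+x^3(2u_{23}+u_3)+u_{22}$, $x^3u_{33}+u_{23}+\frac{u_3}2$, $u_{33}$. - $\mathfrak g^3_7$, $[e_1,e_2]=e_3$, $[e_2,e_3]=e_1$, $[e_3,e_1]=e_2$: $X_1=\partial_{x^1}$, $X_2=\sin x^1\tan x^2\,\partial_{x^1}+\cos x^1\,\partial_{x^2}+\frac{\sin x^1}{\cos x^2}\partial_{x^3}$,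 $X_3=\cos x^1\tan x^2\,\partial_{x^1}-\sin x^1\,\partial_{x^2}+\frac{\cos x^1}{\cos x^2}\partial_{x^3}$; $J$: $u_1\frac{\cos x^3}{\cos x^2}-u_2\sin x^3+u_3\tan x^2\cos x^3$, $u_1\frac{\sin x^3}{\cos x^2}+u_2\cos x^3+u_3\tan x^2\sin x^3$, $u_3$; $K$: $$u_{11}\tfrac{\cos^2x^3}{\cos^2x^2}-u_{12}\tfrac{\sin2x^3}{\cos x^2}+2u_{13}\tfrac{\tan x^2\cos^2x^3}{\cos x^2}+u_{22}\sin^2x^3-u_{23}\tan x^2\sin2x^3+u_{33}\tan^2x^2\cos^2x^3-u_1\tfrac{\tan x^2\sin2x^3}{\cos x^2}-u_2\tan x^2\cos^2x^3-u_3(\tfrac12+\tan^2x^2)\sin2x^3,$$ $$u_{11}\tfrac{\sin2x^3}{2\cos^2x^2}+u_{12}\tfrac{\cos2x^3}{\cos x^2}+u_{13}\tfrac{\tan x^2\sin2x^3}{\cos x^2}-\tfrac12u_{22}\sin2x^3+u_{23}\tan x^2\cos2x^3+\tfrac12u_{33}\tan^2x^2\sin2x^3+u_1\tfrac{\tan x^2\cos2x^3}{\cos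 x^2}-\tfrac12u_2\tan x^2\sin2x^3+u_3(\tfrac12+\tan^2x^2)\cos2x^3,$$ $$u_{11}\tfrac{\sin^2x^3}{\cos^2x^2}+u_{12}\tfrac{\sin2x^3}{\cos x^2}+2u_{13}\tfrac{\tan x^2\sin^2x^3}{\cos x^2}+u_{22}\cos^2x^3+u_{23}\tan x^2\sin2x^3+u_{33}\tan^2x^2\sin^2x^3+u_1\tfrac{\tan x^2\sin2x^3}{\cos x^2}-u_2\tan x^2\sin^2x^3+u_3(\tfrac12+\tan^2x^2)\sin2x^3,$$ $$u_{13}\tfrac{\cos x^3}{\cos x^2}-u_{23}\sin x^3+u_{33}\cos x^3\tan x^2-\tfrac{u_1}2\tfrac{\sin x^3}{\cos x^2}-\tfrac{u_2}2\cos x^3-\tfrac{u_3}2\sin x^3\tan x^2,$$ $$u_{13}\tfrac{\sin x^3}{\cos x^2}+u_{23}\cos x^3+u_{33}\sin x^3\tan x^2+\tfrac{u_1}2\tfrac{\cos x^3}{\cos x^2}-\tfrac{u_2}2\sin x^3+\tfrac{u_3}2\cos x^3\tan x^2,\qquad u_{33}.$$ **Theorem.** 1. Every $n$-dimensional real Lie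 algebra has, for exactly one row (parameters $h$, $p$ included), a basis satisfying the commutation relations of that row. 2. Let $\mathfrak g$ be a real Lie algebra with a basis $e_1,\dots,e_n$ satisfying the relations of a row, and let $\rho$ be a free action of $\mathfrak g$ on an open set $Z\subset\mathbb R^{n+k+1}$. Near every $z_0\in Z$ there are smooth coordinates $(x,y,u)$, $x\in D$, in which $\rho(e_i)=X_i$ for all $i$. If $v:Z\to\mathbb R^{k+1}$ is smooth with $\rho(X)v=0$ for all $X\in\mathfrak g$ and $dv(z_0)$ is surjective, these coordinates can be chosen so that $(y,u)=v$. 3. For every row and every $k\ge0$, the generators $X_i$ are smooth on $\{(x,y,u):x\in D\}$, satisfy the commutation relations of the row, and are linearly independent at every point. The invariants listed in the row are smooth on the second jet space over $D$, and their differentials are linearly independent at every point. They form a complete set of second-order differential invariants: a smooth function $F$ on an open subset $\Omega$ of this jet space satisfies $X_i^{(2)}F=0$ for all $i$ ($X^{(2)}$ denotes the second prolongation of $X$) if and only if near every point of $\Omega$ it is a smooth function of the listed invariants. If $\Omega$ is the whole jet space over $D$, this holds if and only if $F=f(y,u,J_i,u_\mu,K_s,J_{i\mu},u_{\mu\nu})$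 for one smooth function $f$ defined everywhere. 4. Let $E=\sum A\cdot(\text{second derivatives of }u)+B$ be a quasi-linear second-order expression whose coefficients are smooth functions of $(x,y,u,u_i,u_\mu)$ on an open subset $\Omega$ of the first jet space over $D$, and suppose that at each point of $\Omega$ at least one coefficient of a second derivative is non-zero. The equation $E=0$ is invariant, that is, $X_i^{(2)}E=0$ wherever $E=0$, for all $i$, if and only if near every point of $\Omega$ $$E=g\cdot\Bigl(\sum_{\mu,\nu}a^{\mu\nu}u_{\mu\nu}+\sum_s b^sK_s+\sum_{\mu,i}c^{\mu i}J_{i\mu}+d\Bigr)$$ with a nowhere vanishing smooth function $g$ of $(x,y,u,u_i,u_\mu)$ and smooth functions $a^{\mu\nu},b^s,c^{\mu i},d$ of $y,u,J_i,u_\mu$. If $\Omega$ is the whole first jet space over $D$, then $E=0$ is invariant if and only if there is such a representation on all of $\Omega$, with $a^{\mu\nu},b^s,c^{\mu i},d$ defined and smooth everywhere. -/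

import Mathlib

open scoped ContDiff

noncomputable section

/-! ## Jets of scalar functions of several variables and prolongation of vector fields -/

/-- The space `Z` of independent variables `q i`, `i : ι`, and one dependent variable `u`. -/
abbrev Jet0 (ι : Type) : Type := (ι → ℝ) × ℝ

/-- The first jet space, with coordinates `(q, u, u_i)`. -/
abbrev Jet1 (ι : Type) : Type := (ι → ℝ) × ℝ × (ι → ℝ)

/-- The second jet space, with coordinates `(q, u, u_i, u_{ij})`; the second derivatives are
indexed by unordered pairs `s(i, j)`. -/
abbrev Jet2 (ι : Type) : Type := (ι → ℝ) × ℝ × (ι → ℝ) × (Sym2 ι → ℝ)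

namespace Jet2

variable {ι : Type}

/-- Projection to the space of independent and dependent variables. -/
def toJet0 (j : Jet2 ι) : Jet0 ι := (j.1, j.2.1)

/-- Projection to the first jet space. -/
def toJet1 (j : Jet2 ι) : Jet1 ι := (j.1, j.2.1, j.2.2.1)

end Jet2

namespace Prolong

variable {ι : Type} [Fintype ι] [DecidableEq ι]

/-- Total derivative `D_i f = ∂f/∂q^i + u_i ∂f/∂u` of a function `f (q, u)`. -/
def totalD0 (f : Jet0 ι → ℝ) (i : ι) (j : Jet1 ι) : ℝ :=
  fderiv ℝ f (j.1, j.2.1) (Pi.single i 1, j.2.2 i)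

/-- Total derivative `D_i f = ∂f/∂q^i + u_i ∂f/∂u + ∑ l, u_{il} ∂f/∂u_l` of a function
`f (q, u, u_l)`. -/
def totalD1 (f : Jet1 ι → ℝ) (i : ι) (j : Jet2 ι) : ℝ :=
  fderiv ℝ f j.toJet1 (Pi.single i 1, j.2.2.1 i, fun l => j.2.2.2 s(i, l))

/-- For `V = ∑ l, ξ^l ∂/∂q^l + φ ∂/∂u`, the coefficient `φ_i = D_i φ - ∑ l, u_l D_i ξ^l` of
`∂/∂u_i` in the prolonged field. -/
def coeff1 (V : Jet0 ι → Jet0 ι) (i : ι) (j : Jet1 ι) : ℝ :=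
  totalD0 (fun z => (V z).2) i j - ∑ l, j.2.2 l * totalD0 (fun z => (V z).1 l) i j

/-- The expression `φ_{ij} = D_j φ_i - ∑ l, u_{il} D_j ξ^l`. -/
def coeff2 (V : Jet0 ι → Jet0 ι) (i l : ι) (j : Jet2 ι) : ℝ :=
  totalD1 (coeff1 V i) l j -
    ∑ m, j.2.2.2 s(i, m) * totalD0 (fun z => (V z).1 m) l j.toJet1

/-- The second prolongation of the vector field `V` on `Z`, a vector field on the second jet
space. The expression `coeff2` is symmetric in its two indices wherever `V` is of class `C^2`, so
that the average below is just that expression; averaging makes it a function of the unordered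
pair. -/
def pr2 (V : Jet0 ι → Jet0 ι) (j : Jet2 ι) : Jet2 ι :=
  ((V j.toJet0).1, (V j.toJet0).2, fun i => coeff1 V i j.toJet1,
    fun s => Sym2.lift ⟨fun i l => (coeff2 V i l j + coeff2 V l i j) / 2,
      fun i l => by
      simp only [add_comm]⟩ s)

end Prolong

/-! ## The tables -/

/-- One row of the tables for an `n`-dimensional Lie algebra, as raw data. -/
structure TableRow (n : ℕ) where
  /-- Structure constants: `[e_i, e_j] = ∑ l, bracket i j l • e_l`. -/
  bracket : Fin n → Fin n → Fin n → ℝ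
  /-- The chart domain in the space of the variables `x^1, …, x^n`. -/
  dom : Set (Fin n → ℝ)
  /-- The components of the generators: `X_i = ∑ a, gen i x a ∂/∂x^a`. -/
  gen : Fin n → (Fin n → ℝ) → (Fin n → ℝ)
  /-- The `n` invariants linear in the first derivatives along the orbits: `inv1 x v` with
  `v = (u_1, …, u_n)` gives the first-order invariants, and with `v = (u_{1μ}, …, u_{nμ})` the
  invariants containing the mixed derivatives. -/
  inv1 : (Fin n → ℝ) → (Fin n → ℝ) → (Fin n → ℝ)
  /-- The `n (n + 1) / 2` invariants `inv2 x p r` containing the second derivatives along the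
  orbits, where `p i = u_i` and `r i j = u_{ij}`. -/
  inv2 : (Fin n → ℝ) → (Fin n → ℝ) → (Fin n → Fin n → ℝ) → (Fin (n * (n + 1) / 2) → ℝ)

/-- Names of the Lie algebras in the tables; the index is the dimension. -/
inductive LowDimAlg : ℕ → Type
  | g1 : LowDimAlg 1
  | twoG1 : LowDimAlg 2
  | g2 : LowDimAlg 2
  | threeG1 : LowDimAlg 3
  | g1_add_g2 : LowDimAlg 3
  | g3_1 : LowDimAlg 3
  | g3_2 : LowDimAlg 3
  | g3_3 : LowDimAlg 3
  | g3_4 (h : ℝ) (abs_le : |h| ≤ 1) (ne_zero : h ≠ 0) (ne_one : h ≠ 1) : LowDimAlg 3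
  | g3_5 (p : ℝ) (nonneg : 0 ≤ p) : LowDimAlg 3
  | g3_6 : LowDimAlg 3
  | g3_7 : LowDimAlg 3

namespace TableRow

open Real

/-- Structure constants in dimension two with `[e_1, e_2] = c12`. -/
def brackets2 (c12 : Fin 2 → ℝ) : Fin 2 → Fin 2 → Fin 2 → ℝ :=
  ![![0, c12], ![-c12, 0]]

/-- Structure constants in dimension three with `[e_1, e_2] = c12`, `[e_1, e_3] = c13`,
`[e_2, e_3] = c23`. -/
def brackets3 (c12 c13 c23 : Fin 3 → ℝ) : Fin 3 → Fin 3 → Fin 3 → ℝ :=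
  ![![0, c12, c13], ![-c12, 0, c23], ![-c13, -c23, 0]]

def g1 : TableRow 1 where
  bracket := 0
  dom := Set.univ
  gen := ![fun _ => ![1]]
  inv1 := fun _ v => ![v 0]
  inv2 := fun _ _ r => ![r 0 0]

def twoG1 : TableRow 2 where
  bracket := 0
  dom := Set.univ
  gen := ![fun _ => ![1, 0], fun _ => ![0, 1]]
  inv1 := fun _ v => ![v 0, v 1]
  inv2 := fun _ _ r => ![r 0 0, r 0 1, r 1 1]

def g2 : TableRow 2 where
  bracket := brackets2 ![1, 0]
  dom := Set.univ
  gen := ![fun _ => ![1, 0], fun x => ![x 0, 1]]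
  inv1 := fun x v => ![exp (x 1) * v 0, v 1]
  inv2 := fun x p r =>
    ![exp (2 * x 1) * r 0 0, exp (x 1) * (r 0 1 + p 0 / 2), r 1 1]

def threeG1 : TableRow 3 where
  bracket := 0
  dom := Set.univ
  gen := ![fun _ => ![1, 0, 0], fun _ => ![0, 1, 0], fun _ => ![0, 0, 1]]
  inv1 := fun _ v => ![v 0, v 1, v 2]
  inv2 := fun _ _ r => ![r 0 0, r 0 1, r 0 2, r 1 1, r 1 2, r 2 2]

def g1_add_g2 : TableRow 3 where
  bracket := brackets3 ![1, 0, 0] 0 0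
  dom := Set.univ
  gen := ![fun _ => ![1, 0, 0], fun x => ![x 0, 1, 0], fun _ => ![0, 0, 1]]
  inv1 := fun x v => ![exp (x 1) * v 0, v 1, v 2]
  inv2 := fun x p r =>
    ![exp (2 * x 1) * r 0 0, exp (x 1) * (r 0 1 + p 0 / 2), exp (x 1) * r 0 2,
      r 1 1, r 1 2, r 2 2]

def g3_1 : TableRow 3 where
  bracket := brackets3 0 0 ![1, 0, 0]
  dom := Set.univ
  gen := ![fun _ => ![1, 0, 0], fun _ => ![0, 1, 0], fun x => ![x 1, 0, 1]]
  inv1 := fun x v => ![v 0, x 2 * v 0 + v 1, v 2]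
  inv2 := fun x p r =>
    ![r 0 0, x 2 * r 0 0 + r 0 1, r 0 2,
      x 2 ^ 2 * r 0 0 + 2 * x 2 * r 0 1 + r 1 1,
      x 2 * r 0 2 + r 1 2 + p 0 / 2, r 2 2]

def g3_2 : TableRow 3 where
  bracket := brackets3 0 ![1, 0, 0] ![1, 1, 0]
  dom := Set.univ
  gen := ![fun _ => ![1, 0, 0], fun _ => ![0, 1, 0], fun x => ![x 0 + x 1, x 1, 1]]
  inv1 := fun x v => ![exp (x 2) * v 0, exp (x 2) * (x 2 * v 0 + v 1), v 2]
  inv2 := fun x p r =>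
    ![exp (2 * x 2) * r 0 0, exp (2 * x 2) * (x 2 * r 0 0 + r 0 1),
      exp (x 2) * (r 0 2 + p 0 / 2), r 2 2,
      exp (2 * x 2) * (x 2 ^ 2 * r 0 0 + 2 * x 2 * r 0 1 + r 1 1),
      exp (x 2) * x 2 * (r 0 2 + p 0 / 2) + exp (x 2) * (r 1 2 + (p 0 + p 1) / 2)]

def g3_3 : TableRow 3 where
  bracket := brackets3 0 ![1, 0, 0] ![0, 1, 0]
  dom := Set.univ
  gen := ![fun _ => ![1, 0, 0], fun _ => ![0, 1, 0], fun x => ![x 0, x 1, 1]]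
  inv1 := fun x v => ![exp (x 2) * v 0, exp (x 2) * v 1, v 2]
  inv2 := fun x p r =>
    ![exp (2 * x 2) * r 0 0, exp (2 * x 2) * r 0 1, exp (x 2) * (r 0 2 + p 0 / 2),
      exp (2 * x 2) * r 1 1, exp (x 2) * (r 1 2 + p 1 / 2), r 2 2]

def g3_4 (h : ℝ) : TableRow 3 where
  bracket := brackets3 0 ![1, 0, 0] ![0, h, 0]
  dom := Set.univ
  gen := ![fun _ => ![1, 0, 0], fun _ => ![0, 1, 0], fun x => ![x 0, h * x 1, 1]]
  inv1 := fun x v => ![exp (x 2) * v 0, exp (h * x 2) * v 1, v 2]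
  inv2 := fun x p r =>
    ![exp (2 * x 2) * r 0 0, exp ((1 + h) * x 2) * r 0 1, exp (x 2) * (r 0 2 + p 0 / 2),
      exp (2 * h * x 2) * r 1 1, exp (h * x 2) * (r 1 2 + h * p 1 / 2), r 2 2]

def g3_5 (c : ℝ) : TableRow 3 where
  bracket := brackets3 0 ![c, -1, 0] ![1, c, 0]
  dom := Set.univ
  gen := ![fun _ => ![1, 0, 0], fun _ => ![0, 1, 0],
    fun x => ![c * x 0 + x 1, c * x 1 - x 0, 1]]
  inv1 := fun x v =>
    ![exp (c * x 2) * (v 0 * cos (x 2) - v 1 * sin (x 2)),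
      exp (c * x 2) * (v 0 * sin (x 2) + v 1 * cos (x 2)), v 2]
  inv2 := fun x p r =>
    ![exp (2 * c * x 2) * (r 0 0 + r 1 1),
      exp (2 * c * x 2) *
        ((r 0 0 - r 1 1) * cos (2 * x 2) - 2 * r 0 1 * sin (2 * x 2)),
      exp (2 * c * x 2) *
        ((r 0 0 - r 1 1) * sin (2 * x 2) + 2 * r 0 1 * cos (2 * x 2)),
      exp (c * x 2) *
        ((r 0 2 + (c * p 0 - p 1) / 2) * cos (x 2) - (r 1 2 + (c * p 1 + p 0) / 2) * sin (x 2)),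
      exp (c * x 2) *
        ((r 0 2 + (c * p 0 - p 1) / 2) * sin (x 2) + (r 1 2 + (c * p 1 + p 0) / 2) * cos (x 2)),
      r 2 2]

def g3_6 : TableRow 3 where
  bracket := brackets3 ![1, 0, 0] ![0, 2, 0] ![0, 0, 1]
  dom := Set.univ
  gen := ![fun _ => ![1, 0, 0], fun x => ![x 0, 1, 0],
    fun x => ![x 0 ^ 2, 2 * x 0, exp (x 1)]]
  inv1 := fun x v =>
    ![exp (x 1) * v 0 + 2 * x 2 * v 1 + x 2 ^ 2 * v 2, v 1 + x 2 * v 2, v 2]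
  inv2 := fun x p r =>
    ![1 / 4 * exp (2 * x 1) * r 0 0
        + exp (x 1) * x 2 * (r 0 1 + (x 2 * r 0 2 + p 0) / 2)
        + x 2 ^ 2 * (x 2 * r 1 2 + r 1 1 + (p 1 + x 2 * p 2) / 2 + x 2 ^ 2 * r 2 2 / 4),
      exp (x 1) * (r 0 1 + x 2 * r 0 2 + p 0 / 2) + x 2 ^ 3 * r 2 2
        + 3 * x 2 ^ 2 * (r 1 2 + p 2 / 2) + x 2 * (2 * r 1 1 + p 1),
      exp (x 1) * r 0 2 + x 2 ^ 2 * r 2 2 + x 2 * (2 * r 1 2 + p 2) + p 1,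
      x 2 ^ 2 * r 2 2 + x 2 * (2 * r 1 2 + p 2) + r 1 1,
      x 2 * r 2 2 + r 1 2 + p 2 / 2,
      r 2 2]

def g3_7 : TableRow 3 where
  bracket := brackets3 ![0, 0, 1] ![0, -1, 0] ![1, 0, 0]
  dom := {x | |x 1| < π / 2}
  gen := ![fun _ => ![1, 0, 0],
    fun x => ![sin (x 0) * tan (x 1), cos (x 0), sin (x 0) / cos (x 1)],
    fun x => ![cos (x 0) * tan (x 1), -sin (x 0), cos (x 0) / cos (x 1)]]
  inv1 := fun x v =>
    ![v 0 * (cos (x 2) / cos (x 1)) - v 1 * sin (x 2) + v 2 * tan (x 1) * cos (x 2),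
      v 0 * (sin (x 2) / cos (x 1)) + v 1 * cos (x 2) + v 2 * tan (x 1) * sin (x 2),
      v 2]
  inv2 := fun x p r =>
    ![r 0 0 * (cos (x 2) ^ 2 / cos (x 1) ^ 2) - r 0 1 * (sin (2 * x 2) / cos (x 1))
        + 2 * r 0 2 * (tan (x 1) * cos (x 2) ^ 2 / cos (x 1)) + r 1 1 * sin (x 2) ^ 2
        - r 1 2 * tan (x 1) * sin (2 * x 2) + r 2 2 * tan (x 1) ^ 2 * cos (x 2) ^ 2
        - p 0 * (tan (x 1) * sin (2 * x 2) / cos (x 1)) - p 1 * tan (x 1) * cos (x 2) ^ 2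
        - p 2 * (1 / 2 + tan (x 1) ^ 2) * sin (2 * x 2),
      r 0 0 * (sin (2 * x 2) / (2 * cos (x 1) ^ 2)) + r 0 1 * (cos (2 * x 2) / cos (x 1))
        + r 0 2 * (tan (x 1) * sin (2 * x 2) / cos (x 1)) - 1 / 2 * r 1 1 * sin (2 * x 2)
        + r 1 2 * tan (x 1) * cos (2 * x 2) + 1 / 2 * r 2 2 * tan (x 1) ^ 2 * sin (2 * x 2)
        + p 0 * (tan (x 1) * cos (2 * x 2) / cos (x 1))
        - 1 / 2 * p 1 * tan (x 1) * sin (2 * x 2)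
        + p 2 * (1 / 2 + tan (x 1) ^ 2) * cos (2 * x 2),
      r 0 0 * (sin (x 2) ^ 2 / cos (x 1) ^ 2) + r 0 1 * (sin (2 * x 2) / cos (x 1))
        + 2 * r 0 2 * (tan (x 1) * sin (x 2) ^ 2 / cos (x 1)) + r 1 1 * cos (x 2) ^ 2
        + r 1 2 * tan (x 1) * sin (2 * x 2) + r 2 2 * tan (x 1) ^ 2 * sin (x 2) ^ 2
        + p 0 * (tan (x 1) * sin (2 * x 2) / cos (x 1)) - p 1 * tan (x 1) * sin (x 2) ^ 2
        + p 2 * (1 / 2 + tan (x 1) ^ 2) * sin (2 * x 2),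
      r 0 2 * (cos (x 2) / cos (x 1)) - r 1 2 * sin (x 2) + r 2 2 * cos (x 2) * tan (x 1)
        - p 0 / 2 * (sin (x 2) / cos (x 1)) - p 1 / 2 * cos (x 2)
        - p 2 / 2 * sin (x 2) * tan (x 1),
      r 0 2 * (sin (x 2) / cos (x 1)) + r 1 2 * cos (x 2) + r 2 2 * sin (x 2) * tan (x 1)
        + p 0 / 2 * (cos (x 2) / cos (x 1)) - p 1 / 2 * sin (x 2)
        + p 2 / 2 * cos (x 2) * tan (x 1),
      r 2 2]

end TableRow

namespace LowDimAlg

/-- The row of the tables that belongs to the name. -/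
def row : {n : ℕ} → LowDimAlg n → TableRow n
  | _, g1 => TableRow.g1
  | _, twoG1 => TableRow.twoG1
  | _, g2 => TableRow.g2
  | _, threeG1 => TableRow.threeG1
  | _, g1_add_g2 => TableRow.g1_add_g2
  | _, g3_1 => TableRow.g3_1
  | _, g3_2 => TableRow.g3_2
  | _, g3_3 => TableRow.g3_3
  | _, g3_4 h _ _ _ => TableRow.g3_4 h
  | _, g3_5 p _ => TableRow.g3_5 p
  | _, g3_6 => TableRow.g3_6
  | _, g3_7 => TableRow.g3_7

variable {n : ℕ} (T : LowDimAlg n) (k : ℕ)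

/-- The basis `b` of the Lie algebra `L` satisfies the commutation relations of the row `T`. -/
def IsAdapted {L : Type*} [LieRing L] [LieAlgebra ℝ L] (b : Module.Basis (Fin n) ℝ L) : Prop :=
  ∀ i j, ⁅b i, b j⁆ = ∑ l, T.row.bracket i j l • b l

/-! The independent variables are `x^a = q (inl a)`, `a : Fin n`, and `y^μ = q (inr μ)`,
`μ : Fin k`; the dependent variable is `u`. Thus `Z` has dimension `n + (k + 1)` and there are
`k + 1` invariant variables `y^1, …, y^k, u`. -/

/-- The part of `Z` over the chart domain of the row. -/
def domZ : Set (Jet0 (Fin n ⊕ Fin k)) := {z | (fun a => z.1 (Sum.inl a)) ∈ T.row.dom}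

/-- The part of the first jet space over the chart domain of the row. -/
def dom1 : Set (Jet1 (Fin n ⊕ Fin k)) := {j | (fun a => j.1 (Sum.inl a)) ∈ T.row.dom}

/-- The part of the second jet space over the chart domain of the row. -/
def dom2 : Set (Jet2 (Fin n ⊕ Fin k)) := {j | (fun a => j.1 (Sum.inl a)) ∈ T.row.dom}

/-- The generator `X_i` of the row as a vector field on `Z`. -/
def genZ (i : Fin n) (z : Jet0 (Fin n ⊕ Fin k)) : Jet0 (Fin n ⊕ Fin k) :=
  (Sum.elim (T.row.gen i (fun a => z.1 (Sum.inl a))) 0, 0)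

/-- The second prolongation of the generator `X_i`. -/
def pr2Gen (i : Fin n) : Jet2 (Fin n ⊕ Fin k) → Jet2 (Fin n ⊕ Fin k) :=
  Prolong.pr2 (T.genZ k i)

variable {k}

/-- The invariants of the row up to first order, in the order `y`, `u`, `u_(i)`, `u_μ`. -/
def firstInv (j : Jet1 (Fin n ⊕ Fin k)) :
    (Fin k → ℝ) × ℝ × (Fin n → ℝ) × (Fin k → ℝ) :=
  (fun μ => j.1 (Sum.inr μ), j.2.1,
    T.row.inv1 (fun a => j.1 (Sum.inl a)) (fun a => j.2.2 (Sum.inl a)),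
    fun μ => j.2.2 (Sum.inr μ))

/-- The invariants of the row that contain the second derivatives along the orbits. -/
def orbitInv (j : Jet2 (Fin n ⊕ Fin k)) : Fin (n * (n + 1) / 2) → ℝ :=
  T.row.inv2 (fun a => j.1 (Sum.inl a)) (fun a => j.2.2.1 (Sum.inl a))
    (fun a b => j.2.2.2 s(Sum.inl a, Sum.inl b))

/-- The invariants of the row that contain the mixed derivatives `u_{1μ}, …, u_{nμ}`. -/
def mixedInv (j : Jet2 (Fin n ⊕ Fin k)) (μ : Fin k) : Fin n → ℝ :=
  T.row.inv1 (fun a => j.1 (Sum.inl a)) (fun a => j.2.2.2 s(Sum.inl a, Sum.inr μ))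

variable (n k) in
/-- The space of values of all the invariants of a row. -/
abbrev InvSpace : Type :=
  ((Fin k → ℝ) × ℝ × (Fin n → ℝ) × (Fin k → ℝ)) ×
    (Fin (n * (n + 1) / 2) → ℝ) × (Fin k → Fin n → ℝ) × (Sym2 (Fin k) → ℝ)

/-- All the invariants of the row: `y`, `u`, `u_(i)`, `u_μ`; the second-order ones along the
orbits; the mixed ones; and `u_{μν}`. -/
def allInv (j : Jet2 (Fin n ⊕ Fin k)) : InvSpace n k :=
  (T.firstInv j.toJet1, T.orbitInv j, T.mixedInv j, fun s => j.2.2.2 (s.map Sum.inr))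

/-- The left-hand side of the quasi-linear equation built from the invariants of the row with
coefficient functions `a`, `b`, `c`, `d` of the invariants `y`, `u`, `u_(i)`, `u_μ`. -/
def invariantQuasiLinear
    (a : (Fin k → ℝ) × ℝ × (Fin n → ℝ) × (Fin k → ℝ) → Fin k → Fin k → ℝ)
    (b : (Fin k → ℝ) × ℝ × (Fin n → ℝ) × (Fin k → ℝ) → Fin (n * (n + 1) / 2) → ℝ)
    (c : (Fin k → ℝ) × ℝ × (Fin n → ℝ) × (Fin k → ℝ) → Fin k → Fin n → ℝ)
    (d : (Fin k → ℝ) × ℝ × (Fin n → ℝ) × (Fin k → ℝ) → ℝ)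
    (j : Jet2 (Fin n ⊕ Fin k)) : ℝ :=
  (∑ μ, ∑ ν, a (T.firstInv j.toJet1) μ ν * j.2.2.2 s(Sum.inr μ, Sum.inr ν)) +
    (∑ s, b (T.firstInv j.toJet1) s * T.orbitInv j s) +
    (∑ μ, ∑ i, c (T.firstInv j.toJet1) μ i * T.mixedInv j μ i) +
    d (T.firstInv j.toJet1)

variable (k)

/-- `F` is a second-order differential invariant of the row on the set `Ω`: it is annihilated by
the second prolongations of the generators. -/
def IsDiffInvariantOn (F : Jet2 (Fin n ⊕ Fin k) → ℝ) (Ω : Set (Jet2 (Fin n ⊕ Fin k))) : Prop :=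
  ∀ j ∈ Ω, ∀ i, fderiv ℝ F j (T.pr2Gen k i j) = 0

/-- The equation `E = 0`, where `E` is given over the set `Ω` of the first jet space, admits the
generators of the row as infinitesimal symmetries: the prolonged generators are tangent to the
surface `E = 0` in the second jet space. -/
def IsSymmetricEquationOver (E : Jet2 (Fin n ⊕ Fin k) → ℝ) (Ω : Set (Jet1 (Fin n ⊕ Fin k))) :
    Prop :=
  ∀ j : Jet2 (Fin n ⊕ Fin k), j.toJet1 ∈ Ω → E j = 0 → ∀ i, fderiv ℝ E j (T.pr2Gen k i j) = 0

/-- `φ` is a smooth chart inside `Z`, with values in the variables `(x, y, u)` of the row, that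
carries the vector fields `V i` to the generators `X_i` of the row. -/
structure IsNormalizingChart {E : Type*} [NormedAddCommGroup E] [NormedSpace ℝ E] (Z : Set E)
    (V : Fin n → E → E) (φ : OpenPartialHomeomorph E (Jet0 (Fin n ⊕ Fin k))) : Prop where
  source_subset : φ.source ⊆ Z
  target_subset : φ.target ⊆ T.domZ k
  contDiffOn : ContDiffOn ℝ ∞ φ φ.source
  contDiffOn_symm : ContDiffOn ℝ ∞ φ.symm φ.target
  map_field : ∀ z ∈ φ.source, ∀ i, fderiv ℝ φ z (V i z) = T.genZ k i (φ z)

end LowDimAlg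

/-- The second-order quasi-linear expression `∑_{i ≤ j} A_{ij} u_{ij} + B`, with coefficients
depending on `(q, u, u_i)`. -/
def quasiLinear {ι : Type} [Fintype ι] [DecidableEq ι] (A : Jet1 ι → Sym2 ι → ℝ) (B : Jet1 ι → ℝ)
    (j : Jet2 ι) : ℝ :=
  (∑ s, A j.toJet1 s * j.2.2.2 s) + B j.toJet1

/-- The linear map `ρ` from a Lie algebra `L` to vector fields is a free smooth infinitesimal action
on `Z`: a Lie algebra homomorphism, with trivial isotropy algebra at every point of `Z`. -/
structure IsFreeAction {L E : Type*} [LieRing L] [LieAlgebra ℝ L]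
    [NormedAddCommGroup E] [NormedSpace ℝ E] (Z : Set E) (ρ : L →ₗ[ℝ] (E → E)) : Prop where
  contDiffOn : ∀ X, ContDiffOn ℝ ∞ (ρ X) Z
  lieBracket : ∀ X Y, ∀ z ∈ Z, VectorField.lieBracket ℝ (ρ X) (ρ Y) z = ρ ⁅X, Y⁆ z
  free : ∀ z ∈ Z, Function.Injective (fun X => ρ X z)

end

/-! The theorem rests on one device: every row has an invariant frame Y_1, …, Y_n on D, that is,
pointwise independent vector fields commuting with all generators X_i (`TableRow.InvariantFrame`).
Its coefficients are read off from the table, because J_i = Y_i u. Likewise J_{iμ} = Y_i u_μ, and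
the K_s are an invertible linear image of the symmetric matrix (Y_i Y_j u + Y_j Y_i u) / 2.

Invariants. Since [X_i, Y_j] = 0, the prolonged generators annihilate these functions; for the
second-order ones the term with the second derivatives of X_i in the prolongation is cancelled by
the derivative of the first-order part of Y_i Y_j u (`fderiv_symmDeriv_gen`,
`fderiv_frameHessian_pr2Gen`). Conversely, x and the values of the listed invariants are coordinates
on the whole jet space over D: `jet2Of` reconstructs the jet (`allInv_jet2Of`, `jet2Of_allInv`). In
these coordinates the prolonged generators act on x alone, as X_i (`fderiv_jet2Of_gen`). The X_i
span all directions of x, so an invariant function has zero derivative in x at fixed values of the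
invariants. It is therefore a function of these values, locally always, and globally because D is
convex.

Invariant equations. In the same coordinates E is an affine function of the second-order invariants,
with coefficients depending on x and on the first-order invariants. Invariance says that the
x-derivative of this affine function vanishes on its zero hyperplane, so the derivative is a
multiple of the function (`exists_eq_mul_of_affine_zero`). Hence the coefficient vector only gets
rescaled as x moves. Divided by the Euclidean length of its linear part it is independent of x
(`div_sqrt_eq_of_fderiv_eq_zero`); that length is the factor g.

Normal form of actions. Let ω(x, z) be the linear map that sends each X_i(x) to ρ(e_i)_z. Equality
of the structure constants is exactly the integrability condition of the total differential equation
dΦ = ω(x, Φ) (`frameForm_integrable`). This equation is solved along the rays from x = 0. The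
integral equation is a fixed point problem in the Banach space of paths, and the inverse function
theorem there gives solutions depending smoothly on the end point of the ray and on the initial
value (`exists_totalDifferential_solution`). With initial values on a complement of the orbit
directions, Φ is a local diffeomorphism whose inverse is the required chart
(`exists_straightening`). The transversal coordinates may be exchanged for any independent
invariants v.

Classification in dimension three. Write [b_{i+1}, b_{i+2}] = Σ_j N_ij b_j with indices mod 3. The
antisymmetric part of N is a vector a, and the Jacobi identity is a N = 0. If a ≠ 0, the vectors
orthogonal to a form an abelian ideal, and the algebra is ℝ² ⋊ ℝ, determined by a 2 × 2 matrix up to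
conjugation and scaling (`SemidirectForm.hasAdaptedBasis`). If a = 0, N is symmetric and an
orthogonal change of basis diagonalizes it; the signs of the eigenvalues decide the row
(`DiagonalForm.hasAdaptedBasis`). Rows are told apart by the trace of ad and the Killing form, in
the last instance by the ratio of the Killing form to the squared trace, which determines h and p
(`eq_of_structureCode_eq`). -/

noncomputable section

open Set Filter Topology

/-! ### Inverse functions that are smooth on their whole domain -/

section SmoothInverse

/-- Smooth inverse function theorem, with smoothness of the inverse on the whole target. -/
theorem ContDiffOn.exists_openPartialHomeomorph {E F : Type*}
    [NormedAddCommGroup E] [NormedSpace ℝ E] [CompleteSpace E]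
    [NormedAddCommGroup F] [NormedSpace ℝ F]
    {f : E → F} {U : Set E} {a : E} (hU : IsOpen U) (ha : a ∈ U) (hf : ContDiffOn ℝ ∞ f U)
    (hinv : (fderiv ℝ f a).IsInvertible) :
    ∃ e : OpenPartialHomeomorph E F, a ∈ e.source ∧ e.source ⊆ U ∧ (∀ x, e x = f x) ∧
      ContDiffOn ℝ ∞ e.symm e.target ∧ ∀ x ∈ e.source, (fderiv ℝ f x).IsInvertible := by
  have hfa : ContDiffAt ℝ ∞ f a := hf.contDiffAt (hU.mem_nhds ha)
  obtain ⟨A, hA⟩ := hinv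
  have hder : HasFDerivAt f (A : E →L[ℝ] F) a := by
    rw [hA]; exact (hfa.differentiableAt (by simp)).hasFDerivAt
  set e₀ := hfa.toOpenPartialHomeomorph f hder (by simp) with he₀
  have he₀c : ∀ x, e₀ x = f x := fun x => by rw [he₀, ContDiffAt.toOpenPartialHomeomorph_coe]
  have hcont : ContinuousOn (fderiv ℝ f) U :=
    (hf.continuousOn_fderiv_of_isOpen hU (by simp))
  -- The chart is cut down to the open set of points with invertible derivative, since the inverse
  -- is smooth exactly at images of such points.
  set s := U ∩ (fderiv ℝ f) ⁻¹' (Set.range ((↑) : (E ≃L[ℝ] F) → E →L[ℝ] F)) with hs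
  have hso : IsOpen s := hcont.isOpen_inter_preimage hU ContinuousLinearEquiv.isOpen
  refine ⟨e₀.restrOpen s hso, ?_, ?_, fun x => he₀c x, ?_, ?_⟩
  · refine ⟨hfa.mem_toOpenPartialHomeomorph_source hder (by simp), ha, A, hA⟩
  · exact fun x hx => hx.2.1
  · intro y hy
    set e := e₀.restrOpen s hso
    have hx : e.symm y ∈ e.source := e.map_target hy
    obtain ⟨B, hB⟩ := hx.2.2
    have hfx : ContDiffAt ℝ ∞ f (e.symm y) := hf.contDiffAt (hU.mem_nhds hx.2.1)
    refine (e.contDiffAt_symm (f₀' := B) hy ?_ ?_).contDiffWithinAt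
    · rw [hB]
      exact (hfx.differentiableAt (by simp)).hasFDerivAt
    · exact hfx
  · intro x hx
    obtain ⟨B, hB⟩ := hx.2.2
    exact ⟨B, hB⟩

end SmoothInverse

/-! ### Composition operators on spaces of continuous paths -/

section Nemytskii

variable {K : Type} [TopologicalSpace K] [CompactSpace K]
  {E F : Type} [NormedAddCommGroup E] [NormedSpace ℝ E] [NormedAddCommGroup F] [NormedSpace ℝ F]

/-- Pointwise application of a continuous family of continuous linear maps. -/
def ContinuousMap.pointwiseApply (K E F : Type) [TopologicalSpace K] [CompactSpace K]
    [NormedAddCommGroup E] [NormedSpace ℝ E] [NormedAddCommGroup F] [NormedSpace ℝ F] :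
    C(K, E →L[ℝ] F) →L[ℝ] C(K, E) →L[ℝ] C(K, F) :=
  LinearMap.mkContinuous₂
    (LinearMap.mk₂ ℝ (fun (A : C(K, E →L[ℝ] F)) (h : C(K, E)) =>
        (⟨fun t => A t (h t), A.continuous.clm_apply h.continuous⟩ : C(K, F)))
      (fun _ _ _ => by ext; simp) (fun _ _ _ => by ext; simp)
      (fun _ _ _ => by ext; simp) (fun _ _ _ => by ext; simp)) 1
    (fun A h => by
      rw [one_mul, ContinuousMap.norm_le _ (by positivity)]
      intro t
      exact ((A t).le_opNorm _).trans (by gcongr <;> exact ContinuousMap.norm_coe_le_norm _ _))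

/-- Pointwise application of a continuous bilinear map to continuous functions. -/
def ContinuousMap.pointwiseBilin {H : Type} [NormedAddCommGroup H] [NormedSpace ℝ H]
    (K : Type) [TopologicalSpace K] [CompactSpace K] (B : H →L[ℝ] E →L[ℝ] F) :
    C(K, H) →L[ℝ] C(K, E) →L[ℝ] C(K, F) :=
  LinearMap.mkContinuous₂
    (LinearMap.mk₂ ℝ (fun (A : C(K, H)) (h : C(K, E)) =>
        (⟨fun t => B (A t) (h t),
          (B.continuous.comp A.continuous).clm_apply h.continuous⟩ : C(K, F)))
      (fun _ _ _ => by ext; simp) (fun _ _ _ => by ext; simp)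
      (fun _ _ _ => by ext; simp) (fun _ _ _ => by ext; simp)) ‖B‖
    (fun A h => by
      rw [ContinuousMap.norm_le _ (by positivity)]
      intro t
      exact (B.le_opNorm₂ _ _).trans (by gcongr <;> exact ContinuousMap.norm_coe_le_norm _ _))

/-- At each t the remainder is estimated by the mean value inequality on a ball around γ t. The
estimate is uniform in t because composition with f' is continuous in the supremum norm; this is
where compactness of K enters. -/
theorem ContinuousMap.hasFDerivAt_postcomp (f : C(E, F)) (f' : C(E, E →L[ℝ] F))
    (hf : ∀ x, HasFDerivAt f (f' x) x) (γ : C(K, E)) :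
    HasFDerivAt (fun γ : C(K, E) => f.comp γ) (ContinuousMap.pointwiseApply K E F (f'.comp γ)) γ := by
  rw [hasFDerivAt_iff_isLittleO, Asymptotics.isLittleO_iff]
  intro ε hε
  have hc : Continuous (fun γ : C(K, E) => f'.comp γ) := ContinuousMap.continuous_postcomp f'
  obtain ⟨δ, hδ, hclose⟩ := (Metric.continuousAt_iff (α := C(K, E)) (β := C(K, E →L[ℝ] F))
    (f := fun γ => f'.comp γ) (a := γ)).1 hc.continuousAt ε hε
  filter_upwards [Metric.ball_mem_nhds γ hδ] with η hη
  rw [ContinuousMap.norm_le _ (by positivity)]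
  intro t
  have hbound : ∀ y ∈ Metric.ball (γ t) δ, ‖f' y - f' (γ t)‖ ≤ ε := by
    intro y hy
    -- Translating γ by the constant y - γ t produces a path close to γ that passes through y at
    -- time t, which turns closeness in the supremum norm into a bound at y.
    have h1 : dist (γ + ContinuousMap.const K (y - γ t)) γ < δ := by
      rw [dist_eq_norm, add_sub_cancel_left]
      rw [mem_ball_iff_norm] at hy
      exact lt_of_le_of_lt ((ContinuousMap.norm_le _ (norm_nonneg _)).2 fun _ => le_rfl) hy
    have h2 := (ContinuousMap.dist_lt_iff hε).1 (hclose h1) t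
    simp only [ContinuousMap.comp_apply, ContinuousMap.add_apply, ContinuousMap.const_apply,
      add_sub_cancel] at h2
    rw [← dist_eq_norm]
    exact h2.le
  have hηt : η t ∈ Metric.ball (γ t) δ := lt_of_le_of_lt (ContinuousMap.dist_apply_le_dist t) hη
  have := (convex_ball (γ t) δ).norm_image_sub_le_of_norm_hasFDerivWithin_le' (f := f) (f' := f')
    (φ := f' (γ t)) (C := ε) (fun x _ => (hf x).hasFDerivWithinAt) hbound
    (Metric.mem_ball_self hδ) hηt
  refine this.trans ?_
  gcongr
  exact ContinuousMap.norm_coe_le_norm (η - γ) t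

/-- Induction on the order: the derivative of composition with f is composition with f' followed by
the continuous linear map `pointwiseApply`. The target space F varies in the induction because f'
takes values in E →L[ℝ] F. -/
theorem ContinuousMap.contDiff_postcomp_nat (n : ℕ) : ∀ (F : Type) [NormedAddCommGroup F]
    [NormedSpace ℝ F] (f : C(E, F)), ContDiff ℝ n f →
    ContDiff ℝ n (fun γ : C(K, E) => f.comp γ) := by
  induction n with
  | zero =>
    intro F _ _ f _
    exact contDiff_zero.2 (ContinuousMap.continuous_postcomp f)
  | succ n ih =>
    intro F _ _ f hf
    have hf' : ContDiff ℝ n (fderiv ℝ f) := hf.fderiv_right (m := n) (by simp)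
    have hd : Differentiable ℝ f := hf.differentiable (by simp)
    let f' : C(E, E →L[ℝ] F) := ⟨fderiv ℝ f, hf'.continuous⟩
    have key : ∀ γ : C(K, E), HasFDerivAt (fun γ : C(K, E) => f.comp γ)
        (ContinuousMap.pointwiseApply K E F (f'.comp γ)) γ :=
      ContinuousMap.hasFDerivAt_postcomp f f' (fun x => (hd x).hasFDerivAt)
    push_cast
    rw [contDiff_succ_iff_hasFDerivAt (n := (n : ℕ))]
    have h1 : ContDiff ℝ n (fun γ : C(K, E) => f'.comp γ) := ih (E →L[ℝ] F) f' hf'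
    have h2 : ContDiff ℝ n (fun A => ContinuousMap.pointwiseApply K E F A) := by
      fun_prop
    exact ⟨fun γ => ContinuousMap.pointwiseApply K E F (f'.comp γ), h2.comp h1, key⟩

/-- Composition with a smooth map is a smooth operator on spaces of continuous functions. -/
theorem ContinuousMap.contDiff_postcomp (f : C(E, F)) (hf : ContDiff ℝ ∞ f) :
    ContDiff ℝ ∞ (fun γ : C(K, E) => f.comp γ) :=
  contDiff_infty.2 fun n => ContinuousMap.contDiff_postcomp_nat n F f (contDiff_infty.1 hf n)

end Nemytskii

/-- A function that is smooth near a point agrees near that point with a globally smooth one. -/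
theorem ContDiffOn.exists_contDiff_extension {E F : Type*}
    [NormedAddCommGroup E] [NormedSpace ℝ E] [FiniteDimensional ℝ E]
    [NormedAddCommGroup F] [NormedSpace ℝ F] {f : E → F} {U : Set E} (hU : IsOpen U)
    (hf : ContDiffOn ℝ ∞ f U) {a : E} (ha : a ∈ U) :
    ∃ (g : E → F) (U' : Set E), ContDiff ℝ ∞ g ∧ IsOpen U' ∧ a ∈ U' ∧ U' ⊆ U ∧
      ∀ x ∈ U', g x = f x := by
  obtain ⟨r, hr, hrU⟩ := Metric.isOpen_iff.1 hU a ha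
  let χ : ContDiffBump a := ⟨r / 4, r / 2, by linarith, by linarith⟩
  refine ⟨fun x => χ x • f x, Metric.ball a (r / 4), ?_, Metric.isOpen_ball,
    Metric.mem_ball_self (by linarith), ?_, ?_⟩
  · rw [contDiff_iff_contDiffAt]
    intro x
    by_cases hx : x ∈ U
    · exact χ.contDiff.contDiffAt.smul (hf.contDiffAt (hU.mem_nhds hx))
    · have hx' : x ∉ tsupport χ := by
        rw [χ.tsupport_eq]
        intro h
        apply hx
        apply hrU
        have hx₂ := Metric.mem_closedBall.1 h
        exact lt_of_le_of_lt hx₂ (by change r / 2 < r; linarith)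
      have : (fun x => χ x • f x) =ᶠ[𝓝 x] fun _ => 0 := by
        filter_upwards [(isClosed_tsupport χ).isOpen_compl.mem_nhds hx'] with y hy
        rw [image_eq_zero_of_notMem_tsupport hy, zero_smul]
      exact contDiffAt_const.congr_of_eventuallyEq this
  · exact (Metric.ball_subset_ball (by linarith)).trans hrU
  · intro x hx
    have : χ x = 1 := χ.one_of_mem_closedBall (Metric.ball_subset_closedBall hx)
    simp [this]

end

noncomputable section

open Set Filter Topology

/-! ### Fixed points depending smoothly on a parameter -/

section FixedPoint

/-- A smooth family of maps that is constant at one parameter has fixed points depending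
smoothly on the parameter near that one. -/
theorem ContDiff.exists_contDiffOn_fixedPoint {Γ P : Type*}
    [NormedAddCommGroup Γ] [NormedSpace ℝ Γ] [CompleteSpace Γ]
    [NormedAddCommGroup P] [NormedSpace ℝ P] [CompleteSpace P]
    {T : Γ × P → Γ} (hT : ContDiff ℝ ∞ T) {p₀ : P} {γ₀ : Γ} (h₀ : ∀ γ, T (γ, p₀) = γ₀) :
    ∃ (W : Set P) (c : P → Γ), IsOpen W ∧ p₀ ∈ W ∧ ContDiffOn ℝ ∞ c W ∧ c p₀ = γ₀ ∧
      ∀ p ∈ W, T (c p, p) = c p := by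
  -- Fixed points over p are the points that H sends to (0, p). As T(·, p₀) is constant, the
  -- derivative of H at (γ₀, p₀) has identity diagonal blocks and a single off-diagonal block, so
  -- its inverse can be written down.
  let H : Γ × P → Γ × P := fun q => (q.1 - T q, q.2)
  have hH : ContDiff ℝ ∞ H := (contDiff_fst.sub hT).prodMk contDiff_snd
  have hTd : HasFDerivAt T (fderiv ℝ T (γ₀, p₀)) (γ₀, p₀) :=
    (hT.differentiable (by simp) _).hasFDerivAt
  have hHd : HasFDerivAt H ((ContinuousLinearMap.fst ℝ Γ P - fderiv ℝ T (γ₀, p₀)).prod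
      (ContinuousLinearMap.snd ℝ Γ P)) (γ₀, p₀) :=
    (hasFDerivAt_fst.sub hTd).prodMk hasFDerivAt_snd
  have hzero : ∀ v : Γ, fderiv ℝ T (γ₀, p₀) (v, 0) = 0 := by
    intro v
    have h1 : HasFDerivAt (fun γ : Γ => (γ, p₀)) (ContinuousLinearMap.inl ℝ Γ P) γ₀ :=
      hasFDerivAt_prodMk_left γ₀ p₀
    have h2 := hTd.comp γ₀ h1
    have h3 : HasFDerivAt (T ∘ fun γ : Γ => (γ, p₀)) (0 : Γ →L[ℝ] Γ) γ₀ := by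
      have : (T ∘ fun γ : Γ => (γ, p₀)) = fun _ => γ₀ := funext h₀
      rw [this]
      exact hasFDerivAt_const _ _
    exact congrArg (fun L : Γ →L[ℝ] Γ => L v) (h2.unique h3)
  have hsplit : ∀ (v : Γ) (w : P), fderiv ℝ T (γ₀, p₀) (v, w) = fderiv ℝ T (γ₀, p₀) (0, w) := by
    intro v w
    have : ((v, w) : Γ × P) = (v, 0) + (0, w) := by simp
    rw [this, map_add, hzero, zero_add]
  have hinv : (fderiv ℝ H (γ₀, p₀)).IsInvertible := by
    rw [hHd.fderiv]
    refine ⟨ContinuousLinearEquiv.equivOfInverse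
      ((ContinuousLinearMap.fst ℝ Γ P - fderiv ℝ T (γ₀, p₀)).prod (ContinuousLinearMap.snd ℝ Γ P))
      ((ContinuousLinearMap.fst ℝ Γ P + (fderiv ℝ T (γ₀, p₀)).comp
        ((0 : Γ × P →L[ℝ] Γ).prod (ContinuousLinearMap.snd ℝ Γ P))).prod
      (ContinuousLinearMap.snd ℝ Γ P)) ?_ ?_, rfl⟩
    · rintro ⟨v, w⟩
      simp [hsplit v w]
    · rintro ⟨v, w⟩
      simp [hsplit _ w]
  obtain ⟨e, hae, -, hef, hes, -⟩ :=
    hH.contDiffOn.exists_openPartialHomeomorph isOpen_univ (mem_univ _) hinv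
  have hHa : H (γ₀, p₀) = (0, p₀) := by simp [H, h₀]
  refine ⟨(fun p => ((0 : Γ), p)) ⁻¹' e.target, fun p => (e.symm (0, p)).1,
    e.open_target.preimage (by fun_prop), ?_, ?_, ?_, ?_⟩
  · rw [mem_preimage, ← hHa, ← hef]
    exact e.map_source hae
  · exact contDiff_fst.comp_contDiffOn (hes.comp (by fun_prop) fun _ hp => hp)
  · change (e.symm (0, p₀)).1 = γ₀
    rw [← hHa, ← hef, e.left_inv hae]
  · intro p hp
    have h1 : H (e.symm (0, p)) = (0, p) := by rw [← hef, e.right_inv hp]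
    have h2 : (e.symm (0, p)).2 = p := congrArg Prod.snd h1
    have h3 := congrArg Prod.fst h1
    have h4 : e.symm (0, p) = ((e.symm (0, p)).1, p) := Prod.ext rfl h2
    simp only [H] at h3
    rw [← h4]
    exact (sub_eq_zero.1 h3).symm

end FixedPoint

/-! ### Operations on paths -/

section Paths

open unitInterval MeasureTheory

variable (X E : Type) [NormedAddCommGroup X] [NormedSpace ℝ X]
  [NormedAddCommGroup E] [NormedSpace ℝ E]

/-- Constant paths. -/
def constPath : E →L[ℝ] C(I, E) :=
  LinearMap.mkContinuous ⟨⟨fun z => ContinuousMap.const I z, fun _ _ => rfl⟩, fun _ _ => rfl⟩ 1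
    (fun z => by
      rw [one_mul]
      exact (ContinuousMap.norm_le _ (norm_nonneg _)).2 fun _ => le_rfl)

@[simp] theorem constPath_apply (z : E) (t : I) : constPath E z t = z := rfl

/-- The pairing of the segment from `0` to `x` with a path. -/
def segmentPair : X × C(I, E) →L[ℝ] C(I, X × E) :=
  LinearMap.mkContinuous
    ⟨⟨fun q => ⟨fun t => ((t : ℝ) • q.1, q.2 t), by fun_prop⟩,
      fun _ _ => by ext <;> simp⟩, fun c q => by ext <;> simp [smul_comm c]⟩ 1
    (fun q => by
      rw [one_mul, ContinuousMap.norm_le _ (norm_nonneg _)]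
      intro t
      refine max_le ?_ ?_
      · refine le_trans ?_ (norm_fst_le q)
        change ‖(t : ℝ) • q.1‖ ≤ _
        rw [norm_smul, Real.norm_of_nonneg t.2.1]
        exact mul_le_of_le_one_left (norm_nonneg _) t.2.2
      · exact (ContinuousMap.norm_coe_le_norm q.2 t).trans (norm_snd_le q))

@[simp] theorem segmentPair_apply (q : X × C(I, E)) (t : I) :
    segmentPair X E q t = ((t : ℝ) • q.1, q.2 t) := rfl

variable [CompleteSpace E]

-- Extending the path by `projIcc` to the whole line makes the integral differentiable from both
-- sides also at the end points of the interval.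
variable {E} in
theorem hasDerivAt_integral_path (γ : C(I, E)) (t : ℝ) :
    HasDerivAt (fun t => ∫ τ in (0 : ℝ)..t, γ (projIcc 0 1 zero_le_one τ))
      (γ (projIcc 0 1 zero_le_one t)) t := by
  have hc : Continuous fun τ : ℝ => γ (projIcc 0 1 zero_le_one τ) :=
    γ.continuous.comp continuous_projIcc
  exact hc.integral_hasStrictDerivAt 0 t |>.hasDerivAt

/-- Integration of paths from the initial point. -/
def integratePath : C(I, E) →L[ℝ] C(I, E) :=
  LinearMap.mkContinuous
    ⟨⟨fun γ => ⟨fun t => ∫ τ in (0 : ℝ)..t, γ (projIcc 0 1 zero_le_one τ),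
        (continuous_iff_continuousAt.2 fun t => (hasDerivAt_integral_path γ t).continuousAt).comp
          continuous_subtype_val⟩,
      fun γ η => by
        ext t
        exact intervalIntegral.integral_add
          ((γ.continuous.comp continuous_projIcc).intervalIntegrable _ _)
          ((η.continuous.comp continuous_projIcc).intervalIntegrable _ _)⟩,
      fun c γ => by
        ext t
        exact intervalIntegral.integral_smul c _⟩ 1
    (fun γ => by
      rw [one_mul, ContinuousMap.norm_le _ (norm_nonneg _)]
      intro t
      refine (intervalIntegral.norm_integral_le_of_norm_le_const (C := ‖γ‖)
        fun τ _ => ContinuousMap.norm_coe_le_norm γ _).trans ?_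
      rw [sub_zero, abs_of_nonneg t.2.1]
      exact mul_le_of_le_one_right (norm_nonneg _) t.2.2)

variable {E} in
theorem integratePath_apply (γ : C(I, E)) (t : I) :
    integratePath E γ t = ∫ τ in (0 : ℝ)..t, γ (projIcc 0 1 zero_le_one τ) := rfl

end Paths

end

noncomputable section

open Set Filter Topology

/-! ### Integrable total differential equations -/

section TotalDifferential

open unitInterval MeasureTheory

variable {X S E : Type} [NormedAddCommGroup X] [NormedSpace ℝ X]
  [NormedAddCommGroup S] [NormedSpace ℝ S]
  [NormedAddCommGroup E] [NormedSpace ℝ E] [CompleteSpace E]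
  {H : Type} [NormedAddCommGroup H] [NormedSpace ℝ H] (B : H →L[ℝ] X →L[ℝ] E)

/-- The right-hand side of the integral equation for solutions of a total differential equation
along the rays from the origin. -/
def rayOperator (G : C(X × E, H)) (z₀ : E) (ι : S →L[ℝ] E)
    (q : C(I, E) × X × S) : C(I, E) :=
  constPath E (z₀ + ι q.2.2) + integratePath E (ContinuousMap.pointwiseBilin I B
    (G.comp (segmentPair X E (q.2.1, q.1))) (constPath X q.2.1))

/-- Apart from composition with G, the operator is built from continuous linear and bilinear maps
and a translation. -/
theorem contDiff_rayOperator (G : C(X × E, H)) (hG : ContDiff ℝ ∞ G) (z₀ : E)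
    (ι : S →L[ℝ] E) : ContDiff ℝ ∞ (rayOperator B G z₀ ι) := by
  have h1 : ContDiff ℝ ∞ (fun γ : C(I, X × E) => G.comp γ) := ContinuousMap.contDiff_postcomp G hG
  have h2 : ContDiff ℝ ∞ (fun q : C(I, E) × X × S => G.comp (segmentPair X E (q.2.1, q.1))) :=
    h1.comp (by fun_prop)
  unfold rayOperator
  fun_prop

/-- The linearized integral equation along a ray. The parameter s of the initial value is kept
fixed, so only the integral contributes: once through the argument of G and once through the factor
x. -/
theorem hasDerivAt_rayOperator (G : C(X × E, H)) (hG : ContDiff ℝ ∞ G) (z₀ : E)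
    (ι : S →L[ℝ] E) (q : C(I, E) × X × S) (η : C(I, E)) (h : X) (t : I) :
    fderiv ℝ (rayOperator B G z₀ ι) q (η, h, 0) t =
      ∫ τ in (0 : ℝ)..t, (B (fderiv ℝ G (segmentPair X E (q.2.1, q.1) (projIcc 0 1 zero_le_one τ))
        (segmentPair X E (h, η) (projIcc 0 1 zero_le_one τ))) q.2.1 +
        B (G (segmentPair X E (q.2.1, q.1) (projIcc 0 1 zero_le_one τ))) h) := by
  let G' : C(X × E, X × E →L[ℝ] H) :=
    ⟨fderiv ℝ G, hG.continuous_fderiv (by simp)⟩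
  let pr : C(I, E) × X × S →L[ℝ] X × C(I, E) :=
    ((ContinuousLinearMap.fst ℝ X S).comp (ContinuousLinearMap.snd ℝ _ _)).prod
      (ContinuousLinearMap.fst ℝ _ _)
  let sg : C(I, E) × X × S →L[ℝ] C(I, X × E) := (segmentPair X E).comp pr
  let cx : C(I, E) × X × S →L[ℝ] C(I, X) :=
    (constPath X).comp ((ContinuousLinearMap.fst ℝ X S).comp (ContinuousLinearMap.snd ℝ _ _))
  have hN : HasFDerivAt (fun q : C(I, E) × X × S => G.comp (sg q))
      ((ContinuousMap.pointwiseApply I (X × E) H (G'.comp (sg q))).comp sg) q :=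
    (ContinuousMap.hasFDerivAt_postcomp G G'
      (fun x => (hG.differentiable (by simp) x).hasFDerivAt) (sg q)).comp q sg.hasFDerivAt
  have hB2 := ContinuousLinearMap.hasFDerivAt_of_bilinear (ContinuousMap.pointwiseBilin I B) hN
    (cx.hasFDerivAt (x := q))
  have hJ := (integratePath E).hasFDerivAt.comp q hB2
  have hcst : HasFDerivAt (fun q : C(I, E) × X × S => constPath E (z₀ + ι q.2.2))
      ((constPath E).comp (ι.comp ((ContinuousLinearMap.snd ℝ X S).comp
        (ContinuousLinearMap.snd ℝ _ _)))) q := by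
    have : HasFDerivAt (fun q : C(I, E) × X × S => z₀ + ι q.2.2)
        (ι.comp ((ContinuousLinearMap.snd ℝ X S).comp (ContinuousLinearMap.snd ℝ _ _))) q :=
      (ι.comp ((ContinuousLinearMap.snd ℝ X S).comp
        (ContinuousLinearMap.snd ℝ C(I, E) _))).hasFDerivAt.const_add z₀
    exact (constPath E).hasFDerivAt.comp q this
  have hfin : HasFDerivAt (rayOperator B G z₀ ι) _ q := hcst.add hJ
  rw [hfin.fderiv]
  have hz : (0 : C(I, E)) t = 0 := rfl
  simp only [add_apply, ContinuousLinearMap.comp_apply,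
    ContinuousLinearMap.coe_snd', map_zero, zero_add, integratePath_apply]
  refine intervalIntegral.integral_congr fun τ _ => ?_
  change B (G _) h + _ = _
  rw [add_comm]
  rfl

/-- For x = 0 and s = 0 the integrand vanishes, so the operator is constant there, as the fixed
point theorem requires. -/
theorem exists_rayFamily [CompleteSpace X] [CompleteSpace S]
    (G : C(X × E, H)) (hG : ContDiff ℝ ∞ G) (z₀ : E)
    (ι : S →L[ℝ] E) : ∃ (W : Set (X × S)) (c : X × S → C(I, E)), IsOpen W ∧ (0, 0) ∈ W ∧
      ContDiffOn ℝ ∞ c W ∧ c (0, 0) = constPath E z₀ ∧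
      ∀ p ∈ W, rayOperator B G z₀ ι (c p, p) = c p :=
  (contDiff_rayOperator B G hG z₀ ι).exists_contDiffOn_fixedPoint fun γ => by
    ext t
    have h0 : constPath X (0 : X) = 0 := map_zero _
    simp [rayOperator, h0]

/-- A total differential equation `dΦ = G (x, Φ)` satisfying the integrability condition has
smooth local solutions with prescribed smooth initial values, depending smoothly on them. -/
theorem exists_totalDifferential_solution [CompleteSpace S]
    [FiniteDimensional ℝ X] [FiniteDimensional ℝ E]
    {G : X × E → H} {U : Set (X × E)} (hU : IsOpen U) (hG : ContDiffOn ℝ ∞ G U)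
    {z₀ : E} (hz₀ : (0, z₀) ∈ U) (ι : S →L[ℝ] E)
    (hcompat : ∀ c ∈ U, ∀ h h' : X,
      B (fderiv ℝ G c (h, B (G c) h)) h' = B (fderiv ℝ G c (h', B (G c) h')) h) :
    ∃ (W : Set (X × S)) (Φ : X × S → E), IsOpen W ∧ (0, 0) ∈ W ∧ ContDiffOn ℝ ∞ Φ W ∧
      (∀ s, (0, s) ∈ W → Φ (0, s) = z₀ + ι s) ∧
      ∀ p ∈ W, (p.1, Φ p) ∈ U ∧ ∀ h, fderiv ℝ Φ p (h, 0) = B (G (p.1, Φ p)) h := by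
  have := FiniteDimensional.complete ℝ X
  -- Composition operators need a map defined everywhere. G is replaced by a global g that agrees
  -- with it on U', and the parameters are later restricted to those whose whole path stays in U'.
  obtain ⟨g, U', hg, hU', hzU', hUU', hgG⟩ := hG.exists_contDiff_extension hU hz₀
  have hgG' : ∀ c ∈ U', fderiv ℝ g c = fderiv ℝ G c := fun c hc =>
    Filter.EventuallyEq.fderiv_eq ((hU'.eventually_mem hc).mono hgG)
  let gc : C(X × E, H) := ⟨g, hg.continuous⟩
  obtain ⟨W, c, hW, hW0, hc, hc0, hfix⟩ := exists_rayFamily B gc hg z₀ ι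
  have hpath : ContinuousOn (fun p : X × S => segmentPair X E (p.1, c p)) W :=
    (segmentPair X E).continuous.comp_continuousOn (continuousOn_fst.prodMk hc.continuousOn)
  have hO : IsOpen {γ : C(I, X × E) | MapsTo γ univ U'} :=
    ContinuousMap.isOpen_setOfPred_mapsTo isCompact_univ hU'
  -- The solution at (x, s) is the end point of the path over the ray from 0 to x.
  refine ⟨W ∩ (fun p : X × S => segmentPair X E (p.1, c p)) ⁻¹' _, fun p => c p 1,
    hpath.isOpen_inter_preimage hW hO, ⟨hW0, ?_⟩, ?_, ?_, ?_⟩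
  · intro t _
    change ((t : ℝ) • (0 : X), c (0, 0) t) ∈ U'
    rw [hc0, smul_zero]
    exact hzU'
  · have h1 : ContDiff ℝ ∞ (ContinuousMap.evalCLM ℝ (1 : I) : C(I, E) →L[ℝ] E) := by fun_prop
    exact h1.comp_contDiffOn (hc.mono inter_subset_left)
  · intro s hs
    change c (0, s) 1 = _
    rw [← hfix _ hs.1]
    have h0 : constPath X (0 : X) = 0 := map_zero _
    simp [rayOperator, h0]
  · rintro ⟨x, s⟩ ⟨hpW, hpU⟩
    have hpU' : ∀ t : I, ((t : ℝ) • x, c (x, s) t) ∈ U' := fun t => hpU (mem_univ t)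
    refine ⟨hUU' (by simpa using hpU' 1), fun h => ?_⟩
    set p : X × S := (x, s) with hp
    have hcd : HasFDerivAt c (fderiv ℝ c p) p :=
      ((hc.contDiffAt (hW.mem_nhds hpW)).differentiableAt (by simp)).hasFDerivAt
    set η := fderiv ℝ c p (h, 0) with hη
    have hΦ : fderiv ℝ (fun p => c p 1) p (h, 0) = η 1 := by
      have h1 := (ContinuousMap.evalCLM ℝ (1 : I) : C(I, E) →L[ℝ] E).hasFDerivAt.comp p hcd
      have h2 : fderiv ℝ (fun p => c p 1) p = _ := h1.fderiv
      rw [h2]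
      rfl
    -- Differentiating the fixed point equation shows that η, the variation of the path when x moves
    -- in direction h, solves the linearized equation.
    have hηeq : η = fderiv ℝ (rayOperator B gc z₀ ι) (c p, p) (η, h, 0) := by
      have h1 : HasFDerivAt (fun p => (c p, p)) ((fderiv ℝ c p).prod (.id ℝ _)) p :=
        hcd.prodMk (hasFDerivAt_id p)
      have h2 := HasFDerivAt.comp (g := rayOperator B gc z₀ ι) (f := fun p => (c p, p)) p
        ((contDiff_rayOperator B gc hg z₀ ι).differentiable (by simp) (c p, p)).hasFDerivAt h1
      have h3 : HasFDerivAt c ((fderiv ℝ (rayOperator B gc z₀ ι) (c p, p)).comp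
          ((fderiv ℝ c p).prod (.id ℝ _))) p :=
        h2.congr_of_eventuallyEq ((hW.eventually_mem hpW).mono
          fun q hq => (hfix q hq).symm)
      have h4 := congrArg (fun L : X × S →L[ℝ] C(I, E) => L (h, 0)) (hcd.unique h3)
      exact h4
    let P : ℝ → I := projIcc 0 1 zero_le_one
    let y : ℝ → X × E := fun t => segmentPair X E (x, c p) (P t)
    have hyU : ∀ t, y t ∈ U' := fun t => hpU' (P t)
    let γe : ℝ → E := fun t => z₀ + ι s + ∫ τ in (0 : ℝ)..t, B (g (y τ)) x
    let ηe : ℝ → E := fun t => ∫ τ in (0 : ℝ)..t,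
      (B (fderiv ℝ g (y τ) (segmentPair X E (h, η) (P τ))) x + B (g (y τ)) h)
    have hγI : ∀ t : I, c p t = γe t := fun t => by
      conv_lhs => rw [← hfix p hpW]
      rfl
    have hηI : ∀ t : I, η t = ηe t := fun t => by
      conv_lhs => rw [hηeq]
      exact hasDerivAt_rayOperator B gc hg z₀ ι (c p, p) η h t
    have hγd : ∀ t, HasDerivAt γe (B (g (y t)) x) t := fun t => by
      have h1 : Continuous fun τ => B (g (y τ)) x := by
        have : Continuous y := by fun_prop
        exact (B.continuous.comp (hg.continuous.comp this)).clm_apply continuous_const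
      exact (h1.integral_hasStrictDerivAt 0 t).hasDerivAt.const_add _
    have hgd : ContDiff ℝ ∞ (fderiv ℝ g) := hg.fderiv_right (by simp)
    have hycont : Continuous y := by fun_prop
    have hηd : ∀ t, HasDerivAt ηe
        (B (fderiv ℝ g (y t) (segmentPair X E (h, η) (P t))) x + B (g (y t)) h) t := fun t => by
      have h1 : Continuous fun τ =>
          B (fderiv ℝ g (y τ) (segmentPair X E (h, η) (P τ))) x + B (g (y τ)) h := by
        have h3 := hg.continuous.comp hycont
        have h4 := hgd.continuous.comp hycont
        have h5 : Continuous fun τ => segmentPair X E (h, η) (P τ) := by fun_prop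
        exact ((B.continuous.comp (h4.clm_apply h5)).clm_apply continuous_const).add
          ((B.continuous.comp h3).clm_apply continuous_const)
      exact (h1.integral_hasStrictDerivAt 0 t).hasDerivAt
    have hPt : ∀ t ∈ Icc (0 : ℝ) 1, ((P t : I) : ℝ) = t := fun t ht => by
      simp only [P, projIcc_of_mem _ ht]
    have hy_eq : ∀ t ∈ Icc (0 : ℝ) 1, y t = (t • x, γe t) := fun t ht => by
      simp only [y, segmentPair_apply, hγI, hPt t ht]
    -- If Φ solves the total differential equation, the path is t ↦ Φ(t x, s), and its variation in
    -- direction h must be ζ. So η = ζ has to be shown; the case t = 1 is the claim.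
    let ζ : ℝ → E := fun t => t • B (g (t • x, γe t)) h
    have hζd : ∀ t ∈ Icc (0 : ℝ) 1, HasDerivAt ζ
        (t • B (fderiv ℝ g (y t) (x, B (g (y t)) x)) h + B (g (y t)) h) t := fun t ht => by
      have h1 : HasDerivAt (fun t => (t • x, γe t)) (x, B (g (y t)) x) t := by
        have := ((hasDerivAt_id t).smul_const x).prodMk (hγd t)
        simpa using this
      have h2 : HasDerivAt (fun t => g (t • x, γe t)) (fderiv ℝ g (y t) (x, B (g (y t)) x)) t := by
        have h3 := (hg.differentiable (by simp) (t • x, γe t)).hasFDerivAt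
        rw [← hy_eq t ht] at h3
        rw [hy_eq t ht] at h3 ⊢
        have h4 := h3.comp_hasDerivAt t h1
        rwa [hy_eq t ht] at h4
      have h5 : HasDerivAt (fun t => B (g (t • x, γe t)) h)
          (B (fderiv ℝ g (y t) (x, B (g (y t)) x)) h) t := by
        have := (B.hasFDerivAt.comp_hasDerivAt t h2).clm_apply (hasDerivAt_const t h)
        simpa using this
      have h6 : HasDerivAt ζ _ t := (hasDerivAt_id t).smul h5
      refine h6.congr_deriv ?_
      simp [hy_eq t ht]
    have hwd : ∀ t ∈ Ico (0 : ℝ) 1, HasDerivAt (fun t => ηe t - ζ t)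
        (B (fderiv ℝ g (y t) (0, ηe t - ζ t)) x) t := fun t ht => by
      have ht' : t ∈ Icc (0 : ℝ) 1 := Ico_subset_Icc_self ht
      refine ((hηd t).sub (hζd t ht')).congr_deriv ?_
      -- The integrability condition: it exchanges x and h, after which the difference η - ζ
      -- satisfies a homogeneous linear equation.
      have hcm : B (fderiv ℝ g (y t) (x, B (g (y t)) x)) h =
          B (fderiv ℝ g (y t) (h, B (g (y t)) h)) x := by
        rw [hgG' _ (hyU t), hgG _ (hyU t)]
        exact hcompat _ (hUU' (hyU t)) x h
      have hseg : segmentPair X E (h, η) (P t) = (t • h, ηe t) := by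
        rw [segmentPair_apply, hηI, hPt t ht']
      have hζt : ζ t = t • B (g (y t)) h := by rw [hy_eq t ht']
      have hsplit : ((0 : X), ηe t - ζ t) = (t • h, ηe t) - t • (h, B (g (y t)) h) := by
        rw [hζt]; ext <;> simp
      rw [hcm, hseg, hsplit, map_sub, map_smul, map_sub, map_smul, sub_apply, smul_apply]
      abel
    obtain ⟨K, hK⟩ := (isCompact_Icc (a := (0 : ℝ)) (b := 1)).exists_bound_of_continuousOn
      (f := fun t => ‖fderiv ℝ g (y t)‖) (hgd.continuous.comp hycont).norm.continuousOn
    -- Grönwall's inequality with initial value zero.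
    have hw0 : ∀ t ∈ Icc (0 : ℝ) 1, ηe t - ζ t = 0 := by
      refine eq_zero_of_abs_deriv_le_mul_abs_self_of_eq_zero_right (K := ‖B‖ * K * ‖x‖)
        (f' := fun t => B (fderiv ℝ g (y t) (0, ηe t - ζ t)) x) ?_ ?_ ?_ ?_
      · intro t ht
        exact ((hηd t).sub (hζd t ht)).continuousAt.continuousWithinAt
      · intro t ht
        exact (hwd t ht).hasDerivWithinAt
      · simp [ηe, ζ]
      · intro t ht
        have hn : ‖((0 : X), ηe t - ζ t)‖ = ‖ηe t - ζ t‖ := by simp [Prod.norm_def]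
        calc ‖B (fderiv ℝ g (y t) (0, ηe t - ζ t)) x‖
            ≤ ‖B‖ * ‖fderiv ℝ g (y t) (0, ηe t - ζ t)‖ * ‖x‖ := B.le_opNorm₂ _ _
          _ ≤ ‖B‖ * (‖fderiv ℝ g (y t)‖ * ‖((0 : X), ηe t - ζ t)‖) * ‖x‖ := by
              gcongr
              exact ContinuousLinearMap.le_opNorm _ _
          _ = ‖B‖ * ‖fderiv ℝ g (y t)‖ * ‖x‖ * ‖ηe t - ζ t‖ := by rw [hn]; ring
          _ ≤ ‖B‖ * K * ‖x‖ * ‖ηe t - ζ t‖ := by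
              gcongr
              exact (le_abs_self _).trans (hK t (Ico_subset_Icc_self ht))
    have h1 : (1 : ℝ) ∈ Icc (0 : ℝ) 1 := ⟨zero_le_one, le_rfl⟩
    have hfin := sub_eq_zero.1 (hw0 1 h1)
    have hy1 : y 1 = (x, c p 1) := by
      rw [hy_eq 1 h1, one_smul, hγI 1]
      rfl
    rw [hΦ, hηI 1]
    change ηe 1 = _
    rw [hfin]
    change (1 : ℝ) • B (g ((1 : ℝ) • x, γe 1)) h = B (G (x, c p 1)) h
    rw [← hy_eq 1 h1, one_smul, hgG _ (hyU 1), hy1]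

end TotalDifferential

end

noncomputable section

open Set Filter Topology

/-! ### Equivalence of frames with equal structure constants -/

section Straightening

/-- The linear map sending the standard basis vectors to given vectors. -/
def frameMap {n : ℕ} {E : Type} [NormedAddCommGroup E] [NormedSpace ℝ E] (w : Fin n → E) :
    (Fin n → ℝ) →L[ℝ] E :=
  ∑ i, (ContinuousLinearMap.proj i : (Fin n → ℝ) →L[ℝ] ℝ).smulRight (w i)

variable {n : ℕ} {E : Type} [NormedAddCommGroup E] [NormedSpace ℝ E]

theorem frameMap_apply (w : Fin n → E) (a : Fin n → ℝ) : frameMap w a = ∑ i, a i • w i := by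
  simp [frameMap]

@[simp]
theorem frameMap_single (w : Fin n → E) (i : Fin n) : frameMap w (Pi.single i 1) = w i := by
  rw [frameMap_apply, Finset.sum_eq_single i]
  · simp
  · intro j _ hj
    simp [Pi.single_eq_of_ne hj]
  · simp

theorem ContDiffOn.frameMap {F : Type} [NormedAddCommGroup F] [NormedSpace ℝ F]
    {w : Fin n → F → E} {s : Set F} (hw : ∀ i, ContDiffOn ℝ ∞ (w i) s) :
    ContDiffOn ℝ ∞ (fun x => frameMap fun i => w i x) s := by
  unfold _root_.frameMap
  refine ContDiffOn.sum fun i _ => ?_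
  exact ((ContinuousLinearMap.smulRightL ℝ (Fin n → ℝ) E
    (ContinuousLinearMap.proj i)).contDiff).comp_contDiffOn (hw i)

theorem frameMap_injective {w : Fin n → E} (hw : LinearIndependent ℝ w) :
    Function.Injective (frameMap w) := by
  rw [injective_iff_map_eq_zero]
  intro a ha
  rw [frameMap_apply] at ha
  exact funext fun i => Fintype.linearIndependent_iff.1 hw a ha i

/-- An injective continuous linear map between finite-dimensional spaces of equal dimensions is
invertible. -/
theorem ContinuousLinearMap.isInvertible_of_injective {F : Type*} {E : Type*}
    [NormedAddCommGroup E] [NormedSpace ℝ E] [NormedAddCommGroup F]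
    [NormedSpace ℝ F] [FiniteDimensional ℝ E] [FiniteDimensional ℝ F] (L : E →L[ℝ] F)
    (hL : Function.Injective L) (hd : Module.finrank ℝ E = Module.finrank ℝ F) :
    L.IsInvertible := by
  let e : E ≃ₗ[ℝ] F := LinearEquiv.ofInjectiveOfFinrankEq (L : E →ₗ[ℝ] F) hL hd
  exact ⟨e.toContinuousLinearEquiv, by ext x; rfl⟩

theorem isInvertible_frameMap {w : Fin n → Fin n → ℝ} (hw : LinearIndependent ℝ w) :
    (frameMap w).IsInvertible :=
  (frameMap w).isInvertible_of_injective (frameMap_injective hw) rfl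

/-- The `E`-valued one-form on the space of `x` that sends the frame `ξ` to the frame `V`. -/
def frameForm (ξ : Fin n → (Fin n → ℝ) → (Fin n → ℝ)) (V : Fin n → E → E)
    (c : (Fin n → ℝ) × E) : (Fin n → ℝ) →L[ℝ] E :=
  (frameMap fun i => V i c.2).comp (frameMap fun i => ξ i c.1).inverse

theorem frameForm_apply {ξ : Fin n → (Fin n → ℝ) → (Fin n → ℝ)} {V : Fin n → E → E}
    {c : (Fin n → ℝ) × E} (hξ : LinearIndependent ℝ fun i => ξ i c.1) (i : Fin n) :
    frameForm ξ V c (ξ i c.1) = V i c.2 := by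
  obtain ⟨e, he⟩ := isInvertible_frameMap hξ
  have h1 : (frameMap fun i => ξ i c.1).inverse (ξ i c.1) = Pi.single i 1 := by
    rw [← he, ContinuousLinearMap.inverse_equiv]
    have : e (Pi.single i 1) = ξ i c.1 := by
      have h2 : (e : (Fin n → ℝ) →L[ℝ] (Fin n → ℝ)) (Pi.single i 1) = ξ i c.1 := by
        rw [he, frameMap_single]
      exact h2
    rw [← this]
    exact e.symm_apply_apply _
  rw [frameForm, ContinuousLinearMap.comp_apply, h1, frameMap_single]

theorem contDiffOn_frameForm {ξ : Fin n → (Fin n → ℝ) → (Fin n → ℝ)} {V : Fin n → E → E}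
    {D : Set (Fin n → ℝ)} {Z : Set E} (hξ : ∀ i, ContDiffOn ℝ ∞ (ξ i) D)
    (hV : ∀ i, ContDiffOn ℝ ∞ (V i) Z)
    (hξi : ∀ x ∈ D, LinearIndependent ℝ fun i => ξ i x) :
    ContDiffOn ℝ ∞ (frameForm ξ V) (D ×ˢ Z) := by
  have h1 : ContDiffOn ℝ ∞ (fun c : (Fin n → ℝ) × E => frameMap fun i => V i c.2) (D ×ˢ Z) :=
    (ContDiffOn.frameMap hV).comp contDiff_snd.contDiffOn fun c hc => hc.2
  have h2 : ContDiffOn ℝ ∞ (fun c : (Fin n → ℝ) × E => frameMap fun i => ξ i c.1) (D ×ˢ Z) :=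
    (ContDiffOn.frameMap hξ).comp contDiff_fst.contDiffOn fun c hc => hc.1
  have h3 : ContDiffOn ℝ ∞ (fun c : (Fin n → ℝ) × E => (frameMap fun i => ξ i c.1).inverse)
      (D ×ˢ Z) := by
    intro c hc
    obtain ⟨e, he⟩ := isInvertible_frameMap (hξi c.1 hc.1)
    have := contDiffAt_map_inverse (n := ∞) (𝕜 := ℝ) e
    rw [he] at this
    exact this.comp_contDiffWithinAt c (h2 c hc)
  exact h1.clm_comp h3

/-- Both sides are bilinear in (h, h'), so it suffices to insert ξ_i(x) and ξ_j(x). Their difference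
is then [V_i, V_j] minus the image of [ξ_i, ξ_j] under the form, which is zero because the structure
constants agree. -/
theorem frameForm_integrable {ξ : Fin n → (Fin n → ℝ) → (Fin n → ℝ)} {V : Fin n → E → E}
    {D : Set (Fin n → ℝ)} {Z : Set E} (hD : IsOpen D) (hZ : IsOpen Z)
    (hξ : ∀ i, ContDiffOn ℝ ∞ (ξ i) D) (hV : ∀ i, ContDiffOn ℝ ∞ (V i) Z)
    (hξi : ∀ x ∈ D, LinearIndependent ℝ fun i => ξ i x) {C : Fin n → Fin n → Fin n → ℝ}
    (hξb : ∀ i j, ∀ x ∈ D, VectorField.lieBracket ℝ (ξ i) (ξ j) x = ∑ l, C i j l • ξ l x)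
    (hVb : ∀ i j, ∀ z ∈ Z, VectorField.lieBracket ℝ (V i) (V j) z = ∑ l, C i j l • V l z)
    (c : (Fin n → ℝ) × E) (hc : c ∈ D ×ˢ Z) (h h' : Fin n → ℝ) :
    fderiv ℝ (frameForm ξ V) c (h, frameForm ξ V c h) h' =
      fderiv ℝ (frameForm ξ V) c (h', frameForm ξ V c h') h := by
  have hO : IsOpen (D ×ˢ Z) := hD.prod hZ
  have hω : HasFDerivAt (frameForm ξ V) (fderiv ℝ (frameForm ξ V) c) c :=
    (((contDiffOn_frameForm hξ hV hξi).contDiffAt (hO.mem_nhds hc)).differentiableAt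
      (by simp)).hasFDerivAt
  -- This is the derivative of the identity that the form sends ξ_i to V_i.
  have key : ∀ i (δ : (Fin n → ℝ) × E), fderiv ℝ (frameForm ξ V) c δ (ξ i c.1) =
      fderiv ℝ (V i) c.2 δ.2 - frameForm ξ V c (fderiv ℝ (ξ i) c.1 δ.1) := by
    intro i δ
    have h1 : HasFDerivAt (ξ i) (fderiv ℝ (ξ i) c.1) c.1 :=
      (((hξ i).contDiffAt (hD.mem_nhds hc.1)).differentiableAt (by simp)).hasFDerivAt
    have h2 : HasFDerivAt (V i) (fderiv ℝ (V i) c.2) c.2 :=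
      (((hV i).contDiffAt (hZ.mem_nhds hc.2)).differentiableAt (by simp)).hasFDerivAt
    have h3 := hω.clm_apply (h1.comp c hasFDerivAt_fst)
    have h4 := (h2.comp c hasFDerivAt_snd).congr_of_eventuallyEq
      ((hO.eventually_mem hc).mono fun q hq => frameForm_apply (V := V) (hξi q.1 hq.1) i)
    have h5 := congrArg (fun L : (Fin n → ℝ) × E →L[ℝ] E => L δ) (h3.unique h4)
    simp only [add_apply, ContinuousLinearMap.comp_apply, ContinuousLinearMap.flip_apply,
      ContinuousLinearMap.coe_fst', ContinuousLinearMap.coe_snd', Function.comp_apply] at h5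
    rw [← h5]
    abel
  let T : (Fin n → ℝ) →ₗ[ℝ] (Fin n → ℝ) →ₗ[ℝ] E :=
    LinearMap.mk₂ ℝ (fun h h' => fderiv ℝ (frameForm ξ V) c (h, frameForm ξ V c h) h')
      (fun a b d => by
        have : (a + b, frameForm ξ V c (a + b)) =
            (a, frameForm ξ V c a) + (b, frameForm ξ V c b) := by simp
        rw [this, map_add, add_apply])
      (fun r a d => by
        have : (r • a, frameForm ξ V c (r • a)) = r • (a, frameForm ξ V c a) := by simp
        rw [this, map_smul, smul_apply])
      (fun a b d => map_add _ _ _) (fun r a d => map_smul _ _ _)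
  have hbasis : ∀ i j, T (ξ i c.1) (ξ j c.1) = T (ξ j c.1) (ξ i c.1) := by
    intro i j
    simp only [T, LinearMap.mk₂_apply]
    rw [key, key, frameForm_apply (hξi _ hc.1), frameForm_apply (hξi _ hc.1)]
    have h1 := hVb i j c.2 hc.2
    have h2 := hξb i j c.1 hc.1
    rw [VectorField.lieBracket_eq] at h1 h2
    have h3 := congrArg (frameForm ξ V c) h2
    simp only [map_sum, map_smul, frameForm_apply (hξi _ hc.1)] at h3
    rw [← h1] at h3
    rw [map_sub] at h3
    rw [sub_eq_sub_iff_add_eq_add] at h3 ⊢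
    rw [add_comm (fderiv ℝ (V i) c.2 _), add_comm]
    rw [add_comm (frameForm ξ V c _) (fderiv ℝ (V j) _ _)]
    exact h3.symm
  have hT : T = T.flip := by
    let b : Module.Basis (Fin n) ℝ (Fin n → ℝ) :=
      .mk (hξi _ hc.1) ((hξi _ hc.1).span_eq_top_of_card_eq_finrank' (by simp)).ge
    refine b.ext fun i => b.ext fun j => ?_
    simpa [b] using hbasis i j
  exact congrArg (fun S : (Fin n → ℝ) →ₗ[ℝ] (Fin n → ℝ) →ₗ[ℝ] E => S h h') hT

/-- Two frames of vector fields with the same structure constants are locally equivalent. -/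
theorem exists_straightening [FiniteDimensional ℝ E]
    {ξ : Fin n → (Fin n → ℝ) → (Fin n → ℝ)} {V : Fin n → E → E}
    {D : Set (Fin n → ℝ)} {Z : Set E} (hD : IsOpen D) (hZ : IsOpen Z)
    (hξ : ∀ i, ContDiffOn ℝ ∞ (ξ i) D) (hV : ∀ i, ContDiffOn ℝ ∞ (V i) Z)
    (hξi : ∀ x ∈ D, LinearIndependent ℝ fun i => ξ i x) {C : Fin n → Fin n → Fin n → ℝ}
    (hξb : ∀ i j, ∀ x ∈ D, VectorField.lieBracket ℝ (ξ i) (ξ j) x = ∑ l, C i j l • ξ l x)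
    (hVb : ∀ i j, ∀ z ∈ Z, VectorField.lieBracket ℝ (V i) (V j) z = ∑ l, C i j l • V l z)
    (hD0 : 0 ∈ D) {z₀ : E} (hz₀ : z₀ ∈ Z) (hVi : LinearIndependent ℝ fun i => V i z₀) :
    ∃ (S : Submodule ℝ E) (ψ : OpenPartialHomeomorph E ((Fin n → ℝ) × S)),
      n + Module.finrank ℝ S = Module.finrank ℝ E ∧ z₀ ∈ ψ.source ∧ ψ.source ⊆ Z ∧
      ψ.target ⊆ D ×ˢ univ ∧ ContDiffOn ℝ ∞ ψ ψ.source ∧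
      (∀ z ∈ ψ.source, (fderiv ℝ ψ z).IsInvertible) ∧
      ∀ z ∈ ψ.source, ∀ i, fderiv ℝ ψ z (V i z) = (ξ i (ψ z).1, 0) := by
  -- A complement of the orbit directions at z₀ serves as the space of initial values.
  obtain ⟨S, hS⟩ := Submodule.exists_isCompl (Submodule.span ℝ (range fun i => V i z₀))
  have hdim : n + Module.finrank ℝ S = Module.finrank ℝ E := by
    rw [← Submodule.finrank_add_eq_of_isCompl hS, finrank_span_eq_card hVi, Fintype.card_fin]
  have hO : IsOpen (D ×ˢ Z) := hD.prod hZ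
  obtain ⟨W, Φ, hW, hW0, hΦ, hΦ0, hΦd⟩ := exists_totalDifferential_solution
    (ContinuousLinearMap.id ℝ ((Fin n → ℝ) →L[ℝ] E)) hO (contDiffOn_frameForm hξ hV hξi)
    (z₀ := z₀) ⟨hD0, hz₀⟩ S.subtypeL
    (fun c hc h h' => frameForm_integrable hD hZ hξ hV hξi hξb hVb c hc h h')
  simp only [ContinuousLinearMap.coe_id', id_eq] at hΦd
  have hΦz : Φ (0, 0) = z₀ := by rw [hΦ0 0 hW0]; simp
  have hd0 : HasFDerivAt Φ (fderiv ℝ Φ (0, 0)) (0, 0) :=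
    ((hΦ.contDiffAt (hW.mem_nhds hW0)).differentiableAt (by simp)).hasFDerivAt
  have hds : ∀ s : S, fderiv ℝ Φ (0, 0) (0, s) = s := by
    intro s
    have h1 := hd0.comp (0 : S) (hasFDerivAt_prodMk_right (0 : Fin n → ℝ) (0 : S))
    have h2 : HasFDerivAt (fun s : S => z₀ + S.subtypeL s) S.subtypeL 0 :=
      S.subtypeL.hasFDerivAt.const_add z₀
    have hnear : ∀ᶠ s : S in 𝓝 0, ((0 : Fin n → ℝ), s) ∈ W :=
      (Continuous.prodMk_right (0 : Fin n → ℝ)).continuousAt.eventually (hW.mem_nhds hW0)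
    have h3 := h2.congr_of_eventuallyEq (hnear.mono fun s hs => hΦ0 s hs)
    exact congrArg (fun L : S →L[ℝ] E => L s) (h1.unique h3)
  have hcp := (hΦd _ hW0).1
  -- At the origin the derivative maps the x-directions injectively into the span of the V_i(z₀) and
  -- is the inclusion on the complement S, so its kernel is zero.
  have hinv : (fderiv ℝ Φ (0, 0)).IsInvertible := by
    refine ContinuousLinearMap.isInvertible_of_injective _ ?_ (by simp [hdim])
    rw [injective_iff_map_eq_zero]
    rintro ⟨h, s⟩ hhs
    obtain ⟨e, he⟩ := isInvertible_frameMap (hξi 0 hD0)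
    have hsplit : ((h, s) : (Fin n → ℝ) × S) = (h, 0) + (0, s) := by simp
    rw [hsplit, map_add, (hΦd _ hW0).2, hds, hΦz] at hhs
    have hmem : frameForm ξ V (0, z₀) h ∈ Submodule.span ℝ (range fun i => V i z₀) := by
      rw [frameForm, ContinuousLinearMap.comp_apply, frameMap_apply]
      exact Submodule.sum_mem _ fun i _ => Submodule.smul_mem _ _ (Submodule.subset_span ⟨i, rfl⟩)
    have hs0 : (s : E) = 0 := by
      refine Submodule.disjoint_def.1 hS.disjoint _ ?_ s.2
      rw [← neg_eq_of_add_eq_zero_right hhs]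
      exact Submodule.neg_mem _ hmem
    have hh0 : frameForm ξ V (0, z₀) h = 0 := by simpa [hs0] using hhs
    rw [frameForm, ContinuousLinearMap.comp_apply, ← he, ContinuousLinearMap.inverse_equiv] at hh0
    have h1 : e.symm h = 0 := frameMap_injective hVi (by rw [map_zero]; exact hh0)
    have h2 : h = 0 := by simpa using h1
    ext1
    · exact h2
    · exact Subtype.ext hs0
  -- Φ goes from the coordinates to Z; the chart is the inverse of this local diffeomorphism.
  obtain ⟨e, he0, heW, hef, hes, heinv⟩ := hΦ.exists_openPartialHomeomorph hW hW0 hinv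
  have hsymm : ∀ z ∈ e.target, HasFDerivAt e.symm (fderiv ℝ e.symm z) z := fun z hz =>
    ((hes.contDiffAt (e.open_target.mem_nhds hz)).differentiableAt (by simp)).hasFDerivAt
  have hΦe : ∀ p ∈ e.source, HasFDerivAt Φ (fderiv ℝ Φ p) p := fun p hp =>
    ((hΦ.contDiffAt (hW.mem_nhds (heW hp))).differentiableAt (by simp)).hasFDerivAt
  have hleft : ∀ z ∈ e.target, (fderiv ℝ e.symm z).comp (fderiv ℝ Φ (e.symm z)) =
      .id ℝ _ := by
    intro z hz
    have hp := e.map_target hz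
    have hzz : Φ (e.symm z) = z := by rw [← hef, e.right_inv hz]
    have h1 : HasFDerivAt e.symm (fderiv ℝ e.symm z) (Φ (e.symm z)) := by
      rw [hzz]; exact hsymm z hz
    have h2 := h1.comp _ (hΦe _ hp)
    have h3 : HasFDerivAt (e.symm ∘ Φ) (.id ℝ ((Fin n → ℝ) × S)) (e.symm z) :=
      (hasFDerivAt_id _).congr_of_eventuallyEq
        ((e.open_source.eventually_mem hp).mono fun q hq => by
          simp only [Function.comp_apply, id_eq]
          rw [← hef, e.left_inv hq])
    exact h2.unique h3
  refine ⟨S, e.symm, hdim, ?_, ?_, ?_, hes, ?_, ?_⟩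
  · rw [← hΦz, ← hef]
    exact e.map_source he0
  · intro z hz
    have := (hΦd _ (heW (e.map_target hz))).1.2
    rw [← hef, e.right_inv hz] at this
    exact this
  · intro p hp
    exact ⟨(hΦd _ (heW hp)).1.1, mem_univ _⟩
  · intro z hz
    obtain ⟨A, hA⟩ := heinv _ (e.map_target hz)
    refine ⟨A.symm, ?_⟩
    have h1 := hleft z hz
    rw [← hA] at h1
    ext1 w
    have h2 := congrArg (fun L : (Fin n → ℝ) × S →L[ℝ] (Fin n → ℝ) × S => L (A.symm w)) h1
    simpa using h2.symm
  · intro z hz i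
    have hp := e.map_target hz
    have hzz : Φ (e.symm z) = z := by rw [← hef, e.right_inv hz]
    have hd := hΦd _ (heW hp)
    -- The equation for dΦ says that Φ pushes ξ_i forward to V_i; the inverse therefore sends V_i
    -- back to ξ_i.
    have h1 : fderiv ℝ Φ (e.symm z) (ξ i (e.symm z).1, 0) = V i z := by
      rw [hd.2, frameForm_apply (hξi _ hd.1.1)]
      exact congrArg (V i) hzz
    have h2 := congrArg (fun L : (Fin n → ℝ) × S →L[ℝ] (Fin n → ℝ) × S =>
      L (ξ i (e.symm z).1, 0)) (hleft z hz)
    simp only [ContinuousLinearMap.comp_apply, h1] at h2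
    exact h2

end Straightening

end

noncomputable section

open Set Filter Topology

/-! ### Normalizing charts for free actions -/

section NormalizingChart

variable {n : ℕ} {E : Type} [NormedAddCommGroup E] [NormedSpace ℝ E] [FiniteDimensional ℝ E]

/-- Straightening with prescribed invariant variables. -/
theorem exists_straightening_of_invariants {Y : Type} [NormedAddCommGroup Y] [NormedSpace ℝ Y]
    [FiniteDimensional ℝ Y]
    {ξ : Fin n → (Fin n → ℝ) → (Fin n → ℝ)} {V : Fin n → E → E}
    {D : Set (Fin n → ℝ)} {Z : Set E} (hD : IsOpen D) (hZ : IsOpen Z)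
    (hξ : ∀ i, ContDiffOn ℝ ∞ (ξ i) D) (hV : ∀ i, ContDiffOn ℝ ∞ (V i) Z)
    (hξi : ∀ x ∈ D, LinearIndependent ℝ fun i => ξ i x) {C : Fin n → Fin n → Fin n → ℝ}
    (hξb : ∀ i j, ∀ x ∈ D, VectorField.lieBracket ℝ (ξ i) (ξ j) x = ∑ l, C i j l • ξ l x)
    (hVb : ∀ i j, ∀ z ∈ Z, VectorField.lieBracket ℝ (V i) (V j) z = ∑ l, C i j l • V l z)
    (hD0 : 0 ∈ D) {z₀ : E} (hz₀ : z₀ ∈ Z) (hVi : LinearIndependent ℝ fun i => V i z₀)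
    (hdim : n + Module.finrank ℝ Y = Module.finrank ℝ E)
    {v : E → Y} (hv : ContDiffOn ℝ ∞ v Z) (hvV : ∀ i, ∀ z ∈ Z, fderiv ℝ v z (V i z) = 0)
    (hvs : Function.Surjective (fderiv ℝ v z₀)) :
    ∃ φ : OpenPartialHomeomorph E ((Fin n → ℝ) × Y),
      z₀ ∈ φ.source ∧ φ.source ⊆ Z ∧ φ.target ⊆ D ×ˢ univ ∧
      ContDiffOn ℝ ∞ φ φ.source ∧ ContDiffOn ℝ ∞ φ.symm φ.target ∧
      (∀ z ∈ φ.source, ∀ i, fderiv ℝ φ z (V i z) = (ξ i (φ z).1, 0)) ∧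
      ∀ z ∈ φ.source, (φ z).2 = v z := by
  obtain ⟨S, ψ, -, hψ0, hψZ, hψD, hψ, -, hψV⟩ :=
    exists_straightening hD hZ hξ hV hξi hξb hVb hD0 hz₀ hVi
  -- The orbit coordinates of the straightening are kept, and its transversal coordinates are
  -- exchanged for the given invariants.
  let f : E → (Fin n → ℝ) × Y := fun z => ((ψ z).1, v z)
  have hf : ContDiffOn ℝ ∞ f ψ.source := (contDiff_fst.comp_contDiffOn hψ).prodMk (hv.mono hψZ)
  have hfd : ∀ z ∈ ψ.source, ∀ w, fderiv ℝ f z w = ((fderiv ℝ ψ z w).1, fderiv ℝ v z w) := by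
    intro z hz w
    have h1 : HasFDerivAt ψ (fderiv ℝ ψ z) z :=
      ((hψ.contDiffAt (ψ.open_source.mem_nhds hz)).differentiableAt (by simp)).hasFDerivAt
    have h2 : HasFDerivAt v (fderiv ℝ v z) z :=
      ((hv.contDiffAt (hZ.mem_nhds (hψZ hz))).differentiableAt (by simp)).hasFDerivAt
    have h3 : HasFDerivAt f _ z := (hasFDerivAt_fst.comp z h1).prodMk h2
    rw [h3.fderiv]
    rfl
  have hfV : ∀ z ∈ ψ.source, ∀ i, fderiv ℝ f z (V i z) = (ξ i (f z).1, 0) := by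
    intro z hz i
    rw [hfd z hz, hψV z hz, hvV i z (hψZ hz)]
  have hinv : (fderiv ℝ f z₀).IsInvertible := by
    refine ContinuousLinearMap.isInvertible_of_injective _ ?_ (by simp [hdim])
    rw [injective_iff_map_eq_zero]
    intro w hw
    rw [hfd z₀ hψ0, Prod.mk_eq_zero] at hw
    -- The fields V_i lie in the kernel of dv, and by the dimension count they exhaust it. On this
    -- kernel the orbit coordinates separate vectors.
    have hker : LinearMap.ker (fderiv ℝ v z₀ : E →ₗ[ℝ] Y) =
        Submodule.span ℝ (range fun i => V i z₀) := by
      symm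
      apply Submodule.eq_of_le_of_finrank_eq
      · rw [Submodule.span_le]
        rintro _ ⟨i, rfl⟩
        exact hvV i z₀ hz₀
      · have h1 := LinearMap.finrank_range_add_finrank_ker (fderiv ℝ v z₀ : E →ₗ[ℝ] Y)
        rw [LinearMap.range_eq_top.2 hvs, finrank_top] at h1
        rw [finrank_span_eq_card hVi, Fintype.card_fin]
        omega
    have hwm : w ∈ Submodule.span ℝ (range fun i => V i z₀) := by
      rw [← hker]; exact hw.2
    obtain ⟨a, rfl⟩ := (Submodule.mem_span_range_iff_exists_fun ℝ).1 hwm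
    have h2 := hw.1
    simp only [map_sum, map_smul, hψV z₀ hψ0] at h2
    have h3 : ∑ i, a i • ξ i (ψ z₀).1 = 0 := by
      rw [← h2, Prod.fst_sum]
      rfl
    have h4 := Fintype.linearIndependent_iff.1
      (hξi _ (hψD (ψ.map_source hψ0)).1) a h3
    simp [h4]
  obtain ⟨φ, hφ0, hφψ, hφf, hφs, -⟩ := hf.exists_openPartialHomeomorph ψ.open_source hψ0 hinv
  have hφfun : (φ : E → (Fin n → ℝ) × Y) = f := funext hφf
  refine ⟨φ, hφ0, hφψ.trans hψZ, ?_, ?_, hφs, ?_, ?_⟩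
  · intro p hp
    have h1 := φ.map_target hp
    rw [← φ.right_inv hp, hφf]
    exact ⟨(hψD (ψ.map_source (hφψ h1))).1, mem_univ _⟩
  · rw [hφfun]
    exact hf.mono hφψ
  · intro z hz i
    rw [hφfun]
    exact hfV z (hφψ hz) i
  · intro z _
    rw [hφf]

/-- The coordinates `x`, `y`, `u` as a linear equivalence. -/
def jet0Equiv (n k : ℕ) :
    ((Fin n → ℝ) × (Fin k → ℝ) × ℝ) ≃L[ℝ] Jet0 (Fin n ⊕ Fin k) :=
  LinearEquiv.toContinuousLinearEquiv
    { toFun := fun p => (Sum.elim p.1 p.2.1, p.2.2)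
      invFun := fun z => (fun a => z.1 (Sum.inl a), fun μ => z.1 (Sum.inr μ), z.2)
      map_add' := fun p q => by
        ext i
        · cases i <;> rfl
        · rfl
      map_smul' := fun c p => by
        ext i
        · cases i <;> rfl
        · rfl
      left_inv := fun _ => rfl
      right_inv := fun z => by
        ext i
        · cases i <;> rfl
        · rfl }

/-- Only a regrouping of coordinates, (x, (y, u)) into ((x, y), u), separates this from
`exists_straightening_of_invariants`. -/
theorem LowDimAlg.exists_isNormalizingChart (T : LowDimAlg n) (k : ℕ)
    {V : Fin n → E → E} {Z : Set E} (hD : IsOpen T.row.dom) (hZ : IsOpen Z)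
    (hξ : ∀ i, ContDiffOn ℝ ∞ (T.row.gen i) T.row.dom) (hV : ∀ i, ContDiffOn ℝ ∞ (V i) Z)
    (hξi : ∀ x ∈ T.row.dom, LinearIndependent ℝ fun i => T.row.gen i x)
    (hξb : ∀ i j, ∀ x ∈ T.row.dom, VectorField.lieBracket ℝ (T.row.gen i) (T.row.gen j) x =
      ∑ l, T.row.bracket i j l • T.row.gen l x)
    (hVb : ∀ i j, ∀ z ∈ Z,
      VectorField.lieBracket ℝ (V i) (V j) z = ∑ l, T.row.bracket i j l • V l z)
    (hD0 : 0 ∈ T.row.dom) {z₀ : E} (hz₀ : z₀ ∈ Z) (hVi : LinearIndependent ℝ fun i => V i z₀)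
    (hdim : n + (k + 1) = Module.finrank ℝ E)
    {v : E → (Fin k → ℝ) × ℝ} (hv : ContDiffOn ℝ ∞ v Z)
    (hvV : ∀ i, ∀ z ∈ Z, fderiv ℝ v z (V i z) = 0)
    (hvs : Function.Surjective (fderiv ℝ v z₀)) :
    ∃ φ : OpenPartialHomeomorph E (Jet0 (Fin n ⊕ Fin k)),
      z₀ ∈ φ.source ∧ T.IsNormalizingChart k Z V φ ∧
      ∀ z ∈ φ.source, ((fun μ => (φ z).1 (Sum.inr μ)), (φ z).2) = v z := by
  obtain ⟨φ, h0, hφZ, hφD, hφ, hφs, hφV, hφv⟩ :=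
    exists_straightening_of_invariants hD hZ hξ hV hξi hξb hVb hD0 hz₀ hVi (by simp [hdim]) hv hvV
      hvs
  refine ⟨φ.transHomeomorph (jet0Equiv n k).toHomeomorph, h0, ⟨hφZ, ?_, ?_, ?_, ?_⟩, ?_⟩
  · intro z hz
    exact (hφD hz).1
  · exact (jet0Equiv n k).contDiff.comp_contDiffOn hφ
  · exact hφs.comp (jet0Equiv n k).symm.contDiff.contDiffOn fun z hz => hz
  · intro z hz i
    have h1 : HasFDerivAt φ (fderiv ℝ φ z) z :=
      ((hφ.contDiffAt (φ.open_source.mem_nhds hz)).differentiableAt (by simp)).hasFDerivAt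
    have h2 : HasFDerivAt (φ.transHomeomorph (jet0Equiv n k).toHomeomorph) _ z :=
      (jet0Equiv n k).hasFDerivAt.comp z h1
    rw [h2.fderiv]
    change jet0Equiv n k (fderiv ℝ φ z (V i z)) = T.genZ k i (jet0Equiv n k (φ z))
    rw [hφV z hz i]
    rfl
  · intro z hz
    rw [← hφv z hz]
    rfl

/-- Existence of normalizing charts, without prescribed invariants. -/
theorem LowDimAlg.exists_isNormalizingChart' (T : LowDimAlg n) (k : ℕ)
    {V : Fin n → E → E} {Z : Set E} (hD : IsOpen T.row.dom) (hZ : IsOpen Z)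
    (hξ : ∀ i, ContDiffOn ℝ ∞ (T.row.gen i) T.row.dom) (hV : ∀ i, ContDiffOn ℝ ∞ (V i) Z)
    (hξi : ∀ x ∈ T.row.dom, LinearIndependent ℝ fun i => T.row.gen i x)
    (hξb : ∀ i j, ∀ x ∈ T.row.dom, VectorField.lieBracket ℝ (T.row.gen i) (T.row.gen j) x =
      ∑ l, T.row.bracket i j l • T.row.gen l x)
    (hVb : ∀ i j, ∀ z ∈ Z,
      VectorField.lieBracket ℝ (V i) (V j) z = ∑ l, T.row.bracket i j l • V l z)
    (hD0 : 0 ∈ T.row.dom) {z₀ : E} (hz₀ : z₀ ∈ Z) (hVi : LinearIndependent ℝ fun i => V i z₀)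
    (hdim : n + (k + 1) = Module.finrank ℝ E) :
    ∃ φ : OpenPartialHomeomorph E (Jet0 (Fin n ⊕ Fin k)),
      z₀ ∈ φ.source ∧ T.IsNormalizingChart k Z V φ := by
  obtain ⟨S, ψ, hS, hψ0, hψZ, -, hψ, hψi, hψV⟩ :=
    exists_straightening hD hZ hξ hV hξi hξb hVb hD0 hz₀ hVi
  -- The transversal coordinates are themselves independent invariants, so any linear identification
  -- of S with the space of (y, u) reduces this to the case of prescribed invariants.
  let e : S ≃L[ℝ] (Fin k → ℝ) × ℝ := ContinuousLinearEquiv.ofFinrankEq (by simp; omega)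
  let L : (Fin n → ℝ) × S →L[ℝ] (Fin k → ℝ) × ℝ :=
    (e : S →L[ℝ] (Fin k → ℝ) × ℝ).comp (ContinuousLinearMap.snd ℝ _ _)
  have hd : ∀ z ∈ ψ.source, fderiv ℝ (fun z => L (ψ z)) z = L.comp (fderiv ℝ ψ z) := by
    intro z hz
    have h1 : HasFDerivAt ψ (fderiv ℝ ψ z) z :=
      ((hψ.contDiffAt (ψ.open_source.mem_nhds hz)).differentiableAt (by simp)).hasFDerivAt
    exact (L.hasFDerivAt.comp z h1).fderiv
  obtain ⟨φ, h0, hφ, -⟩ := T.exists_isNormalizingChart k (v := fun z => L (ψ z)) hD ψ.open_source hξ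
    (fun i => (hV i).mono hψZ) hξi hξb (fun i j z hz => hVb i j z (hψZ hz)) hD0 hψ0 hVi hdim
    (L.contDiff.comp_contDiffOn hψ)
    (fun i z hz => by
      rw [hd z hz, ContinuousLinearMap.comp_apply, hψV z hz]
      simp [L])
    (by
      rw [hd z₀ hψ0]
      obtain ⟨A, hA⟩ := hψi z₀ hψ0
      rw [← hA]
      intro w
      exact ⟨A.symm (0, e.symm w), by simp [L]⟩)
  exact ⟨φ, h0, hφ.source_subset.trans hψZ, hφ.target_subset, hφ.contDiffOn, hφ.contDiffOn_symm,
    hφ.map_field⟩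

end NormalizingChart

end

noncomputable section

open Set Filter Topology

/-! ### Evaluation of directional derivatives of explicit vector fields -/

section DirectionalDerivatives

variable {E : Type*} [NormedAddCommGroup E] [NormedSpace ℝ E] {f g h : E → ℝ} {x : E}

theorem fderiv_vec2_apply (hf : DifferentiableAt ℝ f x) (hg : DifferentiableAt ℝ g x) (v : E) :
    fderiv ℝ (fun x => ![f x, g x]) x v = ![fderiv ℝ f x v, fderiv ℝ g x v] := by
  rw [fderiv_pi (fun i => by fin_cases i <;> simpa)]
  ext i; fin_cases i <;> rfl

theorem fderiv_vec3_apply (hf : DifferentiableAt ℝ f x) (hg : DifferentiableAt ℝ g x)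
    (hh : DifferentiableAt ℝ h x) (v : E) :
    fderiv ℝ (fun x => ![f x, g x, h x]) x v =
      ![fderiv ℝ f x v, fderiv ℝ g x v, fderiv ℝ h x v] := by
  rw [fderiv_pi (fun i => by fin_cases i <;> simpa)]
  ext i; fin_cases i <;> rfl

theorem fderiv_coord_apply {n : ℕ} (i : Fin n) (x v : Fin n → ℝ) :
    fderiv ℝ (fun x : Fin n → ℝ => x i) x v = v i := by
  rw [(hasFDerivAt_apply i x).fderiv]; rfl

theorem fderiv_add_apply' (hf : DifferentiableAt ℝ f x) (hg : DifferentiableAt ℝ g x) (v : E) :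
    fderiv ℝ (fun x => f x + g x) x v = fderiv ℝ f x v + fderiv ℝ g x v := by
  rw [fderiv_fun_add hf hg]; rfl

theorem fderiv_sub_apply' (hf : DifferentiableAt ℝ f x) (hg : DifferentiableAt ℝ g x) (v : E) :
    fderiv ℝ (fun x => f x - g x) x v = fderiv ℝ f x v - fderiv ℝ g x v := by
  rw [fderiv_fun_sub hf hg]; rfl

theorem fderiv_mul_apply' (hf : DifferentiableAt ℝ f x) (hg : DifferentiableAt ℝ g x) (v : E) :
    fderiv ℝ (fun x => f x * g x) x v = fderiv ℝ f x v * g x + f x * fderiv ℝ g x v := by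
  rw [fderiv_fun_mul hf hg]; simp; ring

theorem fderiv_sq_apply' (hf : DifferentiableAt ℝ f x) (v : E) :
    fderiv ℝ (fun x => f x ^ 2) x v = 2 * f x * fderiv ℝ f x v := by
  rw [fderiv_fun_pow 2 hf]; simp

theorem fderiv_div_apply' (hf : DifferentiableAt ℝ f x) (hg : DifferentiableAt ℝ g x)
    (h0 : g x ≠ 0) (v : E) :
    fderiv ℝ (fun x => f x / g x) x v =
      (fderiv ℝ f x v * g x - f x * fderiv ℝ g x v) / g x ^ 2 := by
  have h1 := (hf.hasFDerivAt.mul (hasFDerivAt_inv h0 |>.comp x hg.hasFDerivAt)).fderiv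
  have h2 : (fun x => f x / g x) = fun x => f x * ((fun y => y⁻¹) ∘ g) x := rfl
  rw [h2]
  have h3 := congrArg (fun L : E →L[ℝ] ℝ => L v) h1
  refine h3.trans ?_
  simp
  field_simp
  ring

theorem ContDiffAt.vec1 (hf : ContDiffAt ℝ ∞ f x) : ContDiffAt ℝ ∞ (fun x => ![f x]) x :=
  contDiffAt_pi.2 fun i => by fin_cases i; simpa

theorem ContDiffAt.vec2 (hf : ContDiffAt ℝ ∞ f x) (hg : ContDiffAt ℝ ∞ g x) :
    ContDiffAt ℝ ∞ (fun x => ![f x, g x]) x :=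
  contDiffAt_pi.2 fun i => by fin_cases i <;> simpa

theorem ContDiffAt.vec3 (hf : ContDiffAt ℝ ∞ f x) (hg : ContDiffAt ℝ ∞ g x)
    (hh : ContDiffAt ℝ ∞ h x) : ContDiffAt ℝ ∞ (fun x => ![f x, g x, h x]) x :=
  contDiffAt_pi.2 fun i => by fin_cases i <;> simpa

end DirectionalDerivatives

/-- An invariant frame of a row of the tables: vector fields commuting with the generators, in
terms of which the invariants of the row are expressed. The functions `dgen` and `dframe` are the
directional derivatives of the generators and of the frame. -/
structure TableRow.InvariantFrame {n : ℕ} (R : TableRow n) where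
  frame : Fin n → (Fin n → ℝ) → (Fin n → ℝ)
  dgen : Fin n → (Fin n → ℝ) → (Fin n → ℝ) → (Fin n → ℝ)
  dframe : Fin n → (Fin n → ℝ) → (Fin n → ℝ) → (Fin n → ℝ)
  -- The table lists the entries of the symmetric matrix in an order, and sometimes in linear
  -- combinations, that differ from row to row; `pack` and `unpack` absorb this difference.
  pack : (Fin n → Fin n → ℝ) →ₗ[ℝ] (Fin (n * (n + 1) / 2) → ℝ)
  unpack : (Fin (n * (n + 1) / 2) → ℝ) →ₗ[ℝ] (Fin n → Fin n → ℝ)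
  isOpen_dom : IsOpen R.dom
  -- Convexity serves as connectedness of D. The point 0 is the base point for the charts and for
  -- the global slices.
  convex_dom : Convex ℝ R.dom
  zero_mem_dom : 0 ∈ R.dom
  contDiffAt_gen : ∀ x ∈ R.dom, ∀ i, ContDiffAt ℝ ∞ (R.gen i) x
  contDiffAt_frame : ∀ x ∈ R.dom, ∀ i, ContDiffAt ℝ ∞ (frame i) x
  fderiv_gen : ∀ x ∈ R.dom, ∀ i v, fderiv ℝ (R.gen i) x v = dgen i x v
  fderiv_frame : ∀ x ∈ R.dom, ∀ i v, fderiv ℝ (frame i) x v = dframe i x v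
  bracket_gen : ∀ x ∈ R.dom, ∀ i j,
    dgen j x (R.gen i x) - dgen i x (R.gen j x) = ∑ l, R.bracket i j l • R.gen l x
  commute : ∀ x ∈ R.dom, ∀ i j, dframe j x (R.gen i x) = dgen i x (frame j x)
  det_gen : ∀ x ∈ R.dom, (Matrix.of fun i => R.gen i x).det ≠ 0
  det_frame : ∀ x ∈ R.dom, (Matrix.of fun i => frame i x).det ≠ 0
  inv1_eq : ∀ x ∈ R.dom, ∀ v i, R.inv1 x v i = ∑ a, v a * frame i x a
  -- The matrix entry is (Y_i Y_j u + Y_j Y_i u) / 2. Symmetrization is needed because the Y_i need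
  -- not commute with each other; it is the source of the halves in the table.
  inv2_eq : ∀ x ∈ R.dom, ∀ p r, (∀ a b, r a b = r b a) → R.inv2 x p r = pack fun i j =>
    ∑ a, ∑ b, r a b * frame i x a * frame j x b +
      (∑ a, p a * (dframe j x (frame i x) a + dframe i x (frame j x) a)) / 2
  pack_unpack : ∀ K, pack (unpack K) = K
  unpack_pack : ∀ q, (∀ a b, q a b = q b a) → unpack (pack q) = q
  unpack_symm : ∀ K a b, unpack K a b = unpack K b a

end

noncomputable section

open Set Filter Topology

/-! ### Invariant frames of the rows with D = ℝⁿ -/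

namespace TableRow

open Real

/-- The linear map listing the entries `(0,0), (0,1), (1,1)` of a matrix. -/
def packTwo : (Fin 2 → Fin 2 → ℝ) →ₗ[ℝ] (Fin (2 * (2 + 1) / 2) → ℝ) where
  toFun q := ![q 0 0, q 0 1, q 1 1]
  map_add' q q' := by ext i; fin_cases i <;> rfl
  map_smul' c q := by ext i; fin_cases i <;> rfl

/-- The symmetric matrix with the given entries `(0,0), (0,1), (1,1)`. -/
def unpackTwo : (Fin (2 * (2 + 1) / 2) → ℝ) →ₗ[ℝ] (Fin 2 → Fin 2 → ℝ) where
  toFun K := ![![K 0, K 1], ![K 1, K 2]]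
  map_add' q q' := by ext i j; fin_cases i <;> fin_cases j <;> rfl
  map_smul' c q := by ext i j; fin_cases i <;> fin_cases j <;> rfl

/-- The linear map listing the upper triangular entries of a matrix row by row. -/
def packThree : (Fin 3 → Fin 3 → ℝ) →ₗ[ℝ] (Fin (3 * (3 + 1) / 2) → ℝ) where
  toFun q := ![q 0 0, q 0 1, q 0 2, q 1 1, q 1 2, q 2 2]
  map_add' q q' := by ext i; fin_cases i <;> rfl
  map_smul' c q := by ext i; fin_cases i <;> rfl

/-- The symmetric matrix with the given upper triangular entries. -/
def unpackThree : (Fin (3 * (3 + 1) / 2) → ℝ) →ₗ[ℝ] (Fin 3 → Fin 3 → ℝ) where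
  toFun K := ![![K 0, K 1, K 2], ![K 1, K 3, K 4], ![K 2, K 4, K 5]]
  map_add' q q' := by ext i j; fin_cases i <;> fin_cases j <;> rfl
  map_smul' c q := by ext i j; fin_cases i <;> fin_cases j <;> rfl

theorem exp_two_mul_eq (t : ℝ) : exp (2 * t) = exp t ^ 2 := by rw [two_mul, exp_add, sq]

theorem exp_two_mul_mul (h t : ℝ) : exp (2 * h * t) = exp (h * t) ^ 2 := by
  rw [mul_assoc, exp_two_mul_eq]

theorem exp_one_add_mul (h t : ℝ) : exp ((1 + h) * t) = exp t * exp (h * t) := by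
  rw [add_mul, one_mul, exp_add]

set_option linter.unusedSimpArgs false
set_option linter.unnecessarySeqFocus false
set_option linter.unreachableTactic false
set_option linter.unusedTactic false

/-- The second-order invariants of the row in terms of those of its frame. -/
def packG1 : (Fin 1 → Fin 1 → ℝ) →ₗ[ℝ] (Fin (1 * (1 + 1) / 2) → ℝ) where
  toFun q := ![q 0 0]
  map_add' q q' := by ext i; fin_cases i <;> simp <;> ring
  map_smul' c q := by ext i; fin_cases i <;> simp <;> ring

/-- The inverse of the above map on symmetric matrices. -/
def unpackG1 : (Fin (1 * (1 + 1) / 2) → ℝ) →ₗ[ℝ] (Fin 1 → Fin 1 → ℝ) where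
  toFun K := ![![K 0]]
  map_add' q q' := by ext i j; fin_cases i <;> fin_cases j <;> simp <;> ring
  map_smul' c q := by ext i j; fin_cases i <;> fin_cases j <;> simp <;> ring

/-- The invariant frame of the row `g1`. -/
def frameG1 : Fin 1 → (Fin 1 → ℝ) → (Fin 1 → ℝ) :=
    ![fun _ => ![1]]

/-- The directional derivatives of the generators of the row `g1`. -/
def dgenG1 : Fin 1 → (Fin 1 → ℝ) → (Fin 1 → ℝ) → (Fin 1 → ℝ) :=
    ![fun _ _ => 0]

/-- The directional derivatives of the invariant frame of the row `g1`. -/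
def dframeG1 : Fin 1 → (Fin 1 → ℝ) → (Fin 1 → ℝ) → (Fin 1 → ℝ) :=
    ![fun _ _ => 0]

set_option maxHeartbeats 2000000 in
def invariantFrameG1 : InvariantFrame g1 where
  frame := frameG1
  dgen := dgenG1
  dframe := dframeG1
  pack := packG1
  unpack := unpackG1
  isOpen_dom := isOpen_univ
  convex_dom := convex_univ
  zero_mem_dom := mem_univ _
  contDiffAt_gen := by
    intro x _ i
    fin_cases i <;> simp only [g1, Fin.zero_eta, Fin.mk_one, Fin.reduceFinMk, Matrix.cons_val] <;>
      refine ContDiffAt.vec1 ?_ <;> fun_prop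
  contDiffAt_frame := by
    intro x _ i
    fin_cases i <;> simp only [frameG1, Fin.zero_eta, Fin.mk_one, Fin.reduceFinMk, Matrix.cons_val] <;>
      refine ContDiffAt.vec1 ?_ <;> fun_prop
  fderiv_gen := by
    intro x _ i v
    ext l
    fin_cases i <;> fin_cases l <;>
    simp (disch := fun_prop) [g1, dgenG1, fderiv_mul_apply',
      fderiv_add_apply', fderiv_sub_apply', fderiv_coord_apply, fderiv_sq_apply'] <;> ring
  fderiv_frame := by
    intro x _ i v
    ext l
    fin_cases i <;> fin_cases l <;>
    simp (disch := fun_prop) [frameG1, dframeG1, fderiv_mul_apply', fderiv_coord_apply, fderiv_sq_apply'] <;> ring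
  bracket_gen := by
    intro x _ i j
    ext l
    fin_cases i <;> fin_cases j <;> fin_cases l <;>
    simp [g1, dgenG1, Fin.sum_univ_one, Fin.isValue] <;> ring
  commute := by
    intro x _ i j
    ext l
    fin_cases i <;> fin_cases j <;> fin_cases l <;>
    simp [g1, dgenG1, frameG1, dframeG1] <;> ring
  det_gen := by
    intro x _
    simp [Matrix.det_fin_one, g1]
  det_frame := by
    intro x _
    simp [Matrix.det_fin_one, frameG1]
  inv1_eq := by
    intro x _ v i
    fin_cases i <;> simp [g1, frameG1, Fin.sum_univ_one, Fin.isValue] <;> ring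
  inv2_eq := by
    intro x _ p r hr
    ext s
    fin_cases s <;>
    simp [g1, packG1, frameG1, dframeG1, Fin.sum_univ_one, Fin.isValue, exp_two_mul_eq,
      exp_two_mul_mul, exp_one_add_mul, sin_two_mul, cos_two_mul] <;> ring
  pack_unpack := by intro K; ext i; fin_cases i <;> simp [packG1, unpackG1] <;> ring
  unpack_pack := by
    intro q hq; ext i j
    fin_cases i <;> fin_cases j <;> simp [packG1, unpackG1] <;> ring
  unpack_symm := by intro K i j; fin_cases i <;> fin_cases j <;> rfl

/-- The invariant frame of the row `twoG1`. -/
def frameTwoG1 : Fin 2 → (Fin 2 → ℝ) → (Fin 2 → ℝ) :=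
    ![fun _ => ![1, 0],
      fun _ => ![0, 1]]

/-- The directional derivatives of the generators of the row `twoG1`. -/
def dgenTwoG1 : Fin 2 → (Fin 2 → ℝ) → (Fin 2 → ℝ) → (Fin 2 → ℝ) :=
    ![fun _ _ => 0,
      fun _ _ => 0]

/-- The directional derivatives of the invariant frame of the row `twoG1`. -/
def dframeTwoG1 : Fin 2 → (Fin 2 → ℝ) → (Fin 2 → ℝ) → (Fin 2 → ℝ) :=
    ![fun _ _ => 0,
      fun _ _ => 0]

set_option maxHeartbeats 2000000 in
def invariantFrameTwoG1 : InvariantFrame twoG1 where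
  frame := frameTwoG1
  dgen := dgenTwoG1
  dframe := dframeTwoG1
  pack := packTwo
  unpack := unpackTwo
  isOpen_dom := isOpen_univ
  convex_dom := convex_univ
  zero_mem_dom := mem_univ _
  contDiffAt_gen := by
    intro x _ i
    fin_cases i <;> simp only [twoG1, Fin.zero_eta, Fin.mk_one, Fin.reduceFinMk, Matrix.cons_val] <;>
      refine ContDiffAt.vec2 ?_ ?_ <;> fun_prop
  contDiffAt_frame := by
    intro x _ i
    fin_cases i <;> simp only [frameTwoG1, Fin.zero_eta, Fin.mk_one, Fin.reduceFinMk, Matrix.cons_val] <;>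
      refine ContDiffAt.vec2 ?_ ?_ <;> fun_prop
  fderiv_gen := by
    intro x _ i v
    ext l
    fin_cases i <;> fin_cases l <;>
    simp (disch := fun_prop) [twoG1, dgenTwoG1, fderiv_vec2_apply, fderiv_mul_apply',
      fderiv_add_apply', fderiv_sub_apply', fderiv_coord_apply, fderiv_sq_apply'] <;> ring
  fderiv_frame := by
    intro x _ i v
    ext l
    fin_cases i <;> fin_cases l <;>
    simp (disch := fun_prop) [frameTwoG1, dframeTwoG1, fderiv_vec2_apply, fderiv_mul_apply', fderiv_coord_apply, fderiv_sq_apply'] <;> ring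
  bracket_gen := by
    intro x _ i j
    ext l
    fin_cases i <;> fin_cases j <;> fin_cases l <;>
    simp [twoG1, dgenTwoG1, brackets2, Fin.sum_univ_two] <;> ring
  commute := by
    intro x _ i j
    ext l
    fin_cases i <;> fin_cases j <;> fin_cases l <;>
    simp [twoG1, dgenTwoG1, frameTwoG1, dframeTwoG1] <;> ring
  det_gen := by
    intro x _
    simp [Matrix.det_fin_two, twoG1]
  det_frame := by
    intro x _
    simp [Matrix.det_fin_two, frameTwoG1]
  inv1_eq := by
    intro x _ v i
    fin_cases i <;> simp [twoG1, frameTwoG1, Fin.sum_univ_two] <;> ring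
  inv2_eq := by
    intro x _ p r hr
    ext s
    -- The double sum contains both orders of each mixed derivative, while the table uses only the
    -- upper triangular entries.
    have h10 := hr 1 0
    fin_cases s <;>
    simp [twoG1, packTwo, frameTwoG1, dframeTwoG1, Fin.sum_univ_two, exp_two_mul_eq,
      exp_two_mul_mul, exp_one_add_mul, sin_two_mul, cos_two_mul, h10] <;> ring
  pack_unpack := by intro K; ext i; fin_cases i <;> rfl
  unpack_pack := by
    intro q hq; ext i j
    fin_cases i <;> fin_cases j <;> first | rfl | exact hq _ _
  unpack_symm := by intro K i j; fin_cases i <;> fin_cases j <;> rfl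

/-- The invariant frame of the row `g2`. -/
def frameG2 : Fin 2 → (Fin 2 → ℝ) → (Fin 2 → ℝ) :=
    ![fun x => ![exp (x 1), 0],
      fun _ => ![0, 1]]

/-- The directional derivatives of the generators of the row `g2`. -/
def dgenG2 : Fin 2 → (Fin 2 → ℝ) → (Fin 2 → ℝ) → (Fin 2 → ℝ) :=
    ![fun _ _ => 0,
      fun _ v => ![v 0, 0]]

/-- The directional derivatives of the invariant frame of the row `g2`. -/
def dframeG2 : Fin 2 → (Fin 2 → ℝ) → (Fin 2 → ℝ) → (Fin 2 → ℝ) :=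
    ![fun x v => ![exp (x 1) * v 1, 0],
      fun _ _ => 0]

set_option maxHeartbeats 2000000 in
def invariantFrameG2 : InvariantFrame g2 where
  frame := frameG2
  dgen := dgenG2
  dframe := dframeG2
  pack := packTwo
  unpack := unpackTwo
  isOpen_dom := isOpen_univ
  convex_dom := convex_univ
  zero_mem_dom := mem_univ _
  contDiffAt_gen := by
    intro x _ i
    fin_cases i <;> simp only [g2, Fin.zero_eta, Fin.mk_one, Fin.reduceFinMk, Matrix.cons_val] <;>
      refine ContDiffAt.vec2 ?_ ?_ <;> fun_prop
  contDiffAt_frame := by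
    intro x _ i
    fin_cases i <;> simp only [frameG2, Fin.zero_eta, Fin.mk_one, Fin.reduceFinMk, Matrix.cons_val] <;>
      refine ContDiffAt.vec2 ?_ ?_ <;> fun_prop
  fderiv_gen := by
    intro x _ i v
    ext l
    fin_cases i <;> fin_cases l <;>
    simp (disch := fun_prop) [g2, dgenG2, fderiv_vec2_apply, fderiv_mul_apply',
      fderiv_add_apply', fderiv_sub_apply', fderiv_coord_apply, fderiv_sq_apply'] <;> ring
  fderiv_frame := by
    intro x _ i v
    ext l
    fin_cases i <;> fin_cases l <;>
    simp (disch := fun_prop) [frameG2, dframeG2, fderiv_vec2_apply, fderiv_mul_apply', fderiv_coord_apply, fderiv_sq_apply'] <;> ring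
  bracket_gen := by
    intro x _ i j
    ext l
    fin_cases i <;> fin_cases j <;> fin_cases l <;>
    simp [g2, dgenG2, brackets2, Fin.sum_univ_two] <;> ring
  commute := by
    intro x _ i j
    ext l
    fin_cases i <;> fin_cases j <;> fin_cases l <;>
    simp [g2, dgenG2, frameG2, dframeG2] <;> ring
  det_gen := by
    intro x _
    simp [Matrix.det_fin_two, g2]
  det_frame := by
    intro x _
    simp [Matrix.det_fin_two, frameG2]
  inv1_eq := by
    intro x _ v i
    fin_cases i <;> simp [g2, frameG2, Fin.sum_univ_two] <;> ring
  inv2_eq := by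
    intro x _ p r hr
    ext s
    have h10 := hr 1 0
    fin_cases s <;>
    simp [g2, packTwo, frameG2, dframeG2, Fin.sum_univ_two, exp_two_mul_eq,
      exp_two_mul_mul, exp_one_add_mul, sin_two_mul, cos_two_mul, h10] <;> ring
  pack_unpack := by intro K; ext i; fin_cases i <;> rfl
  unpack_pack := by
    intro q hq; ext i j
    fin_cases i <;> fin_cases j <;> first | rfl | exact hq _ _
  unpack_symm := by intro K i j; fin_cases i <;> fin_cases j <;> rfl

/-- The invariant frame of the row `threeG1`. -/
def frameThreeG1 : Fin 3 → (Fin 3 → ℝ) → (Fin 3 → ℝ) :=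
    ![fun _ => ![1, 0, 0],
      fun _ => ![0, 1, 0],
      fun _ => ![0, 0, 1]]

/-- The directional derivatives of the generators of the row `threeG1`. -/
def dgenThreeG1 : Fin 3 → (Fin 3 → ℝ) → (Fin 3 → ℝ) → (Fin 3 → ℝ) :=
    ![fun _ _ => 0,
      fun _ _ => 0,
      fun _ _ => 0]

/-- The directional derivatives of the invariant frame of the row `threeG1`. -/
def dframeThreeG1 : Fin 3 → (Fin 3 → ℝ) → (Fin 3 → ℝ) → (Fin 3 → ℝ) :=
    ![fun _ _ => 0,
      fun _ _ => 0,
      fun _ _ => 0]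

set_option maxHeartbeats 2000000 in
def invariantFrameThreeG1 : InvariantFrame threeG1 where
  frame := frameThreeG1
  dgen := dgenThreeG1
  dframe := dframeThreeG1
  pack := packThree
  unpack := unpackThree
  isOpen_dom := isOpen_univ
  convex_dom := convex_univ
  zero_mem_dom := mem_univ _
  contDiffAt_gen := by
    intro x _ i
    fin_cases i <;> simp only [threeG1, Fin.zero_eta, Fin.mk_one, Fin.reduceFinMk, Matrix.cons_val] <;>
      refine ContDiffAt.vec3 ?_ ?_ ?_ <;> fun_prop
  contDiffAt_frame := by
    intro x _ i
    fin_cases i <;> simp only [frameThreeG1, Fin.zero_eta, Fin.mk_one, Fin.reduceFinMk, Matrix.cons_val] <;>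
      refine ContDiffAt.vec3 ?_ ?_ ?_ <;> fun_prop
  fderiv_gen := by
    intro x _ i v
    ext l
    fin_cases i <;> fin_cases l <;>
    simp (disch := fun_prop) [threeG1, dgenThreeG1, fderiv_vec3_apply, fderiv_mul_apply',
      fderiv_add_apply', fderiv_sub_apply', fderiv_coord_apply, fderiv_sq_apply'] <;> ring
  fderiv_frame := by
    intro x _ i v
    ext l
    fin_cases i <;> fin_cases l <;>
    simp (disch := fun_prop) [frameThreeG1, dframeThreeG1, fderiv_vec3_apply, fderiv_mul_apply', fderiv_coord_apply, fderiv_sq_apply'] <;> ring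
  bracket_gen := by
    intro x _ i j
    ext l
    fin_cases i <;> fin_cases j <;> fin_cases l <;>
    simp [threeG1, dgenThreeG1, brackets3, Fin.sum_univ_three] <;> ring
  commute := by
    intro x _ i j
    ext l
    fin_cases i <;> fin_cases j <;> fin_cases l <;>
    simp [threeG1, dgenThreeG1, frameThreeG1, dframeThreeG1] <;> ring
  det_gen := by
    intro x _
    simp [Matrix.det_fin_three, threeG1]
  det_frame := by
    intro x _
    simp [Matrix.det_fin_three, frameThreeG1]
  inv1_eq := by
    intro x _ v i
    fin_cases i <;> simp [threeG1, frameThreeG1, Fin.sum_univ_three] <;> ring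
  inv2_eq := by
    intro x _ p r hr
    ext s
    have h10 := hr 1 0
    have h20 := hr 2 0
    have h21 := hr 2 1
    fin_cases s <;>
    simp [threeG1, packThree, frameThreeG1, dframeThreeG1, Fin.sum_univ_three, exp_two_mul_eq,
      exp_two_mul_mul, exp_one_add_mul, sin_two_mul, cos_two_mul, h10, h20, h21] <;> ring
  pack_unpack := by intro K; ext i; fin_cases i <;> rfl
  unpack_pack := by
    intro q hq; ext i j
    fin_cases i <;> fin_cases j <;> first | rfl | exact hq _ _
  unpack_symm := by intro K i j; fin_cases i <;> fin_cases j <;> rfl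

/-- The invariant frame of the row `g1_add_g2`. -/
def frameG1AddG2 : Fin 3 → (Fin 3 → ℝ) → (Fin 3 → ℝ) :=
    ![fun x => ![exp (x 1), 0, 0],
      fun _ => ![0, 1, 0],
      fun _ => ![0, 0, 1]]

/-- The directional derivatives of the generators of the row `g1_add_g2`. -/
def dgenG1AddG2 : Fin 3 → (Fin 3 → ℝ) → (Fin 3 → ℝ) → (Fin 3 → ℝ) :=
    ![fun _ _ => 0,
      fun _ v => ![v 0, 0, 0],
      fun _ _ => 0]

/-- The directional derivatives of the invariant frame of the row `g1_add_g2`. -/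
def dframeG1AddG2 : Fin 3 → (Fin 3 → ℝ) → (Fin 3 → ℝ) → (Fin 3 → ℝ) :=
    ![fun x v => ![exp (x 1) * v 1, 0, 0],
      fun _ _ => 0,
      fun _ _ => 0]

set_option maxHeartbeats 2000000 in
def invariantFrameG1AddG2 : InvariantFrame g1_add_g2 where
  frame := frameG1AddG2
  dgen := dgenG1AddG2
  dframe := dframeG1AddG2
  pack := packThree
  unpack := unpackThree
  isOpen_dom := isOpen_univ
  convex_dom := convex_univ
  zero_mem_dom := mem_univ _
  contDiffAt_gen := by
    intro x _ i
    fin_cases i <;> simp only [g1_add_g2, Fin.zero_eta, Fin.mk_one, Fin.reduceFinMk, Matrix.cons_val] <;>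
      refine ContDiffAt.vec3 ?_ ?_ ?_ <;> fun_prop
  contDiffAt_frame := by
    intro x _ i
    fin_cases i <;> simp only [frameG1AddG2, Fin.zero_eta, Fin.mk_one, Fin.reduceFinMk, Matrix.cons_val] <;>
      refine ContDiffAt.vec3 ?_ ?_ ?_ <;> fun_prop
  fderiv_gen := by
    intro x _ i v
    ext l
    fin_cases i <;> fin_cases l <;>
    simp (disch := fun_prop) [g1_add_g2, dgenG1AddG2, fderiv_vec3_apply, fderiv_mul_apply',
      fderiv_add_apply', fderiv_sub_apply', fderiv_coord_apply, fderiv_sq_apply'] <;> ring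
  fderiv_frame := by
    intro x _ i v
    ext l
    fin_cases i <;> fin_cases l <;>
    simp (disch := fun_prop) [frameG1AddG2, dframeG1AddG2, fderiv_vec3_apply, fderiv_mul_apply', fderiv_coord_apply, fderiv_sq_apply'] <;> ring
  bracket_gen := by
    intro x _ i j
    ext l
    fin_cases i <;> fin_cases j <;> fin_cases l <;>
    simp [g1_add_g2, dgenG1AddG2, brackets3, Fin.sum_univ_three] <;> ring
  commute := by
    intro x _ i j
    ext l
    fin_cases i <;> fin_cases j <;> fin_cases l <;>
    simp [g1_add_g2, dgenG1AddG2, frameG1AddG2, dframeG1AddG2] <;> ring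
  det_gen := by
    intro x _
    simp [Matrix.det_fin_three, g1_add_g2]
  det_frame := by
    intro x _
    simp [Matrix.det_fin_three, frameG1AddG2]
  inv1_eq := by
    intro x _ v i
    fin_cases i <;> simp [g1_add_g2, frameG1AddG2, Fin.sum_univ_three] <;> ring
  inv2_eq := by
    intro x _ p r hr
    ext s
    have h10 := hr 1 0
    have h20 := hr 2 0
    have h21 := hr 2 1
    fin_cases s <;>
    simp [g1_add_g2, packThree, frameG1AddG2, dframeG1AddG2, Fin.sum_univ_three, exp_two_mul_eq,
      exp_two_mul_mul, exp_one_add_mul, sin_two_mul, cos_two_mul, h10, h20, h21] <;> ring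
  pack_unpack := by intro K; ext i; fin_cases i <;> rfl
  unpack_pack := by
    intro q hq; ext i j
    fin_cases i <;> fin_cases j <;> first | rfl | exact hq _ _
  unpack_symm := by intro K i j; fin_cases i <;> fin_cases j <;> rfl

/-- The invariant frame of the row `g3_1`. -/
def frameG31 : Fin 3 → (Fin 3 → ℝ) → (Fin 3 → ℝ) :=
    ![fun _ => ![1, 0, 0],
      fun x => ![x 2, 1, 0],
      fun _ => ![0, 0, 1]]

/-- The directional derivatives of the generators of the row `g3_1`. -/
def dgenG31 : Fin 3 → (Fin 3 → ℝ) → (Fin 3 → ℝ) → (Fin 3 → ℝ) :=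
    ![fun _ _ => 0,
      fun _ _ => 0,
      fun _ v => ![v 1, 0, 0]]

/-- The directional derivatives of the invariant frame of the row `g3_1`. -/
def dframeG31 : Fin 3 → (Fin 3 → ℝ) → (Fin 3 → ℝ) → (Fin 3 → ℝ) :=
    ![fun _ _ => 0,
      fun _ v => ![v 2, 0, 0],
      fun _ _ => 0]

set_option maxHeartbeats 2000000 in
def invariantFrameG31 : InvariantFrame g3_1 where
  frame := frameG31
  dgen := dgenG31
  dframe := dframeG31
  pack := packThree
  unpack := unpackThree
  isOpen_dom := isOpen_univ
  convex_dom := convex_univ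
  zero_mem_dom := mem_univ _
  contDiffAt_gen := by
    intro x _ i
    fin_cases i <;> simp only [g3_1, Fin.zero_eta, Fin.mk_one, Fin.reduceFinMk, Matrix.cons_val] <;>
      refine ContDiffAt.vec3 ?_ ?_ ?_ <;> fun_prop
  contDiffAt_frame := by
    intro x _ i
    fin_cases i <;> simp only [frameG31, Fin.zero_eta, Fin.mk_one, Fin.reduceFinMk, Matrix.cons_val] <;>
      refine ContDiffAt.vec3 ?_ ?_ ?_ <;> fun_prop
  fderiv_gen := by
    intro x _ i v
    ext l
    fin_cases i <;> fin_cases l <;>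
    simp (disch := fun_prop) [g3_1, dgenG31, fderiv_vec3_apply, fderiv_mul_apply',
      fderiv_add_apply', fderiv_sub_apply', fderiv_coord_apply, fderiv_sq_apply'] <;> ring
  fderiv_frame := by
    intro x _ i v
    ext l
    fin_cases i <;> fin_cases l <;>
    simp (disch := fun_prop) [frameG31, dframeG31, fderiv_vec3_apply, fderiv_mul_apply', fderiv_coord_apply, fderiv_sq_apply'] <;> ring
  bracket_gen := by
    intro x _ i j
    ext l
    fin_cases i <;> fin_cases j <;> fin_cases l <;>
    simp [g3_1, dgenG31, brackets3, Fin.sum_univ_three] <;> ring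
  commute := by
    intro x _ i j
    ext l
    fin_cases i <;> fin_cases j <;> fin_cases l <;>
    simp [g3_1, dgenG31, frameG31, dframeG31] <;> ring
  det_gen := by
    intro x _
    simp [Matrix.det_fin_three, g3_1]
  det_frame := by
    intro x _
    simp [Matrix.det_fin_three, frameG31]
  inv1_eq := by
    intro x _ v i
    fin_cases i <;> simp [g3_1, frameG31, Fin.sum_univ_three] <;> ring
  inv2_eq := by
    intro x _ p r hr
    ext s
    have h10 := hr 1 0
    have h20 := hr 2 0
    have h21 := hr 2 1
    fin_cases s <;>
    simp [g3_1, packThree, frameG31, dframeG31, Fin.sum_univ_three, exp_two_mul_eq,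
      exp_two_mul_mul, exp_one_add_mul, sin_two_mul, cos_two_mul, h10, h20, h21] <;> ring
  pack_unpack := by intro K; ext i; fin_cases i <;> rfl
  unpack_pack := by
    intro q hq; ext i j
    fin_cases i <;> fin_cases j <;> first | rfl | exact hq _ _
  unpack_symm := by intro K i j; fin_cases i <;> fin_cases j <;> rfl

/-- The second-order invariants of the row in terms of those of its frame. -/
def packG32 : (Fin 3 → Fin 3 → ℝ) →ₗ[ℝ] (Fin (3 * (3 + 1) / 2) → ℝ) where
  -- In this row the table puts u_33 in the fourth place.
  toFun q := ![q 0 0, q 0 1, q 0 2, q 2 2, q 1 1, q 1 2]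
  map_add' q q' := by ext i; fin_cases i <;> simp <;> ring
  map_smul' c q := by ext i; fin_cases i <;> simp <;> ring

/-- The inverse of the above map on symmetric matrices. -/
def unpackG32 : (Fin (3 * (3 + 1) / 2) → ℝ) →ₗ[ℝ] (Fin 3 → Fin 3 → ℝ) where
  toFun K := ![![K 0, K 1, K 2], ![K 1, K 4, K 5], ![K 2, K 5, K 3]]
  map_add' q q' := by ext i j; fin_cases i <;> fin_cases j <;> simp <;> ring
  map_smul' c q := by ext i j; fin_cases i <;> fin_cases j <;> simp <;> ring

/-- The invariant frame of the row `g3_2`. -/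
def frameG32 : Fin 3 → (Fin 3 → ℝ) → (Fin 3 → ℝ) :=
    ![fun x => ![exp (x 2), 0, 0],
      fun x => ![exp (x 2) * x 2, exp (x 2), 0],
      fun _ => ![0, 0, 1]]

/-- The directional derivatives of the generators of the row `g3_2`. -/
def dgenG32 : Fin 3 → (Fin 3 → ℝ) → (Fin 3 → ℝ) → (Fin 3 → ℝ) :=
    ![fun _ _ => 0,
      fun _ _ => 0,
      fun _ v => ![v 0 + v 1, v 1, 0]]

/-- The directional derivatives of the invariant frame of the row `g3_2`. -/
def dframeG32 : Fin 3 → (Fin 3 → ℝ) → (Fin 3 → ℝ) → (Fin 3 → ℝ) :=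
    ![fun x v => ![exp (x 2) * v 2, 0, 0],
      fun x v => ![exp (x 2) * x 2 * v 2 + exp (x 2) * v 2, exp (x 2) * v 2, 0],
      fun _ _ => 0]

set_option maxHeartbeats 2000000 in
def invariantFrameG32 : InvariantFrame g3_2 where
  frame := frameG32
  dgen := dgenG32
  dframe := dframeG32
  pack := packG32
  unpack := unpackG32
  isOpen_dom := isOpen_univ
  convex_dom := convex_univ
  zero_mem_dom := mem_univ _
  contDiffAt_gen := by
    intro x _ i
    fin_cases i <;> simp only [g3_2, Fin.zero_eta, Fin.mk_one, Fin.reduceFinMk, Matrix.cons_val] <;>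
      refine ContDiffAt.vec3 ?_ ?_ ?_ <;> fun_prop
  contDiffAt_frame := by
    intro x _ i
    fin_cases i <;> simp only [frameG32, Fin.zero_eta, Fin.mk_one, Fin.reduceFinMk, Matrix.cons_val] <;>
      refine ContDiffAt.vec3 ?_ ?_ ?_ <;> fun_prop
  fderiv_gen := by
    intro x _ i v
    ext l
    fin_cases i <;> fin_cases l <;>
    simp (disch := fun_prop) [g3_2, dgenG32, fderiv_vec3_apply, fderiv_mul_apply',
      fderiv_add_apply', fderiv_sub_apply', fderiv_coord_apply, fderiv_sq_apply'] <;> ring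
  fderiv_frame := by
    intro x _ i v
    ext l
    fin_cases i <;> fin_cases l <;>
    simp (disch := fun_prop) [frameG32, dframeG32, fderiv_vec3_apply, fderiv_mul_apply', fderiv_coord_apply, fderiv_sq_apply'] <;> ring
  bracket_gen := by
    intro x _ i j
    ext l
    fin_cases i <;> fin_cases j <;> fin_cases l <;>
    simp [g3_2, dgenG32, brackets3, Fin.sum_univ_three] <;> ring
  commute := by
    intro x _ i j
    ext l
    fin_cases i <;> fin_cases j <;> fin_cases l <;>
    simp [g3_2, dgenG32, frameG32, dframeG32] <;> ring
  det_gen := by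
    intro x _
    simp [Matrix.det_fin_three, g3_2]
  det_frame := by
    intro x _
    simp [Matrix.det_fin_three, frameG32]
  inv1_eq := by
    intro x _ v i
    fin_cases i <;> simp [g3_2, frameG32, Fin.sum_univ_three] <;> ring
  inv2_eq := by
    intro x _ p r hr
    ext s
    have h10 := hr 1 0
    have h20 := hr 2 0
    have h21 := hr 2 1
    fin_cases s <;>
    simp [g3_2, packG32, frameG32, dframeG32, Fin.sum_univ_three, exp_two_mul_eq,
      exp_two_mul_mul, exp_one_add_mul, sin_two_mul, cos_two_mul, h10, h20, h21] <;> ring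
  pack_unpack := by intro K; ext i; fin_cases i <;> simp [packG32, unpackG32] <;> ring
  unpack_pack := by
    intro q hq; ext i j
    have h10 := hq 1 0
    have h20 := hq 2 0
    have h21 := hq 2 1
    fin_cases i <;> fin_cases j <;> simp [packG32, unpackG32, h10, h20, h21] <;> ring
  unpack_symm := by intro K i j; fin_cases i <;> fin_cases j <;> rfl

/-- The invariant frame of the row `g3_3`. -/
def frameG33 : Fin 3 → (Fin 3 → ℝ) → (Fin 3 → ℝ) :=
    ![fun x => ![exp (x 2), 0, 0],
      fun x => ![0, exp (x 2), 0],
      fun _ => ![0, 0, 1]]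

/-- The directional derivatives of the generators of the row `g3_3`. -/
def dgenG33 : Fin 3 → (Fin 3 → ℝ) → (Fin 3 → ℝ) → (Fin 3 → ℝ) :=
    ![fun _ _ => 0,
      fun _ _ => 0,
      fun _ v => ![v 0, v 1, 0]]

/-- The directional derivatives of the invariant frame of the row `g3_3`. -/
def dframeG33 : Fin 3 → (Fin 3 → ℝ) → (Fin 3 → ℝ) → (Fin 3 → ℝ) :=
    ![fun x v => ![exp (x 2) * v 2, 0, 0],
      fun x v => ![0, exp (x 2) * v 2, 0],
      fun _ _ => 0]

set_option maxHeartbeats 2000000 in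
def invariantFrameG33 : InvariantFrame g3_3 where
  frame := frameG33
  dgen := dgenG33
  dframe := dframeG33
  pack := packThree
  unpack := unpackThree
  isOpen_dom := isOpen_univ
  convex_dom := convex_univ
  zero_mem_dom := mem_univ _
  contDiffAt_gen := by
    intro x _ i
    fin_cases i <;> simp only [g3_3, Fin.zero_eta, Fin.mk_one, Fin.reduceFinMk, Matrix.cons_val] <;>
      refine ContDiffAt.vec3 ?_ ?_ ?_ <;> fun_prop
  contDiffAt_frame := by
    intro x _ i
    fin_cases i <;> simp only [frameG33, Fin.zero_eta, Fin.mk_one, Fin.reduceFinMk, Matrix.cons_val] <;>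
      refine ContDiffAt.vec3 ?_ ?_ ?_ <;> fun_prop
  fderiv_gen := by
    intro x _ i v
    ext l
    fin_cases i <;> fin_cases l <;>
    simp (disch := fun_prop) [g3_3, dgenG33, fderiv_vec3_apply, fderiv_mul_apply',
      fderiv_add_apply', fderiv_sub_apply', fderiv_coord_apply, fderiv_sq_apply'] <;> ring
  fderiv_frame := by
    intro x _ i v
    ext l
    fin_cases i <;> fin_cases l <;>
    simp (disch := fun_prop) [frameG33, dframeG33, fderiv_vec3_apply, fderiv_mul_apply', fderiv_coord_apply, fderiv_sq_apply'] <;> ring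
  bracket_gen := by
    intro x _ i j
    ext l
    fin_cases i <;> fin_cases j <;> fin_cases l <;>
    simp [g3_3, dgenG33, brackets3, Fin.sum_univ_three] <;> ring
  commute := by
    intro x _ i j
    ext l
    fin_cases i <;> fin_cases j <;> fin_cases l <;>
    simp [g3_3, dgenG33, frameG33, dframeG33] <;> ring
  det_gen := by
    intro x _
    simp [Matrix.det_fin_three, g3_3]
  det_frame := by
    intro x _
    simp [Matrix.det_fin_three, frameG33]
  inv1_eq := by
    intro x _ v i
    fin_cases i <;> simp [g3_3, frameG33, Fin.sum_univ_three] <;> ring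
  inv2_eq := by
    intro x _ p r hr
    ext s
    have h10 := hr 1 0
    have h20 := hr 2 0
    have h21 := hr 2 1
    fin_cases s <;>
    simp [g3_3, packThree, frameG33, dframeG33, Fin.sum_univ_three, exp_two_mul_eq,
      exp_two_mul_mul, exp_one_add_mul, sin_two_mul, cos_two_mul, h10, h20, h21] <;> ring
  pack_unpack := by intro K; ext i; fin_cases i <;> rfl
  unpack_pack := by
    intro q hq; ext i j
    fin_cases i <;> fin_cases j <;> first | rfl | exact hq _ _
  unpack_symm := by intro K i j; fin_cases i <;> fin_cases j <;> rfl

/-- The invariant frame of the row `g3_4`. -/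
def frameG34 (h : ℝ) : Fin 3 → (Fin 3 → ℝ) → (Fin 3 → ℝ) :=
    ![fun x => ![exp (x 2), 0, 0],
      fun x => ![0, exp (h * x 2), 0],
      fun _ => ![0, 0, 1]]

/-- The directional derivatives of the generators of the row `g3_4`. -/
def dgenG34 (h : ℝ) : Fin 3 → (Fin 3 → ℝ) → (Fin 3 → ℝ) → (Fin 3 → ℝ) :=
    ![fun _ _ => 0,
      fun _ _ => 0,
      fun _ v => ![v 0, h * v 1, 0]]

/-- The directional derivatives of the invariant frame of the row `g3_4`. -/
def dframeG34 (h : ℝ) : Fin 3 → (Fin 3 → ℝ) → (Fin 3 → ℝ) → (Fin 3 → ℝ) :=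
    ![fun x v => ![exp (x 2) * v 2, 0, 0],
      fun x v => ![0, h * exp (h * x 2) * v 2, 0],
      fun _ _ => 0]

set_option maxHeartbeats 2000000 in
def invariantFrameG34 (h : ℝ) : InvariantFrame (g3_4 h) where
  frame := frameG34 h
  dgen := dgenG34 h
  dframe := dframeG34 h
  pack := packThree
  unpack := unpackThree
  isOpen_dom := isOpen_univ
  convex_dom := convex_univ
  zero_mem_dom := mem_univ _
  contDiffAt_gen := by
    intro x _ i
    fin_cases i <;> simp only [g3_4, Fin.zero_eta, Fin.mk_one, Fin.reduceFinMk, Matrix.cons_val] <;>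
      refine ContDiffAt.vec3 ?_ ?_ ?_ <;> fun_prop
  contDiffAt_frame := by
    intro x _ i
    fin_cases i <;> simp only [frameG34, Fin.zero_eta, Fin.mk_one, Fin.reduceFinMk, Matrix.cons_val] <;>
      refine ContDiffAt.vec3 ?_ ?_ ?_ <;> fun_prop
  fderiv_gen := by
    intro x _ i v
    ext l
    fin_cases i <;> fin_cases l <;>
    simp (disch := fun_prop) [g3_4, dgenG34, fderiv_vec3_apply, fderiv_mul_apply',
      fderiv_add_apply', fderiv_sub_apply', fderiv_coord_apply, fderiv_sq_apply'] <;> ring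
  fderiv_frame := by
    intro x _ i v
    ext l
    fin_cases i <;> fin_cases l <;>
    simp (disch := fun_prop) [frameG34, dframeG34, fderiv_vec3_apply, fderiv_mul_apply', fderiv_coord_apply, fderiv_sq_apply'] <;> ring
  bracket_gen := by
    intro x _ i j
    ext l
    fin_cases i <;> fin_cases j <;> fin_cases l <;>
    simp [g3_4, dgenG34, brackets3, Fin.sum_univ_three] <;> ring
  commute := by
    intro x _ i j
    ext l
    fin_cases i <;> fin_cases j <;> fin_cases l <;>
    simp [g3_4, dgenG34, frameG34, dframeG34] <;> ring
  det_gen := by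
    intro x _
    simp [Matrix.det_fin_three, g3_4]
  det_frame := by
    intro x _
    simp [Matrix.det_fin_three, frameG34]
  inv1_eq := by
    intro x _ v i
    fin_cases i <;> simp [g3_4, frameG34, Fin.sum_univ_three] <;> ring
  inv2_eq := by
    intro x _ p r hr
    ext s
    have h10 := hr 1 0
    have h20 := hr 2 0
    have h21 := hr 2 1
    fin_cases s <;>
    simp [g3_4, packThree, frameG34, dframeG34, Fin.sum_univ_three, exp_two_mul_eq,
      exp_two_mul_mul, exp_one_add_mul, sin_two_mul, cos_two_mul, h10, h20, h21] <;> ring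
  pack_unpack := by intro K; ext i; fin_cases i <;> rfl
  unpack_pack := by
    intro q hq; ext i j
    fin_cases i <;> fin_cases j <;> first | rfl | exact hq _ _
  unpack_symm := by intro K i j; fin_cases i <;> fin_cases j <;> rfl

/-- The second-order invariants of the row in terms of those of its frame. -/
def packG35 : (Fin 3 → Fin 3 → ℝ) →ₗ[ℝ] (Fin (3 * (3 + 1) / 2) → ℝ) where
  -- The table lists the trace of the upper left 2 × 2 block and then its trace-free part, which
  -- rotates with the double angle 2x³.
  toFun q := ![q 0 0 + q 1 1, q 0 0 - q 1 1, 2 * q 0 1, q 0 2, q 1 2, q 2 2]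
  map_add' q q' := by ext i; fin_cases i <;> simp <;> ring
  map_smul' c q := by ext i; fin_cases i <;> simp <;> ring

/-- The inverse of the above map on symmetric matrices. -/
def unpackG35 : (Fin (3 * (3 + 1) / 2) → ℝ) →ₗ[ℝ] (Fin 3 → Fin 3 → ℝ) where
  toFun K := ![![(K 0 + K 1) / 2, K 2 / 2, K 3], ![K 2 / 2, (K 0 - K 1) / 2, K 4], ![K 3, K 4, K 5]]
  map_add' q q' := by ext i j; fin_cases i <;> fin_cases j <;> simp <;> ring
  map_smul' c q := by ext i j; fin_cases i <;> fin_cases j <;> simp <;> ring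

/-- The invariant frame of the row `g3_5`. -/
def frameG35 (c : ℝ) : Fin 3 → (Fin 3 → ℝ) → (Fin 3 → ℝ) :=
    ![fun x => ![exp (c * x 2) * cos (x 2), -(exp (c * x 2) * sin (x 2)), 0],
      fun x => ![exp (c * x 2) * sin (x 2), exp (c * x 2) * cos (x 2), 0],
      fun _ => ![0, 0, 1]]

/-- The directional derivatives of the generators of the row `g3_5`. -/
def dgenG35 (c : ℝ) : Fin 3 → (Fin 3 → ℝ) → (Fin 3 → ℝ) → (Fin 3 → ℝ) :=
    ![fun _ _ => 0,
      fun _ _ => 0,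
      fun _ v => ![c * v 0 + v 1, c * v 1 - v 0, 0]]

/-- The directional derivatives of the invariant frame of the row `g3_5`. -/
def dframeG35 (c : ℝ) : Fin 3 → (Fin 3 → ℝ) → (Fin 3 → ℝ) → (Fin 3 → ℝ) :=
    ![fun x v => ![exp (c * x 2) * (c * cos (x 2) - sin (x 2)) * v 2, -(exp (c * x 2) * (c * sin (x 2) + cos (x 2)) * v 2), 0],
      fun x v => ![exp (c * x 2) * (c * sin (x 2) + cos (x 2)) * v 2, exp (c * x 2) * (c * cos (x 2) - sin (x 2)) * v 2, 0],
      fun _ _ => 0]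

set_option maxHeartbeats 2000000 in
def invariantFrameG35 (c : ℝ) : InvariantFrame (g3_5 c) where
  frame := frameG35 c
  dgen := dgenG35 c
  dframe := dframeG35 c
  pack := packG35
  unpack := unpackG35
  isOpen_dom := isOpen_univ
  convex_dom := convex_univ
  zero_mem_dom := mem_univ _
  contDiffAt_gen := by
    intro x _ i
    fin_cases i <;> simp only [g3_5, Fin.zero_eta, Fin.mk_one, Fin.reduceFinMk, Matrix.cons_val] <;>
      refine ContDiffAt.vec3 ?_ ?_ ?_ <;> fun_prop
  contDiffAt_frame := by
    intro x _ i
    fin_cases i <;> simp only [frameG35, Fin.zero_eta, Fin.mk_one, Fin.reduceFinMk, Matrix.cons_val] <;>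
      refine ContDiffAt.vec3 ?_ ?_ ?_ <;> fun_prop
  fderiv_gen := by
    intro x _ i v
    ext l
    fin_cases i <;> fin_cases l <;>
    simp (disch := fun_prop) [g3_5, dgenG35, fderiv_vec3_apply, fderiv_mul_apply',
      fderiv_add_apply', fderiv_sub_apply', fderiv_coord_apply, fderiv_sq_apply'] <;> ring
  fderiv_frame := by
    intro x _ i v
    ext l
    fin_cases i <;> fin_cases l <;>
    simp (disch := fun_prop) [frameG35, dframeG35, fderiv_vec3_apply, fderiv_mul_apply', fderiv_coord_apply, fderiv_sq_apply'] <;> ring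
  bracket_gen := by
    intro x _ i j
    ext l
    fin_cases i <;> fin_cases j <;> fin_cases l <;>
    simp [g3_5, dgenG35, brackets3, Fin.sum_univ_three] <;> ring
  commute := by
    intro x _ i j
    ext l
    fin_cases i <;> fin_cases j <;> fin_cases l <;>
    simp [g3_5, dgenG35, frameG35, dframeG35] <;> ring
  det_gen := by
    intro x _
    simp [Matrix.det_fin_three, g3_5]
  det_frame := by
    intro x _
    have ht := sin_sq_add_cos_sq (x 2)
    have he := exp_ne_zero (c * x 2)
    -- The determinant of the frame is this square times cos² + sin².
    have hd : exp (c * x 2) ^ 2 ≠ 0 := pow_ne_zero 2 he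
    simp [Matrix.det_fin_three, frameG35]
    convert hd using 1
    grind
  inv1_eq := by
    intro x _ v i
    fin_cases i <;> simp [g3_5, frameG35, Fin.sum_univ_three] <;> ring
  inv2_eq := by
    intro x _ p r hr
    have ht := sin_sq_add_cos_sq (x 2)
    ext s
    have h10 := hr 1 0
    have h20 := hr 2 0
    have h21 := hr 2 1
    fin_cases s <;>
    simp [g3_5, packG35, frameG35, dframeG35, Fin.sum_univ_three, exp_two_mul_eq,
      exp_two_mul_mul, exp_one_add_mul, sin_two_mul, cos_two_mul, h10, h20, h21] <;> (try grind)
  pack_unpack := by intro K; ext i; fin_cases i <;> simp [packG35, unpackG35] <;> ring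
  unpack_pack := by
    intro q hq; ext i j
    have h10 := hq 1 0
    have h20 := hq 2 0
    have h21 := hq 2 1
    fin_cases i <;> fin_cases j <;> simp [packG35, unpackG35, h10, h20, h21] <;> ring
  unpack_symm := by intro K i j; fin_cases i <;> fin_cases j <;> rfl

/-- The second-order invariants of the row in terms of those of its frame. -/
def packG36 : (Fin 3 → Fin 3 → ℝ) →ₗ[ℝ] (Fin (3 * (3 + 1) / 2) → ℝ) where
  -- The first entry of the table is a quarter of Y_1 Y_1 u.
  toFun q := ![1 / 4 * q 0 0, q 0 1, q 0 2, q 1 1, q 1 2, q 2 2]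
  map_add' q q' := by ext i; fin_cases i <;> simp <;> ring
  map_smul' c q := by ext i; fin_cases i <;> simp <;> ring

/-- The inverse of the above map on symmetric matrices. -/
def unpackG36 : (Fin (3 * (3 + 1) / 2) → ℝ) →ₗ[ℝ] (Fin 3 → Fin 3 → ℝ) where
  toFun K := ![![4 * K 0, K 1, K 2], ![K 1, K 3, K 4], ![K 2, K 4, K 5]]
  map_add' q q' := by ext i j; fin_cases i <;> fin_cases j <;> simp <;> ring
  map_smul' c q := by ext i j; fin_cases i <;> fin_cases j <;> simp <;> ring

/-- The invariant frame of the row `g3_6`. -/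
def frameG36 : Fin 3 → (Fin 3 → ℝ) → (Fin 3 → ℝ) :=
    ![fun x => ![exp (x 1), 2 * x 2, x 2 ^ 2],
      fun x => ![0, 1, x 2],
      fun _ => ![0, 0, 1]]

/-- The directional derivatives of the generators of the row `g3_6`. -/
def dgenG36 : Fin 3 → (Fin 3 → ℝ) → (Fin 3 → ℝ) → (Fin 3 → ℝ) :=
    ![fun _ _ => 0,
      fun _ v => ![v 0, 0, 0],
      fun x v => ![2 * x 0 * v 0, 2 * v 0, exp (x 1) * v 1]]

/-- The directional derivatives of the invariant frame of the row `g3_6`. -/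
def dframeG36 : Fin 3 → (Fin 3 → ℝ) → (Fin 3 → ℝ) → (Fin 3 → ℝ) :=
    ![fun x v => ![exp (x 1) * v 1, 2 * v 2, 2 * x 2 * v 2],
      fun _ v => ![0, 0, v 2],
      fun _ _ => 0]

set_option maxHeartbeats 2000000 in
def invariantFrameG36 : InvariantFrame g3_6 where
  frame := frameG36
  dgen := dgenG36
  dframe := dframeG36
  pack := packG36
  unpack := unpackG36
  isOpen_dom := isOpen_univ
  convex_dom := convex_univ
  zero_mem_dom := mem_univ _
  contDiffAt_gen := by
    intro x _ i
    fin_cases i <;> simp only [g3_6, Fin.zero_eta, Fin.mk_one, Fin.reduceFinMk, Matrix.cons_val] <;>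
      refine ContDiffAt.vec3 ?_ ?_ ?_ <;> fun_prop
  contDiffAt_frame := by
    intro x _ i
    fin_cases i <;> simp only [frameG36, Fin.zero_eta, Fin.mk_one, Fin.reduceFinMk, Matrix.cons_val] <;>
      refine ContDiffAt.vec3 ?_ ?_ ?_ <;> fun_prop
  fderiv_gen := by
    intro x _ i v
    ext l
    fin_cases i <;> fin_cases l <;>
    simp (disch := fun_prop) [g3_6, dgenG36, fderiv_vec3_apply, fderiv_mul_apply',
      fderiv_add_apply', fderiv_sub_apply', fderiv_coord_apply, fderiv_sq_apply'] <;> ring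
  fderiv_frame := by
    intro x _ i v
    ext l
    fin_cases i <;> fin_cases l <;>
    simp (disch := fun_prop) [frameG36, dframeG36, fderiv_vec3_apply, fderiv_mul_apply', fderiv_coord_apply, fderiv_sq_apply'] <;> ring
  bracket_gen := by
    intro x _ i j
    ext l
    fin_cases i <;> fin_cases j <;> fin_cases l <;>
    simp [g3_6, dgenG36, brackets3, Fin.sum_univ_three] <;> ring
  commute := by
    intro x _ i j
    ext l
    fin_cases i <;> fin_cases j <;> fin_cases l <;>
    simp [g3_6, dgenG36, frameG36, dframeG36] <;> ring
  det_gen := by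
    intro x _
    simp [Matrix.det_fin_three, g3_6]
  det_frame := by
    intro x _
    simp [Matrix.det_fin_three, frameG36]
  inv1_eq := by
    intro x _ v i
    fin_cases i <;> simp [g3_6, frameG36, Fin.sum_univ_three] <;> ring
  inv2_eq := by
    intro x _ p r hr
    ext s
    have h10 := hr 1 0
    have h20 := hr 2 0
    have h21 := hr 2 1
    fin_cases s <;>
    simp [g3_6, packG36, frameG36, dframeG36, Fin.sum_univ_three, exp_two_mul_eq,
      exp_two_mul_mul, exp_one_add_mul, sin_two_mul, cos_two_mul, h10, h20, h21] <;> ring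
  pack_unpack := by intro K; ext i; fin_cases i <;> simp [packG36, unpackG36] <;> ring
  unpack_pack := by
    intro q hq; ext i j
    have h10 := hq 1 0
    have h20 := hq 2 0
    have h21 := hq 2 1
    fin_cases i <;> fin_cases j <;> simp [packG36, unpackG36, h10, h20, h21] <;> ring
  unpack_symm := by intro K i j; fin_cases i <;> fin_cases j <;> rfl

end TableRow

end
noncomputable section
open Set Filter Topology
-- The invariant frame of the row with D = {|x²| < π/2}
namespace TableRow
open Real
theorem cos_ne_zero_of_mem_g3_7_dom {x : Fin 3 → ℝ} (hx : x ∈ g3_7.dom) : cos (x 1) ≠ 0 := by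
  have h : |x 1| < π / 2 := hx
  exact (cos_pos_of_mem_Ioo (abs_lt.1 h)).ne'

/-- The coefficients are those of the J_i in this row. The denominators cos x² have no zeros on D.
-/
def frameG37 : Fin 3 → (Fin 3 → ℝ) → (Fin 3 → ℝ) :=
  ![fun x => ![cos (x 2) / cos (x 1), -sin (x 2), tan (x 1) * cos (x 2)],
    fun x => ![sin (x 2) / cos (x 1), cos (x 2), tan (x 1) * sin (x 2)],
    fun _ => ![0, 0, 1]]

def dgenG37 : Fin 3 → (Fin 3 → ℝ) → (Fin 3 → ℝ) → (Fin 3 → ℝ) :=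
  ![fun _ _ => 0,
    fun x v => ![cos (x 0) * tan (x 1) * v 0 + sin (x 0) / cos (x 1) ^ 2 * v 1, -sin (x 0) * v 0,
      cos (x 0) / cos (x 1) * v 0 + sin (x 0) * sin (x 1) / cos (x 1) ^ 2 * v 1],
    fun x v => ![-sin (x 0) * tan (x 1) * v 0 + cos (x 0) / cos (x 1) ^ 2 * v 1, -cos (x 0) * v 0,
      -sin (x 0) / cos (x 1) * v 0 + cos (x 0) * sin (x 1) / cos (x 1) ^ 2 * v 1]]

def dframeG37 : Fin 3 → (Fin 3 → ℝ) → (Fin 3 → ℝ) → (Fin 3 → ℝ) :=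
  ![fun x v => ![-sin (x 2) / cos (x 1) * v 2 + cos (x 2) * sin (x 1) / cos (x 1) ^ 2 * v 1,
      -cos (x 2) * v 2, cos (x 2) / cos (x 1) ^ 2 * v 1 - tan (x 1) * sin (x 2) * v 2],
    fun x v => ![cos (x 2) / cos (x 1) * v 2 + sin (x 2) * sin (x 1) / cos (x 1) ^ 2 * v 1,
      -sin (x 2) * v 2, sin (x 2) / cos (x 1) ^ 2 * v 1 + tan (x 1) * cos (x 2) * v 2],
    fun _ _ => 0]

/-- The table lists the upper left 2 × 2 block before the entries with index 3. -/
def packG37 : (Fin 3 → Fin 3 → ℝ) →ₗ[ℝ] (Fin (3 * (3 + 1) / 2) → ℝ) where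
  toFun q := ![q 0 0, q 0 1, q 1 1, q 0 2, q 1 2, q 2 2]
  map_add' q q' := by ext i; fin_cases i <;> rfl
  map_smul' c q := by ext i; fin_cases i <;> rfl

def unpackG37 : (Fin (3 * (3 + 1) / 2) → ℝ) →ₗ[ℝ] (Fin 3 → Fin 3 → ℝ) where
  toFun K := ![![K 0, K 1, K 3], ![K 1, K 2, K 4], ![K 3, K 4, K 5]]
  map_add' q q' := by ext i j; fin_cases i <;> fin_cases j <;> rfl
  map_smul' c q := by ext i j; fin_cases i <;> fin_cases j <;> rfl

set_option linter.unusedSimpArgs false in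
set_option maxHeartbeats 8000000 in
def invariantFrameG37 : InvariantFrame g3_7 where
  frame := frameG37
  dgen := dgenG37
  dframe := dframeG37
  pack := packG37
  unpack := unpackG37
  isOpen_dom := isOpen_lt (by fun_prop) continuous_const
  convex_dom := by
    have h : g3_7.dom = (LinearMap.proj 1 : (Fin 3 → ℝ) →ₗ[ℝ] ℝ) ⁻¹' Ioo (-(π / 2)) (π / 2) := by
      ext x; simp [g3_7, abs_lt]
    rw [h]
    exact (convex_Ioo _ _).linear_preimage _
  zero_mem_dom := by
    change |(0 : ℝ)| < π / 2
    rw [abs_zero]; positivity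
  contDiffAt_gen := by
    intro x hx i
    have hc := cos_ne_zero_of_mem_g3_7_dom hx
    -- With tan written as a quotient, the only side condition for smoothness is that cos x² is
    -- non-zero.
    simp only [g3_7, tan_eq_sin_div_cos]
    fin_cases i
    · exact contDiffAt_const
    all_goals
      simp only [Fin.zero_eta, Fin.mk_one, Fin.reduceFinMk, Matrix.cons_val]
      refine ContDiffAt.vec3 ?_ ?_ ?_ <;> fun_prop (disch := assumption)
  contDiffAt_frame := by
    intro x hx i
    have hc := cos_ne_zero_of_mem_g3_7_dom hx
    simp only [frameG37, tan_eq_sin_div_cos]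
    fin_cases i
    pick_goal 3
    · exact contDiffAt_const
    all_goals
      simp only [Fin.zero_eta, Fin.mk_one, Fin.reduceFinMk, Matrix.cons_val]
      refine ContDiffAt.vec3 ?_ ?_ ?_ <;> fun_prop (disch := assumption)
  fderiv_gen := by
    intro x hx i v
    have hc := cos_ne_zero_of_mem_g3_7_dom hx
    have h1 := sin_sq_add_cos_sq (x 1)
    ext l
    fin_cases i <;> fin_cases l <;>
    simp (disch := first | assumption | fun_prop (disch := assumption)) [g3_7, dgenG37, 
      tan_eq_sin_div_cos, fderiv_vec3_apply, fderiv_mul_apply',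
      fderiv_coord_apply, fderiv_div_apply'] <;> (try field_simp) <;> (try grind)
  fderiv_frame := by
    intro x hx i v
    have hc := cos_ne_zero_of_mem_g3_7_dom hx
    have h1 := sin_sq_add_cos_sq (x 1)
    ext l
    fin_cases i <;> fin_cases l <;>
    simp (disch := first | assumption | fun_prop (disch := assumption)) [frameG37, dframeG37, 
      tan_eq_sin_div_cos, fderiv_vec3_apply, fderiv_mul_apply',
      fderiv_coord_apply, fderiv_div_apply'] <;> (try field_simp) <;> (try grind)
  bracket_gen := by
    intro x hx i j
    have hc := cos_ne_zero_of_mem_g3_7_dom hx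
    have h0 := sin_sq_add_cos_sq (x 0)
    have h1 := sin_sq_add_cos_sq (x 1)
    ext l
    fin_cases i <;> fin_cases j <;> fin_cases l <;>
    simp [g3_7, dgenG37, brackets3, Fin.sum_univ_three, tan_eq_sin_div_cos] <;> (try field_simp) <;> (try grind)
  commute := by
    intro x hx i j
    have hc := cos_ne_zero_of_mem_g3_7_dom hx
    have h0 := sin_sq_add_cos_sq (x 0)
    have h1 := sin_sq_add_cos_sq (x 1)
    have h2 := sin_sq_add_cos_sq (x 2)
    ext l
    fin_cases i <;> fin_cases j <;> fin_cases l <;>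
    simp [g3_7, dgenG37, frameG37, dframeG37, tan_eq_sin_div_cos] <;> (try field_simp) <;> (try grind)
  det_gen := by
    intro x hx
    have hc := cos_ne_zero_of_mem_g3_7_dom hx
    have h0 := sin_sq_add_cos_sq (x 0)
    simp [Matrix.det_fin_three, g3_7]
    grind
  det_frame := by
    intro x hx
    have hc := cos_ne_zero_of_mem_g3_7_dom hx
    have h2 := sin_sq_add_cos_sq (x 2)
    simp [Matrix.det_fin_three, frameG37]
    grind
  inv1_eq := by
    intro x hx v i
    fin_cases i <;> simp [g3_7, frameG37, Fin.sum_univ_three] <;> ring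
  inv2_eq := by
    intro x hx p r hr
    have hc := cos_ne_zero_of_mem_g3_7_dom hx
    have h1 := sin_sq_add_cos_sq (x 1)
    have h2 := sin_sq_add_cos_sq (x 2)
    ext s
    have h10 := hr 1 0
    have h20 := hr 2 0
    have h21 := hr 2 1
    fin_cases s <;>
    simp [g3_7, packG37, frameG37, dframeG37, Fin.sum_univ_three, tan_eq_sin_div_cos, sin_two_mul,
      cos_two_mul, h10, h20, h21] <;> (try field_simp) <;> (try grind)
  pack_unpack := by intro K; ext i; fin_cases i <;> rfl
  unpack_pack := by
    intro q hq; ext i j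
    fin_cases i <;> fin_cases j <;> first | rfl | exact hq _ _
  unpack_symm := by intro K i j; fin_cases i <;> fin_cases j <;> rfl
end TableRow
end

noncomputable section

open Set Filter Topology

/-! ### Jets as linear and bilinear forms on orbit directions -/

section JetForms

variable {n k : ℕ}

/-- The coordinates `x` of a point `(x, y)`. -/
def orbitCoord (n k : ℕ) : (Fin n ⊕ Fin k → ℝ) →L[ℝ] (Fin n → ℝ) :=
  ContinuousLinearMap.pi fun a => ContinuousLinearMap.proj (Sum.inl a)

@[simp] theorem orbitCoord_apply (q : Fin n ⊕ Fin k → ℝ) (a : Fin n) :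
    orbitCoord n k q a = q (Sum.inl a) := rfl

@[simp] theorem orbitCoord_single_inl (a : Fin n) :
    orbitCoord n k (Pi.single (Sum.inl a) 1) = Pi.single a 1 := by
  ext b
  simp [Pi.single_apply]

@[simp] theorem orbitCoord_single_inr (μ : Fin k) :
    orbitCoord n k (Pi.single (Sum.inr μ) 1) = 0 := by
  ext b
  simp

/-- The first derivatives along the orbits as a linear form. -/
def orbitForm (n k : ℕ) : (Fin n ⊕ Fin k → ℝ) →L[ℝ] (Fin n → ℝ) →L[ℝ] ℝ :=
  ∑ a, (ContinuousLinearMap.proj (Sum.inl a) : (Fin n ⊕ Fin k → ℝ) →L[ℝ] ℝ).smulRight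
    (ContinuousLinearMap.proj a : (Fin n → ℝ) →L[ℝ] ℝ)

theorem orbitForm_apply (p : Fin n ⊕ Fin k → ℝ) (v : Fin n → ℝ) :
    orbitForm n k p v = ∑ a, p (Sum.inl a) * v a := by
  simp [orbitForm]

/-- The mixed second derivatives as linear forms. -/
def mixedForm (n : ℕ) {k : ℕ} (μ : Fin k) :
    (Sym2 (Fin n ⊕ Fin k) → ℝ) →L[ℝ] (Fin n → ℝ) →L[ℝ] ℝ :=
  ∑ a, (ContinuousLinearMap.proj s(Sum.inl a, Sum.inr μ) :
    (Sym2 (Fin n ⊕ Fin k) → ℝ) →L[ℝ] ℝ).smulRight (ContinuousLinearMap.proj a : (Fin n → ℝ) →L[ℝ] ℝ)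

theorem mixedForm_apply (μ : Fin k) (r : Sym2 (Fin n ⊕ Fin k) → ℝ) (v : Fin n → ℝ) :
    mixedForm n μ r v = ∑ a, r s(Sum.inl a, Sum.inr μ) * v a := by
  simp [mixedForm]

set_option maxSynthPendingDepth 3 in
/-- The family of bilinear forms with given coefficients. -/
def bilinearFamily {P X ι : Type*} [NormedAddCommGroup P] [NormedSpace ℝ P]
    [NormedAddCommGroup X] [NormedSpace ℝ X] [Fintype ι] (c : ι → ι → P →L[ℝ] ℝ)
    (α : ι → X →L[ℝ] ℝ) : P →L[ℝ] X →L[ℝ] X →L[ℝ] ℝ :=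
  ∑ a, ∑ b, (c a b).smulRight ((α a).smulRight (α b))

set_option maxSynthPendingDepth 3 in
theorem bilinearFamily_apply {P X ι : Type*} [NormedAddCommGroup P] [NormedSpace ℝ P]
    [NormedAddCommGroup X] [NormedSpace ℝ X] [Fintype ι] (c : ι → ι → P →L[ℝ] ℝ)
    (α : ι → X →L[ℝ] ℝ) (r : P) (v w : X) :
    bilinearFamily c α r v w = ∑ a, ∑ b, c a b r * α a v * α b w := by
  simp [bilinearFamily, mul_assoc]

/-- The second derivatives along the orbits as a bilinear form. -/
def orbitForm₂ (n k : ℕ) :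
    (Sym2 (Fin n ⊕ Fin k) → ℝ) →L[ℝ] (Fin n → ℝ) →L[ℝ] (Fin n → ℝ) →L[ℝ] ℝ :=
  bilinearFamily (fun a b => ContinuousLinearMap.proj s(Sum.inl a, Sum.inl b))
    fun a => ContinuousLinearMap.proj a

theorem orbitForm₂_apply (r : Sym2 (Fin n ⊕ Fin k) → ℝ) (v w : Fin n → ℝ) :
    orbitForm₂ n k r v w = ∑ a, ∑ b, r s(Sum.inl a, Sum.inl b) * v a * w b := by
  simp [orbitForm₂, bilinearFamily_apply]

theorem orbitForm₂_comm (r : Sym2 (Fin n ⊕ Fin k) → ℝ) (v w : Fin n → ℝ) :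
    orbitForm₂ n k r v w = orbitForm₂ n k r w v := by
  rw [orbitForm₂_apply, orbitForm₂_apply, Finset.sum_comm]
  refine Finset.sum_congr rfl fun a _ => Finset.sum_congr rfl fun b _ => ?_
  rw [Sym2.eq_swap]
  ring

theorem orbitForm₂_single (r : Sym2 (Fin n ⊕ Fin k) → ℝ) (a b : Fin n) :
    orbitForm₂ n k r (Pi.single a 1) (Pi.single b 1) = r s(Sum.inl a, Sum.inl b) := by
  simp [orbitForm₂_apply, Pi.single_apply]

theorem orbitForm₂_single_left (r : Sym2 (Fin n ⊕ Fin k) → ℝ) (a : Fin n) (v : Fin n → ℝ) :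
    orbitForm₂ n k r (Pi.single a 1) v = orbitForm n k (fun l => r s(Sum.inl a, l)) v := by
  simp [orbitForm₂_apply, orbitForm_apply, Pi.single_apply]

theorem mixedForm_single (μ : Fin k) (r : Sym2 (Fin n ⊕ Fin k) → ℝ) (a : Fin n) :
    mixedForm n μ r (Pi.single a 1) = r s(Sum.inl a, Sum.inr μ) := by
  simp [mixedForm_apply, Pi.single_apply]

theorem mixedForm_eq_orbitForm (μ : Fin k) (r : Sym2 (Fin n ⊕ Fin k) → ℝ) (v : Fin n → ℝ) :
    orbitForm n k (fun l => r s(Sum.inr μ, l)) v = mixedForm n μ r v := by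
  rw [mixedForm_apply, orbitForm_apply]
  refine Finset.sum_congr rfl fun a _ => ?_
  rw [Sym2.eq_swap]

theorem orbitForm_single (p : Fin n ⊕ Fin k → ℝ) (a : Fin n) :
    orbitForm n k p (Pi.single a 1) = p (Sum.inl a) := by
  simp [orbitForm_apply, Pi.single_apply]

end JetForms

/-! ### The prolonged generators in terms of these forms -/

namespace LowDimAlg

variable {n : ℕ} (T : LowDimAlg n) (k : ℕ) {i : Fin n}

variable {k} in
theorem totalD0_genZ_inl {q : Fin n ⊕ Fin k → ℝ}
    (hG : ContDiffAt ℝ ∞ (T.row.gen i) (orbitCoord n k q)) (m : Fin n ⊕ Fin k) (a : Fin n)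
    (w : ℝ × (Fin n ⊕ Fin k → ℝ)) :
    Prolong.totalD0 (fun z => (T.genZ k i z).1 (Sum.inl a)) m (q, w) =
      fderiv ℝ (T.row.gen i) (orbitCoord n k q) (orbitCoord n k (Pi.single m 1)) a := by
  have h1 : HasFDerivAt (T.row.gen i) (fderiv ℝ (T.row.gen i) (orbitCoord n k q))
    (orbitCoord n k q) := (hG.differentiableAt (by simp)).hasFDerivAt
  have h2 : HasFDerivAt (fun z : Jet0 (Fin n ⊕ Fin k) => T.row.gen i (orbitCoord n k z.1))
      ((fderiv ℝ (T.row.gen i) (orbitCoord n k q)).comp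
        ((orbitCoord n k).comp (ContinuousLinearMap.fst ℝ _ ℝ))) (q, w.1) :=
    HasFDerivAt.comp (g := T.row.gen i)
      (f := fun z : Jet0 (Fin n ⊕ Fin k) => orbitCoord n k z.1) (q, w.1) h1
      ((orbitCoord n k).comp (ContinuousLinearMap.fst ℝ _ ℝ)).hasFDerivAt
  have h3 := (hasFDerivAt_pi'.1 h2 a).fderiv
  exact congrArg (fun L : Jet0 (Fin n ⊕ Fin k) →L[ℝ] ℝ => L (Pi.single m 1, w.2 m)) h3

variable {k} in
theorem totalD0_genZ_inr (j : Jet1 (Fin n ⊕ Fin k)) (m : Fin n ⊕ Fin k) (μ : Fin k) :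
    Prolong.totalD0 (fun z => (T.genZ k i z).1 (Sum.inr μ)) m j = 0 := by
  simp [Prolong.totalD0, genZ]

variable {k} in
theorem sum_totalD0_genZ {q : Fin n ⊕ Fin k → ℝ}
    (hG : ContDiffAt ℝ ∞ (T.row.gen i) (orbitCoord n k q)) (m : Fin n ⊕ Fin k)
    (w : ℝ × (Fin n ⊕ Fin k → ℝ)) (p : Fin n ⊕ Fin k → ℝ) :
    ∑ l, p l * Prolong.totalD0 (fun z => (T.genZ k i z).1 l) m (q, w) =
      orbitForm n k p
        (fderiv ℝ (T.row.gen i) (orbitCoord n k q) (orbitCoord n k (Pi.single m 1))) := by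
  simp only [Fintype.sum_sum_type, totalD0_genZ_inr, T.totalD0_genZ_inl hG, orbitForm_apply,
    mul_zero, Finset.sum_const_zero, add_zero]

-- The generators have no ∂/∂u component, so only -Σ u_l D_m ξ^l survives. It vanishes for a y-index
-- m, since the generators do not depend on y.
variable {k} in
theorem coeff1_genZ {q : Fin n ⊕ Fin k → ℝ}
    (hG : ContDiffAt ℝ ∞ (T.row.gen i) (orbitCoord n k q)) (m : Fin n ⊕ Fin k)
    (w : ℝ × (Fin n ⊕ Fin k → ℝ)) :
    Prolong.coeff1 (T.genZ k i) m (q, w) = -orbitForm n k w.2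
        (fderiv ℝ (T.row.gen i) (orbitCoord n k q) (orbitCoord n k (Pi.single m 1))) := by
  have h0 : Prolong.totalD0 (fun z => (T.genZ k i z).2) m (q, w) = 0 := by
    simp [Prolong.totalD0, genZ]
  rw [Prolong.coeff1, h0, zero_sub, ← T.sum_totalD0_genZ hG m w]

-- Total differentiation of the first-order coefficient yields the term with the second derivative
-- of the generator and one term linear in the second derivatives of u; the other linear term is the
-- one subtracted in `coeff2`. Smoothness is required near the point because the formula for
-- `coeff1` is differentiated there.
variable {k} in
theorem coeff2_genZ {j : Jet2 (Fin n ⊕ Fin k)}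
    (hG : ∀ᶠ x in 𝓝 (orbitCoord n k j.1), ContDiffAt ℝ ∞ (T.row.gen i) x)
    (m l : Fin n ⊕ Fin k) :
    Prolong.coeff2 (T.genZ k i) m l j =
      -(orbitForm n k (fun l' => j.2.2.2 s(l, l'))
          (fderiv ℝ (T.row.gen i) (orbitCoord n k j.1) (orbitCoord n k (Pi.single m 1))) +
        orbitForm n k (fun l' => j.2.2.2 s(m, l'))
          (fderiv ℝ (T.row.gen i) (orbitCoord n k j.1) (orbitCoord n k (Pi.single l 1))) +
        orbitForm n k j.2.2.1 (fderiv ℝ (fderiv ℝ (T.row.gen i)) (orbitCoord n k j.1)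
          (orbitCoord n k (Pi.single l 1)) (orbitCoord n k (Pi.single m 1)))) := by
  have hG0 := hG.self_of_nhds
  set e := orbitCoord n k (Pi.single m 1)
  have hD : HasFDerivAt (fderiv ℝ (T.row.gen i))
      (fderiv ℝ (fderiv ℝ (T.row.gen i)) (orbitCoord n k j.1)) (orbitCoord n k j.1) :=
    ((hG0.fderiv_right (m := ∞) (by simp)).differentiableAt (by simp)).hasFDerivAt
  let q₁ : Jet1 (Fin n ⊕ Fin k) →L[ℝ] (Fin n → ℝ) :=
    (orbitCoord n k).comp (ContinuousLinearMap.fst ℝ _ _)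
  have h1 : HasFDerivAt (fun j₁ : Jet1 (Fin n ⊕ Fin k) => fderiv ℝ (T.row.gen i) (q₁ j₁))
      ((fderiv ℝ (fderiv ℝ (T.row.gen i)) (orbitCoord n k j.1)).comp q₁) j.toJet1 :=
    HasFDerivAt.comp (f := q₁) (g := fderiv ℝ (T.row.gen i)) j.toJet1 hD q₁.hasFDerivAt
  have h2 := h1.clm_apply (hasFDerivAt_const e j.toJet1)
  let p₁ : Jet1 (Fin n ⊕ Fin k) →L[ℝ] ((Fin n → ℝ) →L[ℝ] ℝ) :=
    (orbitForm n k).comp ((ContinuousLinearMap.snd ℝ ℝ _).comp (ContinuousLinearMap.snd ℝ _ _))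
  have h3 := ((p₁.hasFDerivAt (x := j.toJet1)).clm_apply h2).neg
  have h4 : Prolong.coeff1 (T.genZ k i) m =ᶠ[𝓝 j.toJet1]
      fun j₁ => -p₁ j₁ (fderiv ℝ (T.row.gen i) (q₁ j₁) e) := by
    have hc : ∀ᶠ j₁ in 𝓝 j.toJet1, ContDiffAt ℝ ∞ (T.row.gen i) (q₁ j₁) :=
      q₁.continuous.continuousAt.eventually hG
    filter_upwards [hc] with j₁ hj₁
    exact T.coeff1_genZ hj₁ m j₁.2
  have h5 := h3.congr_of_eventuallyEq h4
  rw [Prolong.coeff2, Prolong.totalD1, h5.fderiv]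
  change _ - ∑ m', j.2.2.2 s(m, m') * Prolong.totalD0 _ l (j.1, j.2.1, j.2.2.1) = _
  rw [T.sum_totalD0_genZ hG0 l (j.2.1, j.2.2.1) (fun m' => j.2.2.2 s(m, m'))]
  simp only [neg_apply, add_apply, ContinuousLinearMap.comp_apply,
    ContinuousLinearMap.flip_apply, zero_apply, map_zero, zero_add]
  change -(orbitForm n k j.2.2.1 (fderiv ℝ (fderiv ℝ (T.row.gen i)) (orbitCoord n k j.1)
    (orbitCoord n k (Pi.single l 1)) e) + orbitForm n k (fun l' => j.2.2.2 s(l, l'))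
      (fderiv ℝ (T.row.gen i) (orbitCoord n k j.1) e)) - _ = _
  ring

section PrGen

variable {k} {j : Jet2 (Fin n ⊕ Fin k)}
  (hG : ∀ᶠ x in 𝓝 (orbitCoord n k j.1), ContDiffAt ℝ ∞ (T.row.gen i) x)

theorem pr2Gen_y (μ : Fin k) : (T.pr2Gen k i j).1 (Sum.inr μ) = 0 := rfl

theorem pr2Gen_u : (T.pr2Gen k i j).2.1 = 0 := rfl

include hG

theorem pr2Gen_u_inr (μ : Fin k) : (T.pr2Gen k i j).2.2.1 (Sum.inr μ) = 0 := by
  refine (T.coeff1_genZ hG.self_of_nhds (Sum.inr μ) (j.2.1, j.2.2.1)).trans ?_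
  simp

/-- The prolonged field moves the covector of first derivatives by minus the transpose of the
derivative of the generator; on basis vectors this is `coeff1_genZ`. -/
theorem orbitForm_pr2Gen (v : Fin n → ℝ) : orbitForm n k (T.pr2Gen k i j).2.2.1 v =
    -orbitForm n k j.2.2.1 (fderiv ℝ (T.row.gen i) (orbitCoord n k j.1) v) := by
  have h : orbitForm n k (T.pr2Gen k i j).2.2.1 =
      -(orbitForm n k j.2.2.1).comp (fderiv ℝ (T.row.gen i) (orbitCoord n k j.1)) := by
    apply ContinuousLinearMap.coe_injective
    refine (Pi.basisFun ℝ (Fin n)).ext fun a => ?_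
    simp only [Pi.basisFun_apply, ContinuousLinearMap.coe_coe, orbitForm_single, neg_apply,
      ContinuousLinearMap.comp_apply]
    refine (T.coeff1_genZ hG.self_of_nhds (Sum.inl a) (j.2.1, j.2.2.1)).trans ?_
    simp
  rw [h]
  rfl

/-- By symmetry of the second derivative of the generator the coefficient is symmetric in its two
indices, so averaging does not change it. -/
theorem pr2Gen_sym2 (m l : Fin n ⊕ Fin k) : (T.pr2Gen k i j).2.2.2 s(m, l) =
    Prolong.coeff2 (T.genZ k i) m l j := by
  have h : (T.pr2Gen k i j).2.2.2 s(m, l) =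
    (Prolong.coeff2 (T.genZ k i) m l j + Prolong.coeff2 (T.genZ k i) l m j) / 2 := rfl
  have hs : IsSymmSndFDerivAt ℝ (T.row.gen i) (orbitCoord n k j.1) :=
    hG.self_of_nhds.isSymmSndFDerivAt (by simp; exact WithTop.coe_le_coe.2 le_top)
  rw [h, T.coeff2_genZ hG, T.coeff2_genZ hG, hs.eq]
  ring

theorem pr2Gen_inr_inr (μ ν : Fin k) : (T.pr2Gen k i j).2.2.2 s(Sum.inr μ, Sum.inr ν) = 0 := by
  rw [T.pr2Gen_sym2 hG, T.coeff2_genZ hG]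
  simp

theorem mixedForm_pr2Gen (μ : Fin k) (v : Fin n → ℝ) :
    mixedForm n μ (T.pr2Gen k i j).2.2.2 v =
      -mixedForm n μ j.2.2.2 (fderiv ℝ (T.row.gen i) (orbitCoord n k j.1) v) := by
  have h : mixedForm n μ (T.pr2Gen k i j).2.2.2 =
      -(mixedForm n μ j.2.2.2).comp (fderiv ℝ (T.row.gen i) (orbitCoord n k j.1)) := by
    apply ContinuousLinearMap.coe_injective
    refine (Pi.basisFun ℝ (Fin n)).ext fun a => ?_
    simp only [Pi.basisFun_apply, ContinuousLinearMap.coe_coe, mixedForm_single, neg_apply,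
      ContinuousLinearMap.comp_apply]
    rw [T.pr2Gen_sym2 hG, T.coeff2_genZ hG, mixedForm_eq_orbitForm]
    simp
  rw [h]
  rfl

/-- Both sides are bilinear in v and w, and on basis vectors the identity is `coeff2_genZ`. In this
form arbitrary frame vectors can be inserted. -/
theorem orbitForm₂_pr2Gen (v w : Fin n → ℝ) :
    orbitForm₂ n k (T.pr2Gen k i j).2.2.2 v w =
      -(orbitForm₂ n k j.2.2.2 (fderiv ℝ (T.row.gen i) (orbitCoord n k j.1) v) w +
        orbitForm₂ n k j.2.2.2 v (fderiv ℝ (T.row.gen i) (orbitCoord n k j.1) w) +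
        orbitForm n k j.2.2.1
          (fderiv ℝ (fderiv ℝ (T.row.gen i)) (orbitCoord n k j.1) v w)) := by
  have hs : IsSymmSndFDerivAt ℝ (T.row.gen i) (orbitCoord n k j.1) :=
    hG.self_of_nhds.isSymmSndFDerivAt (by simp; exact WithTop.coe_le_coe.2 le_top)
  let B : (Fin n → ℝ) →ₗ[ℝ] (Fin n → ℝ) →ₗ[ℝ] ℝ :=
    LinearMap.mk₂ ℝ (fun v w => orbitForm₂ n k (T.pr2Gen k i j).2.2.2 v w)
      (by intros; simp) (by intros; simp) (by intros; simp) (by intros; simp)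
  let B' : (Fin n → ℝ) →ₗ[ℝ] (Fin n → ℝ) →ₗ[ℝ] ℝ :=
    LinearMap.mk₂ ℝ (fun v w =>
      -(orbitForm₂ n k j.2.2.2 (fderiv ℝ (T.row.gen i) (orbitCoord n k j.1) v) w +
        orbitForm₂ n k j.2.2.2 v (fderiv ℝ (T.row.gen i) (orbitCoord n k j.1) w) +
        orbitForm n k j.2.2.1
          (fderiv ℝ (fderiv ℝ (T.row.gen i)) (orbitCoord n k j.1) v w)))
      (by intros; simp; ring) (by intros; simp; ring) (by intros; simp; ring)
      (by intros; simp; ring)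
  have h : B = B' := by
    refine (Pi.basisFun ℝ (Fin n)).ext fun a => (Pi.basisFun ℝ (Fin n)).ext fun b => ?_
    simp only [Pi.basisFun_apply, B, B', LinearMap.mk₂_apply, orbitForm₂_single]
    rw [T.pr2Gen_sym2 hG, T.coeff2_genZ hG, orbitForm₂_comm, orbitForm₂_single_left,
      orbitForm₂_single_left]
    simp only [orbitCoord_single_inl]
    rw [hs.eq]
  exact congrArg (fun S : (Fin n → ℝ) →ₗ[ℝ] (Fin n → ℝ) →ₗ[ℝ] ℝ => S v w) h

end PrGen

end LowDimAlg

end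

noncomputable section

open Set Filter Topology

/-! ### Pairings of jets with vector fields and their derivatives -/

section Projections

variable (n k : ℕ)

/-- The projection of the second jet space to the coordinates `x`. -/
def jetCoord : Jet2 (Fin n ⊕ Fin k) →L[ℝ] (Fin n → ℝ) :=
  (orbitCoord n k).comp (ContinuousLinearMap.fst ℝ _ _)

/-- The first derivatives along the orbits of a point of the second jet space. -/
def jetGrad : Jet2 (Fin n ⊕ Fin k) →L[ℝ] (Fin n → ℝ) →L[ℝ] ℝ :=
  (orbitForm n k).comp ((ContinuousLinearMap.fst ℝ _ _).comp
    ((ContinuousLinearMap.snd ℝ _ _).comp (ContinuousLinearMap.snd ℝ _ _)))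

/-- The second derivatives along the orbits of a point of the second jet space. -/
def jetHess : Jet2 (Fin n ⊕ Fin k) →L[ℝ] (Fin n → ℝ) →L[ℝ] (Fin n → ℝ) →L[ℝ] ℝ :=
  (orbitForm₂ n k).comp ((ContinuousLinearMap.snd ℝ _ _).comp
    ((ContinuousLinearMap.snd ℝ _ _).comp (ContinuousLinearMap.snd ℝ _ _)))

variable {n} in
/-- The mixed derivatives of a point of the second jet space. -/
def jetMixed {k : ℕ} (μ : Fin k) : Jet2 (Fin n ⊕ Fin k) →L[ℝ] (Fin n → ℝ) →L[ℝ] ℝ :=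
  (mixedForm n μ).comp ((ContinuousLinearMap.snd ℝ _ _).comp
    ((ContinuousLinearMap.snd ℝ _ _).comp (ContinuousLinearMap.snd ℝ _ _)))

variable {n k} (j : Jet2 (Fin n ⊕ Fin k))

theorem jetCoord_apply : jetCoord n k j = orbitCoord n k j.1 := rfl

theorem jetGrad_apply : jetGrad n k j = orbitForm n k j.2.2.1 := rfl

theorem jetHess_apply : jetHess n k j = orbitForm₂ n k j.2.2.2 := rfl

theorem jetMixed_apply (μ : Fin k) : jetMixed μ j = mixedForm n μ j.2.2.2 := rfl

end Projections

section Pairing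

variable {J X : Type*} [NormedAddCommGroup J] [NormedSpace ℝ J] [NormedAddCommGroup X]
  [NormedSpace ℝ X] {q : J →L[ℝ] X} {j : J}

theorem contDiffAt_pairing (B : J →L[ℝ] X →L[ℝ] ℝ) {Y : X → X} (hY : ContDiffAt ℝ ∞ Y (q j)) :
    ContDiffAt ℝ ∞ (fun j => B j (Y (q j))) j :=
  B.contDiff.contDiffAt.clm_apply (hY.comp j q.contDiff.contDiffAt)

theorem fderiv_pairing (B : J →L[ℝ] X →L[ℝ] ℝ) {Y : X → X} (hY : DifferentiableAt ℝ Y (q j))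
    (v : J) : fderiv ℝ (fun j => B j (Y (q j))) j v =
      B v (Y (q j)) + B j (fderiv ℝ Y (q j) (q v)) := by
  have h := B.hasFDerivAt.clm_apply (hY.hasFDerivAt.comp j q.hasFDerivAt)
  refine (congrArg (fun L : J →L[ℝ] ℝ => L v) h.fderiv).trans ?_
  simp [add_comm]

set_option maxSynthPendingDepth 3 in
theorem contDiffAt_pairing₂ (B : J →L[ℝ] X →L[ℝ] X →L[ℝ] ℝ) {Y Z : X → X}
    (hY : ContDiffAt ℝ ∞ Y (q j)) (hZ : ContDiffAt ℝ ∞ Z (q j)) :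
    ContDiffAt ℝ ∞ (fun j => B j (Y (q j)) (Z (q j))) j :=
  (B.contDiff.contDiffAt.clm_apply (hY.comp j q.contDiff.contDiffAt)).clm_apply
    (hZ.comp j q.contDiff.contDiffAt)

set_option maxSynthPendingDepth 3 in
theorem fderiv_pairing₂ (B : J →L[ℝ] X →L[ℝ] X →L[ℝ] ℝ) {Y Z : X → X}
    (hY : DifferentiableAt ℝ Y (q j)) (hZ : DifferentiableAt ℝ Z (q j)) (v : J) :
    fderiv ℝ (fun j => B j (Y (q j)) (Z (q j))) j v =
      B v (Y (q j)) (Z (q j)) + B j (fderiv ℝ Y (q j) (q v)) (Z (q j)) +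
        B j (Y (q j)) (fderiv ℝ Z (q j) (q v)) := by
  have h := (B.hasFDerivAt.clm_apply (hY.hasFDerivAt.comp j q.hasFDerivAt)).clm_apply
    (hZ.hasFDerivAt.comp j q.hasFDerivAt)
  refine (congrArg (fun L : J →L[ℝ] ℝ => L v) h.fderiv).trans ?_
  simp
  abel

theorem fderiv_fderiv_apply {Y Z : X → X} {x : X} (hY : ContDiffAt ℝ ∞ Y x)
    (hZ : ContDiffAt ℝ ∞ Z x) (v : X) :
    fderiv ℝ (fun x => fderiv ℝ Y x (Z x)) x v =
      fderiv ℝ (fderiv ℝ Y) x v (Z x) + fderiv ℝ Y x (fderiv ℝ Z x v) := by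
  have h := (((hY.fderiv_right (m := ∞) (by simp)).differentiableAt (by simp)).hasFDerivAt).clm_apply
    (hZ.differentiableAt (by simp)).hasFDerivAt
  refine (congrArg (fun L : X →L[ℝ] X => L v) h.fderiv).trans ?_
  simp [add_comm]

end Pairing

/-! ### Invariance and smoothness of the listed functions -/

namespace LowDimAlg

variable {n k : ℕ} {T : LowDimAlg n}

theorem isOpen_dom1 (I : T.row.InvariantFrame) (k : ℕ) : IsOpen (T.dom1 k) :=
  I.isOpen_dom.preimage ((orbitCoord n k).continuous.comp continuous_fst)

theorem isOpen_dom2 (I : T.row.InvariantFrame) (k : ℕ) : IsOpen (T.dom2 k) :=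
  I.isOpen_dom.preimage ((orbitCoord n k).continuous.comp continuous_fst)

section FrameDerivative

variable (I : T.row.InvariantFrame) {x : Fin n → ℝ}

/-- The symmetrized derivative of the vector fields of the frame along each other. -/
def symmDeriv (a b : Fin n) (x : Fin n → ℝ) : Fin n → ℝ :=
  (2⁻¹ : ℝ) • (fderiv ℝ (I.frame b) x (I.frame a x) + fderiv ℝ (I.frame a) x (I.frame b x))

theorem symmDeriv_comm (a b : Fin n) : symmDeriv I a b x = symmDeriv I b a x := by
  rw [symmDeriv, add_comm]; rfl

variable (hx : x ∈ T.row.dom)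
include I hx

theorem contDiffAt_symmDeriv (a b : Fin n) : ContDiffAt ℝ ∞ (symmDeriv I a b) x :=
  ContDiffAt.const_smul _ ((((I.contDiffAt_frame x hx b).fderiv_right (m := ∞) (by simp)).clm_apply
    (I.contDiffAt_frame x hx a)).add (((I.contDiffAt_frame x hx a).fderiv_right (m := ∞)
      (by simp)).clm_apply (I.contDiffAt_frame x hx b)))

theorem eventually_mem_dom : ∀ᶠ x in 𝓝 x, x ∈ T.row.dom := I.isOpen_dom.mem_nhds hx

theorem eventually_contDiffAt_gen (i : Fin n) : ∀ᶠ x in 𝓝 x, ContDiffAt ℝ ∞ (T.row.gen i) x := by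
  filter_upwards [eventually_mem_dom I hx] with x hx using I.contDiffAt_gen x hx i

/-- This is [X_i, Y_a] = 0 written out in coordinates. -/
theorem fderiv_frame_gen (i a : Fin n) : fderiv ℝ (I.frame a) x (T.row.gen i x) =
    fderiv ℝ (T.row.gen i) x (I.frame a x) := by
  rw [I.fderiv_frame x hx, I.fderiv_gen x hx, I.commute x hx]

/-- The derivative, in the direction v, of the commutation relation of frame and generator. -/
theorem fderiv_fderiv_frame_gen (i a : Fin n) (v : Fin n → ℝ) :
    fderiv ℝ (fderiv ℝ (I.frame a)) x v (T.row.gen i x) +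
        fderiv ℝ (I.frame a) x (fderiv ℝ (T.row.gen i) x v) =
      fderiv ℝ (fderiv ℝ (T.row.gen i)) x v (I.frame a x) +
        fderiv ℝ (T.row.gen i) x (fderiv ℝ (I.frame a) x v) := by
  rw [← fderiv_fderiv_apply (I.contDiffAt_frame x hx a) (I.contDiffAt_gen x hx i),
    ← fderiv_fderiv_apply (I.contDiffAt_gen x hx i) (I.contDiffAt_frame x hx a)]
  congr 1
  apply Filter.EventuallyEq.fderiv_eq
  filter_upwards [eventually_mem_dom I hx] with x hx using fderiv_frame_gen I hx i a

/-- The derivative of Y_b along Y_a is not a tensorial expression: a field commuting with both fails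
to preserve it by its own second derivative, evaluated on (Y_a, Y_b). This defect is what cancels
the second-derivative term of the prolongation. -/
theorem fderiv_symmDeriv_gen (i a b : Fin n) : fderiv ℝ (symmDeriv I a b) x (T.row.gen i x) =
    fderiv ℝ (T.row.gen i) x (symmDeriv I a b x) +
      fderiv ℝ (fderiv ℝ (T.row.gen i)) x (I.frame a x) (I.frame b x) := by
  have ha := I.contDiffAt_frame x hx a
  have hb := I.contDiffAt_frame x hx b
  have hi := I.contDiffAt_gen x hx i
  have hs : ∀ {Y : (Fin n → ℝ) → (Fin n → ℝ)}, ContDiffAt ℝ ∞ Y x → IsSymmSndFDerivAt ℝ Y x :=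
    fun h => h.isSymmSndFDerivAt (by simp; exact WithTop.coe_le_coe.2 le_top)
  have hd : ∀ {Y Z : (Fin n → ℝ) → (Fin n → ℝ)}, ContDiffAt ℝ ∞ Y x → ContDiffAt ℝ ∞ Z x →
      DifferentiableAt ℝ (fun x => fderiv ℝ Y x (Z x)) x := fun hY hZ =>
    ((hY.fderiv_right (m := ∞) (by simp)).clm_apply hZ).differentiableAt (by simp)
  have h : fderiv ℝ (symmDeriv I a b) x (T.row.gen i x) = (2⁻¹ : ℝ) •
      (fderiv ℝ (fun x => fderiv ℝ (I.frame b) x (I.frame a x)) x (T.row.gen i x) +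
        fderiv ℝ (fun x => fderiv ℝ (I.frame a) x (I.frame b x)) x (T.row.gen i x)) := by
    have h' := (((hd hb ha).hasFDerivAt.add (hd ha hb).hasFDerivAt).const_smul (2⁻¹ : ℝ)).fderiv
    exact congrArg (fun L : (Fin n → ℝ) →L[ℝ] (Fin n → ℝ) => L (T.row.gen i x)) h'
  have e₁ := fderiv_fderiv_frame_gen I hx i a (I.frame b x)
  have e₂ := fderiv_fderiv_frame_gen I hx i b (I.frame a x)
  rw [(hs hi).eq] at e₁
  rw [h, fderiv_fderiv_apply hb ha, fderiv_fderiv_apply ha hb, fderiv_frame_gen I hx,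
    fderiv_frame_gen I hx, (hs ha).eq, (hs hb).eq, e₁, e₂, symmDeriv, map_smul, map_add]
  module

end FrameDerivative

section Invariants

variable (I : T.row.InvariantFrame)

/-- The matrix of second derivatives along the vector fields of the frame, symmetrized. -/
def frameHessian (j : Jet2 (Fin n ⊕ Fin k)) (a b : Fin n) : ℝ :=
  jetHess n k j (I.frame a (jetCoord n k j)) (I.frame b (jetCoord n k j)) +
    jetGrad n k j (symmDeriv I a b (jetCoord n k j))

theorem frameHessian_comm (j : Jet2 (Fin n ⊕ Fin k)) (a b : Fin n) :
    frameHessian I j a b = frameHessian I j b a := by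
  rw [frameHessian, jetHess_apply, orbitForm₂_comm, symmDeriv_comm]; rfl

theorem firstInv_eq {j : Jet1 (Fin n ⊕ Fin k)} (hj : j ∈ T.dom1 k) : T.firstInv j =
    (fun μ => j.1 (Sum.inr μ), j.2.1,
      fun i => orbitForm n k j.2.2 (I.frame i (orbitCoord n k j.1)),
      fun μ => j.2.2 (Sum.inr μ)) := by
  refine Prod.ext rfl (Prod.ext rfl (Prod.ext ?_ rfl))
  ext i
  exact (I.inv1_eq _ hj _ i).trans (orbitForm_apply _ _).symm

variable {j : Jet2 (Fin n ⊕ Fin k)} (hj : j ∈ T.dom2 k)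
include hj

theorem mixedInv_eq (μ : Fin k) (i : Fin n) : T.mixedInv j μ i =
    mixedForm n μ j.2.2.2 (I.frame i (orbitCoord n k j.1)) :=
  (I.inv1_eq _ hj _ i).trans (mixedForm_apply _ _ _).symm

theorem orbitInv_eq : T.orbitInv j = I.pack (frameHessian I j) := by
  refine (I.inv2_eq _ hj _ _ fun a b => by rw [Sym2.eq_swap]).trans (congrArg I.pack ?_)
  ext a b
  have hj' : orbitCoord n k j.1 ∈ T.row.dom := hj
  rw [frameHessian, jetHess_apply, jetGrad_apply, jetCoord_apply, orbitForm₂_apply,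
    orbitForm_apply, symmDeriv, I.fderiv_frame _ hj', I.fderiv_frame _ hj', Finset.sum_div]
  refine congrArg₂ (· + ·) rfl (Finset.sum_congr rfl fun c _ => ?_)
  simp only [Pi.smul_apply, Pi.add_apply, smul_eq_mul]
  change j.2.2.1 (Sum.inl c) * (I.dframe b (orbitCoord n k j.1) _ c + _) / 2 = _
  ring_nf
  rfl

theorem contDiffAt_frameHessian (a b : Fin n) :
    ContDiffAt ℝ ∞ (fun j : Jet2 (Fin n ⊕ Fin k) => frameHessian I j a b) j :=
  (contDiffAt_pairing₂ (jetHess n k) (I.contDiffAt_frame _ hj a) (I.contDiffAt_frame _ hj b)).add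
    (contDiffAt_pairing (jetGrad n k) (contDiffAt_symmDeriv I hj a b))

/-- The change of the forms under the prolonged field is opposite to the change of the frame vectors
along X_i, term by term; the remaining second derivative of X_i cancels against the one from
`fderiv_symmDeriv_gen`. -/
theorem fderiv_frameHessian_pr2Gen (i a b : Fin n) :
    fderiv ℝ (fun j : Jet2 (Fin n ⊕ Fin k) => frameHessian I j a b) j (T.pr2Gen k i j) = 0 := by
  have hj' : jetCoord n k j ∈ T.row.dom := hj
  have h₁ := contDiffAt_pairing₂ (jetHess n k) (I.contDiffAt_frame _ hj' a)
    (I.contDiffAt_frame _ hj' b)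
  have h₂ := contDiffAt_pairing (jetGrad n k) (contDiffAt_symmDeriv I hj' a b)
  have hd : ∀ {Y : (Fin n → ℝ) → (Fin n → ℝ)}, ContDiffAt ℝ ∞ Y (jetCoord n k j) →
    DifferentiableAt ℝ Y (jetCoord n k j) := fun h => h.differentiableAt (by simp)
  have h := congrArg (fun L : Jet2 (Fin n ⊕ Fin k) →L[ℝ] ℝ => L (T.pr2Gen k i j))
    ((h₁.differentiableAt (by simp)).hasFDerivAt.add
      (h₂.differentiableAt (by simp)).hasFDerivAt).fderiv
  have hG := eventually_contDiffAt_gen I hj' i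
  refine h.trans ?_
  rw [add_apply, fderiv_pairing₂ _ (hd (I.contDiffAt_frame _ hj' a))
    (hd (I.contDiffAt_frame _ hj' b)), fderiv_pairing _ (hd (contDiffAt_symmDeriv I hj' a b))]
  have hX : jetCoord n k (T.pr2Gen k i j) = T.row.gen i (jetCoord n k j) := rfl
  rw [hX, fderiv_frame_gen I hj', fderiv_frame_gen I hj', fderiv_symmDeriv_gen I hj', map_add,
    jetHess_apply, jetGrad_apply, T.orbitForm₂_pr2Gen hG, T.orbitForm_pr2Gen hG]
  simp only [jetHess_apply, jetGrad_apply, jetCoord_apply]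
  ring

/-- By commutation the derivative of the frame vector along X_i equals dX_i(Y_a), and the
prolongation contributes the same term with the opposite sign. -/
theorem fderiv_frameGrad_pr2Gen (i a : Fin n) :
    fderiv ℝ (fun j : Jet2 (Fin n ⊕ Fin k) => jetGrad n k j (I.frame a (jetCoord n k j))) j
      (T.pr2Gen k i j) = 0 := by
  have hj' : jetCoord n k j ∈ T.row.dom := hj
  have hX : jetCoord n k (T.pr2Gen k i j) = T.row.gen i (jetCoord n k j) := rfl
  rw [fderiv_pairing _ ((I.contDiffAt_frame _ hj' a).differentiableAt (by simp)), hX,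
    fderiv_frame_gen I hj', jetGrad_apply, T.orbitForm_pr2Gen (eventually_contDiffAt_gen I hj' i)]
  exact neg_add_cancel _

theorem fderiv_frameMixed_pr2Gen (i a : Fin n) (μ : Fin k) :
    fderiv ℝ (fun j : Jet2 (Fin n ⊕ Fin k) => jetMixed μ j (I.frame a (jetCoord n k j))) j
      (T.pr2Gen k i j) = 0 := by
  have hj' : jetCoord n k j ∈ T.row.dom := hj
  have hX : jetCoord n k (T.pr2Gen k i j) = T.row.gen i (jetCoord n k j) := rfl
  rw [fderiv_pairing _ ((I.contDiffAt_frame _ hj' a).differentiableAt (by simp)), hX,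
    fderiv_frame_gen I hj', jetMixed_apply, T.mixedForm_pr2Gen (eventually_contDiffAt_gen I hj' i)]
  exact neg_add_cancel _

theorem allInv_eq : T.allInv j =
    ((fun μ => j.1 (Sum.inr μ), j.2.1, fun i => jetGrad n k j (I.frame i (jetCoord n k j)),
      fun μ => j.2.2.1 (Sum.inr μ)), I.pack (frameHessian I j),
      fun μ i => jetMixed μ j (I.frame i (jetCoord n k j)), fun s => j.2.2.2 (s.map Sum.inr)) := by
  have h : j.toJet1 ∈ T.dom1 k := hj
  refine Prod.ext (firstInv_eq I h) (Prod.ext (orbitInv_eq I hj) (Prod.ext ?_ rfl))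
  ext μ i
  exact mixedInv_eq I hj μ i

end Invariants

section Smoothness

variable (I : T.row.InvariantFrame) {j : Jet2 (Fin n ⊕ Fin k)} (hj : j ∈ T.dom2 k)
include I hj

theorem eventually_allInv_eq : T.allInv =ᶠ[𝓝 j] fun j =>
    ((fun μ => j.1 (Sum.inr μ), j.2.1, fun i => jetGrad n k j (I.frame i (jetCoord n k j)),
      fun μ => j.2.2.1 (Sum.inr μ)), I.pack (frameHessian I j),
      fun μ i => jetMixed μ j (I.frame i (jetCoord n k j)), fun s => j.2.2.2 (s.map Sum.inr)) := by
  filter_upwards [(isOpen_dom2 I k).mem_nhds hj] with j hj using allInv_eq I hj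

theorem contDiffAt_allInv : ContDiffAt ℝ ∞ (T.allInv (k := k)) j := by
  refine ContDiffAt.congr_of_eventuallyEq ?_ (eventually_allInv_eq I hj)
  refine ((contDiffAt_pi.2 fun μ => by fun_prop).prodMk (ContDiffAt.prodMk (by fun_prop)
    ((contDiffAt_pi.2 fun i => contDiffAt_pairing (jetGrad n k) (I.contDiffAt_frame _ hj i)).prodMk
      (contDiffAt_pi.2 fun μ => by fun_prop)))).prodMk (ContDiffAt.prodMk ?_
      ((contDiffAt_pi.2 fun μ => contDiffAt_pi.2 fun i =>
        contDiffAt_pairing (jetMixed μ) (I.contDiffAt_frame _ hj i)).prodMk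
        (contDiffAt_pi.2 fun s => by fun_prop)))
  exact I.pack.toContinuousLinearMap.contDiff.contDiffAt.comp j
    (contDiffAt_pi.2 fun a => contDiffAt_pi.2 fun b => contDiffAt_frameHessian I hj a b)

theorem fderiv_allInv_pr2Gen (i : Fin n) :
    fderiv ℝ (T.allInv (k := k)) j (T.pr2Gen k i j) = 0 := by
  have hd := (contDiffAt_allInv I hj).differentiableAt (by simp)
  -- The components are treated one at a time, each by comparing a linear functional of the
  -- invariants with an explicit function near j.
  have key : ∀ L : InvSpace n k →L[ℝ] ℝ, ∀ f : Jet2 (Fin n ⊕ Fin k) → ℝ,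
      (∀ᶠ w in 𝓝 j, L (T.allInv w) = f w) → fderiv ℝ f j (T.pr2Gen k i j) = 0 →
      L (fderiv ℝ (T.allInv (k := k)) j (T.pr2Gen k i j)) = 0 := by
    intro L f hf h0
    have h : fderiv ℝ (fun w => L (T.allInv w)) j = L.comp (fderiv ℝ (T.allInv (k := k)) j) :=
      (L.hasFDerivAt.comp j hd.hasFDerivAt).fderiv
    rw [Filter.EventuallyEq.fderiv_eq hf] at h
    rw [h] at h0
    exact h0
  have hG := eventually_contDiffAt_gen I (x := jetCoord n k j) hj i
  have hev := eventually_allInv_eq I hj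
  have hlin : ∀ ℓ : Jet2 (Fin n ⊕ Fin k) →L[ℝ] ℝ, ℓ (T.pr2Gen k i j) = 0 →
      fderiv ℝ (fun w => ℓ w) j (T.pr2Gen k i j) = 0 := fun ℓ h => by
    rw [ℓ.fderiv]; exact h
  have hpack : ∀ w ∈ T.dom2 k, I.unpack (T.orbitInv w) = frameHessian I w := fun w hw => by
    rw [orbitInv_eq I hw, I.unpack_pack _ (frameHessian_comm I w)]
  refine Prod.ext (Prod.ext ?_ (Prod.ext ?_ (Prod.ext ?_ ?_)))
    (Prod.ext ?_ (Prod.ext ?_ ?_))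
  · ext μ
    refine key ((ContinuousLinearMap.proj μ).comp ((ContinuousLinearMap.fst ℝ _ _).comp
      (ContinuousLinearMap.fst ℝ _ _))) _ (hev.mono fun w hw => by rw [hw]; rfl)
      (hlin ((ContinuousLinearMap.proj (Sum.inr μ)).comp (ContinuousLinearMap.fst ℝ _ _)) ?_)
    exact T.pr2Gen_y (i := i) (j := j) μ
  · refine key ((ContinuousLinearMap.fst ℝ _ _).comp ((ContinuousLinearMap.snd ℝ _ _).comp
      (ContinuousLinearMap.fst ℝ _ _))) _ (hev.mono fun w hw => by rw [hw]; rfl)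
      (hlin ((ContinuousLinearMap.fst ℝ _ _).comp (ContinuousLinearMap.snd ℝ _ _)) ?_)
    exact T.pr2Gen_u (i := i) (j := j)
  · ext a
    exact key ((ContinuousLinearMap.proj a).comp ((ContinuousLinearMap.fst ℝ _ _).comp
      ((ContinuousLinearMap.snd ℝ _ _).comp ((ContinuousLinearMap.snd ℝ _ _).comp
      (ContinuousLinearMap.fst ℝ _ _))))) _ (hev.mono fun w hw => by rw [hw]; rfl)
      (fderiv_frameGrad_pr2Gen I hj i a)
  · ext μ
    refine key ((ContinuousLinearMap.proj μ).comp ((ContinuousLinearMap.snd ℝ _ _).comp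
      ((ContinuousLinearMap.snd ℝ _ _).comp ((ContinuousLinearMap.snd ℝ _ _).comp
      (ContinuousLinearMap.fst ℝ _ _))))) _ (hev.mono fun w hw => by rw [hw]; rfl)
      (hlin ((ContinuousLinearMap.proj (Sum.inr μ)).comp ((ContinuousLinearMap.fst ℝ _ _).comp
      ((ContinuousLinearMap.snd ℝ _ _).comp (ContinuousLinearMap.snd ℝ _ _)))) ?_)
    exact T.pr2Gen_u_inr hG μ
  · have h : I.unpack (fderiv ℝ (T.allInv (k := k)) j (T.pr2Gen k i j)).2.1 = 0 := by
      ext a b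
      refine key ((ContinuousLinearMap.proj b).comp ((ContinuousLinearMap.proj a).comp
        (I.unpack.toContinuousLinearMap.comp ((ContinuousLinearMap.fst ℝ _ _).comp
        (ContinuousLinearMap.snd ℝ _ _))))) _ ?_ (fderiv_frameHessian_pr2Gen I hj i a b)
      filter_upwards [(isOpen_dom2 I k).mem_nhds hj] with w hw
      exact congrFun (congrFun (hpack w hw) a) b
    have h' := congrArg I.pack h
    rw [I.pack_unpack, map_zero] at h'
    exact h'
  · ext μ a
    exact key ((ContinuousLinearMap.proj (φ := fun _ : Fin n => ℝ) a).comp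
      ((ContinuousLinearMap.proj (φ := fun _ : Fin k => Fin n → ℝ) μ).comp
      ((ContinuousLinearMap.fst ℝ _ _).comp ((ContinuousLinearMap.snd ℝ _ _).comp
      (ContinuousLinearMap.snd ℝ _ _))))) _ (hev.mono fun w hw => by rw [hw]; rfl)
      (fderiv_frameMixed_pr2Gen I hj i a μ)
  · ext s
    refine key ((ContinuousLinearMap.proj s).comp ((ContinuousLinearMap.snd ℝ _ _).comp
      ((ContinuousLinearMap.snd ℝ _ _).comp (ContinuousLinearMap.snd ℝ _ _)))) _
      (hev.mono fun w hw => by rw [hw]; rfl)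
      (hlin ((ContinuousLinearMap.proj (s.map Sum.inr)).comp ((ContinuousLinearMap.snd ℝ _ _).comp
      ((ContinuousLinearMap.snd ℝ _ _).comp (ContinuousLinearMap.snd ℝ _ _)))) ?_)
    induction s using Sym2.ind with
    | _ μ ν => exact T.pr2Gen_inr_inr hG μ ν

end Smoothness

end LowDimAlg

end

noncomputable section

open Set Filter Topology

/-! ### Orbit variables and invariants as coordinates on jet space -/

namespace LowDimAlg

variable {n k : ℕ} {T : LowDimAlg n} (I : T.row.InvariantFrame)

/-- The space of values of the invariants of order at most one. -/
abbrev FirstInvSpace (n k : ℕ) : Type := (Fin k → ℝ) × ℝ × (Fin n → ℝ) × (Fin k → ℝ)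

/-- The space of values of the second-order invariants. -/
abbrev SecondInvSpace (n k : ℕ) : Type :=
  (Fin (n * (n + 1) / 2) → ℝ) × (Fin k → Fin n → ℝ) × (Sym2 (Fin k) → ℝ)

/-- The linear map that sends a vector to its coordinates with respect to the frame. -/
def coframe (x : Fin n → ℝ) : (Fin n → ℝ) →L[ℝ] (Fin n → ℝ) :=
  (frameMap fun i => I.frame i x).inverse

section Coframe

variable {x : Fin n → ℝ} (hx : x ∈ T.row.dom)
include I hx

theorem linearIndependent_frame : LinearIndependent ℝ fun i => I.frame i x :=
  Matrix.linearIndependent_rows_of_det_ne_zero (I.det_frame x hx)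

theorem linearIndependent_gen : LinearIndependent ℝ fun i => T.row.gen i x :=
  Matrix.linearIndependent_rows_of_det_ne_zero (I.det_gen x hx)

theorem coframe_frame (i : Fin n) : coframe I x (I.frame i x) = Pi.single i 1 := by
  have h := (isInvertible_frameMap (linearIndependent_frame I hx)).inverse_apply_self (Pi.single i 1)
  rwa [frameMap_single] at h

theorem sum_coframe (v : Fin n → ℝ) : ∑ i, coframe I x v i • I.frame i x = v := by
  have h := (isInvertible_frameMap (linearIndependent_frame I hx)).self_apply_inverse v
  rwa [frameMap_apply] at h

theorem contDiffAt_coframe : ContDiffAt ℝ ∞ (coframe I) x := by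
  have h : ContDiffOn ℝ ∞ (fun x => frameMap fun i => I.frame i x) T.row.dom :=
    ContDiffOn.frameMap fun i x hx => (I.contDiffAt_frame x hx i).contDiffWithinAt
  exact ((isInvertible_frameMap (linearIndependent_frame I hx)).contDiffAt_map_inverse).comp x
    (h.contDiffAt (I.isOpen_dom.mem_nhds hx))

end Coframe

/-- The point of the first jet space over `x` at which the invariants have the given values. -/
def jet1Of (x : Fin n → ℝ) (w : FirstInvSpace n k) : Jet1 (Fin n ⊕ Fin k) :=
  (Sum.elim x w.1, w.2.1,
    Sum.elim (fun a => ∑ i, w.2.2.1 i * coframe I x (Pi.single a 1) i) w.2.2.2)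

/-- The second derivatives along the frame of the jets with given values of the invariants. -/
def reducedHessian (x : Fin n → ℝ) (w : FirstInvSpace n k) (K : Fin (n * (n + 1) / 2) → ℝ)
    (i j : Fin n) : ℝ :=
  I.unpack K i j - orbitForm n k (jet1Of I x w).2.2 (symmDeriv I i j x)

theorem reducedHessian_comm (x : Fin n → ℝ) (w : FirstInvSpace n k)
    (K : Fin (n * (n + 1) / 2) → ℝ) (i j : Fin n) :
    reducedHessian I x w K i j = reducedHessian I x w K j i := by
  rw [reducedHessian, I.unpack_symm, symmDeriv_comm]; rfl

/-- The second derivatives of the jet over `x` at which the invariants have the given values. -/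
def hessianOf (x : Fin n → ℝ) (w : FirstInvSpace n k) (W : SecondInvSpace n k) :
    Sym2 (Fin n ⊕ Fin k) → ℝ :=
  Sym2.lift ⟨fun m l => Sum.elim
    (fun a => Sum.elim
      (fun b => ∑ i, ∑ j, reducedHessian I x w W.1 i j * coframe I x (Pi.single a 1) i *
        coframe I x (Pi.single b 1) j)
      (fun μ => ∑ i, W.2.1 μ i * coframe I x (Pi.single a 1) i) l)
    (fun μ => Sum.elim
      (fun a => ∑ i, W.2.1 μ i * coframe I x (Pi.single a 1) i)
      (fun ν => W.2.2 s(μ, ν)) l) m, by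
    rintro (a | μ) (b | ν)
    · simp only [Sum.elim_inl]
      rw [Finset.sum_comm]
      refine Finset.sum_congr rfl fun i _ => Finset.sum_congr rfl fun j _ => ?_
      rw [reducedHessian_comm]
      ring
    · rfl
    · rfl
    · simp only [Sum.elim_inr]
      rw [Sym2.eq_swap]⟩

/-- The point of the second jet space over `x` at which the invariants have the given values. -/
def jet2Of (x : Fin n → ℝ) (w : InvSpace n k) : Jet2 (Fin n ⊕ Fin k) :=
  ((jet1Of I x w.1).1, (jet1Of I x w.1).2.1, (jet1Of I x w.1).2.2, hessianOf I x w.1 w.2)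

section JetOf

variable {x : Fin n → ℝ}

theorem jetCoord_jet2Of (w : InvSpace n k) : jetCoord n k (jet2Of I x w) = x := rfl

theorem orbitCoord_jet1Of (w : FirstInvSpace n k) : orbitCoord n k (jet1Of I x w).1 = x := rfl

theorem clm_pi_ext {f g : (Fin n → ℝ) →L[ℝ] ℝ} (h : ∀ a, f (Pi.single a 1) = g (Pi.single a 1)) :
    f = g := by
  apply ContinuousLinearMap.coe_injective
  exact (Pi.basisFun ℝ (Fin n)).ext fun a => by simpa using h a

theorem orbitForm_jet1Of (w : FirstInvSpace n k) (v : Fin n → ℝ) :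
    orbitForm n k (jet1Of I x w).2.2 v = ∑ i, w.2.2.1 i * coframe I x v i := by
  have h : orbitForm n k (jet1Of I x w).2.2 =
      ∑ i, w.2.2.1 i • (ContinuousLinearMap.proj i).comp (coframe I x) :=
    clm_pi_ext fun a => by simp [orbitForm_single, jet1Of]
  simp [h]

theorem mixedForm_hessianOf (w : FirstInvSpace n k) (W : SecondInvSpace n k) (μ : Fin k)
    (v : Fin n → ℝ) :
    mixedForm n μ (hessianOf I x w W) v = ∑ i, W.2.1 μ i * coframe I x v i := by
  have h : mixedForm n μ (hessianOf I x w W) =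
      ∑ i, W.2.1 μ i • (ContinuousLinearMap.proj i).comp (coframe I x) :=
    clm_pi_ext fun a => by simp [mixedForm_single, hessianOf]
  simp [h]

theorem orbitForm₂_hessianOf (w : FirstInvSpace n k) (W : SecondInvSpace n k)
    (v v' : Fin n → ℝ) : orbitForm₂ n k (hessianOf I x w W) v v' =
      ∑ i, ∑ j, reducedHessian I x w W.1 i j * coframe I x v i * coframe I x v' j := by
  let B : (Fin n → ℝ) →ₗ[ℝ] (Fin n → ℝ) →ₗ[ℝ] ℝ :=
    LinearMap.mk₂ ℝ (fun v v' => orbitForm₂ n k (hessianOf I x w W) v v')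
      (by intros; simp) (by intros; simp) (by intros; simp) (by intros; simp)
  let B' : (Fin n → ℝ) →ₗ[ℝ] (Fin n → ℝ) →ₗ[ℝ] ℝ :=
    LinearMap.mk₂ ℝ (fun v v' =>
      ∑ i, ∑ j, reducedHessian I x w W.1 i j * coframe I x v i * coframe I x v' j)
      (by intros; simp only [map_add, Pi.add_apply, mul_add, add_mul, Finset.sum_add_distrib])
      (by intros; simp only [map_smul, Pi.smul_apply, smul_eq_mul, Finset.mul_sum]
          refine Finset.sum_congr rfl fun i _ => Finset.sum_congr rfl fun j _ => by ring)
      (by intros; simp only [map_add, Pi.add_apply, mul_add, Finset.sum_add_distrib])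
      (by intros; simp only [map_smul, Pi.smul_apply, smul_eq_mul, Finset.mul_sum]
          refine Finset.sum_congr rfl fun i _ => Finset.sum_congr rfl fun j _ => by ring)
  have h : B = B' := by
    refine (Pi.basisFun ℝ (Fin n)).ext fun a => (Pi.basisFun ℝ (Fin n)).ext fun b => ?_
    simp only [Pi.basisFun_apply, B, B', LinearMap.mk₂_apply, orbitForm₂_single]
    rfl
  exact congrArg (fun S : (Fin n → ℝ) →ₗ[ℝ] (Fin n → ℝ) →ₗ[ℝ] ℝ => S v v') h

variable (hx : x ∈ T.row.dom)
include hx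

theorem jet1Of_mem_dom1 (w : FirstInvSpace n k) : jet1Of I x w ∈ T.dom1 k := hx

theorem jet2Of_mem_dom2 (w : InvSpace n k) : jet2Of I x w ∈ T.dom2 k := hx

theorem firstInv_jet1Of (w : FirstInvSpace n k) : T.firstInv (jet1Of I x w) = w := by
  rw [firstInv_eq I (jet1Of_mem_dom1 I hx w), orbitCoord_jet1Of]
  refine Prod.ext rfl (Prod.ext rfl (Prod.ext ?_ rfl))
  ext i
  simp only [orbitForm_jet1Of, coframe_frame I hx]
  simp [Pi.single_apply]

/-- Evaluation on the frame collapses the sums, because the coframe sends frame vectors to unit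
vectors. The first-order term subtracted in `reducedHessian` is the one that `frameHessian` adds. -/
theorem allInv_jet2Of (w : InvSpace n k) : T.allInv (jet2Of I x w) = w := by
  have hm := jet2Of_mem_dom2 I hx w
  refine Prod.ext (firstInv_jet1Of I hx w.1) (Prod.ext ?_ (Prod.ext ?_ ?_))
  · have h : frameHessian I (jet2Of I x w) = I.unpack w.2.1 := by
      ext a b
      rw [frameHessian, jetHess_apply, jetGrad_apply, jetCoord_jet2Of]
      change orbitForm₂ n k (hessianOf I x w.1 w.2) _ _ + orbitForm n k (jet1Of I x w.1).2.2 _ = _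
      rw [orbitForm₂_hessianOf, coframe_frame I hx, coframe_frame I hx]
      simp [Pi.single_apply, reducedHessian]
    exact (orbitInv_eq I hm).trans (by rw [h, I.pack_unpack])
  · ext μ i
    refine (mixedInv_eq I hm μ i).trans ?_
    change mixedForm n μ (hessianOf I x w.1 w.2) (I.frame i x) = _
    rw [mixedForm_hessianOf, coframe_frame I hx]
    simp [Pi.single_apply]
  · ext s
    induction s using Sym2.ind with
    | _ μ ν => rfl

end JetOf

theorem jet1Of_firstInv {j : Jet1 (Fin n ⊕ Fin k)} (hj : j ∈ T.dom1 k) :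
    jet1Of I (orbitCoord n k j.1) (T.firstInv j) = j := by
  have hx : orbitCoord n k j.1 ∈ T.row.dom := hj
  rw [firstInv_eq I hj]
  refine Prod.ext ?_ (Prod.ext rfl ?_)
  · ext (a | μ) <;> rfl
  · ext (a | μ)
    · have h := congrArg (orbitForm n k j.2.2) (sum_coframe I hx (Pi.single a 1))
      simp only [map_sum, map_smul, smul_eq_mul, orbitForm_single] at h
      rw [← h]
      simp only [jet1Of, Sum.elim_inl]
      exact Finset.sum_congr rfl fun i _ => mul_comm _ _
    · rfl

/-- Expanding the coordinate vectors in the frame recovers every derivative of u from its values on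
the frame. Together with `allInv_jet2Of` this makes x and the invariants coordinates on the whole
jet space over D. -/
theorem jet2Of_allInv {j : Jet2 (Fin n ⊕ Fin k)} (hj : j ∈ T.dom2 k) :
    jet2Of I (jetCoord n k j) (T.allInv j) = j := by
  have hx : orbitCoord n k j.1 ∈ T.row.dom := hj
  have h₁ : jet1Of I (jetCoord n k j) (T.allInv j).1 = j.toJet1 :=
    jet1Of_firstInv I (j := j.toJet1) hj
  refine Prod.ext (congrArg (·.1) h₁) (Prod.ext (congrArg (·.2.1) h₁)
    (Prod.ext (congrArg (·.2.2) h₁) ?_))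
  ext s
  induction s using Sym2.ind with
  | _ m l =>
  have hmix : ∀ (μ : Fin k) (a : Fin n), ∑ i, (T.allInv j).2.2.1 μ i *
      coframe I (jetCoord n k j) (Pi.single a 1) i = j.2.2.2 s(Sum.inl a, Sum.inr μ) := by
    intro μ a
    have h := congrArg (mixedForm n μ j.2.2.2) (sum_coframe I hx (Pi.single a 1))
    simp only [map_sum, map_smul, smul_eq_mul, mixedForm_single] at h
    rw [← h]
    refine Finset.sum_congr rfl fun i _ => ?_
    rw [mul_comm, ← mixedInv_eq I hj]
    rfl
  rcases m with a | μ <;> rcases l with b | ν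
  · change ∑ i, ∑ i', reducedHessian I (jetCoord n k j) (T.allInv j).1 (T.allInv j).2.1 i i' *
      coframe I (jetCoord n k j) (Pi.single a 1) i *
        coframe I (jetCoord n k j) (Pi.single b 1) i' = _
    have hr : ∀ i i', reducedHessian I (jetCoord n k j) (T.allInv j).1 (T.allInv j).2.1 i i' =
        orbitForm₂ n k j.2.2.2 (I.frame i (jetCoord n k j)) (I.frame i' (jetCoord n k j)) := by
      intro i i'
      have hK : (T.allInv j).2.1 = I.pack (frameHessian I j) := orbitInv_eq I hj
      rw [reducedHessian, h₁, hK, I.unpack_pack _ (frameHessian_comm I j), frameHessian]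
      exact add_sub_cancel_right _ _
    have h : orbitForm₂ n k j.2.2.2 (Pi.single a 1) (Pi.single b 1) =
        j.2.2.2 s(Sum.inl a, Sum.inl b) := orbitForm₂_single _ _ _
    rw [← sum_coframe I hx (Pi.single a 1), ← sum_coframe I hx (Pi.single b 1)] at h
    simp only [map_sum, map_smul, _root_.sum_apply, smul_apply, smul_eq_mul] at h
    rw [← h, Finset.sum_comm]
    simp only [Finset.mul_sum]
    refine Finset.sum_congr rfl fun i _ => Finset.sum_congr rfl fun i' _ => ?_
    rw [hr]
    change _ = _ * (_ * orbitForm₂ n k j.2.2.2 (I.frame i' (jetCoord n k j)) _)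
    simp only [jetCoord_apply]
    ring
  · exact hmix ν a
  · refine (hmix μ b).trans ?_
    rw [Sym2.eq_swap]
  · rfl

section Smoothness

variable {x : Fin n → ℝ} (hx : x ∈ T.row.dom)
include hx

theorem contDiffAt_coframe_coord {G : Type*} [NormedAddCommGroup G] [NormedSpace ℝ G] (g : G)
    (v : Fin n → ℝ) (i : Fin n) :
    ContDiffAt ℝ ∞ (fun c : (Fin n → ℝ) × G => coframe I c.1 v i) (x, g) := by
  have h : ContDiffAt ℝ ∞ (fun x => coframe I x v i) x :=
    contDiffAt_pi.1 ((contDiffAt_coframe I hx).clm_apply contDiffAt_const) i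
  exact h.comp (x, g) contDiffAt_fst

theorem contDiffAt_jet1Of (w : FirstInvSpace n k) :
    ContDiffAt ℝ ∞ (fun c : (Fin n → ℝ) × FirstInvSpace n k => jet1Of I c.1 c.2) (x, w) := by
  refine ContDiffAt.prodMk (contDiffAt_pi.2 ?_) (ContDiffAt.prodMk (by fun_prop)
    (contDiffAt_pi.2 ?_))
  · rintro (a | μ) <;> simp only [Sum.elim_inl, Sum.elim_inr] <;> fun_prop
  · rintro (a | μ)
    · exact ContDiffAt.sum fun i _ => ContDiffAt.mul (by fun_prop)
        (contDiffAt_coframe_coord I hx w _ i)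
    · simp only [Sum.elim_inr]
      fun_prop

theorem contDiffAt_reducedHessian (w : InvSpace n k) (i j : Fin n) :
    ContDiffAt ℝ ∞ (fun c : (Fin n → ℝ) × InvSpace n k =>
      reducedHessian I c.1 c.2.1 c.2.2.1 i j) (x, w) := by
  have h₁ : ContDiffAt ℝ ∞ (fun c : (Fin n → ℝ) × InvSpace n k => jet1Of I c.1 c.2.1) (x, w) :=
    (contDiffAt_jet1Of I hx w.1).comp (x, w) (f := fun c : (Fin n → ℝ) × InvSpace n k =>
      (c.1, c.2.1)) (by fun_prop)
  refine ContDiffAt.sub ?_ ?_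
  · have h := (I.unpack.toContinuousLinearMap.contDiff (n := ∞)).contDiffAt.comp (x, w)
      (f := fun c : (Fin n → ℝ) × InvSpace n k => c.2.2.1) (by fun_prop)
    exact contDiffAt_pi.1 (contDiffAt_pi.1 h i) j
  · have h₂ : ContDiffAt ℝ ∞ (fun c : (Fin n → ℝ) × InvSpace n k => symmDeriv I i j c.1) (x, w) :=
      ContDiffAt.comp (g := symmDeriv I i j) (x, w) (contDiffAt_symmDeriv I hx i j) contDiffAt_fst
    exact ((orbitForm n k).contDiff.contDiffAt.comp (x, w) h₁.snd.snd).clm_apply h₂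

theorem contDiffAt_jet2Of (w : InvSpace n k) :
    ContDiffAt ℝ ∞ (fun c : (Fin n → ℝ) × InvSpace n k => jet2Of I c.1 c.2) (x, w) := by
  have h₁ : ContDiffAt ℝ ∞ (fun c : (Fin n → ℝ) × InvSpace n k => jet1Of I c.1 c.2.1) (x, w) :=
    (contDiffAt_jet1Of I hx w.1).comp (x, w) (f := fun c : (Fin n → ℝ) × InvSpace n k =>
      (c.1, c.2.1)) (by fun_prop)
  refine h₁.fst.prodMk (h₁.snd.fst.prodMk (h₁.snd.snd.prodMk (contDiffAt_pi.2 fun s => ?_)))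
  have hmix : ∀ (μ : Fin k) (a : Fin n), ContDiffAt ℝ ∞ (fun c : (Fin n → ℝ) × InvSpace n k =>
      ∑ i, c.2.2.2.1 μ i * coframe I c.1 (Pi.single a 1) i) (x, w) := fun μ a =>
    ContDiffAt.sum fun i _ => ContDiffAt.mul (by fun_prop) (contDiffAt_coframe_coord I hx w _ i)
  induction s using Sym2.ind with
  | _ m l =>
  rcases m with a | μ <;> rcases l with b | ν
  · change ContDiffAt ℝ ∞ (fun c : (Fin n → ℝ) × InvSpace n k =>
      ∑ i, ∑ j, reducedHessian I c.1 c.2.1 c.2.2.1 i j * coframe I c.1 (Pi.single a 1) i *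
        coframe I c.1 (Pi.single b 1) j) (x, w)
    exact ContDiffAt.sum fun i _ => ContDiffAt.sum fun j _ =>
      ((contDiffAt_reducedHessian I hx w i j).mul (contDiffAt_coframe_coord I hx w _ i)).mul
        (contDiffAt_coframe_coord I hx w _ j)
  · exact hmix ν a
  · exact hmix μ b
  · change ContDiffAt ℝ ∞ (fun c : (Fin n → ℝ) × InvSpace n k => c.2.2.2.2 s(μ, ν)) (x, w)
    fun_prop

/-- The prolonged generators are tangent to the submanifolds with constant invariants. -/
theorem fderiv_jet2Of_gen (w : InvSpace n k) (i : Fin n) :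
    fderiv ℝ (fun x => jet2Of I x w) x (T.row.gen i x) = T.pr2Gen k i (jet2Of I x w) := by
  have hm : jet2Of I x w ∈ T.dom2 k := hx
  let A : Jet2 (Fin n ⊕ Fin k) → (Fin n → ℝ) × InvSpace n k := fun j => (jetCoord n k j, T.allInv j)
  have hA : HasFDerivAt A ((jetCoord n k).prod (fderiv ℝ T.allInv (jet2Of I x w)))
      (jet2Of I x w) := (jetCoord n k).hasFDerivAt.prodMk
    ((contDiffAt_allInv I hm).differentiableAt (by simp)).hasFDerivAt
  have hA₀ : A (jet2Of I x w) = (x, w) := Prod.ext rfl (allInv_jet2Of I hx w)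
  have hΨ := ((contDiffAt_jet2Of I hx w).differentiableAt (by simp)).hasFDerivAt
  have hΨ' : HasFDerivAt (fun c : (Fin n → ℝ) × InvSpace n k => jet2Of I c.1 c.2)
    (fderiv ℝ (fun c : (Fin n → ℝ) × InvSpace n k => jet2Of I c.1 c.2) (x, w)) (A (jet2Of I x w)) := by rw [hA₀]; exact hΨ
  -- Near the jet, reconstruction from x and the invariants is the identity. Its derivative is
  -- applied to the prolonged generator, which has components X_i in x and 0 in the invariants.
  have hid : HasFDerivAt id ((fderiv ℝ (fun c : (Fin n → ℝ) × InvSpace n k => jet2Of I c.1 c.2)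
      (x, w)).comp ((jetCoord n k).prod (fderiv ℝ T.allInv (jet2Of I x w)))) (jet2Of I x w) :=
    (hΨ'.comp _ hA).congr_of_eventuallyEq (f₁ := id) (by
    filter_upwards [(isOpen_dom2 I k).mem_nhds hm] with j hj using (jet2Of_allInv I hj).symm)
  have h := congrArg (fun L : Jet2 (Fin n ⊕ Fin k) →L[ℝ] Jet2 (Fin n ⊕ Fin k) =>
    L (T.pr2Gen k i (jet2Of I x w))) (hid.unique (hasFDerivAt_id (𝕜 := ℝ) (jet2Of I x w)))
  have hpart : HasFDerivAt (fun x => jet2Of I x w)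
      ((fderiv ℝ (fun c : (Fin n → ℝ) × InvSpace n k => jet2Of I c.1 c.2) (x, w)).comp
        (ContinuousLinearMap.inl ℝ (Fin n → ℝ) (InvSpace n k))) x :=
    hΨ.comp (f := fun x : Fin n → ℝ => (x, w)) x (hasFDerivAt_prodMk_left x w)
  rw [hpart.fderiv]
  refine Eq.trans ?_ h
  simp only [ContinuousLinearMap.comp_apply, ContinuousLinearMap.prod_apply,
    fderiv_allInv_pr2Gen I hm]
  rfl

end Smoothness

include I in
/-- The invariants are functionally independent. -/
theorem surjective_fderiv_allInv {j : Jet2 (Fin n ⊕ Fin k)} (hj : j ∈ T.dom2 k) :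
    Function.Surjective (fderiv ℝ (T.allInv (k := k)) j) := by
  have hx' : jetCoord n k j ∈ T.row.dom := hj
  have hA := ((contDiffAt_allInv I hj).differentiableAt (by simp)).hasFDerivAt
  have hj' := jet2Of_allInv I hj
  have hΨ : HasFDerivAt (fun w => jet2Of I (jetCoord n k j) w) _ (T.allInv j) :=
    ((contDiffAt_jet2Of I hx' (T.allInv j)).differentiableAt (by simp)).hasFDerivAt.comp
      (f := fun w : InvSpace n k => (jetCoord n k j, w)) _ (hasFDerivAt_prodMk_right _ _)
  have hA' : HasFDerivAt (T.allInv (k := k)) (fderiv ℝ T.allInv j)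
    (jet2Of I (jetCoord n k j) (T.allInv j)) := by rw [hj']; exact hA
  -- At fixed x the invariants of the reconstructed jet are the prescribed ones, so the derivative
  -- of `allInv` has a right inverse.
  have hid := (hA'.comp _ hΨ).congr_of_eventuallyEq (f₁ := id)
    (Eventually.of_forall fun w => (allInv_jet2Of I hx' w).symm)
  intro w
  exact ⟨_, congrArg (fun L : InvSpace n k →L[ℝ] InvSpace n k => L w)
    (hid.unique (hasFDerivAt_id (𝕜 := ℝ) (T.allInv j)))⟩

end LowDimAlg

end

noncomputable section

open Set Filter Topology

/-! ### Generators on Z and completeness of the invariants -/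

section OrbitInclusion

variable {n k : ℕ}

/-- The inclusion of the tangent vectors `∂/∂x` in the tangent space of `Z`. -/
def orbitInclusion (n k : ℕ) : (Fin n → ℝ) →L[ℝ] Jet0 (Fin n ⊕ Fin k) :=
  (ContinuousLinearMap.pi (Sum.elim (fun a => ContinuousLinearMap.proj a) 0)).prod 0

theorem orbitInclusion_apply (v : Fin n → ℝ) :
    orbitInclusion n k v = (Sum.elim v 0, 0) := by
  refine Prod.ext ?_ rfl
  ext (a | μ) <;> rfl

theorem orbitInclusion_injective : Function.Injective (orbitInclusion n k) := by
  intro v w h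
  rw [orbitInclusion_apply, orbitInclusion_apply] at h
  ext a
  exact congrArg (fun z : Jet0 (Fin n ⊕ Fin k) => z.1 (Sum.inl a)) h

end OrbitInclusion

namespace LowDimAlg

variable {n k : ℕ} {T : LowDimAlg n} (I : T.row.InvariantFrame)

section Generators

theorem genZ_eq (i : Fin n) (z : Jet0 (Fin n ⊕ Fin k)) :
    T.genZ k i z = orbitInclusion n k (T.row.gen i (orbitCoord n k z.1)) :=
  (orbitInclusion_apply _).symm

variable {z : Jet0 (Fin n ⊕ Fin k)} (hz : z ∈ T.domZ k)
include I hz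

theorem contDiffAt_genZ (i : Fin n) : ContDiffAt ℝ ∞ (T.genZ k i) z := by
  have h : T.genZ k i = fun z => orbitInclusion n k (T.row.gen i (orbitCoord n k z.1)) :=
    funext fun z => genZ_eq i z
  rw [h]
  exact (orbitInclusion n k).contDiff.contDiffAt.comp z
    (ContDiffAt.comp (g := T.row.gen i) z (I.contDiffAt_gen _ hz i)
      ((orbitCoord n k).contDiff.contDiffAt.comp z contDiffAt_fst))

theorem fderiv_genZ (i : Fin n) (v : Jet0 (Fin n ⊕ Fin k)) :
    fderiv ℝ (T.genZ k i) z v =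
      orbitInclusion n k (I.dgen i (orbitCoord n k z.1) (orbitCoord n k v.1)) := by
  have h : T.genZ k i = fun z => orbitInclusion n k (T.row.gen i (orbitCoord n k z.1)) :=
    funext fun z => genZ_eq i z
  let q : Jet0 (Fin n ⊕ Fin k) →L[ℝ] (Fin n → ℝ) :=
    (orbitCoord n k).comp (ContinuousLinearMap.fst ℝ _ ℝ)
  have h₁ : HasFDerivAt (T.row.gen i) (fderiv ℝ (T.row.gen i) (q z)) (q z) :=
    ((I.contDiffAt_gen _ hz i).differentiableAt (by simp)).hasFDerivAt
  have h₂ := (orbitInclusion n k).hasFDerivAt.comp z (h₁.comp z q.hasFDerivAt)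
  rw [← I.fderiv_gen (orbitCoord n k z.1) hz, h]
  exact congrArg (fun L : Jet0 (Fin n ⊕ Fin k) →L[ℝ] Jet0 (Fin n ⊕ Fin k) => L v) h₂.fderiv

theorem lieBracket_genZ (i j : Fin n) :
    VectorField.lieBracket ℝ (T.genZ k i) (T.genZ k j) z =
      ∑ l, T.row.bracket i j l • T.genZ k l z := by
  have hq : ∀ i, orbitCoord n k (T.genZ k i z).1 = T.row.gen i (orbitCoord n k z.1) :=
    fun i => rfl
  rw [VectorField.lieBracket, fderiv_genZ I hz, fderiv_genZ I hz, hq, hq, ← map_sub,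
    I.bracket_gen (orbitCoord n k z.1) hz, map_sum]
  refine Finset.sum_congr rfl fun l _ => ?_
  rw [map_smul, genZ_eq]

theorem linearIndependent_genZ : LinearIndependent ℝ fun i => T.genZ k i z := by
  have h := (linearIndependent_gen I (x := orbitCoord n k z.1) hz).map'
    (orbitInclusion n k : (Fin n → ℝ) →ₗ[ℝ] Jet0 (Fin n ⊕ Fin k))
    (LinearMap.ker_eq_bot.2 orbitInclusion_injective)
  have e : (fun i => T.genZ k i z) = (orbitInclusion n k : (Fin n → ℝ) →ₗ[ℝ] _) ∘
    fun i => T.row.gen i (orbitCoord n k z.1) := funext fun i => genZ_eq i z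
  rw [e]
  exact h

end Generators

section Invariants

include I

theorem span_gen {x : Fin n → ℝ} (hx : x ∈ T.row.dom) (v : Fin n → ℝ) :
    ∃ c : Fin n → ℝ, v = ∑ i, c i • T.row.gen i x := by
  obtain ⟨c, hc⟩ := (isInvertible_frameMap (linearIndependent_gen I hx)).surjective v
  exact ⟨c, by rw [← hc, frameMap_apply]⟩

/-- A linear map that vanishes on the generators vanishes. -/
theorem clm_eq_zero_of_gen {G : Type*} [NormedAddCommGroup G] [NormedSpace ℝ G]
    {x : Fin n → ℝ} (hx : x ∈ T.row.dom) {L : (Fin n → ℝ) →L[ℝ] G}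
    (h : ∀ i, L (T.row.gen i x) = 0) : L = 0 := by
  ext1 v
  obtain ⟨c, rfl⟩ := span_gen I hx v
  simp [map_sum, h]

theorem hasFDerivAt_comp_jet2Of {F : Jet2 (Fin n ⊕ Fin k) → ℝ} {x : Fin n → ℝ}
    (hx : x ∈ T.row.dom) (w : InvSpace n k) (hF : DifferentiableAt ℝ F (jet2Of I x w)) :
    HasFDerivAt (fun x => F (jet2Of I x w))
      ((fderiv ℝ F (jet2Of I x w)).comp (fderiv ℝ (fun x => jet2Of I x w) x)) x := by
  have h₁ : DifferentiableAt ℝ (fun x => jet2Of I x w) x :=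
    DifferentiableAt.comp (f := fun x : Fin n → ℝ => (x, w))
      (g := fun c : (Fin n → ℝ) × InvSpace n k => jet2Of I c.1 c.2) x
      ((contDiffAt_jet2Of I hx w).differentiableAt (by simp)) (by fun_prop)
  exact HasFDerivAt.comp (g := F) (f := fun x => jet2Of I x w) x hF.hasFDerivAt h₁.hasFDerivAt

/-- A differential invariant depends only on the invariants of the row. -/
theorem IsDiffInvariantOn.eq_of_allInv {Ω : Set (Jet2 (Fin n ⊕ Fin k))} (hΩ : IsOpen Ω)
    {F : Jet2 (Fin n ⊕ Fin k) → ℝ} (hF : ContDiffOn ℝ ∞ F Ω) (h : T.IsDiffInvariantOn k F Ω)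
    {D : Set (Fin n → ℝ)} (hD : IsOpen D) (hDc : IsPreconnected D) (hDs : D ⊆ T.row.dom)
    {w : InvSpace n k} (hw : ∀ x ∈ D, jet2Of I x w ∈ Ω) {x x' : Fin n → ℝ} (hx : x ∈ D)
    (hx' : x' ∈ D) : F (jet2Of I x w) = F (jet2Of I x' w) := by
  have hd : ∀ x ∈ D, HasFDerivAt (fun x => F (jet2Of I x w)) (0 : (Fin n → ℝ) →L[ℝ] ℝ) x := by
    intro x hx
    have h₁ := hasFDerivAt_comp_jet2Of I (hDs hx) w
      ((hF.contDiffAt (hΩ.mem_nhds (hw x hx))).differentiableAt (by simp))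
    -- On a slice of constant invariants, the derivative of F in the direction X_i is its derivative
    -- along the prolonged generator. Since the X_i span, the whole derivative vanishes.
    have h₂ := clm_eq_zero_of_gen I (hDs hx) (L := (fderiv ℝ F (jet2Of I x w)).comp
      (fderiv ℝ (fun x => jet2Of I x w) x)) (fun i => by
        rw [ContinuousLinearMap.comp_apply, fderiv_jet2Of_gen I (hDs hx)]
        exact h _ (hw x hx) i)
    rwa [h₂] at h₁
  exact hD.is_const_of_fderiv_eq_zero hDc
    (fun x hx => (hd x hx).differentiableAt.differentiableWithinAt)
    (fun x hx => (hd x hx).fderiv) hx hx'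

theorem fderiv_comp_allInv_pr2Gen {F : Jet2 (Fin n ⊕ Fin k) → ℝ} {f : InvSpace n k → ℝ}
    {j : Jet2 (Fin n ⊕ Fin k)} (hj : j ∈ T.dom2 k) (hf : DifferentiableAt ℝ f (T.allInv j))
    (h : ∀ᶠ w in 𝓝 j, F w = f (T.allInv w)) (i : Fin n) :
    fderiv ℝ F j (T.pr2Gen k i j) = 0 := by
  rw [Filter.EventuallyEq.fderiv_eq h]
  have h₁ := hf.hasFDerivAt.comp j ((contDiffAt_allInv I hj).differentiableAt (by simp)).hasFDerivAt
  refine (congrArg (fun L : Jet2 (Fin n ⊕ Fin k) →L[ℝ] ℝ => L (T.pr2Gen k i j)) h₁.fderiv).trans ?_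
  rw [ContinuousLinearMap.comp_apply, fderiv_allInv_pr2Gen I hj, map_zero]

theorem contDiffAt_jet2Of_right {x : Fin n → ℝ} (hx : x ∈ T.row.dom) (w : InvSpace n k) :
    ContDiffAt ℝ ∞ (fun w => jet2Of I x w) w :=
  ContDiffAt.comp (f := fun w : InvSpace n k => (x, w))
    (g := fun c : (Fin n → ℝ) × InvSpace n k => jet2Of I c.1 c.2) w
    (contDiffAt_jet2Of I hx w) (by fun_prop)

/-- The function f is F restricted to the jets over the single point x of the given jet, expressed
through the invariants. -/
theorem isDiffInvariantOn_iff_local {Ω : Set (Jet2 (Fin n ⊕ Fin k))} (hΩ : IsOpen Ω)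
    (hΩd : Ω ⊆ T.dom2 k) {F : Jet2 (Fin n ⊕ Fin k) → ℝ} (hF : ContDiffOn ℝ ∞ F Ω) :
    T.IsDiffInvariantOn k F Ω ↔
      ∀ j ∈ Ω, ∃ W ⊆ Ω, IsOpen W ∧ j ∈ W ∧
        ∃ (V : Set (InvSpace n k)) (f : InvSpace n k → ℝ),
          IsOpen V ∧ ContDiffOn ℝ ∞ f V ∧
          ∀ w ∈ W, T.allInv w ∈ V ∧ F w = f (T.allInv w) := by
  constructor
  · intro h j hj
    have hx : jetCoord n k j ∈ T.row.dom := hΩd hj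
    have hS : ∀ᶠ c : (Fin n → ℝ) × InvSpace n k in 𝓝 (jetCoord n k j, T.allInv j),
        c.1 ∈ T.row.dom ∧ jet2Of I c.1 c.2 ∈ Ω := by
      refine (continuousAt_fst.eventually (I.isOpen_dom.mem_nhds hx)).and ?_
      refine (contDiffAt_jet2Of I hx (T.allInv j)).continuousAt.eventually (hΩ.mem_nhds ?_)
      change jet2Of I (jetCoord n k j) (T.allInv j) ∈ Ω
      rwa [jet2Of_allInv I (hΩd hj)]
    -- A product of balls in the coordinates (x, invariants): its slices at fixed invariants are
    -- balls, hence connected, so F is constant on them.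
    obtain ⟨ε, hε, hball⟩ := Metric.eventually_nhds_iff_ball.1 hS
    have hmem : ∀ x ∈ Metric.ball (jetCoord n k j) ε, ∀ w ∈ Metric.ball (T.allInv j) ε,
        x ∈ T.row.dom ∧ jet2Of I x w ∈ Ω := fun x hx w hw =>
      hball (x, w) (by rw [← ball_prod_same]; exact ⟨hx, hw⟩)
    have hxb := Metric.mem_ball_self (x := jetCoord n k j) hε
    have hcont : ContinuousOn (fun j => (jetCoord n k j, T.allInv j)) (T.dom2 k) := fun j hj =>
      ((jetCoord n k).continuous.continuousAt.prodMk
        (contDiffAt_allInv I hj).continuousAt).continuousWithinAt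
    refine ⟨T.dom2 k ∩ (fun j => (jetCoord n k j, T.allInv j)) ⁻¹'
        (Metric.ball (jetCoord n k j) ε ×ˢ Metric.ball (T.allInv j) ε), ?_,
      hcont.isOpen_inter_preimage (isOpen_dom2 I k) (Metric.isOpen_ball.prod Metric.isOpen_ball),
      ⟨hΩd hj, hxb, Metric.mem_ball_self hε⟩, Metric.ball (T.allInv j) ε,
      fun w => F (jet2Of I (jetCoord n k j) w), Metric.isOpen_ball, ?_, ?_⟩
    · rintro j' ⟨hj', h₁, h₂⟩
      have h₃ := (hmem _ h₁ _ h₂).2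
      rwa [jet2Of_allInv I hj'] at h₃
    · intro w hw
      exact (ContDiffAt.comp w (hF.contDiffAt (hΩ.mem_nhds (hmem _ hxb w hw).2))
        (contDiffAt_jet2Of_right I hx w)).contDiffWithinAt
    · rintro j' ⟨hj', h₁, h₂⟩
      refine ⟨h₂, ?_⟩
      have h₃ := h.eq_of_allInv I hΩ hF Metric.isOpen_ball
        (convex_ball (jetCoord n k j) ε).isPreconnected (fun x hx => (hmem x hx _ h₂).1)
        (fun x hx => (hmem x hx _ h₂).2) h₁ hxb
      rwa [jet2Of_allInv I hj'] at h₃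
  · intro h j hj i
    obtain ⟨W, -, hW, hjW, V, f, hV, hf, hFf⟩ := h j hj
    exact fderiv_comp_allInv_pr2Gen I (hΩd hj)
      ((hf.contDiffAt (hV.mem_nhds (hFf j hjW).1)).differentiableAt (by simp))
      (by filter_upwards [hW.mem_nhds hjW] with w hw using (hFf w hw).2) i

/-- The jets over x = 0 realize all values of the invariants, so the restriction of F to them
defines f everywhere. Every slice is a copy of the convex set D. -/
theorem isDiffInvariantOn_iff_global {F : Jet2 (Fin n ⊕ Fin k) → ℝ}
    (hF : ContDiffOn ℝ ∞ F (T.dom2 k)) :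
    T.IsDiffInvariantOn k F (T.dom2 k) ↔
      ∃ f : InvSpace n k → ℝ, ContDiff ℝ ∞ f ∧ ∀ j ∈ T.dom2 k, F j = f (T.allInv j) := by
  have hΩ := isOpen_dom2 I k
  constructor
  · intro h
    refine ⟨fun w => F (jet2Of I 0 w), contDiff_iff_contDiffAt.2 fun w =>
      ContDiffAt.comp w (hF.contDiffAt (hΩ.mem_nhds (jet2Of_mem_dom2 I I.zero_mem_dom w)))
        (contDiffAt_jet2Of_right I I.zero_mem_dom w), fun j hj => ?_⟩
    have h₃ := h.eq_of_allInv I hΩ hF I.isOpen_dom I.convex_dom.isPreconnected subset_rfl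
      (w := T.allInv j) (fun x hx => jet2Of_mem_dom2 I hx _) (x := jetCoord n k j) hj I.zero_mem_dom
    rwa [jet2Of_allInv I hj] at h₃
  · rintro ⟨f, hf, hFf⟩ j hj i
    exact fderiv_comp_allInv_pr2Gen I hj (hf.differentiable (by simp) _)
      (by filter_upwards [hΩ.mem_nhds hj] with w hw using hFf w hw) i

end Invariants

end LowDimAlg

end

noncomputable section

open Set Filter Topology

/-! ### Families of affine functions with infinitesimally constant zero sets -/

section AffineHyperplanes

variable {σ : Type*} [Fintype σ]

/-- If an affine hyperplane is contained in the zero set of an affine function, this function is a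
multiple of the equation of the hyperplane. -/
theorem exists_eq_mul_of_affine_zero {a a' : σ → ℝ} {b b' : ℝ} (ha : a ≠ 0)
    (h : ∀ y : σ → ℝ, ∑ s, a s * y s + b = 0 → ∑ s, a' s * y s + b' = 0) :
    ∃ c : ℝ, (∀ s, a' s = c * a s) ∧ b' = c * b := by
  have hρ : ∑ s, a s * a s ≠ 0 := by
    intro h0
    refine ha (funext fun s => ?_)
    have := (Finset.sum_eq_zero_iff_of_nonneg (fun s _ => mul_self_nonneg (a s))).1 h0 s
      (Finset.mem_univ s)
    exact mul_self_eq_zero.1 this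
  set ρ := ∑ s, a s * a s with hρd
  -- If a' is a multiple of a, the factor is this projection coefficient.
  set c := (∑ s, a' s * a s) / ρ with hc
  -- The point -(b/ρ) a lies on the hyperplane; comparing the hypothesis at this point and at its
  -- translate by z leaves the homogeneous statement.
  have h₀ : ∀ z : σ → ℝ, ∑ s, a s * z s = 0 →
      ∑ s, a' s * z s = 0 := by
    intro z hz
    have e₁ := h (fun s => -(b / ρ) * a s) (by
      have : ∑ s, a s * (-(b / ρ) * a s) = -(b / ρ) * ρ := by
        rw [hρd, Finset.mul_sum]; exact Finset.sum_congr rfl fun s _ => by ring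
      rw [this]; field_simp; ring)
    have e₂ := h (fun s => -(b / ρ) * a s + z s) (by
      have : ∑ s, a s * (-(b / ρ) * a s + z s) = -(b / ρ) * ρ + ∑ s, a s * z s := by
        rw [hρd, Finset.mul_sum, ← Finset.sum_add_distrib]
        exact Finset.sum_congr rfl fun s _ => by ring
      rw [this, hz]; field_simp; ring)
    simp only [mul_add, Finset.sum_add_distrib] at e₂
    linarith
  have hz : ∑ s, a s * (a' s - c * a s) = 0 := by
    have : ∑ s, a s * (a' s - c * a s) = ∑ s, a' s * a s - c * ρ := by
      rw [hρd, Finset.mul_sum, ← Finset.sum_sub_distrib]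
      exact Finset.sum_congr rfl fun s _ => by ring
    rw [this, hc]; field_simp; ring
  have hz' := h₀ _ hz
  -- a' - c a is orthogonal to a, hence annihilated by a', and so it is orthogonal to itself.
  have hsq : ∑ s, (a' s - c * a s) * (a' s - c * a s) = 0 := by
    have : ∑ s, (a' s - c * a s) * (a' s - c * a s) =
        ∑ s, a' s * (a' s - c * a s) - c * ∑ s, a s * (a' s - c * a s) := by
      rw [Finset.mul_sum, ← Finset.sum_sub_distrib]
      exact Finset.sum_congr rfl fun s _ => by ring
    rw [this, hz, hz']; ring
  have heq : ∀ s, a' s = c * a s := fun s => by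
    have := (Finset.sum_eq_zero_iff_of_nonneg
      (fun s _ => mul_self_nonneg (a' s - c * a s))).1 hsq s (Finset.mem_univ s)
    exact sub_eq_zero.1 (mul_self_eq_zero.1 this)
  refine ⟨c, heq, ?_⟩
  have e₁ := h (fun s => -(b / ρ) * a s) (by
      have : ∑ s, a s * (-(b / ρ) * a s) = -(b / ρ) * ρ := by
        rw [hρd, Finset.mul_sum]; exact Finset.sum_congr rfl fun s _ => by ring
      rw [this]; field_simp; ring)
  have e₃ : ∑ s, a' s * (-(b / ρ) * a s) = -(b / ρ) * (c * ρ) := by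
    rw [hρd, Finset.mul_sum, Finset.mul_sum]
    exact Finset.sum_congr rfl fun s _ => by rw [heq s]; ring
  rw [e₃] at e₁
  field_simp at e₁
  linarith

variable {X : Type*} [NormedAddCommGroup X] [NormedSpace ℝ X]

/-- A family of affine functions whose zero sets are infinitesimally constant is constant up to
multiplication by a positive function. -/
theorem div_sqrt_eq_of_fderiv_eq_zero {D : Set X} (hD : IsOpen D) (hDc : IsPreconnected D)
    {α : σ → X → ℝ} {β : X → ℝ} (hα : ∀ s, ∀ x ∈ D, DifferentiableAt ℝ (α s) x)
    (hβ : ∀ x ∈ D, DifferentiableAt ℝ β x) (hα₀ : ∀ x ∈ D, ∃ s, α s x ≠ 0)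
    (h : ∀ x ∈ D, ∀ y : σ → ℝ, ∑ s, α s x * y s + β x = 0 →
      fderiv ℝ (fun x => ∑ s, α s x * y s + β x) x = 0) {x x' : X} (hx : x ∈ D) (hx' : x' ∈ D) :
    (∀ s, α s x / √(∑ s, α s x * α s x) = α s x' / √(∑ s, α s x' * α s x')) ∧
      β x / √(∑ s, α s x * α s x) = β x' / √(∑ s, α s x' * α s x') := by
  have hρ : ∀ x ∈ D, 0 < ∑ s, α s x * α s x := fun x hx => by
    obtain ⟨s, hs⟩ := hα₀ x hx
    exact Finset.sum_pos' (fun s _ => mul_self_nonneg _)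
      ⟨s, Finset.mem_univ s, mul_self_pos.2 hs⟩
  have hρd : ∀ x ∈ D, HasFDerivAt (fun x => ∑ s, α s x * α s x)
      (∑ s, (α s x • fderiv ℝ (α s) x + α s x • fderiv ℝ (α s) x)) x := fun x hx =>
    HasFDerivAt.fun_sum fun s _ => (hα s x hx).hasFDerivAt.mul (hα s x hx).hasFDerivAt
  have hsq : ∀ x ∈ D, HasFDerivAt (fun x => √(∑ s, α s x * α s x)) _ x := fun x hx =>
    (hρd x hx).sqrt (hρ x hx).ne'
  -- Along every v, all coefficients have the same logarithmic derivative c.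
  have key : ∀ x ∈ D, ∀ v, ∃ c : ℝ, (∀ s, fderiv ℝ (α s) x v = c * α s x) ∧
      fderiv ℝ β x v = c * β x := by
    intro x hx v
    refine exists_eq_mul_of_affine_zero (a := fun s => α s x) (b := β x)
      (a' := fun s => fderiv ℝ (α s) x v) (b' := fderiv ℝ β x v) ?_ fun y hy => ?_
    · obtain ⟨s, hs⟩ := hα₀ x hx
      exact fun h0 => hs (congrFun h0 s)
    · have h₁ : HasFDerivAt (fun x => ∑ s, α s x * y s + β x)
          (∑ s, y s • fderiv ℝ (α s) x + fderiv ℝ β x) x :=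
        (HasFDerivAt.fun_sum fun s _ => (hα s x hx).hasFDerivAt.mul_const (y s)).add
          (hβ x hx).hasFDerivAt
      have h₂ := h x hx y hy
      rw [h₁.fderiv] at h₂
      have h₃ := congrArg (fun L : X →L[ℝ] ℝ => L v) h₂
      simpa [mul_comm] using h₃
  have hconst : ∀ f : X → ℝ, (∀ x ∈ D, DifferentiableAt ℝ f x) →
      (∀ x ∈ D, ∀ v, ∀ c : ℝ, (∀ s, fderiv ℝ (α s) x v = c * α s x) →
        fderiv ℝ β x v = c * β x → fderiv ℝ f x v = c * f x) →
      f x / √(∑ s, α s x * α s x) = f x' / √(∑ s, α s x' * α s x') := by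
    intro f hf hf'
    have hdiff : ∀ x ∈ D, DifferentiableAt ℝ (fun x => f x / √(∑ s, α s x * α s x)) x :=
      fun x hx => by
        simp only [div_eq_mul_inv]
        exact (hf x hx).mul ((hsq x hx).differentiableAt.fun_inv (Real.sqrt_pos.2 (hρ x hx)).ne')
    refine hD.is_const_of_fderiv_eq_zero (f := fun x => f x / √(∑ s, α s x * α s x)) hDc
      (fun x hx => (hdiff x hx).differentiableWithinAt) (fun x hx => ?_) hx hx'
    ext1 v
    obtain ⟨c, hc₁, hc₂⟩ := key x hx v
    have hr := Real.sqrt_pos.2 (hρ x hx)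
    rw [fderiv_div_apply' (hf x hx) (hsq x hx).differentiableAt hr.ne', (hsq x hx).fderiv,
      hf' x hx v c hc₁ hc₂]
    -- The squared length has logarithmic derivative 2c, so its root has c, and the quotients are
    -- stationary.
    have e : (∑ s, (α s x • fderiv ℝ (α s) x + α s x • fderiv ℝ (α s) x)) v =
        2 * c * ∑ s, α s x * α s x := by
      rw [Finset.mul_sum, _root_.sum_apply]
      refine Finset.sum_congr rfl fun s _ => ?_
      simp only [add_apply, smul_apply, smul_eq_mul, hc₁]
      ring
    rw [smul_apply, e, smul_eq_mul]
    have hs := Real.mul_self_sqrt (hρ x hx).le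
    set r := √(∑ s, α s x * α s x)
    rw [← hs]
    change _ = (0 : ℝ)
    field_simp
    ring
  exact ⟨fun s => hconst (α s) (hα s) fun x hx v c h₁ _ => h₁ s,
    hconst β hβ fun x hx v c _ h₂ => h₂⟩

end AffineHyperplanes

/-- Each unordered pair is spread evenly over the ordered pairs that represent it, one on the
diagonal and two off it. This passes from coefficients on unordered pairs to the a^{μν} of the
theorem. -/
theorem sum_sym2_eq_sum_sum {k : ℕ} (f : Sym2 (Fin k) → ℝ) :
    ∑ μ, ∑ ν, f s(μ, ν) / (Finset.univ.filter fun p : Fin k × Fin k =>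
      s(p.1, p.2) = s(μ, ν)).card = ∑ s, f s := by
  rw [← Fintype.sum_prod_type' (f := fun μ ν => f s(μ, ν) / (Finset.univ.filter
    fun p : Fin k × Fin k => s(p.1, p.2) = s(μ, ν)).card),
    ← Finset.sum_fiberwise (s := Finset.univ) (g := fun p : Fin k × Fin k => s(p.1, p.2))]
  refine Finset.sum_congr rfl fun s _ => ?_
  have hne : ((Finset.univ.filter fun p : Fin k × Fin k => s(p.1, p.2) = s).card : ℝ) ≠ 0 := by
    induction s using Sym2.ind with
    | _ μ ν =>
    exact Nat.cast_ne_zero.2 (Finset.card_pos.2 ⟨(μ, ν), by simp⟩).ne'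
  rw [Finset.sum_congr rfl (g := fun _ => f s / (Finset.univ.filter
    fun p : Fin k × Fin k => s(p.1, p.2) = s).card)]
  · rw [Finset.sum_const, nsmul_eq_mul]
    field_simp
  · intro p hp
    rw [(Finset.mem_filter.1 hp).2]

end

noncomputable section

open Set Filter Topology

/-! ### Invariant quasi-linear equations -/

namespace LowDimAlg

variable {n k : ℕ} {T : LowDimAlg n} (I : T.row.InvariantFrame)

/-- The index set of the second-order invariants. -/
abbrev SecondIndex (n k : ℕ) : Type :=
  Fin (n * (n + 1) / 2) ⊕ (Fin k × Fin n) ⊕ Sym2 (Fin k)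

/-- The values of the second-order invariants as a family of numbers. -/
def secondCoord (W : SecondInvSpace n k) : SecondIndex n k → ℝ :=
  Sum.elim W.1 (Sum.elim (fun p => W.2.1 p.1 p.2) W.2.2)

/-- The values of the second-order invariants with given coordinates. -/
def ofSecondCoord (n k : ℕ) : (SecondIndex n k → ℝ) →ₗ[ℝ] SecondInvSpace n k where
  toFun y := (fun s => y (Sum.inl s), fun μ i => y (Sum.inr (Sum.inl (μ, i))),
    fun s => y (Sum.inr (Sum.inr s)))
  map_add' _ _ := rfl
  map_smul' _ _ := rfl

theorem ofSecondCoord_secondCoord (W : SecondInvSpace n k) :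
    ofSecondCoord n k (secondCoord W) = W := rfl

/-- The second derivatives depend on the second-order invariants affinely, with a constant part
coming from the first-order terms of `reducedHessian`; subtracting the value at 0 leaves the linear
part. -/
theorem hessianOf_add (x : Fin n → ℝ) (w : FirstInvSpace n k) (W W' : SecondInvSpace n k) :
    hessianOf I x w (W + W') - hessianOf I x w 0 =
      (hessianOf I x w W - hessianOf I x w 0) + (hessianOf I x w W' - hessianOf I x w 0) := by
  ext s
  induction s using Sym2.ind with
  | _ m l =>
  rcases m with a | μ <;> rcases l with b | ν <;>
    simp only [Pi.sub_apply, Pi.add_apply, hessianOf, Sym2.lift_mk, Sum.elim_inl, Sum.elim_inr,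
      Prod.snd_add, Prod.fst_add, Prod.fst_zero, Prod.snd_zero, Pi.zero_apply, ← Finset.sum_sub_distrib,
      ← Finset.sum_add_distrib, reducedHessian, map_add, map_zero]
  · exact Finset.sum_congr rfl fun i _ => Finset.sum_congr rfl fun j _ => by ring
  · exact Finset.sum_congr rfl fun i _ => by ring
  · exact Finset.sum_congr rfl fun i _ => by ring
  · ring

theorem hessianOf_smul (x : Fin n → ℝ) (w : FirstInvSpace n k) (c : ℝ) (W : SecondInvSpace n k) :
    hessianOf I x w (c • W) - hessianOf I x w 0 =
      c • (hessianOf I x w W - hessianOf I x w 0) := by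
  ext s
  induction s using Sym2.ind with
  | _ m l =>
  rcases m with a | μ <;> rcases l with b | ν <;>
    simp only [Pi.sub_apply, Pi.smul_apply, hessianOf, Sym2.lift_mk, Sum.elim_inl, Sum.elim_inr,
      Prod.smul_snd, Prod.smul_fst, Prod.fst_zero, Prod.snd_zero, Pi.zero_apply,
      ← Finset.sum_sub_distrib, Finset.mul_sum, smul_eq_mul, reducedHessian, map_smul, map_zero]
  · exact Finset.sum_congr rfl fun i _ => Finset.sum_congr rfl fun j _ => by ring
  · exact Finset.sum_congr rfl fun i _ => by ring
  · exact Finset.sum_congr rfl fun i _ => by ring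
  · ring

/-- The dependence of the second derivatives on the second-order invariants. -/
def hessianLinear (x : Fin n → ℝ) (w : FirstInvSpace n k) :
    SecondInvSpace n k →ₗ[ℝ] (Sym2 (Fin n ⊕ Fin k) → ℝ) where
  toFun W := hessianOf I x w W - hessianOf I x w 0
  map_add' := hessianOf_add I x w
  map_smul' := hessianOf_smul I x w

theorem hessianOf_eq (x : Fin n → ℝ) (w : FirstInvSpace n k) (W : SecondInvSpace n k) :
    hessianOf I x w W = hessianLinear I x w W + hessianOf I x w 0 :=
  (sub_add_cancel _ _).symm

/-- Given r, a preimage consists of the second-order invariants of the jet whose second derivatives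
are r plus the constant part. -/
theorem hessianLinear_surjective {x : Fin n → ℝ} (hx : x ∈ T.row.dom) (w : FirstInvSpace n k) :
    Function.Surjective (hessianLinear I x w) := by
  intro r
  let j : Jet2 (Fin n ⊕ Fin k) :=
    ((jet1Of I x w).1, (jet1Of I x w).2.1, (jet1Of I x w).2.2, r + hessianOf I x w 0)
  have hj : j ∈ T.dom2 k := hx
  have hw : (T.allInv j).1 = w := firstInv_jet1Of I hx w
  have h : hessianOf I x (T.allInv j).1 (T.allInv j).2 = r + hessianOf I x w 0 :=
    congrArg (fun j : Jet2 (Fin n ⊕ Fin k) => j.2.2.2) (jet2Of_allInv I hj)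
  rw [hw] at h
  exact ⟨(T.allInv j).2, sub_eq_iff_eq_add.2 h⟩

section QuasiLinear

variable (A : Jet1 (Fin n ⊕ Fin k) → Sym2 (Fin n ⊕ Fin k) → ℝ) (B : Jet1 (Fin n ⊕ Fin k) → ℝ)

/-- The coefficients of a quasi-linear expression with respect to the second-order invariants. -/
def invCoeff (s : SecondIndex n k) (x : Fin n → ℝ) (w : FirstInvSpace n k) : ℝ :=
  quasiLinear A B (jet2Of I x (w, ofSecondCoord n k (Pi.single s 1))) -
    quasiLinear A B (jet2Of I x (w, 0))

/-- The part of a quasi-linear expression that is free of the second-order invariants. -/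
def invConst (x : Fin n → ℝ) (w : FirstInvSpace n k) : ℝ :=
  quasiLinear A B (jet2Of I x (w, 0))

/-- The linear part of a quasi-linear expression with respect to the second-order invariants. -/
def invLinear (x : Fin n → ℝ) (w : FirstInvSpace n k) : SecondInvSpace n k →ₗ[ℝ] ℝ :=
  (∑ s, A (jet1Of I x w) s • LinearMap.proj s : (Sym2 (Fin n ⊕ Fin k) → ℝ) →ₗ[ℝ] ℝ) ∘ₗ
    hessianLinear I x w

theorem quasiLinear_jet2Of (x : Fin n → ℝ) (w : FirstInvSpace n k) (W : SecondInvSpace n k) :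
    quasiLinear A B (jet2Of I x (w, W)) = invLinear I A x w W + invConst I A B x w := by
  have h : ∀ W, quasiLinear A B (jet2Of I x (w, W)) =
      ∑ s, A (jet1Of I x w) s * hessianOf I x w W s + B (jet1Of I x w) := fun W => rfl
  rw [invConst, h, h, ← add_assoc, hessianOf_eq I x w W]
  simp [invLinear, mul_add, Finset.sum_add_distrib]

theorem invCoeff_eq (s : SecondIndex n k) (x : Fin n → ℝ) (w : FirstInvSpace n k) :
    invCoeff I A B s x w = invLinear I A x w (ofSecondCoord n k (Pi.single s 1)) := by
  rw [invCoeff, quasiLinear_jet2Of, invConst, add_sub_cancel_right]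

theorem quasiLinear_eq_sum (x : Fin n → ℝ) (w : FirstInvSpace n k) (y : SecondIndex n k → ℝ) :
    quasiLinear A B (jet2Of I x (w, ofSecondCoord n k y)) =
      ∑ s, invCoeff I A B s x w * y s + invConst I A B x w := by
  rw [quasiLinear_jet2Of]
  congr 1
  have h := LinearMap.pi_apply_eq_sum_univ (invLinear I A x w ∘ₗ ofSecondCoord n k) y
  rw [LinearMap.comp_apply] at h
  rw [h]
  refine Finset.sum_congr rfl fun s _ => ?_
  rw [invCoeff_eq, smul_eq_mul, mul_comm, LinearMap.comp_apply]
  congr 3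
  ext s'
  simp [Pi.single_apply, eq_comm]

/-- Since every array of second derivatives is attained by `hessianLinear`, a non-zero coefficient
vector stays non-zero when E is expressed through the invariants. -/
theorem exists_invCoeff_ne_zero {x : Fin n → ℝ} (hx : x ∈ T.row.dom) {w : FirstInvSpace n k}
    (hA : A (jet1Of I x w) ≠ 0) : ∃ s, invCoeff I A B s x w ≠ 0 := by
  by_contra! h
  refine hA (funext fun t => ?_)
  obtain ⟨W, hW⟩ := hessianLinear_surjective I hx w (Pi.single t 1)
  have h₁ : invLinear I A x w W = A (jet1Of I x w) t := by
    simp [invLinear, hW, Pi.single_apply]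
  have h₂ := quasiLinear_eq_sum I A B x w (secondCoord W)
  rw [ofSecondCoord_secondCoord, quasiLinear_jet2Of, h₁] at h₂
  simpa [h] using h₂

variable {A B} {Ω : Set (Jet1 (Fin n ⊕ Fin k))} (hΩ : IsOpen Ω)

theorem isOpen_preimage_toJet1 (hΩ : IsOpen Ω) :
    IsOpen {j : Jet2 (Fin n ⊕ Fin k) | j.toJet1 ∈ Ω} :=
  hΩ.preimage (by unfold Jet2.toJet1; fun_prop)

theorem contDiffAt_quasiLinear (hΩ : IsOpen Ω) (hA : ContDiffOn ℝ ∞ A Ω) (hB : ContDiffOn ℝ ∞ B Ω)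
    {j : Jet2 (Fin n ⊕ Fin k)} (hj : j.toJet1 ∈ Ω) : ContDiffAt ℝ ∞ (quasiLinear A B) j := by
  have ht : ContDiffAt ℝ ∞ (Jet2.toJet1 : Jet2 (Fin n ⊕ Fin k) → Jet1 (Fin n ⊕ Fin k)) j := by
    unfold Jet2.toJet1; fun_prop
  have hA' : ContDiffAt ℝ ∞ (fun j : Jet2 (Fin n ⊕ Fin k) => A j.toJet1) j :=
    (hA.contDiffAt (hΩ.mem_nhds hj)).comp j ht
  have hB' : ContDiffAt ℝ ∞ (fun j : Jet2 (Fin n ⊕ Fin k) => B j.toJet1) j :=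
    (hB.contDiffAt (hΩ.mem_nhds hj)).comp j ht
  exact (ContDiffAt.sum fun s _ => (contDiffAt_pi.1 hA' s).mul (by fun_prop)).add hB'

theorem contDiffAt_quasiLinear_jet2Of (hΩ : IsOpen Ω) (hA : ContDiffOn ℝ ∞ A Ω)
    (hB : ContDiffOn ℝ ∞ B Ω) {c : (Fin n → ℝ) × FirstInvSpace n k} (hx : c.1 ∈ T.row.dom)
    (hc : jet1Of I c.1 c.2 ∈ Ω) (W : SecondInvSpace n k) :
    ContDiffAt ℝ ∞ (fun c : (Fin n → ℝ) × FirstInvSpace n k =>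
      quasiLinear A B (jet2Of I c.1 (c.2, W))) c :=
  ContDiffAt.comp (g := quasiLinear A B) c
    (contDiffAt_quasiLinear (j := jet2Of I c.1 (c.2, W)) hΩ hA hB hc)
    (ContDiffAt.comp (f := fun c : (Fin n → ℝ) × FirstInvSpace n k => (c.1, (c.2, W)))
      (g := fun c : (Fin n → ℝ) × InvSpace n k => jet2Of I c.1 c.2) c
      (contDiffAt_jet2Of I hx (c.2, W)) (by fun_prop))

theorem contDiffAt_invCoeff (hΩ : IsOpen Ω) (hA : ContDiffOn ℝ ∞ A Ω)
    (hB : ContDiffOn ℝ ∞ B Ω) {c : (Fin n → ℝ) × FirstInvSpace n k} (hx : c.1 ∈ T.row.dom)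
    (hc : jet1Of I c.1 c.2 ∈ Ω) (s : SecondIndex n k) :
    ContDiffAt ℝ ∞ (fun c : (Fin n → ℝ) × FirstInvSpace n k => invCoeff I A B s c.1 c.2) c :=
  (contDiffAt_quasiLinear_jet2Of I hΩ hA hB hx hc _).sub
    (contDiffAt_quasiLinear_jet2Of I hΩ hA hB hx hc _)

theorem contDiffAt_invConst (hΩ : IsOpen Ω) (hA : ContDiffOn ℝ ∞ A Ω)
    (hB : ContDiffOn ℝ ∞ B Ω) {c : (Fin n → ℝ) × FirstInvSpace n k} (hx : c.1 ∈ T.row.dom)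
    (hc : jet1Of I c.1 c.2 ∈ Ω) :
    ContDiffAt ℝ ∞ (fun c : (Fin n → ℝ) × FirstInvSpace n k => invConst I A B c.1 c.2) c :=
  contDiffAt_quasiLinear_jet2Of I hΩ hA hB hx hc _

variable (A B) in
/-- The length of the coefficient vector of a quasi-linear expression with respect to the
second-order invariants. -/
def invNorm (x : Fin n → ℝ) (w : FirstInvSpace n k) : ℝ :=
  √(∑ s, invCoeff I A B s x w * invCoeff I A B s x w)

theorem invNorm_pos {x : Fin n → ℝ} (hx : x ∈ T.row.dom) {w : FirstInvSpace n k}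
    (hA : A (jet1Of I x w) ≠ 0) : 0 < invNorm I A B x w := by
  obtain ⟨s, hs⟩ := exists_invCoeff_ne_zero I A B hx hA
  exact Real.sqrt_pos.2 (Finset.sum_pos' (fun s _ => mul_self_nonneg _)
    ⟨s, Finset.mem_univ s, mul_self_pos.2 hs⟩)

theorem contDiffAt_invNorm (hΩ : IsOpen Ω) (hA : ContDiffOn ℝ ∞ A Ω)
    (hB : ContDiffOn ℝ ∞ B Ω) {c : (Fin n → ℝ) × FirstInvSpace n k} (hx : c.1 ∈ T.row.dom)
    (hc : jet1Of I c.1 c.2 ∈ Ω) (hA₀ : A (jet1Of I c.1 c.2) ≠ 0) :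
    ContDiffAt ℝ ∞ (fun c : (Fin n → ℝ) × FirstInvSpace n k => invNorm I A B c.1 c.2) c := by
  refine ContDiffAt.sqrt (ContDiffAt.sum fun s _ => ?_)
    (Real.sqrt_pos.1 (invNorm_pos (B := B) I hx hA₀)).ne'
  exact (contDiffAt_invCoeff I hΩ hA hB hx hc s).mul (contDiffAt_invCoeff I hΩ hA hB hx hc s)

include I in
theorem contDiffAt_firstInv {j : Jet1 (Fin n ⊕ Fin k)} (hj : j ∈ T.dom1 k) :
    ContDiffAt ℝ ∞ (T.firstInv (k := k)) j := by
  have h : ContDiffAt ℝ ∞ (T.allInv (k := k)) (j.1, j.2.1, j.2.2, 0) := contDiffAt_allInv I hj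
  exact (h.comp j (f := fun j : Jet1 (Fin n ⊕ Fin k) => (j.1, j.2.1, j.2.2, 0))
    (by fun_prop)).fst

variable (A B) in
/-- The coefficients of the invariant form of a quasi-linear expression, over a given orbit point. -/
def normCoeff (x : Fin n → ℝ) (s : SecondIndex n k) (w : FirstInvSpace n k) : ℝ :=
  invCoeff I A B s x w / invNorm I A B x w

/-- With the coefficient on each unordered pair divided among its ordered representatives, the form
in the theorem becomes one sum over all second-order invariants. -/
theorem invariantQuasiLinear_eq (α : SecondIndex n k → FirstInvSpace n k → ℝ)
    (β : FirstInvSpace n k → ℝ) (j : Jet2 (Fin n ⊕ Fin k)) :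
    T.invariantQuasiLinear
      (fun w μ ν => α (Sum.inr (Sum.inr s(μ, ν))) w /
        (Finset.univ.filter fun p : Fin k × Fin k => s(p.1, p.2) = s(μ, ν)).card)
      (fun w s => α (Sum.inl s) w) (fun w μ i => α (Sum.inr (Sum.inl (μ, i))) w) β j =
    ∑ s, α s (T.firstInv j.toJet1) * secondCoord (T.allInv j).2 s + β (T.firstInv j.toJet1) := by
  rw [invariantQuasiLinear, Fintype.sum_sum_type, Fintype.sum_sum_type, Fintype.sum_prod_type]
  have h := sum_sym2_eq_sum_sum fun s : Sym2 (Fin k) =>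
    α (Sum.inr (Sum.inr s)) (T.firstInv j.toJet1) * j.2.2.2 (s.map Sum.inr)
  have h' : ∑ s, α (Sum.inr (Sum.inr s)) (T.firstInv j.toJet1) *
      secondCoord (T.allInv j).2 (Sum.inr (Sum.inr s)) = _ := h.symm
  rw [h', add_comm (∑ _, ∑ _, _) (∑ s, _), add_assoc (∑ s, _)]
  congr 2
  rw [add_comm]
  congr 1
  refine Finset.sum_congr rfl fun μ _ => Finset.sum_congr rfl fun ν _ => ?_
  simp only [Sym2.map_mk]
  ring

/-- An equation that admits the generators as symmetries has the same left-hand side on all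
points of an orbit, up to normalization. -/
theorem IsSymmetricEquationOver.quasiLinear_eq (hΩ : IsOpen Ω) (hA : ContDiffOn ℝ ∞ A Ω)
    (hB : ContDiffOn ℝ ∞ B Ω) (hA₀ : ∀ j ∈ Ω, A j ≠ 0)
    (h : T.IsSymmetricEquationOver k (quasiLinear A B) Ω) {D : Set (Fin n → ℝ)} (hD : IsOpen D)
    (hDc : IsPreconnected D) (hDs : D ⊆ T.row.dom) {w : FirstInvSpace n k}
    (hw : ∀ x ∈ D, jet1Of I x w ∈ Ω) {x x₀ : Fin n → ℝ} (hx : x ∈ D) (hx₀ : x₀ ∈ D)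
    (y : SecondIndex n k → ℝ) :
    quasiLinear A B (jet2Of I x (w, ofSecondCoord n k y)) = invNorm I A B x w *
      (∑ s, normCoeff I A B x₀ s w * y s + invConst I A B x₀ w / invNorm I A B x₀ w) := by
  have hc : ∀ x : Fin n → ℝ, ContDiffAt ℝ ∞ (fun x : Fin n → ℝ => (x, w)) x := fun x => by fun_prop
  have key := div_sqrt_eq_of_fderiv_eq_zero hD hDc (α := fun s x => invCoeff I A B s x w)
    (β := fun x => invConst I A B x w)
    (fun s x hx => (ContDiffAt.comp (g := fun c : (Fin n → ℝ) × FirstInvSpace n k =>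
      invCoeff I A B s c.1 c.2) x (contDiffAt_invCoeff (c := (x, w)) I hΩ hA hB (hDs hx)
        (hw x hx) s) (hc x)).differentiableAt (by simp))
    (fun x hx => (ContDiffAt.comp (g := fun c : (Fin n → ℝ) × FirstInvSpace n k =>
      invConst I A B c.1 c.2) x (contDiffAt_invConst (c := (x, w)) I hΩ hA hB (hDs hx)
        (hw x hx)) (hc x)).differentiableAt (by simp))
    (fun x hx => exists_invCoeff_ne_zero I A B (hDs hx) (hA₀ _ (hw x hx))) ?_ hx hx₀
  · obtain ⟨h₁, h₂⟩ := key
    have hpos := invNorm_pos (B := B) I (hDs hx) (hA₀ _ (hw x hx))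
    have e₁ : ∀ s, normCoeff I A B x₀ s w = invCoeff I A B s x w / invNorm I A B x w :=
      fun s => (h₁ s).symm
    have e₂ : invConst I A B x₀ w / invNorm I A B x₀ w =
      invConst I A B x w / invNorm I A B x w := h₂.symm
    have e₃ : invNorm I A B x w * (invConst I A B x w / invNorm I A B x w) =
      invConst I A B x w := by field_simp
    rw [quasiLinear_eq_sum, e₂, mul_add (invNorm I A B x w), Finset.mul_sum, e₃]
    congr 1
    refine Finset.sum_congr rfl fun s _ => ?_
    rw [e₁]
    field_simp
  · intro x hx y hy
    have hf : (fun x => ∑ s, invCoeff I A B s x w * y s + invConst I A B x w) =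
        fun x => quasiLinear A B (jet2Of I x (w, ofSecondCoord n k y)) :=
      funext fun x => (quasiLinear_eq_sum I A B x w y).symm
    -- Along a slice, the derivative of E in the direction X_i is its derivative along the prolonged
    -- generator, and symmetry makes this zero wherever E = 0.
    have hy' : quasiLinear A B (jet2Of I x (w, ofSecondCoord n k y)) = 0 := by
      rw [quasiLinear_eq_sum]; exact hy
    rw [hf, (hasFDerivAt_comp_jet2Of I (hDs hx) _ ((contDiffAt_quasiLinear
      (j := jet2Of I x (w, ofSecondCoord n k y)) hΩ hA hB (hw x hx)).differentiableAt
      (by simp))).fderiv]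
    refine clm_eq_zero_of_gen I (hDs hx) fun i => ?_
    rw [ContinuousLinearMap.comp_apply, fderiv_jet2Of_gen I (hDs hx)]
    exact h (jet2Of I x (w, ofSecondCoord n k y)) (hw x hx) hy' i

/-- Invariant representation over the product of a part of an orbit with a set of values of the
first-order invariants. -/
theorem IsSymmetricEquationOver.exists_representation (hΩ : IsOpen Ω) (hA : ContDiffOn ℝ ∞ A Ω)
    (hB : ContDiffOn ℝ ∞ B Ω) (hA₀ : ∀ j ∈ Ω, A j ≠ 0)
    (h : T.IsSymmetricEquationOver k (quasiLinear A B) Ω) {D : Set (Fin n → ℝ)} (hD : IsOpen D)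
    (hDc : IsPreconnected D) (hDs : D ⊆ T.row.dom) {V : Set (FirstInvSpace n k)}
    (hV : ∀ x ∈ D, ∀ w ∈ V, jet1Of I x w ∈ Ω) {x₀ : Fin n → ℝ} (hx₀ : x₀ ∈ D) :
    ∃ (a : FirstInvSpace n k → Fin k → Fin k → ℝ)
      (b : FirstInvSpace n k → Fin (n * (n + 1) / 2) → ℝ)
      (c : FirstInvSpace n k → Fin k → Fin n → ℝ) (d : FirstInvSpace n k → ℝ)
      (g : Jet1 (Fin n ⊕ Fin k) → ℝ),
      ContDiffOn ℝ ∞ a V ∧ ContDiffOn ℝ ∞ b V ∧ ContDiffOn ℝ ∞ c V ∧ ContDiffOn ℝ ∞ d V ∧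
      ∀ W : Set (Jet1 (Fin n ⊕ Fin k)), W ⊆ T.dom1 k →
        (∀ j ∈ W, orbitCoord n k j.1 ∈ D ∧ T.firstInv j ∈ V) →
        ContDiffOn ℝ ∞ g W ∧ (∀ j ∈ W, g j ≠ 0) ∧
        ∀ j : Jet2 (Fin n ⊕ Fin k), j.toJet1 ∈ W →
          quasiLinear A B j = g j.toJet1 * T.invariantQuasiLinear a b c d j := by
  have hc₀ : ∀ w : FirstInvSpace n k, ContDiffAt ℝ ∞ (fun w : FirstInvSpace n k => (x₀, w)) w :=
    fun w => by fun_prop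
  have hN : ∀ w ∈ V, ContDiffAt ℝ ∞ (fun w => invNorm I A B x₀ w) w := fun w hw =>
    (contDiffAt_invNorm (c := (x₀, w)) I hΩ hA hB (hDs hx₀) (hV x₀ hx₀ w hw)
      (hA₀ _ (hV x₀ hx₀ w hw))).comp w (hc₀ w)
  have hN₀ : ∀ w ∈ V, invNorm I A B x₀ w ≠ 0 := fun w hw =>
    (invNorm_pos I (hDs hx₀) (hA₀ _ (hV x₀ hx₀ w hw))).ne'
  have hC : ∀ s, ContDiffOn ℝ ∞ (normCoeff I A B x₀ s) V := fun s w hw =>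
    (((contDiffAt_invCoeff (c := (x₀, w)) I hΩ hA hB (hDs hx₀) (hV x₀ hx₀ w hw) s).comp w
      (hc₀ w)).div (hN w hw) (hN₀ w hw)).contDiffWithinAt
  -- The coefficients are those over x₀, divided by their length; the factor g is the length over
  -- the actual point x.
  refine ⟨fun w μ ν => normCoeff I A B x₀ (Sum.inr (Sum.inr s(μ, ν))) w /
      (Finset.univ.filter fun p : Fin k × Fin k => s(p.1, p.2) = s(μ, ν)).card,
    fun w s => normCoeff I A B x₀ (Sum.inl s) w,
    fun w μ i => normCoeff I A B x₀ (Sum.inr (Sum.inl (μ, i))) w,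
    fun w => invConst I A B x₀ w / invNorm I A B x₀ w,
    fun j => invNorm I A B (orbitCoord n k j.1) (T.firstInv j), ?_, ?_, ?_, ?_, ?_⟩
  · exact contDiffOn_pi.2 fun μ => contDiffOn_pi.2 fun ν => (hC _).div_const _
  · exact contDiffOn_pi.2 fun s => hC _
  · exact contDiffOn_pi.2 fun μ => contDiffOn_pi.2 fun i => hC _
  · exact fun w hw => (((contDiffAt_invConst (c := (x₀, w)) I hΩ hA hB (hDs hx₀)
      (hV x₀ hx₀ w hw)).comp w (hc₀ w)).div (hN w hw) (hN₀ w hw)).contDiffWithinAt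
  · intro W hWd hW
    refine ⟨fun j hj => ?_, fun j hj => ?_, fun j hj => ?_⟩
    · obtain ⟨h₁, h₂⟩ := hW j hj
      exact (ContDiffAt.comp (f := fun j : Jet1 (Fin n ⊕ Fin k) => (orbitCoord n k j.1, T.firstInv j))
        (g := fun c : (Fin n → ℝ) × FirstInvSpace n k => invNorm I A B c.1 c.2) j
        (contDiffAt_invNorm (c := (orbitCoord n k j.1, T.firstInv j)) I hΩ hA hB (hDs h₁)
          (hV _ h₁ _ h₂) (hA₀ _ (hV _ h₁ _ h₂)))
        (((orbitCoord n k).contDiff.contDiffAt.comp j contDiffAt_fst).prodMk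
          (contDiffAt_firstInv I (hWd hj)))).contDiffWithinAt
    · obtain ⟨h₁, h₂⟩ := hW j hj
      exact (invNorm_pos I (hDs h₁) (hA₀ _ (hV _ h₁ _ h₂))).ne'
    · obtain ⟨h₁, h₂⟩ := hW _ hj
      have hj' : j ∈ T.dom2 k := hWd hj
      have e := h.quasiLinear_eq I hΩ hA hB hA₀ hD hDc hDs
        (fun x hx => hV x hx _ h₂) h₁ hx₀ (secondCoord (T.allInv j).2)
      rw [invariantQuasiLinear_eq (T := T) (fun s => normCoeff I A B x₀ s)
        (fun w => invConst I A B x₀ w / invNorm I A B x₀ w) j, ← e, ofSecondCoord_secondCoord]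
      congr 1
      exact (jet2Of_allInv I hj').symm

include I

/-- The expressions built from the invariants define equations that admit the generators as
symmetries. -/
theorem fderiv_quasiLinear_pr2Gen {a : FirstInvSpace n k → Fin k → Fin k → ℝ}
    {b : FirstInvSpace n k → Fin (n * (n + 1) / 2) → ℝ}
    {c : FirstInvSpace n k → Fin k → Fin n → ℝ} {d : FirstInvSpace n k → ℝ}
    {g : Jet1 (Fin n ⊕ Fin k) → ℝ} {V : Set (FirstInvSpace n k)} (hV : IsOpen V)
    (ha : ContDiffOn ℝ ∞ a V) (hb : ContDiffOn ℝ ∞ b V) (hc : ContDiffOn ℝ ∞ c V)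
    (hd : ContDiffOn ℝ ∞ d V) {W : Set (Jet1 (Fin n ⊕ Fin k))} (hW : IsOpen W)
    (hg : ContDiffOn ℝ ∞ g W) (hg₀ : ∀ w ∈ W, g w ≠ 0)
    (hE : ∀ j : Jet2 (Fin n ⊕ Fin k), j.toJet1 ∈ W →
      quasiLinear A B j = g j.toJet1 * T.invariantQuasiLinear a b c d j)
    {j : Jet2 (Fin n ⊕ Fin k)} (hj : j ∈ T.dom2 k) (hjW : j.toJet1 ∈ W)
    (hjV : T.firstInv j.toJet1 ∈ V) (hj₀ : quasiLinear A B j = 0) (i : Fin n) :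
    fderiv ℝ (quasiLinear A B) j (T.pr2Gen k i j) = 0 := by
  let f : InvSpace n k → ℝ := fun w =>
    (∑ μ, ∑ ν, a w.1 μ ν * w.2.2.2 s(μ, ν)) + (∑ s, b w.1 s * w.2.1 s) +
      (∑ μ, ∑ i, c w.1 μ i * w.2.2.1 μ i) + d w.1
  have hf : ContDiffAt ℝ ∞ f (T.allInv j) := by
    have ha' : ∀ μ ν, ContDiffAt ℝ ∞ (fun w : InvSpace n k => a w.1 μ ν) (T.allInv j) :=
      fun μ ν => contDiffAt_pi.1 (contDiffAt_pi.1 (ContDiffAt.comp (g := a) (T.allInv j)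
        (ha.contDiffAt (hV.mem_nhds hjV)) contDiffAt_fst) μ) ν
    have hb' : ∀ s, ContDiffAt ℝ ∞ (fun w : InvSpace n k => b w.1 s) (T.allInv j) :=
      fun s => contDiffAt_pi.1 (ContDiffAt.comp (g := b) (T.allInv j)
        (hb.contDiffAt (hV.mem_nhds hjV)) contDiffAt_fst) s
    have hc' : ∀ μ i, ContDiffAt ℝ ∞ (fun w : InvSpace n k => c w.1 μ i) (T.allInv j) :=
      fun μ i => contDiffAt_pi.1 (contDiffAt_pi.1 (ContDiffAt.comp (g := c) (T.allInv j)
        (hc.contDiffAt (hV.mem_nhds hjV)) contDiffAt_fst) μ) i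
    have hd' : ContDiffAt ℝ ∞ (fun w : InvSpace n k => d w.1) (T.allInv j) :=
      ContDiffAt.comp (g := d) (T.allInv j) (hd.contDiffAt (hV.mem_nhds hjV)) contDiffAt_fst
    refine (((ContDiffAt.sum fun μ _ => ContDiffAt.sum fun ν _ => (ha' μ ν).mul ?_).add
      (ContDiffAt.sum fun s _ => (hb' s).mul ?_)).add
      (ContDiffAt.sum fun μ _ => ContDiffAt.sum fun i _ => (hc' μ i).mul ?_)).add hd' <;> fun_prop
  have ht : ContDiffAt ℝ ∞ (Jet2.toJet1 : Jet2 (Fin n ⊕ Fin k) → Jet1 (Fin n ⊕ Fin k)) j := by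
    unfold Jet2.toJet1; fun_prop
  have hG₁ : DifferentiableAt ℝ (fun j : Jet2 (Fin n ⊕ Fin k) => g j.toJet1) j :=
    (ContDiffAt.comp (g := g) j (hg.contDiffAt (hW.mem_nhds hjW)) ht).differentiableAt (by simp)
  have hG₂ : DifferentiableAt ℝ (fun j => f (T.allInv j)) j :=
    (ContDiffAt.comp (g := f) j hf (contDiffAt_allInv I hj)).differentiableAt (by simp)
  have hev : quasiLinear A B =ᶠ[𝓝 j] fun j => g j.toJet1 * f (T.allInv j) := by
    filter_upwards [(isOpen_preimage_toJet1 hW).mem_nhds hjW] with j' hj' using hE j' hj'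
  -- Because g has no zeros, the invariant factor vanishes where E does, which removes the term
  -- containing the derivative of g.
  have hz : f (T.allInv j) = 0 := by
    have h₁ := hE j hjW
    rw [hj₀] at h₁
    exact (mul_eq_zero.1 h₁.symm).resolve_left (hg₀ _ hjW)
  rw [hev.fderiv_eq, fderiv_mul_apply' hG₁ hG₂, hz, mul_zero, zero_add,
    fderiv_comp_allInv_pr2Gen I hj (f := f) (hf.differentiableAt (by simp))
      (Eventually.of_forall fun _ => rfl), mul_zero]

/-- The representation is obtained on a product of balls in the coordinates (x, first-order
invariants), whose slices in x are connected. -/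
theorem isSymmetricEquationOver_iff_local (hΩ : IsOpen Ω) (hΩd : Ω ⊆ T.dom1 k)
    (hA : ContDiffOn ℝ ∞ A Ω) (hB : ContDiffOn ℝ ∞ B Ω) (hA₀ : ∀ j ∈ Ω, A j ≠ 0) :
    T.IsSymmetricEquationOver k (quasiLinear A B) Ω ↔
      ∀ j₀ ∈ Ω, ∃ W ⊆ Ω, IsOpen W ∧ j₀ ∈ W ∧
        ∃ (V : Set (FirstInvSpace n k)) (a : FirstInvSpace n k → Fin k → Fin k → ℝ)
          (b : FirstInvSpace n k → Fin (n * (n + 1) / 2) → ℝ)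
          (c : FirstInvSpace n k → Fin k → Fin n → ℝ) (d : FirstInvSpace n k → ℝ)
          (g : Jet1 (Fin n ⊕ Fin k) → ℝ),
          IsOpen V ∧ Set.MapsTo T.firstInv W V ∧
          ContDiffOn ℝ ∞ a V ∧ ContDiffOn ℝ ∞ b V ∧
          ContDiffOn ℝ ∞ c V ∧ ContDiffOn ℝ ∞ d V ∧
          ContDiffOn ℝ ∞ g W ∧ (∀ w ∈ W, g w ≠ 0) ∧
          ∀ j : Jet2 (Fin n ⊕ Fin k), j.toJet1 ∈ W →
            quasiLinear A B j = g j.toJet1 * T.invariantQuasiLinear a b c d j := by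
  constructor
  · intro h j hj
    have hx : orbitCoord n k j.1 ∈ T.row.dom := hΩd hj
    have hS : ∀ᶠ c : (Fin n → ℝ) × FirstInvSpace n k in 𝓝 (orbitCoord n k j.1, T.firstInv j),
        c.1 ∈ T.row.dom ∧ jet1Of I c.1 c.2 ∈ Ω := by
      refine (continuousAt_fst.eventually (I.isOpen_dom.mem_nhds hx)).and ?_
      refine (contDiffAt_jet1Of I hx (T.firstInv j)).continuousAt.eventually (hΩ.mem_nhds ?_)
      change jet1Of I (orbitCoord n k j.1) (T.firstInv j) ∈ Ω
      rwa [jet1Of_firstInv I (hΩd hj)]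
    obtain ⟨ε, hε, hball⟩ := Metric.eventually_nhds_iff_ball.1 hS
    have hmem : ∀ x ∈ Metric.ball (orbitCoord n k j.1) ε, ∀ w ∈ Metric.ball (T.firstInv j) ε,
        x ∈ T.row.dom ∧ jet1Of I x w ∈ Ω := fun x hx w hw =>
      hball (x, w) (by rw [← ball_prod_same]; exact ⟨hx, hw⟩)
    have hxb := Metric.mem_ball_self (x := orbitCoord n k j.1) hε
    have hwb := Metric.mem_ball_self (x := T.firstInv j) hε
    have hcont : ContinuousOn (fun j : Jet1 (Fin n ⊕ Fin k) => (orbitCoord n k j.1, T.firstInv j))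
        (T.dom1 k) := fun j hj =>
      (((orbitCoord n k).continuous.comp continuous_fst).continuousAt.prodMk
        (contDiffAt_firstInv I hj).continuousAt).continuousWithinAt
    obtain ⟨a, b, c, d, g, ha, hb, hc, hd, hW⟩ := h.exists_representation I hΩ hA hB hA₀
      Metric.isOpen_ball (convex_ball (orbitCoord n k j.1) ε).isPreconnected
      (fun x hx => (hmem x hx _ hwb).1) (fun x hx w hw => (hmem x hx w hw).2) hxb
    obtain ⟨hg, hg₀, hE⟩ := hW (T.dom1 k ∩ (fun j : Jet1 (Fin n ⊕ Fin k) =>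
        (orbitCoord n k j.1, T.firstInv j)) ⁻¹'
        (Metric.ball (orbitCoord n k j.1) ε ×ˢ Metric.ball (T.firstInv j) ε))
      inter_subset_left (fun j hj => hj.2)
    refine ⟨_, ?_, hcont.isOpen_inter_preimage (isOpen_dom1 I k)
      (Metric.isOpen_ball.prod Metric.isOpen_ball), ⟨hΩd hj, hxb, hwb⟩,
      Metric.ball (T.firstInv j) ε, a, b, c, d, g, Metric.isOpen_ball, fun j hj => hj.2.2,
      ha, hb, hc, hd, hg, hg₀, hE⟩
    rintro j' ⟨hj', h₁, h₂⟩
    have h₃ := (hmem _ h₁ _ h₂).2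
    rwa [jet1Of_firstInv I hj'] at h₃
  · intro h j hj hj₀ i
    obtain ⟨W, -, hW, hjW, V, a, b, c, d, g, hV, hWV, ha, hb, hc, hd, hg, hg₀, hE⟩ := h _ hj
    exact fderiv_quasiLinear_pr2Gen I hV ha hb hc hd hW hg hg₀ hE (hΩd hj) hjW (hWV hjW) hj₀ i

/-- Here D is all of the row's domain, the base point is 0, and all values of the first-order
invariants are admitted, so the coefficients are defined everywhere. -/
theorem isSymmetricEquationOver_iff_global (hA : ContDiffOn ℝ ∞ A (T.dom1 k))
    (hB : ContDiffOn ℝ ∞ B (T.dom1 k)) (hA₀ : ∀ j ∈ T.dom1 k, A j ≠ 0) :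
    T.IsSymmetricEquationOver k (quasiLinear A B) (T.dom1 k) ↔
      ∃ (a : FirstInvSpace n k → Fin k → Fin k → ℝ)
        (b : FirstInvSpace n k → Fin (n * (n + 1) / 2) → ℝ)
        (c : FirstInvSpace n k → Fin k → Fin n → ℝ) (d : FirstInvSpace n k → ℝ)
        (g : Jet1 (Fin n ⊕ Fin k) → ℝ),
        ContDiff ℝ ∞ a ∧ ContDiff ℝ ∞ b ∧ ContDiff ℝ ∞ c ∧ ContDiff ℝ ∞ d ∧
        ContDiffOn ℝ ∞ g (T.dom1 k) ∧ (∀ j ∈ T.dom1 k, g j ≠ 0) ∧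
        ∀ j : Jet2 (Fin n ⊕ Fin k), j.toJet1 ∈ T.dom1 k →
          quasiLinear A B j = g j.toJet1 * T.invariantQuasiLinear a b c d j := by
  have hΩ := isOpen_dom1 I k
  constructor
  · intro h
    obtain ⟨a, b, c, d, g, ha, hb, hc, hd, hW⟩ := h.exists_representation I hΩ hA hB hA₀
      I.isOpen_dom I.convex_dom.isPreconnected subset_rfl (V := univ)
      (fun x hx w _ => jet1Of_mem_dom1 I hx w) I.zero_mem_dom
    obtain ⟨hg, hg₀, hE⟩ := hW (T.dom1 k) subset_rfl fun j hj => ⟨hj, mem_univ _⟩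
    exact ⟨a, b, c, d, g, contDiffOn_univ.1 ha, contDiffOn_univ.1 hb, contDiffOn_univ.1 hc,
      contDiffOn_univ.1 hd, hg, hg₀, hE⟩
  · rintro ⟨a, b, c, d, g, ha, hb, hc, hd, hg, hg₀, hE⟩ j hj hj₀ i
    exact fderiv_quasiLinear_pr2Gen I isOpen_univ ha.contDiffOn hb.contDiffOn hc.contDiffOn
      hd.contDiffOn hΩ hg hg₀ hE hj hj (mem_univ _) hj₀ i

end QuasiLinear

end LowDimAlg

end

noncomputable section

open Set Filter Topology

/-! ### Semidirect products of ℝ and ℝ² -/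

section LieBases

variable {L : Type*} [LieRing L] [LieAlgebra ℝ L]

theorem Module.Basis.exists_of_det_ne_zero {n : ℕ} (b : Module.Basis (Fin n) ℝ L)
    (P : Matrix (Fin n) (Fin n) ℝ) (hP : P.det ≠ 0) :
    ∃ b' : Module.Basis (Fin n) ℝ L, ∀ i, b' i = ∑ j, P i j • b j := by
  have h : LinearIndependent ℝ fun i => b.equivFun.symm (P i) :=
    (Matrix.linearIndependent_rows_of_det_ne_zero hP).map'
      (b.equivFun.symm : (Fin n → ℝ) →ₗ[ℝ] L) (LinearEquiv.ker _)
  have : Module.Finite ℝ L := Module.Finite.of_basis b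
  by_cases hn : n = 0
  · subst hn
    exact ⟨b, fun i => i.elim0⟩
  have : Nonempty (Fin n) := ⟨⟨0, Nat.pos_of_ne_zero hn⟩⟩
  refine ⟨basisOfLinearIndependentOfCardEqFinrank h (Module.finrank_eq_card_basis b).symm,
    fun i => ?_⟩
  rw [coe_basisOfLinearIndependentOfCardEqFinrank, Module.Basis.equivFun_symm_apply]

theorem Module.Basis.exists_three (b : Module.Basis (Fin 3) ℝ L)
    (P : Matrix (Fin 3) (Fin 3) ℝ) (hP : P.det ≠ 0) :
    ∃ b' : Module.Basis (Fin 3) ℝ L,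
      ∀ i, b' i = P i 0 • b 0 + P i 1 • b 1 + P i 2 • b 2 := by
  obtain ⟨b', hb'⟩ := b.exists_of_det_ne_zero P hP
  exact ⟨b', fun i => by rw [hb', Fin.sum_univ_three]⟩

namespace LowDimAlg

theorem isAdapted_of_brackets3 {T : LowDimAlg 3} {c₁₂ c₁₃ c₂₃ : Fin 3 → ℝ}
    (hT : T.row.bracket = TableRow.brackets3 c₁₂ c₁₃ c₂₃) {b : Module.Basis (Fin 3) ℝ L}
    (h₁₂ : ⁅b 0, b 1⁆ = c₁₂ 0 • b 0 + c₁₂ 1 • b 1 + c₁₂ 2 • b 2)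
    (h₁₃ : ⁅b 0, b 2⁆ = c₁₃ 0 • b 0 + c₁₃ 1 • b 1 + c₁₃ 2 • b 2)
    (h₂₃ : ⁅b 1, b 2⁆ = c₂₃ 0 • b 0 + c₂₃ 1 • b 1 + c₂₃ 2 • b 2) : T.IsAdapted b := by
  have h₂₁ := lie_skew (b 1) (b 0)
  have h₃₁ := lie_skew (b 2) (b 0)
  have h₃₂ := lie_skew (b 2) (b 1)
  rw [h₁₂] at h₂₁
  rw [h₁₃] at h₃₁
  rw [h₂₃] at h₃₂
  intro i j
  rw [hT, Fin.sum_univ_three]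
  fin_cases i <;> fin_cases j <;>
    simp [TableRow.brackets3, h₁₂, h₁₃, h₂₃, ← h₂₁, ← h₃₁, ← h₃₂] <;> abel

/-- The commutation relations of a semidirect product of `ℝ` and the abelian algebra `ℝ²`. -/
def SemidirectForm (b : Module.Basis (Fin 3) ℝ L) (m : Matrix (Fin 2) (Fin 2) ℝ) : Prop :=
  ⁅b 0, b 1⁆ = 0 ∧ ⁅b 0, b 2⁆ = m 0 0 • b 0 + m 0 1 • b 1 ∧
    ⁅b 1, b 2⁆ = m 1 0 • b 0 + m 1 1 • b 1

/-- The commutation relations of an algebra with diagonal structure matrix. -/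
def DiagonalForm (b : Module.Basis (Fin 3) ℝ L) (l : Fin 3 → ℝ) : Prop :=
  ⁅b 1, b 2⁆ = l 0 • b 0 ∧ ⁅b 2, b 0⁆ = l 1 • b 1 ∧ ⁅b 0, b 1⁆ = l 2 • b 2

/-- The matrix P changes the basis of the abelian ideal and t rescales the third vector; m turns
into t P m P⁻¹. -/
theorem SemidirectForm.exists_basis {b : Module.Basis (Fin 3) ℝ L} {m : Matrix (Fin 2) (Fin 2) ℝ}
    (h : SemidirectForm b m) (P m' : Matrix (Fin 2) (Fin 2) ℝ) (t : ℝ) (ht : t ≠ 0)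
    (hP : P.det ≠ 0) (hm : t • (P * m) = m' * P) :
    ∃ b' : Module.Basis (Fin 3) ℝ L, SemidirectForm b' m' := by
  obtain ⟨b', hb'⟩ := b.exists_three !![P 0 0, P 0 1, 0; P 1 0, P 1 1, 0; 0, 0, t] (by
    rw [Matrix.det_fin_two] at hP
    simp only [Matrix.det_fin_three, Matrix.of_apply, Matrix.cons_val', Matrix.cons_val_zero,
      Matrix.cons_val_one, Matrix.cons_val, Matrix.cons_val_fin_one]
    have := mul_ne_zero hP ht
    intro h0
    apply this
    linear_combination h0)
  have e₀ : b' 0 = P 0 0 • b 0 + P 0 1 • b 1 := by simpa using hb' 0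
  have e₁ : b' 1 = P 1 0 • b 0 + P 1 1 • b 1 := by simpa using hb' 1
  have e₂ : b' 2 = t • b 2 := by simpa using hb' 2
  obtain ⟨h₁, h₂, h₃⟩ := h
  have h₁' : ⁅b 1, b 0⁆ = 0 := by rw [← lie_skew, h₁, neg_zero]
  have hm' : ∀ i j, t * (P i 0 * m 0 j + P i 1 * m 1 j) = m' i 0 * P 0 j + m' i 1 * P 1 j := by
    intro i j
    have := congrFun (congrFun hm i) j
    simpa [Matrix.mul_apply, Fin.sum_univ_two] using this
  have key : ∀ i, ⁅P i 0 • b 0 + P i 1 • b 1, t • b 2⁆ =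
      m' i 0 • (P 0 0 • b 0 + P 0 1 • b 1) + m' i 1 • (P 1 0 • b 0 + P 1 1 • b 1) := by
    intro i
    have e : ⁅P i 0 • b 0 + P i 1 • b 1, t • b 2⁆ =
        (t * (P i 0 * m 0 0 + P i 1 * m 1 0)) • b 0 +
          (t * (P i 0 * m 0 1 + P i 1 * m 1 1)) • b 1 := by
      simp only [add_lie, smul_lie, lie_smul, h₂, h₃]
      module
    rw [e, hm', hm']
    module
  refine ⟨b', ?_, ?_, ?_⟩
  · rw [e₀, e₁]
    simp [h₁, h₁']
  · rw [e₀, e₁, e₂]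
    exact key 0
  · rw [e₀, e₁, e₂]
    exact key 1

/-- For example, [c_1 b_1, c_2 b_2] = c_1 c_2 l_0 b_0, which is c_1 c_2 / c_0 · l_0 times the new
vector c_0 b_0. -/
theorem DiagonalForm.exists_smul {b : Module.Basis (Fin 3) ℝ L} {l : Fin 3 → ℝ}
    (h : DiagonalForm b l) (c : Fin 3 → ℝ) (hc : ∀ i, c i ≠ 0) :
    ∃ b' : Module.Basis (Fin 3) ℝ L, DiagonalForm b'
      ![c 1 * c 2 / c 0 * l 0, c 2 * c 0 / c 1 * l 1, c 0 * c 1 / c 2 * l 2] := by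
  obtain ⟨b', hb'⟩ := b.exists_of_det_ne_zero (Matrix.diagonal c) (by
    rw [Matrix.det_diagonal]; exact Finset.prod_ne_zero_iff.2 fun i _ => hc i)
  have e : ∀ i, b' i = c i • b i := fun i => by rw [hb']; simp [Matrix.diagonal_apply]
  obtain ⟨h₁, h₂, h₃⟩ := h
  have h0 := hc 0
  have h1 := hc 1
  have h2 := hc 2
  refine ⟨b', ?_, ?_, ?_⟩ <;>
    simp only [e, smul_lie, lie_smul, h₁, h₂, h₃, smul_smul, Matrix.cons_val_zero,
      Matrix.cons_val_one, Matrix.cons_val] <;> congr 1 <;> field_simp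

theorem DiagonalForm.exists_rotate {b : Module.Basis (Fin 3) ℝ L} {l : Fin 3 → ℝ}
    (h : DiagonalForm b l) : ∃ b' : Module.Basis (Fin 3) ℝ L, DiagonalForm b' ![l 1, l 2, l 0] := by
  obtain ⟨h₁, h₂, h₃⟩ := h
  obtain ⟨b', hb'⟩ := b.exists_three !![0, 1, 0; 0, 0, 1; 1, 0, 0] (by simp [Matrix.det_fin_three])
  have e₀ : b' 0 = b 1 := by simpa using hb' 0
  have e₁ : b' 1 = b 2 := by simpa using hb' 1
  have e₂ : b' 2 = b 0 := by simpa using hb' 2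
  exact ⟨b', by rw [e₀, e₁, e₂]; exact h₂, by rw [e₀, e₁, e₂]; exact h₃,
    by rw [e₀, e₁, e₂]; exact h₁⟩

/-- The algebra `L` has a basis with the commutation relations of some row. -/
def HasAdaptedBasis (n : ℕ) (L : Type*) [LieRing L] [LieAlgebra ℝ L] : Prop :=
  ∃ (T : LowDimAlg n) (b : Module.Basis (Fin n) ℝ L), T.IsAdapted b

theorem SemidirectForm.hasAdaptedBasis_of_bracket {b : Module.Basis (Fin 3) ℝ L}
    {m : Matrix (Fin 2) (Fin 2) ℝ} (h : SemidirectForm b m) {T : LowDimAlg 3}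
    (hT : T.row.bracket = TableRow.brackets3 0 ![m 0 0, m 0 1, 0] ![m 1 0, m 1 1, 0]) :
    HasAdaptedBasis 3 L :=
  ⟨T, b, isAdapted_of_brackets3 hT (by simpa using h.1) (by simpa using h.2.1)
    (by simpa using h.2.2)⟩

/-- Dividing by the eigenvalue of larger modulus gives eigenvalues 1 and h = y / x with |h| ≤ 1. For
h = 0 the second vector is central and splits off, which is 𝔤¹ + 𝔤². -/
theorem SemidirectForm.hasAdaptedBasis_of_diagonal {b : Module.Basis (Fin 3) ℝ L} {x y : ℝ}
    (h : SemidirectForm b !![x, 0; 0, y]) (hxy : x ≠ y) (hx : x ≠ 0) (hle : |y| ≤ |x|) :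
    HasAdaptedBasis 3 L := by
  obtain ⟨b', h'⟩ := h.exists_basis 1 !![1, 0; 0, y / x] x⁻¹ (inv_ne_zero hx) (by simp) (by
    ext i j
    fin_cases i <;> fin_cases j <;> simp [hx]
    field_simp)
  by_cases hy : y = 0
  · obtain ⟨b'', hb''⟩ := b'.exists_three !![1, 0, 0; 0, 0, 1; 0, 1, 0]
      (by simp [Matrix.det_fin_three])
    have e₀ : b'' 0 = b' 0 := by simpa using hb'' 0
    have e₁ : b'' 1 = b' 2 := by simpa using hb'' 1
    have e₂ : b'' 2 = b' 1 := by simpa using hb'' 2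
    obtain ⟨h₁, h₂, h₃⟩ := h'
    refine ⟨g1_add_g2, b'', isAdapted_of_brackets3 rfl ?_ ?_ ?_⟩ <;> rw [e₀, e₁, e₂]
    · simpa using h₂
    · simpa using h₁
    · rw [← lie_skew, h₃]
      simp [hy]
  · refine h'.hasAdaptedBasis_of_bracket (T := g3_4 (y / x) ?_ (div_ne_zero hy hx) ?_) ?_
    · rw [abs_div]
      exact div_le_one_of_le₀ hle (abs_nonneg _)
    · rw [Ne, div_eq_one_iff_eq hx]
      exact hxy.symm
    · simp [row, TableRow.g3_4]

/-- Only conjugation and scaling of m are available, so the cases are its Jordan types over ℝ,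
separated by the discriminant d of the characteristic polynomial. -/
theorem SemidirectForm.hasAdaptedBasis {b : Module.Basis (Fin 3) ℝ L}
    {m : Matrix (Fin 2) (Fin 2) ℝ} (h : SemidirectForm b m) : HasAdaptedBasis 3 L := by
  set s := m 0 0 + m 1 1 with hs
  set d := s ^ 2 - 4 * (m 0 0 * m 1 1 - m 0 1 * m 1 0) with hd
  rcases lt_trichotomy d 0 with hneg | hzero | hpos
  · -- complex eigenvalues
    -- The eigenvalues are (s ± i r) / 2, and scaling by 2 / r makes them p ± i with p = s / r. The
    -- sign of r is chosen so that p ≥ 0.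
    obtain ⟨r, hr, hr2, hrs⟩ : ∃ r : ℝ, r ≠ 0 ∧ r ^ 2 = -d ∧ 0 ≤ s / r := by
      have hq := Real.sq_sqrt (neg_pos.2 hneg).le
      have hp := Real.sqrt_pos.2 (neg_pos.2 hneg)
      rcases le_total 0 s with h0 | h0
      · exact ⟨√(-d), hp.ne', hq, div_nonneg h0 hp.le⟩
      · exact ⟨-√(-d), neg_ne_zero.2 hp.ne', by rw [neg_sq, hq],
          div_nonneg_of_nonpos h0 (neg_nonpos.2 hp.le)⟩
    have hm01 : m 0 1 ≠ 0 := by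
      intro h0
      rw [hd, hs, h0] at hneg
      nlinarith [sq_nonneg (m 0 0 - m 1 1)]
    -- With first row (1, 0), the first row of the conjugation equation forces the second row of P;
    -- the second row of the equation is then the Cayley–Hamilton identity.
    obtain ⟨b', h'⟩ := h.exists_basis !![1, 0; s / r - 2 / r * m 0 0, -(2 / r * m 0 1)]
      !![s / r, -1; 1, s / r] (2 / r) (div_ne_zero two_ne_zero hr)
      (by rw [Matrix.det_fin_two]
          simp
          exact ⟨hr, hm01⟩) (by
      have hr2' : r ^ 2 = 4 * (m 0 0 * m 1 1 - m 0 1 * m 1 0) - (m 0 0 + m 1 1) ^ 2 := by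
        rw [hr2, hd, hs]; ring
      ext i j
      fin_cases i <;> fin_cases j <;>
        simp [Matrix.mul_apply, Fin.sum_univ_two, Matrix.vecMul, dotProduct] <;> rw [hs] <;>
        field_simp <;> first | ring1 | linear_combination hr2' | linear_combination -hr2')
    refine h'.hasAdaptedBasis_of_bracket (T := g3_5 (s / r) hrs) ?_
    simp [row, TableRow.g3_5]
  · -- a double eigenvalue
    have hz : (m 0 0 - m 1 1) ^ 2 + 4 * (m 0 1 * m 1 0) = 0 := by
      rw [hd, hs] at hzero; linear_combination hzero
    by_cases hsc : m 0 1 = 0 ∧ m 1 0 = 0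
    · have hmm : m 0 0 = m 1 1 := by
        rw [hsc.1, zero_mul, mul_zero, add_zero] at hz
        exact sub_eq_zero.1 (pow_eq_zero_iff two_ne_zero |>.1 hz)
      by_cases h0 : m 0 0 = 0
      · refine h.hasAdaptedBasis_of_bracket (T := threeG1) ?_
        ext i j l
        rw [← hmm, hsc.1, hsc.2, h0]
        fin_cases i <;> fin_cases j <;> fin_cases l <;>
          simp [row, TableRow.threeG1, TableRow.brackets3]
      · obtain ⟨b', h'⟩ := h.exists_basis 1 1 (m 0 0)⁻¹ (inv_ne_zero h0) (by simp) (by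
          ext i j
          fin_cases i <;> fin_cases j <;> simp [hsc.1, hsc.2, ← hmm, h0])
        refine h'.hasAdaptedBasis_of_bracket (T := g3_3) ?_
        simp [row, TableRow.g3_3]
    · obtain ⟨u, w, hw⟩ : ∃ u w : ℝ,
          (u * (m 0 0 - s / 2) + w * m 1 0) * w - (u * m 0 1 + w * (m 1 1 - s / 2)) * u ≠ 0 := by
        by_cases h10 : m 1 0 = 0
        · exact ⟨1, 0, by simpa using fun h01 => hsc ⟨h01, h10⟩⟩
        · exact ⟨0, 1, by simpa using h10⟩
      set p := u * (m 0 0 - s / 2) + w * m 1 0 with hp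
      set q := u * m 0 1 + w * (m 1 1 - s / 2) with hq
      -- A zero double eigenvalue gives the Heisenberg algebra; otherwise scaling by 2 / s makes the
      -- eigenvalue 1.
      by_cases h0 : s = 0
      · obtain ⟨b', h'⟩ := h.exists_basis !![p, q; u, w] !![0, 0; 1, 0] 1 one_ne_zero
          (by rw [Matrix.det_fin_two]; simpa using hw) (by
            have h11 : m 1 1 = -m 0 0 := by linarith
            rw [h11] at hz
            ext i j
            fin_cases i <;> fin_cases j <;>
              simp [Matrix.vecMul, dotProduct, Fin.sum_univ_two, hp, hq, h0, h11]
            · linear_combination u / 4 * hz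
            · linear_combination w / 4 * hz)
        refine h'.hasAdaptedBasis_of_bracket (T := g3_1) ?_
        ext i j l
        fin_cases i <;> fin_cases j <;> fin_cases l <;>
          simp [row, TableRow.g3_1, TableRow.brackets3]
      · obtain ⟨b', h'⟩ := h.exists_basis !![2 / s * p, 2 / s * q; u, w] !![1, 0; 1, 1] (2 / s)
          (div_ne_zero two_ne_zero h0)
          (by
            rw [Matrix.det_fin_two]
            have := mul_ne_zero (div_ne_zero two_ne_zero h0) hw
            intro h1
            apply this
            simp at h1
            linear_combination h1) (by
            have h11 : m 1 1 = s - m 0 0 := by linarith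
            rw [h11] at hz
            ext i j
            fin_cases i <;> fin_cases j <;>
              simp [Matrix.vecMul, dotProduct, Fin.sum_univ_two, hp, hq, h11, h0] <;> field_simp
            · linear_combination u * hz
            · linear_combination w * hz
            · ring
            · ring)
        refine h'.hasAdaptedBasis_of_bracket (T := g3_2) ?_
        simp [row, TableRow.g3_2]
  · -- two real eigenvalues
    have hq := Real.sq_sqrt hpos.le
    set e := √d with he
    have he0 : e ≠ 0 := (Real.sqrt_pos.2 hpos).ne'
    -- Left eigenvectors, because the rows of P act on m from the left.
    have heig : ∀ x : ℝ, x ^ 2 - s * x + (m 0 0 * m 1 1 - m 0 1 * m 1 0) = 0 →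
        ∃ v : Fin 2 → ℝ, v ≠ 0 ∧ v 0 * m 0 0 + v 1 * m 1 0 = x * v 0 ∧
          v 0 * m 0 1 + v 1 * m 1 1 = x * v 1 := by
      intro x hx
      have hdet : (m - x • (1 : Matrix (Fin 2) (Fin 2) ℝ)).det = 0 := by
        rw [Matrix.det_fin_two]
        simp
        rw [hs] at hx
        linear_combination hx
      obtain ⟨v, hv, hv'⟩ := Matrix.exists_vecMul_eq_zero_iff.2 hdet
      have h₀ := congrFun hv' 0
      have h₁ := congrFun hv' 1
      simp [Matrix.vecMul, dotProduct, Fin.sum_univ_two] at h₀ h₁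
      exact ⟨v, hv, by linear_combination h₀, by linear_combination h₁⟩
    -- The eigenvalue x of larger modulus comes first; it is non-zero since the two are distinct.
    have main : ∀ x y : ℝ, x ^ 2 - s * x + (m 0 0 * m 1 1 - m 0 1 * m 1 0) = 0 →
        y ^ 2 - s * y + (m 0 0 * m 1 1 - m 0 1 * m 1 0) = 0 → x ≠ y → |y| ≤ |x| →
        HasAdaptedBasis 3 L := by
      intro x y hx hy hxy hle
      have hx0 : x ≠ 0 := by
        rintro rfl
        rw [abs_zero, abs_nonpos_iff] at hle
        exact hxy hle.symm
      obtain ⟨v, hv, hv₀, hv₁⟩ := heig x hx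
      obtain ⟨w, hw, hw₀, hw₁⟩ := heig y hy
      have hdet : v 0 * w 1 - v 1 * w 0 ≠ 0 := by
        intro h0
        have k₀ : (x - y) * (v 0 * w 0) = 0 := by
          have := congrArg (· * w 0) hv₀
          by_cases hw0 : w 0 = 0
          · rw [hw0]; ring
          · have e1 : v 1 = v 0 * w 1 / w 0 := by field_simp; linear_combination -h0
            rw [e1] at hv₀
            field_simp at hv₀
            linear_combination v 0 * hw₀ - hv₀
        have k₁ : (x - y) * (v 1 * w 1) = 0 := by
          by_cases hw1 : w 1 = 0
          · rw [hw1]; ring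
          · have e1 : v 0 = v 1 * w 0 / w 1 := by field_simp; linear_combination h0
            rw [e1] at hv₁
            field_simp at hv₁
            linear_combination v 1 * hw₁ - hv₁
        have k₀' := (mul_eq_zero.1 k₀).resolve_left (sub_ne_zero.2 hxy)
        have k₁' := (mul_eq_zero.1 k₁).resolve_left (sub_ne_zero.2 hxy)
        have hw' : w 0 ≠ 0 ∨ w 1 ≠ 0 := by
          by_contra! hc
          exact hw (by ext i; fin_cases i; exacts [hc.1, hc.2])
        have hv' : v 0 ≠ 0 ∨ v 1 ≠ 0 := by
          by_contra! hc
          exact hv (by ext i; fin_cases i; exacts [hc.1, hc.2])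
        rcases hw' with hw' | hw'
        · have v0 := (mul_eq_zero.1 k₀').resolve_right hw'
          rw [v0, zero_mul, zero_sub, neg_eq_zero] at h0
          exact hv'.elim (fun h => h v0) fun h => h ((mul_eq_zero.1 h0).resolve_right hw')
        · have v1 := (mul_eq_zero.1 k₁').resolve_right hw'
          rw [v1, zero_mul, sub_zero] at h0
          exact hv'.elim (fun h => h ((mul_eq_zero.1 h0).resolve_right hw')) fun h => h v1
      obtain ⟨b', h'⟩ := h.exists_basis !![v 0, v 1; w 0, w 1] !![x, 0; 0, y] 1 one_ne_zero
        (by rw [Matrix.det_fin_two]; simpa using hdet) (by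
          ext i j
          fin_cases i <;> fin_cases j <;>
            simp [Matrix.vecMul, dotProduct, Fin.sum_univ_two]
          exacts [hv₀, hv₁, hw₀, hw₁])
      exact h'.hasAdaptedBasis_of_diagonal hxy hx0 hle
    have r₁ : ((s + e) / 2) ^ 2 - s * ((s + e) / 2) +
        (m 0 0 * m 1 1 - m 0 1 * m 1 0) = 0 := by
      rw [hd] at hq; linear_combination hq / 4
    have r₂ : ((s - e) / 2) ^ 2 - s * ((s - e) / 2) +
        (m 0 0 * m 1 1 - m 0 1 * m 1 0) = 0 := by
      rw [hd] at hq; linear_combination hq / 4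
    have hne : (s + e) / 2 ≠ (s - e) / 2 := fun h0 => he0 (by linarith)
    rcases le_total |(s - e) / 2| |(s + e) / 2| with hle | hle
    · exact main _ _ r₁ r₂ hne hle
    · exact main _ _ r₂ r₁ hne.symm hle

end LowDimAlg

end LieBases

end

noncomputable section

open Set Filter Topology

/-! ### Structure matrices and existence of an adapted basis -/

section LieBases

variable {L : Type*} [LieRing L] [LieAlgebra ℝ L]

namespace LowDimAlg

/-- If l_2 = 0, the first two basis vectors commute and span an abelian ideal. -/
theorem DiagonalForm.hasAdaptedBasis_of_zero {b : Module.Basis (Fin 3) ℝ L} {l : Fin 3 → ℝ}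
    (h : DiagonalForm b l) (h0 : l 2 = 0) : HasAdaptedBasis 3 L := by
  obtain ⟨h₁, h₂, h₃⟩ := h
  refine SemidirectForm.hasAdaptedBasis (b := b) (m := !![0, -l 1; l 0, 0]) ⟨?_, ?_, ?_⟩
  · rw [h₃, h0, zero_smul]
  · rw [← lie_skew, h₂]; simp
  · rw [h₁]; simp

theorem DiagonalForm.exists_neg {b : Module.Basis (Fin 3) ℝ L} {l : Fin 3 → ℝ}
    (h : DiagonalForm b l) :
    ∃ b' : Module.Basis (Fin 3) ℝ L, DiagonalForm b' ![-l 0, -l 1, -l 2] := by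
  obtain ⟨b', h'⟩ := h.exists_smul (fun _ => -1) (fun _ => by norm_num)
  exact ⟨b', by simpa using h'⟩

theorem DiagonalForm.hasAdaptedBasis_of_pos {b : Module.Basis (Fin 3) ℝ L} {l : Fin 3 → ℝ}
    (h : DiagonalForm b l) (h0 : 0 < l 0) (h1 : 0 < l 1) (h2 : 0 < l 2) :
    HasAdaptedBasis 3 L := by
  have q0 := Real.mul_self_sqrt h0.le
  have q1 := Real.mul_self_sqrt h1.le
  have q2 := Real.mul_self_sqrt h2.le
  have p0 := (Real.sqrt_pos.2 h0).ne'
  have p1 := (Real.sqrt_pos.2 h1).ne'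
  have p2 := (Real.sqrt_pos.2 h2).ne'
  set r0 := √(l 0)
  set r1 := √(l 1)
  set r2 := √(l 2)
  -- With r_i² = l_i, the factors c_i = r_i / (r_0 r_1 r_2) turn each structure constant into 1.
  obtain ⟨b', e₁, e₂, e₃⟩ := h.exists_smul
    ![r0 / (r0 * r1 * r2), r1 / (r0 * r1 * r2), r2 / (r0 * r1 * r2)]
    (fun i => by fin_cases i <;> simp [p0, p1, p2])
  simp only [Matrix.cons_val_zero, Matrix.cons_val_one, Matrix.cons_val, ← q0, ← q1, ← q2] at e₁ e₂ e₃
  field_simp at e₁ e₂ e₃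
  simp only [one_smul] at e₁ e₂ e₃
  exact ⟨g3_7, b', isAdapted_of_brackets3 rfl (by simpa using e₃)
    (by rw [← lie_skew, e₂]; simp) (by simpa using e₁)⟩

theorem DiagonalForm.hasAdaptedBasis_of_neg {b : Module.Basis (Fin 3) ℝ L} {l : Fin 3 → ℝ}
    (h : DiagonalForm b l) (h0 : 0 < l 0) (h1 : 0 < l 1) (h2 : l 2 < 0) :
    HasAdaptedBasis 3 L := by
  have q0 := Real.mul_self_sqrt h0.le
  have q1 := Real.mul_self_sqrt h1.le
  have q2 : l 2 = -(√(-l 2) * √(-l 2)) := by rw [Real.mul_self_sqrt (neg_pos.2 h2).le, neg_neg]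
  have p0 := (Real.sqrt_pos.2 h0).ne'
  have p1 := (Real.sqrt_pos.2 h1).ne'
  have p2 := (Real.sqrt_pos.2 (neg_pos.2 h2)).ne'
  set r0 := √(l 0)
  set r1 := √(l 1)
  set r2 := √(-l 2)
  obtain ⟨b', e₁, e₂, e₃⟩ := h.exists_smul
    ![r0 / (r0 * r1 * r2), r1 / (r0 * r1 * r2), r2 / (r0 * r1 * r2)]
    (fun i => by fin_cases i <;> simp [p0, p1, p2])
  simp only [Matrix.cons_val_zero, Matrix.cons_val_one, Matrix.cons_val, ← q0, ← q1] at e₁ e₂ e₃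
  rw [q2] at e₃
  field_simp at e₁ e₂ e₃
  simp only [one_smul, neg_smul] at e₁ e₂ e₃
  -- After scaling, the constants are 1, 1, -1. The combinations b'_1 + b'_2 and -b'_1 + b'_2 are
  -- eigenvectors of ad b'_0 for the eigenvalues -1 and 1, which gives the relations of 𝔤³₆.
  obtain ⟨b'', hb''⟩ := b'.exists_three !![0, 1, 1; 1, 0, 0; 0, -1, 1]
    (by simp [Matrix.det_fin_three])
  have f₀ : b'' 0 = b' 1 + b' 2 := by simpa using hb'' 0
  have f₁ : b'' 1 = b' 0 := by simpa using hb'' 1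
  have f₂ : b'' 2 = -b' 1 + b' 2 := by simpa using hb'' 2
  have e₁' : ⁅b' 2, b' 1⁆ = -b' 0 := by rw [← lie_skew, e₁]
  have e₂' : ⁅b' 0, b' 2⁆ = -b' 1 := by rw [← lie_skew, e₂]
  have e₃' : ⁅b' 1, b' 0⁆ = b' 2 := by rw [← lie_skew, e₃, neg_neg]
  refine ⟨g3_6, b'', isAdapted_of_brackets3 rfl ?_ ?_ ?_⟩ <;>
    simp [f₀, f₁, f₂, e₁, e₂, e₃, e₁', e₂', e₃'] <;> first | abel1 | module

/-- Cyclic rotations and the change of all signs reduce every sign pattern to one with a zero, to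
(+, +, +) or to (+, +, -). -/
theorem DiagonalForm.hasAdaptedBasis {b : Module.Basis (Fin 3) ℝ L} {l : Fin 3 → ℝ}
    (h : DiagonalForm b l) : HasAdaptedBasis 3 L := by
  obtain ⟨b₁, h₁⟩ := h.exists_rotate
  obtain ⟨b₂, h₂⟩ := h₁.exists_rotate
  obtain ⟨c, hc⟩ := h.exists_neg
  obtain ⟨c₁, hc₁⟩ := hc.exists_rotate
  obtain ⟨c₂, hc₂⟩ := hc₁.exists_rotate
  rcases lt_trichotomy (l 0) 0 with h0 | h0 | h0
  · rcases lt_trichotomy (l 1) 0 with h1 | h1 | h1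
    · rcases lt_trichotomy (l 2) 0 with h2 | h2 | h2
      · exact hc.hasAdaptedBasis_of_pos (by simpa) (by simpa) (by simpa)
      · exact h.hasAdaptedBasis_of_zero h2
      · exact hc.hasAdaptedBasis_of_neg (by simpa) (by simpa) (by simpa)
    · exact h₂.hasAdaptedBasis_of_zero (by simpa)
    · rcases lt_trichotomy (l 2) 0 with h2 | h2 | h2
      · exact hc₂.hasAdaptedBasis_of_neg (by simpa) (by simpa) (by simpa)
      · exact h.hasAdaptedBasis_of_zero h2
      · exact h₁.hasAdaptedBasis_of_neg (by simpa) (by simpa) (by simpa)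
  · exact h₁.hasAdaptedBasis_of_zero (by simpa)
  · rcases lt_trichotomy (l 1) 0 with h1 | h1 | h1
    · rcases lt_trichotomy (l 2) 0 with h2 | h2 | h2
      · exact hc₁.hasAdaptedBasis_of_neg (by simpa) (by simpa) (by simpa)
      · exact h.hasAdaptedBasis_of_zero h2
      · exact h₂.hasAdaptedBasis_of_neg (by simpa) (by simpa) (by simpa)
    · exact h₂.hasAdaptedBasis_of_zero (by simpa)
    · rcases lt_trichotomy (l 2) 0 with h2 | h2 | h2
      · exact h.hasAdaptedBasis_of_neg h0 h1 h2
      · exact h.hasAdaptedBasis_of_zero h2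
      · exact h.hasAdaptedBasis_of_pos h0 h1 h2

/-- The brackets of a basis are given by the matrix `N`, in cyclic order. -/
def StructureForm (b : Module.Basis (Fin 3) ℝ L) (N : Matrix (Fin 3) (Fin 3) ℝ) : Prop :=
  ∀ i, ⁅b (i + 1), b (i + 2)⁆ = ∑ j, N i j • b j

theorem exists_structureForm (b : Module.Basis (Fin 3) ℝ L) : ∃ N, StructureForm b N :=
  ⟨fun i j => b.repr ⁅b (i + 1), b (i + 2)⁆ j, fun _ => (b.sum_repr _).symm⟩

theorem StructureForm.exists_rotate {b : Module.Basis (Fin 3) ℝ L} {N : Matrix (Fin 3) (Fin 3) ℝ}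
    (h : StructureForm b N) : ∃ b' : Module.Basis (Fin 3) ℝ L,
      StructureForm b' (Matrix.of fun i j => N (i + 1) (j + 1)) := by
  refine ⟨b.reindex (Equiv.addRight 1).symm, fun i => ?_⟩
  have e := h (i + 1)
  rw [← Equiv.sum_comp (Equiv.addRight (1 : Fin 3))] at e
  simp only [Module.Basis.reindex_apply, Equiv.symm_symm, Equiv.coe_addRight] at e ⊢
  rw [add_right_comm i 2 1]
  exact e

/-- In coordinates the bracket is the row vector (x × y) N. -/
theorem StructureForm.lie_eq {b : Module.Basis (Fin 3) ℝ L} {N : Matrix (Fin 3) (Fin 3) ℝ}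
    (h : StructureForm b N) (x y : Fin 3 → ℝ) :
    ⁅x 0 • b 0 + x 1 • b 1 + x 2 • b 2, y 0 • b 0 + y 1 • b 1 + y 2 • b 2⁆ =
      ((x 1 * y 2 - x 2 * y 1) * N 0 0 + (x 2 * y 0 - x 0 * y 2) * N 1 0 +
        (x 0 * y 1 - x 1 * y 0) * N 2 0) • b 0 +
      ((x 1 * y 2 - x 2 * y 1) * N 0 1 + (x 2 * y 0 - x 0 * y 2) * N 1 1 +
        (x 0 * y 1 - x 1 * y 0) * N 2 1) • b 1 +
      ((x 1 * y 2 - x 2 * y 1) * N 0 2 + (x 2 * y 0 - x 0 * y 2) * N 1 2 +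
        (x 0 * y 1 - x 1 * y 0) * N 2 2) • b 2 := by
  have h₀ : ⁅b 1, b 2⁆ = N 0 0 • b 0 + N 0 1 • b 1 + N 0 2 • b 2 := by
    simpa [Fin.sum_univ_three] using h 0
  have h₁ : ⁅b 2, b 0⁆ = N 1 0 • b 0 + N 1 1 • b 1 + N 1 2 • b 2 := by
    simpa [Fin.sum_univ_three] using h 1
  have h₂ : ⁅b 0, b 1⁆ = N 2 0 • b 0 + N 2 1 • b 1 + N 2 2 • b 2 := by
    simpa [Fin.sum_univ_three] using h 2
  have h₀' : ⁅b 2, b 1⁆ = -(N 0 0 • b 0 + N 0 1 • b 1 + N 0 2 • b 2) := by rw [← lie_skew, h₀]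
  have h₁' : ⁅b 0, b 2⁆ = -(N 1 0 • b 0 + N 1 1 • b 1 + N 1 2 • b 2) := by rw [← lie_skew, h₁]
  have h₂' : ⁅b 1, b 0⁆ = -(N 2 0 • b 0 + N 2 1 • b 1 + N 2 2 • b 2) := by rw [← lie_skew, h₂]
  simp only [add_lie, lie_add, smul_lie, lie_smul, lie_self, h₀, h₁, h₂, h₀', h₁', h₂', smul_zero]
  module

theorem basis_three_coeff {b : Module.Basis (Fin 3) ℝ L} {x : Fin 3 → ℝ}
    (h : x 0 • b 0 + x 1 • b 1 + x 2 • b 2 = 0) (i : Fin 3) : x i = 0 :=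
  Fintype.linearIndependent_iff.1 b.linearIndependent x (by rw [Fin.sum_univ_three, h]) i

/-- The Jacobi identity in terms of the structure matrix. -/
theorem StructureForm.jacobi {b : Module.Basis (Fin 3) ℝ L} {N : Matrix (Fin 3) (Fin 3) ℝ}
    (h : StructureForm b N) (j : Fin 3) :
    (N 1 2 - N 2 1) * N 0 j + (N 2 0 - N 0 2) * N 1 j + (N 0 1 - N 1 0) * N 2 j = 0 := by
  have e : ∀ i, b i = (Pi.single i 1 : Fin 3 → ℝ) 0 • b 0 + (Pi.single i 1 : Fin 3 → ℝ) 1 • b 1 +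
      (Pi.single i 1 : Fin 3 → ℝ) 2 • b 2 := by
    intro i
    fin_cases i <;> simp
  have hJ := lie_jacobi (b 0) (b 1) (b 2)
  have h₀ : ⁅b 1, b 2⁆ = N 0 0 • b 0 + N 0 1 • b 1 + N 0 2 • b 2 := by
    simpa [Fin.sum_univ_three] using h 0
  have h₁ : ⁅b 2, b 0⁆ = N 1 0 • b 0 + N 1 1 • b 1 + N 1 2 • b 2 := by
    simpa [Fin.sum_univ_three] using h 1
  have h₂ : ⁅b 0, b 1⁆ = N 2 0 • b 0 + N 2 1 • b 1 + N 2 2 • b 2 := by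
    simpa [Fin.sum_univ_three] using h 2
  have h₀' : ⁅b 2, b 1⁆ = -(N 0 0 • b 0 + N 0 1 • b 1 + N 0 2 • b 2) := by rw [← lie_skew, h₀]
  have h₁' : ⁅b 0, b 2⁆ = -(N 1 0 • b 0 + N 1 1 • b 1 + N 1 2 • b 2) := by rw [← lie_skew, h₁]
  have h₂' : ⁅b 1, b 0⁆ = -(N 2 0 • b 0 + N 2 1 • b 1 + N 2 2 • b 2) := by rw [← lie_skew, h₂]
  rw [h₀, h₁, h₂] at hJ
  simp only [lie_add, lie_smul, lie_self, h₀, h₁, h₂, h₀', h₁', h₂', smul_zero] at hJ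
  refine basis_three_coeff (b := b) (x := fun j => (N 1 2 - N 2 1) * N 0 j +
    (N 2 0 - N 0 2) * N 1 j + (N 0 1 - N 1 0) * N 2 j) ?_ j
  rw [← hJ]
  module

/-- The vector a of the antisymmetric part of N has a N = 0 by the Jacobi identity, and also N a =
0. The first relation makes the plane orthogonal to a abelian; the second makes all brackets lie in
this plane. -/
theorem StructureForm.hasAdaptedBasis_of_ne {b : Module.Basis (Fin 3) ℝ L}
    {N : Matrix (Fin 3) (Fin 3) ℝ} (h : StructureForm b N) (h0 : N 0 1 ≠ N 1 0) :
    HasAdaptedBasis 3 L := by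
  set a0 := N 1 2 - N 2 1 with ha0
  set a1 := N 2 0 - N 0 2 with ha1
  set a2 := N 0 1 - N 1 0 with ha2
  have hne : a2 ≠ 0 := sub_ne_zero.2 h0
  have hJ := h.jacobi
  rw [← ha0, ← ha1, ← ha2] at hJ
  -- N and its transpose agree on a, because their difference acts as the cross product with a up to
  -- sign.
  have r₀ : N 0 0 * a0 + N 0 1 * a1 + N 0 2 * a2 = 0 := by
    have := hJ 0
    have e : N 0 0 * a0 + N 0 1 * a1 + N 0 2 * a2 =
        a0 * N 0 0 + a1 * N 1 0 + a2 * N 2 0 := by rw [ha1, ha2]; ring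
    rw [e, this]
  have r₁ : N 1 0 * a0 + N 1 1 * a1 + N 1 2 * a2 = 0 := by
    have := hJ 1
    have e : N 1 0 * a0 + N 1 1 * a1 + N 1 2 * a2 =
        a0 * N 0 1 + a1 * N 1 1 + a2 * N 2 1 := by rw [ha0, ha2]; ring
    rw [e, this]
  -- The first two rows span the plane orthogonal to a, and their cross product is a2 · a.
  obtain ⟨b', hb'⟩ := b.exists_three !![a2, 0, -a0; 0, a2, -a1; 0, 0, 1]
    (by simp [Matrix.det_fin_three, hne])
  have hb'' : ∀ i, b' i = (![![a2, 0, -a0], ![0, a2, -a1], ![0, 0, 1]] : Fin 3 → Fin 3 → ℝ) i 0 • b 0 +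
    (![![a2, 0, -a0], ![0, a2, -a1], ![0, 0, 1]] : Fin 3 → Fin 3 → ℝ) i 1 • b 1 +
    (![![a2, 0, -a0], ![0, a2, -a1], ![0, 0, 1]] : Fin 3 → Fin 3 → ℝ) i 2 • b 2 := hb'
  refine SemidirectForm.hasAdaptedBasis (b := b')
    (m := !![-N 1 0, -N 1 1; N 0 0, N 0 1]) ⟨?_, ?_, ?_⟩
  · rw [hb'' 0, hb'' 1, h.lie_eq]
    simp only [Matrix.cons_val_zero, Matrix.cons_val_one, Matrix.cons_val]
    have z : ∀ j, (0 * -a1 - -a0 * a2) * N 0 j + (-a0 * 0 - a2 * -a1) * N 1 j +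
        (a2 * a2 - 0 * 0) * N 2 j = 0 := fun j => by linear_combination a2 * hJ j
    rw [z, z, z]
    simp
  · rw [hb'' 0, hb'' 2, h.lie_eq, hb'' 1]
    simp only [Matrix.cons_val_zero, Matrix.cons_val_one, Matrix.cons_val, Matrix.of_apply,
      Matrix.cons_val', Matrix.cons_val_fin_one]
    have z : N 1 2 * a2 = -(N 1 0 * a0 + N 1 1 * a1) := by linear_combination r₁
    have z' : (0 * 1 - -a0 * 0) * N 0 2 + (-a0 * 0 - a2 * 1) * N 1 2 + (a2 * 0 - 0 * 0) * N 2 2 =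
      N 1 0 * a0 + N 1 1 * a1 := by linear_combination -z
    rw [z']
    module
  · rw [hb'' 1, hb'' 2, h.lie_eq, hb'' 0]
    simp only [Matrix.cons_val_zero, Matrix.cons_val_one, Matrix.cons_val, Matrix.of_apply,
      Matrix.cons_val', Matrix.cons_val_fin_one]
    have z' : (a2 * 1 - -a1 * 0) * N 0 2 + (-a1 * 0 - 0 * 1) * N 1 2 + (0 * 0 - a2 * 0) * N 2 2 =
      -(N 0 0 * a0 + N 0 1 * a1) := by linear_combination r₀
    rw [z']
    module

/-- In an orthonormal eigenbasis of N the cross product of two rows is ± the third, and N multiplies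
it by its eigenvalue; the sign is the determinant of the basis. -/
theorem StructureForm.hasAdaptedBasis_of_symm {b : Module.Basis (Fin 3) ℝ L}
    {N : Matrix (Fin 3) (Fin 3) ℝ} (h : StructureForm b N) (hN : N.IsHermitian) :
    HasAdaptedBasis 3 L := by
  let U : Matrix (Fin 3) (Fin 3) ℝ := fun i j => hN.eigenvectorBasis i j
  have hU : U * U.transpose = 1 := by
    ext i j
    have e := orthonormal_iff_ite.1 hN.eigenvectorBasis.orthonormal i j
    rw [Matrix.one_apply, ← e, Matrix.mul_apply, PiLp.inner_apply]
    refine Finset.sum_congr rfl fun l _ => ?_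
    change U i l * U j l = _
    simp [U, mul_comm]
  have hdet : U.det ≠ 0 := by
    intro h0
    have := congrArg Matrix.det hU
    rw [Matrix.det_mul, h0, zero_mul, Matrix.det_one] at this
    exact zero_ne_one this
  -- For an orthogonal matrix the cofactors are the entries times the determinant, which expresses
  -- the cross products of the rows.
  have hadj : U.adjugate = U.det • U.transpose := by
    calc U.adjugate = U.adjugate * (U * U.transpose) := by rw [hU, Matrix.mul_one]
      _ = U.det • U.transpose := by
        rw [← Matrix.mul_assoc, Matrix.adjugate_mul, Matrix.smul_mul, Matrix.one_mul]
  have hcof : ∀ i j, U.adjugate i j = U.det * U j i := fun i j => by rw [hadj]; rfl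
  have heig : ∀ i j, U i 0 * N 0 j + U i 1 * N 1 j + U i 2 * N 2 j = hN.eigenvalues i * U i j := by
    intro i j
    have e := congrFun (hN.mulVec_eigenvectorBasis i) j
    have hs : ∀ a c, N a c = N c a := fun a c => by
      have := congrFun (congrFun hN a) c
      simpa using this.symm
    rw [hs 0 j, hs 1 j, hs 2 j]
    simp only [Matrix.mulVec, dotProduct, Fin.sum_univ_three, Pi.smul_apply, smul_eq_mul] at e
    change _ = hN.eigenvalues i * hN.eigenvectorBasis i j
    rw [← e]
    simp only [U]
    ring
  obtain ⟨b', hb'⟩ := b.exists_three U hdet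
  rw [Matrix.adjugate_fin_three] at hcof
  refine DiagonalForm.hasAdaptedBasis (b := b') (l := fun i => U.det * hN.eigenvalues i)
    ⟨?_, ?_, ?_⟩
  · have c₀ := hcof 0 0
    have c₁ := hcof 1 0
    have c₂ := hcof 2 0
    simp at c₀ c₁ c₂
    rw [hb' 1, hb' 2, h.lie_eq, hb' 0]
    have z : ∀ j, (U 1 1 * U 2 2 - U 1 2 * U 2 1) * N 0 j + (U 1 2 * U 2 0 - U 1 0 * U 2 2) * N 1 j
        + (U 1 0 * U 2 1 - U 1 1 * U 2 0) * N 2 j = U.det * hN.eigenvalues 0 * U 0 j := fun j => by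
      rw [mul_assoc, ← heig]
      linear_combination N 0 j * c₀ + N 1 j * c₁ + N 2 j * c₂
    rw [z, z, z]
    module
  · have c₀ := hcof 0 1
    have c₁ := hcof 1 1
    have c₂ := hcof 2 1
    simp at c₀ c₁ c₂
    rw [hb' 2, hb' 0, h.lie_eq, hb' 1]
    have z : ∀ j, (U 2 1 * U 0 2 - U 2 2 * U 0 1) * N 0 j + (U 2 2 * U 0 0 - U 2 0 * U 0 2) * N 1 j
        + (U 2 0 * U 0 1 - U 2 1 * U 0 0) * N 2 j = U.det * hN.eigenvalues 1 * U 1 j := fun j => by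
      rw [mul_assoc, ← heig]
      linear_combination N 0 j * c₀ + N 1 j * c₁ + N 2 j * c₂
    rw [z, z, z]
    module
  · have c₀ := hcof 0 2
    have c₁ := hcof 1 2
    have c₂ := hcof 2 2
    simp at c₀ c₁ c₂
    rw [hb' 0, hb' 1, h.lie_eq, hb' 2]
    have z : ∀ j, (U 0 1 * U 1 2 - U 0 2 * U 1 1) * N 0 j + (U 0 2 * U 1 0 - U 0 0 * U 1 2) * N 1 j
        + (U 0 0 * U 1 1 - U 0 1 * U 1 0) * N 2 j = U.det * hN.eigenvalues 2 * U 2 j := fun j => by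
      rw [mul_assoc, ← heig]
      linear_combination N 0 j * c₀ + N 1 j * c₁ + N 2 j * c₂
    rw [z, z, z]
    module

/-- A cyclic rotation brings a non-zero component of the antisymmetric part into the last place; if
there is none, N is symmetric. -/
theorem hasAdaptedBasis_three (hL : Module.finrank ℝ L = 3) : HasAdaptedBasis 3 L := by
  have : Module.Finite ℝ L := Module.finite_of_finrank_pos (by omega)
  obtain ⟨N, h⟩ := exists_structureForm (Module.finBasisOfFinrankEq ℝ L hL)
  obtain ⟨b₁, h₁⟩ := h.exists_rotate
  obtain ⟨b₂, h₂⟩ := h₁.exists_rotate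
  by_cases e₀ : N 0 1 = N 1 0
  · by_cases e₁ : N 1 2 = N 2 1
    · by_cases e₂ : N 2 0 = N 0 2
      · refine h.hasAdaptedBasis_of_symm ?_
        ext i j
        fin_cases i <;> fin_cases j <;> simp [e₀, e₁, e₂]
      · exact h₂.hasAdaptedBasis_of_ne (by simpa using e₂)
    · exact h₁.hasAdaptedBasis_of_ne (by simpa using e₁)
  · exact h.hasAdaptedBasis_of_ne e₀

theorem hasAdaptedBasis_two (hL : Module.finrank ℝ L = 2) : HasAdaptedBasis 2 L := by
  have : Module.Finite ℝ L := Module.finite_of_finrank_pos (by omega)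
  let b := Module.finBasisOfFinrankEq ℝ L hL
  have hb : ⁅b 0, b 1⁆ = b.repr ⁅b 0, b 1⁆ 0 • b 0 + b.repr ⁅b 0, b 1⁆ 1 • b 1 := by
    rw [← Fin.sum_univ_two (fun i => b.repr ⁅b 0, b 1⁆ i • b i), b.sum_repr]
  set x := b.repr ⁅b 0, b 1⁆ 0
  set y := b.repr ⁅b 0, b 1⁆ 1
  have hb' : ⁅b 1, b 0⁆ = -(x • b 0 + y • b 1) := by rw [← lie_skew, hb]
  -- If [b_0, b_1] = x b_0 + y b_1 is non-zero, it becomes the first basis vector. A second vector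
  -- completing it to determinant 1 gives the relation of 𝔤².
  have key : ∀ u w : ℝ, x * w - y * u = 1 → HasAdaptedBasis 2 L := by
    intro u w huw
    obtain ⟨c, hc⟩ := b.exists_of_det_ne_zero !![x, y; u, w]
      (by rw [Matrix.det_fin_two]; simp; rw [huw]; norm_num)
    have c₀ : c 0 = x • b 0 + y • b 1 := by rw [hc]; simp [Fin.sum_univ_two]
    have c₁ : c 1 = u • b 0 + w • b 1 := by rw [hc]; simp [Fin.sum_univ_two]
    have e : ⁅c 0, c 1⁆ = c 0 := by
      have : ⁅c 0, c 1⁆ = (x * w - y * u) • (x • b 0 + y • b 1) := by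
        rw [c₀, c₁]
        simp only [add_lie, lie_add, smul_lie, lie_smul, lie_self, hb, hb', smul_zero]
        module
      rw [this, huw, one_smul, c₀]
    have e' : ⁅c 1, c 0⁆ = -c 0 := by rw [← lie_skew, e]
    refine ⟨g2, c, fun i j => ?_⟩
    fin_cases i <;> fin_cases j <;>
      simp [row, TableRow.g2, TableRow.brackets2, Fin.sum_univ_two, e, e']
  by_cases hx : x = 0
  · by_cases hy : y = 0
    · rw [hx, hy] at hb hb'
      simp only [zero_smul, add_zero, neg_zero] at hb hb'
      refine ⟨twoG1, b, fun i j => ?_⟩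
      fin_cases i <;> fin_cases j <;> simp [row, TableRow.twoG1, hb, hb']
    · exact key (-y⁻¹) 0 (by field_simp; ring)
  · exact key 0 x⁻¹ (by field_simp; ring)

theorem hasAdaptedBasis_one (hL : Module.finrank ℝ L = 1) : HasAdaptedBasis 1 L := by
  have : Module.Finite ℝ L := Module.finite_of_finrank_pos (by omega)
  refine ⟨g1, Module.finBasisOfFinrankEq ℝ L hL, fun i j => ?_⟩
  fin_cases i; fin_cases j
  simp [row, TableRow.g1]

end LowDimAlg

end LieBases

end

noncomputable section

open Set Filter Topology

/-! ### Isomorphism invariants that separate the rows -/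

section StructureConstants

variable {n : ℕ}

/-- The matrix of the adjoint map of the element with coordinates `x`. -/
def adMatrix (C : Fin n → Fin n → Fin n → ℝ) (x : Fin n → ℝ) : Matrix (Fin n) (Fin n) ℝ :=
  Matrix.of fun l j => ∑ i, x i * C i j l

/-- The adjoint map of the element with coordinates `x`. -/
def adMap (C : Fin n → Fin n → Fin n → ℝ) (x : Fin n → ℝ) : (Fin n → ℝ) →ₗ[ℝ] (Fin n → ℝ) :=
  Matrix.toLin' (adMatrix C x)

/-- The trace of the adjoint map. -/
def adTrace (C : Fin n → Fin n → Fin n → ℝ) (x : Fin n → ℝ) : ℝ :=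
  LinearMap.trace ℝ _ (adMap C x)

/-- The Killing form. -/
def killingValue (C : Fin n → Fin n → Fin n → ℝ) (x : Fin n → ℝ) : ℝ :=
  LinearMap.trace ℝ _ (adMap C x ∘ₗ adMap C x)

theorem adTrace_eq (C : Fin n → Fin n → Fin n → ℝ) (x : Fin n → ℝ) :
    adTrace C x = (adMatrix C x).trace := by
  rw [adTrace, adMap, Matrix.trace_toLin'_eq]

theorem killingValue_eq (C : Fin n → Fin n → Fin n → ℝ) (x : Fin n → ℝ) :
    killingValue C x = (adMatrix C x * adMatrix C x).trace := by
  rw [killingValue, adMap, ← Matrix.toLin'_mul, Matrix.trace_toLin'_eq]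

open Classical in
/-- Data that distinguish the three-dimensional real Lie algebras. -/
def structureCode (C : Fin n → Fin n → Fin n → ℝ) : ℕ × Set ℝ :=
  -- For trace-free ad, the sign behaviour of the Killing form decides: codes 1 to 5 belong to 𝔤³₆,
  -- 𝔤³₄ with h = -1, 𝔤³₅ with p = 0, 𝔤³₇ and 𝔤³₁. Otherwise the Killing form is f times the squared
  -- trace in each row, and f is recorded. Code 6 means that ad x acts on the derived algebra as
  -- half its trace; it separates 𝔤³₃ from 𝔤³₂, where f = 1/2 as well.
  if ∀ x y, adMap C x y = 0 then (0, ∅)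
  else if ∀ x, adTrace C x = 0 then
    (if ∃ x, 0 < killingValue C x then (if ∃ x, killingValue C x < 0 then 1 else 2)
      else if ∃ x, killingValue C x < 0 then
        (if ∃ x, x ≠ 0 ∧ killingValue C x = 0 then 3 else 4) else 5, ∅)
  else (if ∀ x y z, (2 : ℝ) • adMap C x (adMap C y z) = adTrace C x • adMap C y z then 6 else 7,
    {f | ∀ x, killingValue C x = f * adTrace C x ^ 2})

open Classical in
/-- Isomorphic Lie algebras have the same code. -/
theorem structureCode_eq {C C' : Fin n → Fin n → Fin n → ℝ} (φ : (Fin n → ℝ) ≃ₗ[ℝ] (Fin n → ℝ))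
    (h : ∀ x y, φ (adMap C x y) = adMap C' (φ x) (φ y)) : structureCode C = structureCode C' := by
  -- An isomorphism conjugates the adjoint maps, so traces of ad and of its square are carried over.
  have had : ∀ x, adMap C' (φ x) = φ.conj (adMap C x) := by
    intro x
    refine LinearMap.ext fun y => ?_
    rw [LinearEquiv.conj_apply_apply, h, LinearEquiv.apply_symm_apply]
  have hτ : ∀ x, adTrace C' (φ x) = adTrace C x := fun x => by
    rw [adTrace, had, LinearMap.trace_conj', adTrace]
  have hκ : ∀ x, killingValue C' (φ x) = killingValue C x := fun x => by
    rw [killingValue, had, ← LinearEquiv.conj_comp, LinearMap.trace_conj', killingValue]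
  have h₀ : (∀ x y, adMap C x y = 0) ↔ ∀ x y, adMap C' x y = 0 := by
    refine Iff.trans ?_ φ.surjective.forall.symm
    refine forall_congr' fun x => ?_
    refine Iff.trans ?_ φ.surjective.forall.symm
    refine forall_congr' fun y => ?_
    rw [← h, map_eq_zero_iff φ φ.injective]
  have h₁ : (∀ x, adTrace C x = 0) ↔ ∀ x, adTrace C' x = 0 := by
    refine Iff.trans ?_ φ.surjective.forall.symm
    simp only [hτ]
  have h₂ : (∃ x, 0 < killingValue C x) ↔ ∃ x, 0 < killingValue C' x := by
    refine Iff.trans ?_ φ.surjective.exists.symm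
    simp only [hκ]
  have h₃ : (∃ x, killingValue C x < 0) ↔ ∃ x, killingValue C' x < 0 := by
    refine Iff.trans ?_ φ.surjective.exists.symm
    simp only [hκ]
  have h₄ : (∃ x, x ≠ 0 ∧ killingValue C x = 0) ↔ ∃ x, x ≠ 0 ∧ killingValue C' x = 0 := by
    refine Iff.trans ?_ φ.surjective.exists.symm
    simp only [hκ, ne_eq, map_eq_zero_iff φ φ.injective]
  have h₅ : (∀ x y z, (2 : ℝ) • adMap C x (adMap C y z) = adTrace C x • adMap C y z) ↔
      ∀ x y z, (2 : ℝ) • adMap C' x (adMap C' y z) = adTrace C' x • adMap C' y z := by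
    refine Iff.trans ?_ φ.surjective.forall.symm
    refine forall_congr' fun x => ?_
    refine Iff.trans ?_ φ.surjective.forall.symm
    refine forall_congr' fun y => ?_
    refine Iff.trans ?_ φ.surjective.forall.symm
    refine forall_congr' fun z => ?_
    rw [← h, ← h, hτ, ← φ.map_smul, ← φ.map_smul, φ.injective.eq_iff]
  have h₆ : {f : ℝ | ∀ x, killingValue C x = f * adTrace C x ^ 2} =
      {f : ℝ | ∀ x, killingValue C' x = f * adTrace C' x ^ 2} := by
    ext f
    change (∀ x, _) ↔ ∀ x, _
    refine Iff.trans ?_ φ.surjective.forall.symm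
    simp only [hκ, hτ]
  unfold structureCode
  rw [h₆]
  refine if_congr h₀ rfl (if_congr h₁ (Prod.ext ?_ rfl) (Prod.ext (if_congr h₅ rfl rfl) rfl))
  exact if_congr h₂ (if_congr h₃ rfl rfl) (if_congr h₃ (if_congr h₄ rfl rfl) rfl)

end StructureConstants

namespace LowDimAlg

section

variable {n : ℕ} {L : Type*} [LieRing L] [LieAlgebra ℝ L]

theorem IsAdapted.lie_equivFun_symm {T : LowDimAlg n} {b : Module.Basis (Fin n) ℝ L}
    (h : T.IsAdapted b) (x y : Fin n → ℝ) :
    ⁅b.equivFun.symm x, b.equivFun.symm y⁆ = b.equivFun.symm (adMap T.row.bracket x y) := by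
  rw [Module.Basis.equivFun_symm_apply, Module.Basis.equivFun_symm_apply,
    Module.Basis.equivFun_symm_apply, sum_lie]
  simp only [lie_sum, smul_lie, lie_smul, h _ _, Finset.smul_sum, smul_smul, adMap,
    Matrix.toLin'_apply, Matrix.mulVec, dotProduct, adMatrix, Matrix.of_apply, Finset.sum_smul,
    Finset.sum_mul]
  rw [Finset.sum_congr rfl fun i _ => Finset.sum_comm, Finset.sum_comm]
  refine Finset.sum_congr rfl fun l _ => ?_
  rw [Finset.sum_comm]
  refine Finset.sum_congr rfl fun j _ => Finset.sum_congr rfl fun i _ => ?_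
  congr 1
  ring

theorem IsAdapted.structureCode_eq {T T' : LowDimAlg n} {b b' : Module.Basis (Fin n) ℝ L}
    (h : T.IsAdapted b) (h' : T'.IsAdapted b') :
    structureCode T.row.bracket = structureCode T'.row.bracket := by
  refine _root_.structureCode_eq (b.equivFun.symm.trans b'.equivFun) fun x y => ?_
  simp only [LinearEquiv.trans_apply]
  apply b'.equivFun.symm.injective
  rw [← h'.lie_equivFun_symm, LinearEquiv.symm_apply_apply, LinearEquiv.symm_apply_apply,
    LinearEquiv.symm_apply_apply, h.lie_equivFun_symm]

end

open TableRow

theorem adMap_brackets3 (u v w x y : Fin 3 → ℝ) :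
    adMap (brackets3 u v w) x y = (x 0 * y 1 - x 1 * y 0) • u + (x 0 * y 2 - x 2 * y 0) • v +
      (x 1 * y 2 - x 2 * y 1) • w := by
  ext l
  simp [adMap, adMatrix, Matrix.toLin'_apply, Matrix.mulVec, dotProduct, brackets3,
    Fin.sum_univ_three]
  ring

theorem adTrace_brackets3 (u v w x : Fin 3 → ℝ) :
    adTrace (brackets3 u v w) x = x 0 * (u 1 + v 2) + x 1 * (w 2 - u 0) - x 2 * (v 0 + w 1) := by
  rw [adTrace_eq]
  simp [adMatrix, brackets3, Fin.sum_univ_three, Matrix.trace]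
  ring

theorem killingValue_semidirect (a b c d : ℝ) (x : Fin 3 → ℝ) :
    killingValue (brackets3 0 ![a, b, 0] ![c, d, 0]) x =
      (a ^ 2 + 2 * b * c + d ^ 2) * x 2 ^ 2 := by
  rw [killingValue_eq]
  simp [adMatrix, brackets3, Fin.sum_univ_three, Matrix.trace, Matrix.mul_apply]
  ring

theorem adTrace_semidirect (a b c d : ℝ) (x : Fin 3 → ℝ) :
    adTrace (brackets3 0 ![a, b, 0] ![c, d, 0]) x = -(a + d) * x 2 := by
  rw [adTrace_brackets3]
  simp
  ring

theorem structureCode_of_unimodular {C : Fin 3 → Fin 3 → Fin 3 → ℝ} (h₀ : ∃ x y, adMap C x y ≠ 0)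
    (h : ∀ x, adTrace C x = 0) {m : ℕ} (hm : m < 6 := by norm_num)
    (hk : m = 1 ∧ (∃ x, 0 < killingValue C x) ∧ (∃ x, killingValue C x < 0) ∨
      m = 2 ∧ (∃ x, 0 < killingValue C x) ∧ (∀ x, 0 ≤ killingValue C x) ∨
      m = 3 ∧ (∀ x, killingValue C x ≤ 0) ∧ (∃ x, killingValue C x < 0) ∧
        (∃ x, x ≠ 0 ∧ killingValue C x = 0) ∨
      m = 4 ∧ (∀ x, killingValue C x ≤ 0) ∧ (∃ x, killingValue C x < 0) ∧
        (∀ x, x ≠ 0 → killingValue C x ≠ 0) ∨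
      m = 5 ∧ (∀ x, killingValue C x = 0)) :
    structureCode C = (m, ∅) := by
  have h₀' : ¬ ∀ x y, adMap C x y = 0 := by push Not; exact h₀
  rw [structureCode, if_neg h₀', if_pos h]
  rcases hk with ⟨rfl, h₁, h₂⟩ | ⟨rfl, h₁, h₂⟩ | ⟨rfl, h₁, h₂, h₃⟩ | ⟨rfl, h₁, h₂, h₃⟩ | ⟨rfl, h₁⟩
  · rw [if_pos h₁, if_pos h₂]
  · rw [if_pos h₁, if_neg (by push Not; exact h₂)]
  · rw [if_neg (by push Not; exact h₁), if_pos h₂, if_pos h₃]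
  · rw [if_neg (by push Not; exact h₁), if_pos h₂, if_neg (by push Not; exact h₃)]
  · rw [if_neg (by simp [h₁]), if_neg (by simp [h₁])]

/-- The trace and the Killing form depend on the single coordinate x_i, so their ratio is s / t².
The triple x, y, z witnesses that ad is not half its trace on the derived algebra. -/
theorem structureCode_of_nonunimodular {C : Fin 3 → Fin 3 → Fin 3 → ℝ} {i : Fin 3} {t s : ℝ}
    (ht : t ≠ 0) (hτ : ∀ x, adTrace C x = t * x i) (hκ : ∀ x, killingValue C x = s * x i ^ 2)
    {x y z : Fin 3 → ℝ} (h : (2 : ℝ) • adMap C x (adMap C y z) ≠ adTrace C x • adMap C y z) :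
    structureCode C = (7, {s / t ^ 2}) := by
  have h₀ : ¬ ∀ x y, adMap C x y = 0 := fun h0 => h (by simp [h0])
  have h₁ : ¬ ∀ x, adTrace C x = 0 := fun h0 => ht (by
    have := h0 (Pi.single i 1)
    rw [hτ] at this
    simpa using this)
  rw [structureCode, if_neg h₀, if_neg h₁, if_neg fun h0 => h (h0 x y z)]
  congr 1
  ext f
  simp only [mem_ofPred_eq, mem_singleton_iff, hτ, hκ]
  constructor
  · intro hf
    have := hf (Pi.single i 1)
    simp at this
    field_simp
    linear_combination -this
  · rintro rfl x
    field_simp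

theorem structureCode_threeG1 : structureCode threeG1.row.bracket = (0, ∅) := by
  rw [structureCode, if_pos]
  intro x y
  have : threeG1.row.bracket = brackets3 0 0 0 := by
    ext i j l
    fin_cases i <;> fin_cases j <;> simp [row, TableRow.threeG1, brackets3]
  rw [this, adMap_brackets3]
  simp

theorem structureCode_g1_add_g2 : structureCode g1_add_g2.row.bracket = (7, {1}) := by
  have h : g1_add_g2.row.bracket = brackets3 ![1, 0, 0] 0 0 := rfl
  rw [h, structureCode_of_nonunimodular (i := 1) (t := -1) (s := 1) (by norm_num)
    (fun x => by rw [adTrace_brackets3]; simp)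
    (fun x => by
      rw [killingValue_eq]
      simp [adMatrix, brackets3, Fin.sum_univ_three, Matrix.trace, Matrix.mul_apply]
      ring)
    (x := ![0, 1, 0]) (y := ![1, 0, 0]) (z := ![0, 1, 0])]
  · norm_num
  · intro h0
    have := congrFun h0 0
    simp [adMap_brackets3, adTrace_brackets3] at this

theorem structureCode_g3_1 : structureCode g3_1.row.bracket = (5, ∅) := by
  have h : g3_1.row.bracket = brackets3 0 ![0, 0, 0] ![1, 0, 0] := by
    ext i j l
    fin_cases i <;> fin_cases j <;> fin_cases l <;> simp [row, TableRow.g3_1, brackets3]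
  rw [h]
  refine structureCode_of_unimodular ⟨![0, 1, 0], ![0, 0, 1], fun h0 => ?_⟩
    (fun x => by rw [adTrace_semidirect]; simp) (by norm_num) (.inr (.inr (.inr (.inr ⟨rfl,
      fun x => by rw [killingValue_semidirect]; simp⟩))))
  simpa [adMap_brackets3] using congrFun h0 0

theorem structureCode_g3_2 : structureCode g3_2.row.bracket = (7, {1 / 2}) := by
  have h : g3_2.row.bracket = brackets3 0 ![1, 0, 0] ![1, 1, 0] := rfl
  rw [h, structureCode_of_nonunimodular (i := 2) (t := -2) (s := 2) (by norm_num)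
    (fun x => by rw [adTrace_semidirect]; norm_num)
    (fun x => by rw [killingValue_semidirect]; norm_num)
    (x := ![0, 0, 1]) (y := ![0, 1, 0]) (z := ![0, 0, 1])]
  · norm_num
  · intro h0
    have := congrFun h0 0
    simp [adMap_brackets3, adTrace_brackets3] at this

theorem structureCode_g3_3 : structureCode g3_3.row.bracket = (6, {1 / 2}) := by
  have h : g3_3.row.bracket = brackets3 0 ![1, 0, 0] ![0, 1, 0] := rfl
  have hτ : ∀ x, adTrace (brackets3 0 ![1, 0, 0] ![0, 1, 0]) x = -2 * x 2 := fun x => by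
    rw [adTrace_semidirect]; norm_num
  have hκ : ∀ x, killingValue (brackets3 0 ![1, 0, 0] ![0, 1, 0]) x = 2 * x 2 ^ 2 := fun x => by
    rw [killingValue_semidirect]; norm_num
  rw [h, structureCode, if_neg, if_neg, if_pos]
  · congr 1
    ext f
    simp only [mem_ofPred_eq, mem_singleton_iff, hτ, hκ]
    constructor
    · intro hf
      have := hf (Pi.single 2 1)
      simp at this
      linarith
    · rintro rfl x
      ring
  -- On the derived algebra, spanned by e_1 and e_2, ad x is the scalar -x_3, half of its trace.
  · intro x y z
    rw [hτ, adMap_brackets3, adMap_brackets3]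
    ext l
    fin_cases l <;> simp <;> ring
  · intro h0
    have := h0 (Pi.single 2 1)
    rw [hτ] at this
    simp at this
  · intro h0
    have := congrFun (h0 ![1, 0, 0] ![0, 0, 1]) 0
    simp [adMap_brackets3] at this

theorem structureCode_g3_4 {h : ℝ} (h₁ : |h| ≤ 1) (h₂ : h ≠ 0) (h₃ : h ≠ 1) :
    structureCode (g3_4 h h₁ h₂ h₃).row.bracket =
      if h = -1 then (2, ∅) else (7, {(1 + h ^ 2) / (1 + h) ^ 2}) := by
  have e : (g3_4 h h₁ h₂ h₃).row.bracket = brackets3 0 ![1, 0, 0] ![0, h, 0] := rfl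
  have hτ : ∀ x, adTrace (brackets3 0 ![1, 0, 0] ![0, h, 0]) x = -(1 + h) * x 2 :=
    fun x => adTrace_semidirect _ _ _ _ x
  have hκ : ∀ x, killingValue (brackets3 0 ![1, 0, 0] ![0, h, 0]) x = (1 + h ^ 2) * x 2 ^ 2 :=
    fun x => by rw [killingValue_semidirect]; ring
  rw [e]
  split_ifs with hh
  · refine structureCode_of_unimodular ⟨![1, 0, 0], ![0, 0, 1], fun h0 => ?_⟩
      (fun x => by rw [hτ, hh]; ring) (by norm_num) (.inr (.inl ⟨rfl,
        ⟨![0, 0, 1], by rw [hκ]; simp; positivity⟩, fun x => by rw [hκ]; positivity⟩))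
    simpa [adMap_brackets3] using congrFun h0 0
  · have hne : 1 + h ≠ 0 := fun h0 => hh (by linarith)
    rw [structureCode_of_nonunimodular (neg_ne_zero.2 hne) hτ hκ
      (x := ![0, 0, 1]) (y := ![1, 0, 0]) (z := ![0, 0, 1]), neg_sq]
    intro h0
    have := congrFun h0 0
    simp [adMap_brackets3, hτ] at this
    exact h₃ (by linarith)

theorem structureCode_g3_5 {p : ℝ} (hp : 0 ≤ p) :
    structureCode (g3_5 p hp).row.bracket =
      if p = 0 then (3, ∅) else (7, {(2 * p ^ 2 - 2) / (2 * p) ^ 2}) := by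
  have e : (g3_5 p hp).row.bracket = brackets3 0 ![p, -1, 0] ![1, p, 0] := rfl
  have hτ : ∀ x, adTrace (brackets3 0 ![p, -1, 0] ![1, p, 0]) x = -(2 * p) * x 2 :=
    fun x => by rw [adTrace_semidirect]; ring
  have hκ : ∀ x, killingValue (brackets3 0 ![p, -1, 0] ![1, p, 0]) x =
      (2 * p ^ 2 - 2) * x 2 ^ 2 := fun x => by rw [killingValue_semidirect]; ring
  rw [e]
  split_ifs with hh
  · refine structureCode_of_unimodular ⟨![1, 0, 0], ![0, 0, 1], fun h0 => ?_⟩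
      (fun x => by rw [hτ, hh]; ring) (by norm_num) (.inr (.inr (.inl ⟨rfl,
        fun x => by rw [hκ, hh]; nlinarith [sq_nonneg (x 2)],
        ⟨![0, 0, 1], by rw [hκ, hh]; simp⟩, ⟨![1, 0, 0], fun h0 => ?_, by rw [hκ]; simp⟩⟩)))
    · simpa [adMap_brackets3] using congrFun h0 1
    · simpa using congrFun h0 0
  · rw [structureCode_of_nonunimodular (neg_ne_zero.2 (mul_ne_zero two_ne_zero hh)) hτ hκ
      (x := ![0, 0, 1]) (y := ![1, 0, 0]) (z := ![0, 0, 1]), neg_sq]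
    intro h0
    have h₀ := congrFun h0 0
    have h₁ := congrFun h0 1
    simp [adMap_brackets3, hτ] at h₀ h₁
    nlinarith

theorem structureCode_g3_6 : structureCode g3_6.row.bracket = (1, ∅) := by
  have h : g3_6.row.bracket = brackets3 ![1, 0, 0] ![0, 2, 0] ![0, 0, 1] := rfl
  have hκ : ∀ x, killingValue (brackets3 ![1, 0, 0] ![0, 2, 0] ![0, 0, 1]) x =
      2 * x 1 ^ 2 - 8 * x 0 * x 2 := fun x => by
    rw [killingValue_eq]
    simp [adMatrix, brackets3, Fin.sum_univ_three, Matrix.trace, Matrix.mul_apply]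
    ring
  rw [h]
  refine structureCode_of_unimodular ⟨![1, 0, 0], ![0, 1, 0], fun h0 => ?_⟩
    (fun x => by rw [adTrace_brackets3]; simp) (by norm_num) (.inl ⟨rfl,
      ⟨![0, 1, 0], by rw [hκ]; simp⟩, ⟨![1, 0, 1], by rw [hκ]; simp⟩⟩)
  simpa [adMap_brackets3] using congrFun h0 0

theorem structureCode_g3_7 : structureCode g3_7.row.bracket = (4, ∅) := by
  have h : g3_7.row.bracket = brackets3 ![0, 0, 1] ![0, -1, 0] ![1, 0, 0] := rfl
  have hκ : ∀ x, killingValue (brackets3 ![0, 0, 1] ![0, -1, 0] ![1, 0, 0]) x =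
      -2 * (x 0 ^ 2 + x 1 ^ 2 + x 2 ^ 2) := fun x => by
    rw [killingValue_eq]
    simp [adMatrix, brackets3, Fin.sum_univ_three, Matrix.trace, Matrix.mul_apply]
    ring
  rw [h]
  refine structureCode_of_unimodular ⟨![1, 0, 0], ![0, 1, 0], fun h0 => ?_⟩
    (fun x => by rw [adTrace_brackets3]; simp) (by norm_num) (.inr (.inr (.inr (.inl ⟨rfl,
      fun x => by rw [hκ]; nlinarith [sq_nonneg (x 0), sq_nonneg (x 1), sq_nonneg (x 2)],
      ⟨![1, 0, 0], by rw [hκ]; simp⟩, fun x hx h0 => hx ?_⟩))))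
  · simpa [adMap_brackets3] using congrFun h0 2
  · rw [hκ] at h0
    have h₀ := sq_nonneg (x 0)
    have h₁ := sq_nonneg (x 1)
    have h₂ := sq_nonneg (x 2)
    ext i
    fin_cases i
    · exact pow_eq_zero_iff two_ne_zero |>.1 (by linarith : x 0 ^ 2 = 0)
    · exact pow_eq_zero_iff two_ne_zero |>.1 (by linarith : x 1 ^ 2 = 0)
    · exact pow_eq_zero_iff two_ne_zero |>.1 (by linarith : x 2 ^ 2 = 0)

/-- The quantity (1 - h) / (1 + h) is positive and determines h. In this form the ratio visibly
exceeds 1/2 and is injective in h. -/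
theorem killing_ratio_g3_4 {h : ℝ} (h₁ : |h| ≤ 1) (h₂ : h ≠ 1) (h₃ : h ≠ -1) :
    0 < (1 - h) / (1 + h) ∧
      (1 + h ^ 2) / (1 + h) ^ 2 = 1 / 2 + ((1 - h) / (1 + h)) ^ 2 / 2 := by
  obtain ⟨h₄, h₅⟩ := abs_le.1 h₁
  have h₆ : 0 < 1 + h := by
    have := lt_of_le_of_ne h₄ (Ne.symm h₃)
    linarith
  have h₇ : h < 1 := lt_of_le_of_ne h₅ h₂
  refine ⟨div_pos (by linarith) h₆, ?_⟩
  field_simp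
  ring

/-- The ratio lies below 1/2 and determines p up to sign. -/
theorem killing_ratio_g3_5 {p : ℝ} (hp : p ≠ 0) :
    (2 * p ^ 2 - 2) / (2 * p) ^ 2 = 1 / 2 - (p⁻¹) ^ 2 / 2 := by
  field_simp

theorem half_lt_killing_ratio {h : ℝ} (h₁ : |h| ≤ 1) (h₂ : h ≠ 1) (h₃ : h ≠ -1) :
    1 / 2 < (1 + h ^ 2) / (1 + h) ^ 2 := by
  obtain ⟨h₄, h₅⟩ := killing_ratio_g3_4 h₁ h₂ h₃
  have := pow_pos h₄ 2
  linarith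

theorem killing_ratio_lt_half {p : ℝ} (hp : p ≠ 0) :
    (2 * p ^ 2 - 2) / (2 * p) ^ 2 < 1 / 2 := by
  have := pow_pos (abs_pos.2 (inv_ne_zero hp)) 2
  rw [sq_abs] at this
  rw [killing_ratio_g3_5 hp]
  linarith

theorem killing_ratio_ne_one {h : ℝ} (h₂ : h ≠ 0) (h₃ : h ≠ -1) :
    (1 + h ^ 2) / (1 + h) ^ 2 ≠ 1 := by
  have h₄ : 1 + h ≠ 0 := fun h0 => h₃ (by linarith)
  rw [Ne, div_eq_one_iff_eq (pow_ne_zero 2 h₄)]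
  intro h0
  exact h₂ (by linarith)

theorem killing_ratio_g3_4_inj {h h' : ℝ} (h₁ : |h| ≤ 1) (h₂ : h ≠ 1) (h₃ : h ≠ -1)
    (h₁' : |h'| ≤ 1) (h₂' : h' ≠ 1) (h₃' : h' ≠ -1)
    (e : (1 + h ^ 2) / (1 + h) ^ 2 = (1 + h' ^ 2) / (1 + h') ^ 2) : h = h' := by
  obtain ⟨h₄, h₅⟩ := killing_ratio_g3_4 h₁ h₂ h₃
  obtain ⟨h₄', h₅'⟩ := killing_ratio_g3_4 h₁' h₂' h₃'
  have h₆ : (1 - h) / (1 + h) = (1 - h') / (1 + h') :=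
    (pow_left_inj₀ h₄.le h₄'.le two_ne_zero).1 (by linarith)
  have h₇ : 1 + h ≠ 0 := fun h0 => h₃ (by linarith)
  have h₇' : 1 + h' ≠ 0 := fun h0 => h₃' (by linarith)
  rw [div_eq_div_iff h₇ h₇'] at h₆
  linarith

theorem killing_ratio_g3_5_inj {p p' : ℝ} (hp : 0 ≤ p) (hp' : 0 ≤ p') (h : p ≠ 0) (h' : p' ≠ 0)
    (e : (2 * p ^ 2 - 2) / (2 * p) ^ 2 = (2 * p' ^ 2 - 2) / (2 * p') ^ 2) : p = p' := by
  rw [killing_ratio_g3_5 h, killing_ratio_g3_5 h'] at e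
  exact inv_injective
    ((pow_left_inj₀ (inv_nonneg.2 hp) (inv_nonneg.2 hp') two_ne_zero).1 (by linarith))

/-- Where both codes are 7 the ratio decides: it is 1 for 𝔤¹ + 𝔤², 1/2 for 𝔤³₂, greater than 1/2 and
different from 1 for 𝔤³₄, and less than 1/2 for 𝔤³₅. -/
theorem eq_of_structureCode_eq {T T' : LowDimAlg 3}
    (e : structureCode T.row.bracket = structureCode T'.row.bracket) : T = T' := by
  cases T <;> cases T' <;> try rfl
  all_goals
    simp only [structureCode_threeG1, structureCode_g1_add_g2, structureCode_g3_1,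
      structureCode_g3_2, structureCode_g3_3, structureCode_g3_4, structureCode_g3_5,
      structureCode_g3_6, structureCode_g3_7] at e
    try split_ifs at e
  all_goals first
    | exact absurd (congrArg Prod.fst e : _ = _) (of_decide_eq_false rfl)
    | replace e := congrArg Prod.snd e
  all_goals try rw [singleton_eq_singleton_iff] at e
  case g1_add_g2.g3_2 => norm_num at e
  case g3_2.g1_add_g2 => norm_num at e
  · rename_i h₁ h₂ h₃ h₄
    exact absurd e.symm (killing_ratio_ne_one h₂ h₄)
  · rename_i hp
    linarith [killing_ratio_lt_half hp]
  · rename_i h₁ h₂ h₃ h₄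
    exact absurd e (half_lt_killing_ratio h₁ h₃ h₄).ne
  · rename_i hp
    exact absurd e (killing_ratio_lt_half hp).ne'
  · rename_i h₁ h₂ h₃ h₄
    exact absurd e (killing_ratio_ne_one h₂ h₄)
  · rename_i h₁ h₂ h₃ h₄
    exact absurd e (half_lt_killing_ratio h₁ h₃ h₄).ne'
  · rename_i h h'
    subst h h'
    rfl
  · rename_i h₁ h₂ h₃ _ h₁' h₂' h₃' h₄ h₄'
    obtain rfl := killing_ratio_g3_4_inj h₁ h₃ h₄ h₁' h₃' h₄' e
    rfl
  · rename_i h₁ h₂ h₃ _ _ h₄ hp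
    linarith [killing_ratio_lt_half hp, half_lt_killing_ratio h₁ h₃ h₄]
  · rename_i hp
    linarith [killing_ratio_lt_half hp]
  · rename_i hp
    exact absurd e (killing_ratio_lt_half hp).ne
  · rename_i h₁ h₂ h₃ hp h₄
    linarith [killing_ratio_lt_half hp, half_lt_killing_ratio h₁ h₃ h₄]
  · rename_i h h'
    subst h h'
    rfl
  · rename_i hp₀ _ hp₀' hp hp'
    obtain rfl := killing_ratio_g3_5_inj hp₀ hp₀' hp hp' e
    rfl

theorem IsAdapted.eq_of_two {L : Type*} [LieRing L] [LieAlgebra ℝ L] {T T' : LowDimAlg 2}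
    {b b' : Module.Basis (Fin 2) ℝ L} (h : T.IsAdapted b) (h' : T'.IsAdapted b') : T = T' := by
  have key : ∀ {c c' : Module.Basis (Fin 2) ℝ L}, twoG1.IsAdapted c → g2.IsAdapted c' → False := by
    intro c c' hc hc'
    have h₀ : ⁅c' 0, c' 1⁆ = 0 := by
      rw [← c.equivFun.symm_apply_apply (c' 0), ← c.equivFun.symm_apply_apply (c' 1),
        hc.lie_equivFun_symm, map_eq_zero_iff _ c.equivFun.symm.injective]
      ext l
      simp [adMap, adMatrix, Matrix.toLin'_apply, Matrix.mulVec, dotProduct, row, TableRow.twoG1]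
    rw [hc' 0 1] at h₀
    refine c'.ne_zero 0 ?_
    simpa [row, TableRow.g2, brackets2] using h₀
  cases T <;> cases T'
  · rfl
  · exact (key h h').elim
  · exact (key h' h).elim
  · rfl

/-- A Lie algebra belongs to at most one row. -/
theorem IsAdapted.unique (hn : 1 ≤ n) (hn3 : n ≤ 3) {L : Type*} [LieRing L] [LieAlgebra ℝ L]
    {T T' : LowDimAlg n} {b b' : Module.Basis (Fin n) ℝ L} (h : T.IsAdapted b)
    (h' : T'.IsAdapted b') : T = T' := by
  obtain rfl | rfl | rfl : n = 1 ∨ n = 2 ∨ n = 3 := by omega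
  · cases T; cases T'; rfl
  · exact h.eq_of_two h'
  · exact eq_of_structureCode_eq (h.structureCode_eq h')

end LowDimAlg

end

noncomputable section

open Set Filter Topology

/-! ### Assembly of the four statements -/

namespace LowDimAlg

/-- Every row of the tables has an invariant frame. -/
def invariantFrame : {n : ℕ} → (T : LowDimAlg n) → T.row.InvariantFrame
  | _, g1 => TableRow.invariantFrameG1
  | _, twoG1 => TableRow.invariantFrameTwoG1
  | _, g2 => TableRow.invariantFrameG2
  | _, threeG1 => TableRow.invariantFrameThreeG1
  | _, g1_add_g2 => TableRow.invariantFrameG1AddG2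
  | _, g3_1 => TableRow.invariantFrameG31
  | _, g3_2 => TableRow.invariantFrameG32
  | _, g3_3 => TableRow.invariantFrameG33
  | _, g3_4 h _ _ _ => TableRow.invariantFrameG34 h
  | _, g3_5 p _ => TableRow.invariantFrameG35 p
  | _, g3_6 => TableRow.invariantFrameG36
  | _, g3_7 => TableRow.invariantFrameG37

theorem existsUnique_isAdapted {n : ℕ} (hn : 1 ≤ n) (hn3 : n ≤ 3) (L : Type*) [LieRing L]
    [LieAlgebra ℝ L] (hL : Module.finrank ℝ L = n) :
    ∃! T : LowDimAlg n, ∃ b : Module.Basis (Fin n) ℝ L, T.IsAdapted b := by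
  have h : HasAdaptedBasis n L := by
    obtain rfl | rfl | rfl : n = 1 ∨ n = 2 ∨ n = 3 := by omega
    exacts [hasAdaptedBasis_one hL, hasAdaptedBasis_two hL, hasAdaptedBasis_three hL]
  obtain ⟨T, b, hb⟩ := h
  exact ⟨T, ⟨b, hb⟩, fun T' ⟨_, hb'⟩ => hb'.unique hn hn3 hb⟩

end LowDimAlg

section FreeAction

variable {n : ℕ} {L : Type*} [LieRing L] [LieAlgebra ℝ L] {E : Type*} [NormedAddCommGroup E]
  [NormedSpace ℝ E] {Z : Set E} {ρ : L →ₗ[ℝ] (E → E)} {T : LowDimAlg n}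
  {b : Module.Basis (Fin n) ℝ L}

theorem IsFreeAction.lieBracket_basis (h : IsFreeAction Z ρ) (hb : T.IsAdapted b) (i j : Fin n)
    {z : E} (hz : z ∈ Z) :
    VectorField.lieBracket ℝ (ρ (b i)) (ρ (b j)) z = ∑ l, T.row.bracket i j l • ρ (b l) z := by
  rw [h.lieBracket _ _ z hz, hb i j, map_sum, Finset.sum_apply]
  simp only [map_smul, Pi.smul_apply]

theorem IsFreeAction.linearIndependent (h : IsFreeAction Z ρ) {z : E} (hz : z ∈ Z) :
    LinearIndependent ℝ fun i => ρ (b i) z := by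
  have := b.linearIndependent.map' ((LinearMap.proj z).comp ρ)
    (LinearMap.ker_eq_bot.2 (h.free z hz))
  exact this

end FreeAction

theorem LowDimAlg.lieBracket_gen {n : ℕ} {T : LowDimAlg n} (I : T.row.InvariantFrame)
    {x : Fin n → ℝ} (hx : x ∈ T.row.dom) (i j : Fin n) :
    VectorField.lieBracket ℝ (T.row.gen i) (T.row.gen j) x =
      ∑ l, T.row.bracket i j l • T.row.gen l x := by
  rw [VectorField.lieBracket, I.fderiv_gen x hx, I.fderiv_gen x hx, I.bracket_gen x hx]

end

theorem mainTheorem2 (n : ℕ) (hn : 1 ≤ n) (hn3 : n ≤ 3) :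
    -- every `n`-dimensional real Lie algebra is isomorphic to exactly one in the tables
    (∀ (L : Type*) [LieRing L] [LieAlgebra ℝ L], Module.finrank ℝ L = n →
      ∃! T : LowDimAlg n, ∃ b : Module.Basis (Fin n) ℝ L, T.IsAdapted b) ∧
    -- every free action with `k + 1` invariant variables is locally the action in the tables, and
    -- any `k + 1` independent invariants can serve as the invariant variables `y^1, …, y^k, u`
    (∀ (L : Type*) [LieRing L] [LieAlgebra ℝ L] (T : LowDimAlg n)
      (b : Module.Basis (Fin n) ℝ L) (k : ℕ) (Z : Set (Fin (n + (k + 1)) → ℝ))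
      (ρ : L →ₗ[ℝ] ((Fin (n + (k + 1)) → ℝ) → (Fin (n + (k + 1)) → ℝ))),
      T.IsAdapted b → IsOpen Z → IsFreeAction Z ρ → ∀ z₀ ∈ Z,
        (∃ φ : OpenPartialHomeomorph (Fin (n + (k + 1)) → ℝ) (Jet0 (Fin n ⊕ Fin k)),
          z₀ ∈ φ.source ∧ T.IsNormalizingChart k Z (fun i => ρ (b i)) φ) ∧
        ∀ v : (Fin (n + (k + 1)) → ℝ) → (Fin k → ℝ) × ℝ, ContDiffOn ℝ ∞ v Z →
          (∀ X, ∀ z ∈ Z, fderiv ℝ v z (ρ X z) = 0) →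
          Function.Surjective (fderiv ℝ v z₀) →
          ∃ φ : OpenPartialHomeomorph (Fin (n + (k + 1)) → ℝ) (Jet0 (Fin n ⊕ Fin k)),
            z₀ ∈ φ.source ∧ T.IsNormalizingChart k Z (fun i => ρ (b i)) φ ∧
            ∀ z ∈ φ.source, ((fun μ => (φ z).1 (Sum.inr μ)), (φ z).2) = v z) ∧
    ∀ (T : LowDimAlg n) (k : ℕ),
      -- the generators in the tables are smooth, satisfy the commutation relations and act freely
      (∀ i, ContDiffOn ℝ ∞ (T.genZ k i) (T.domZ k)) ∧
      (∀ i j, ∀ z ∈ T.domZ k, VectorField.lieBracket ℝ (T.genZ k i) (T.genZ k j) z =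
        ∑ l, T.row.bracket i j l • T.genZ k l z) ∧
      (∀ z ∈ T.domZ k, LinearIndependent ℝ (fun i => T.genZ k i z)) ∧
      -- the functions in the tables are smooth and functionally independent
      ContDiffOn ℝ ∞ (T.allInv (k := k)) (T.dom2 k) ∧
      (∀ j ∈ T.dom2 k, Function.Surjective (fderiv ℝ (T.allInv (k := k)) j)) ∧
      -- the second-order differential invariants are locally exactly the functions of them
      (∀ Ω : Set (Jet2 (Fin n ⊕ Fin k)), IsOpen Ω → Ω ⊆ T.dom2 k →
        ∀ F : Jet2 (Fin n ⊕ Fin k) → ℝ, ContDiffOn ℝ ∞ F Ω →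
          (T.IsDiffInvariantOn k F Ω ↔
            ∀ j ∈ Ω, ∃ W ⊆ Ω, IsOpen W ∧ j ∈ W ∧
              ∃ (V : Set (LowDimAlg.InvSpace n k)) (f : LowDimAlg.InvSpace n k → ℝ),
                IsOpen V ∧ ContDiffOn ℝ ∞ f V ∧
                ∀ w ∈ W, T.allInv w ∈ V ∧ F w = f (T.allInv w))) ∧
      -- the invariants defined on the whole jet domain are globally functions of them
      (∀ F : Jet2 (Fin n ⊕ Fin k) → ℝ, ContDiffOn ℝ ∞ F (T.dom2 k) →
        (T.IsDiffInvariantOn k F (T.dom2 k) ↔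
          ∃ f : LowDimAlg.InvSpace n k → ℝ, ContDiff ℝ ∞ f ∧
            ∀ j ∈ T.dom2 k, F j = f (T.allInv j))) ∧
      -- local form of the invariant quasi-linear second-order equations
      (∀ Ω : Set (Jet1 (Fin n ⊕ Fin k)), IsOpen Ω → Ω ⊆ T.dom1 k →
        ∀ (A : Jet1 (Fin n ⊕ Fin k) → Sym2 (Fin n ⊕ Fin k) → ℝ)
          (B : Jet1 (Fin n ⊕ Fin k) → ℝ),
          ContDiffOn ℝ ∞ A Ω → ContDiffOn ℝ ∞ B Ω → (∀ j ∈ Ω, A j ≠ 0) →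
          (T.IsSymmetricEquationOver k (quasiLinear A B) Ω ↔
            ∀ j₀ ∈ Ω, ∃ W ⊆ Ω, IsOpen W ∧ j₀ ∈ W ∧
              ∃ (V : Set ((Fin k → ℝ) × ℝ × (Fin n → ℝ) × (Fin k → ℝ))) (a : _) (b : _) (c : _)
                (d : _) (g : Jet1 (Fin n ⊕ Fin k) → ℝ),
                IsOpen V ∧ Set.MapsTo T.firstInv W V ∧
                ContDiffOn ℝ ∞ a V ∧ ContDiffOn ℝ ∞ b V ∧
                ContDiffOn ℝ ∞ c V ∧ ContDiffOn ℝ ∞ d V ∧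
                ContDiffOn ℝ ∞ g W ∧ (∀ w ∈ W, g w ≠ 0) ∧
                ∀ j : Jet2 (Fin n ⊕ Fin k), j.toJet1 ∈ W →
                  quasiLinear A B j = g j.toJet1 * T.invariantQuasiLinear a b c d j)) ∧
      -- global form of the invariant quasi-linear second-order equations
      (∀ (A : Jet1 (Fin n ⊕ Fin k) → Sym2 (Fin n ⊕ Fin k) → ℝ)
          (B : Jet1 (Fin n ⊕ Fin k) → ℝ),
          ContDiffOn ℝ ∞ A (T.dom1 k) → ContDiffOn ℝ ∞ B (T.dom1 k) →
          (∀ j ∈ T.dom1 k, A j ≠ 0) →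
          (T.IsSymmetricEquationOver k (quasiLinear A B) (T.dom1 k) ↔
            ∃ (a : _) (b : _) (c : _) (d : _) (g : Jet1 (Fin n ⊕ Fin k) → ℝ),
              ContDiff ℝ ∞ a ∧ ContDiff ℝ ∞ b ∧ ContDiff ℝ ∞ c ∧ ContDiff ℝ ∞ d ∧
              ContDiffOn ℝ ∞ g (T.dom1 k) ∧ (∀ j ∈ T.dom1 k, g j ≠ 0) ∧
              ∀ j : Jet2 (Fin n ⊕ Fin k), j.toJet1 ∈ T.dom1 k →
                quasiLinear A B j = g j.toJet1 * T.invariantQuasiLinear a b c d j)) := by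
  refine ⟨fun L _ _ hL => LowDimAlg.existsUnique_isAdapted hn hn3 L hL, ?_, ?_⟩
  · intro L _ _ T b k Z ρ hb hZ hρ z₀ hz₀
    have I := T.invariantFrame
    refine ⟨T.exists_isNormalizingChart' k I.isOpen_dom hZ
      (fun i x hx => (I.contDiffAt_gen x hx i).contDiffWithinAt) (fun i => hρ.contDiffOn (b i))
      (fun x hx => LowDimAlg.linearIndependent_gen I hx)
      (fun i j x hx => LowDimAlg.lieBracket_gen I hx i j)
      (fun i j z hz => hρ.lieBracket_basis hb i j hz) I.zero_mem_dom hz₀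
      (hρ.linearIndependent hz₀) (by simp), fun v hv hvρ hvs => ?_⟩
    exact T.exists_isNormalizingChart k I.isOpen_dom hZ
      (fun i x hx => (I.contDiffAt_gen x hx i).contDiffWithinAt) (fun i => hρ.contDiffOn (b i))
      (fun x hx => LowDimAlg.linearIndependent_gen I hx)
      (fun i j x hx => LowDimAlg.lieBracket_gen I hx i j)
      (fun i j z hz => hρ.lieBracket_basis hb i j hz) I.zero_mem_dom hz₀
      (hρ.linearIndependent hz₀) (by simp) hv (fun i z hz => hvρ (b i) z hz) hvs
  · intro T k
    have I := T.invariantFrame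
    exact ⟨fun i z hz => (LowDimAlg.contDiffAt_genZ I hz i).contDiffWithinAt,
      fun i j z hz => LowDimAlg.lieBracket_genZ I hz i j,
      fun z hz => LowDimAlg.linearIndependent_genZ I hz,
      fun j hj => (LowDimAlg.contDiffAt_allInv I hj).contDiffWithinAt,
      fun j hj => LowDimAlg.surjective_fderiv_allInv I hj,
      fun Ω hΩ hΩd F hF => LowDimAlg.isDiffInvariantOn_iff_local I hΩ hΩd hF,
      fun F hF => LowDimAlg.isDiffInvariantOn_iff_global I hF,
      fun Ω hΩ hΩd A B hA hB hA₀ =>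
        LowDimAlg.isSymmetricEquationOver_iff_local I hΩ hΩd hA hB hA₀,
      fun A B hA hB hA₀ => LowDimAlg.isSymmetricEquationOver_iff_global I hA hB hA₀⟩
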